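/- Let $G^\star$ denote the transitive closure of a digraph $G$, let $\mathrm{dist}_G(u,v)$ be the number of edges of a shortest directed path from $u$ to $v$, and let the diameter of $G$ be $\max_{(u,v)\in G^\star}\mathrm{dist}_G(u,v)$. For integers $1\le D\le n$ put $$s(n,D)=\begin{cases} n^2/D^3, & D\le n^{1/3},\\ (n/D)^{3/2}, & D>n^{1/3}.\end{cases}$$ **(1) Existence.** There are constants $C,k$ such that for all $1\le D\le n$ and every $n$-vertex digraph $G$ there is a set of edges $H\subseteq G^\star$ with $|H|\le C\,s(n,D)\,(1+\log n)^k$ (that is, $|H|=\widetilde O(s(n,D))$) such that $G\cup H$ has diameter at most $D$. **(2) Algorithm.** Such sets are computed by a randomized $\widetilde O(n^{\omega})$-time algorithm, where $\omega$ is the optimal matrix multiplication exponent. The machine is a random access machine with fair coin flips and logarithmic costs. Let $\omega$ be the infimum of the real $\tau$ such that some program multiplies, over the integers, any two $n\times n$ matrices with entries in $\{0,1\}$ in time $\widetilde O(n^\tau)$ (the restriction to $0/1$ entries loses only polylogarithmic factors compared with integer entries of $O(\log n)$ bits). For every $c\in\mathbb N$ there are constants $C,k$ such that for every real $\tau$ for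 which $n\times n$ matrices can be multiplied in time $\widetilde O(n^\tau)$ in this sense, and also for every $\tau>\omega$ (so for $\tau=\omega$ whenever the infimum is attained), there are a program and constants $C',k'$ such that, for all $1\le D\le n$ and every digraph $G$ on $n$ vertices given by its adjacency matrix together with $n$ and $D$: for every outcome of the coin flips, the program halts within time $C'n^{\tau}(1+\log n)^{k'}$ and outputs (the adjacency matrix of) a set $H\subseteq G^\star$ with $|H|\le C\,s(n,D)\,(1+\log n)^k$; and with probability at least $1-n^{-c}$ the diameter of $G\cup H$ is at most $D$. **(3)** In particular, there are constants $C,k$ such that every $n$-vertex digraph $G$ with $n\ge1$ has a set $H\subseteq G^\star$ with $|H|\le C\,n\,(1+\log n)^k$ for which $G\cup H$ has diameter at most $n^{1/3}$, and a set $H\subseteq G^\star$ with $|H|\le C\,n^{3/4}(1+\log n)^k$ for which $G\cup H$ has diameter at most $\sqrt n$. -/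

import Mathlib

namespace Shortcut

/-! ### Digraphs: walks, distances, transitive closure, diameter -/

section Graphs

variable {V : Type*}

/-- `HasWalk G k u v`: there is a directed walk with exactly `k` edges from `u` to `v`. -/
def HasWalk (G : Digraph V) : ℕ → V → V → Prop
  | 0, u, v => u = v
  | k + 1, u, v => ∃ w, G.Adj u w ∧ HasWalk G k w v

/-- The number of edges of a shortest directed path from `u` to `v` (`⊤` if there is none). -/
noncomputable def dist (G : Digraph V) (u v : V) : ℕ∞ :=
  ⨅ (k : ℕ) (_ : HasWalk G k u v), (k : ℕ∞)

/-- The transitive closure of `G`. -/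
def transClosure (G : Digraph V) : Digraph V := ⟨Relation.TransGen G.Adj⟩

/-- The diameter: the largest distance over all pairs of the transitive closure. -/
noncomputable def diam (G : Digraph V) : ℕ∞ :=
  ⨆ (u : V) (v : V) (_ : (transClosure G).Adj u v), dist G u v

/-- The digraph with edge set `H`. -/
def ofEdges (H : Finset (V × V)) : Digraph V := ⟨fun u v => (u, v) ∈ H⟩

end Graphs

/-- The main term of the size bound: `n² / D³` if `D ≤ n^{1/3}` and `(n / D)^{3/2}` otherwise. -/
noncomputable def sizeBound (n D : ℕ) : ℝ :=
  if (D : ℝ) ≤ (n : ℝ) ^ (1 / 3 : ℝ) then (n : ℝ) ^ 2 / (D : ℝ) ^ 3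
  else ((n : ℝ) / (D : ℝ)) ^ (3 / 2 : ℝ)

/-! ### A random access machine with coin flips, under the logarithmic cost measure

Programs are finite pieces of syntax. They work on finitely many integer registers and finitely
many arrays of natural numbers (those that they mention). -/

/-- A configuration: registers, arrays (`arr a i` is cell `i` of array `a`), and the coin flips
that have not been used yet. -/
structure State where
  vars : ℕ → ℕ
  arr : ℕ → ℕ → ℕ
  coins : ℕ → Bool

/-- Expressions; `get a e` is the cell of array `a` whose index is the value of `e`. -/
inductive Expr where
  | const (c : ℕ)
  | var (x : ℕ)
  | get (a : ℕ) (i : Expr)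
  | add (e f : Expr)
  | sub (e f : Expr)
  | mul (e f : Expr)
  | div (e f : Expr)

/-- The value of an expression (subtraction is truncated at `0`, division rounds down). -/
def Expr.eval (s : State) : Expr → ℕ
  | .const c => c
  | .var x => s.vars x
  | .get a i => s.arr a (i.eval s)
  | .add e f => e.eval s + f.eval s
  | .sub e f => e.eval s - f.eval s
  | .mul e f => e.eval s * f.eval s
  | .div e f => e.eval s / f.eval s

/-- The logarithmic cost of an evaluation: every operation costs one plus the number of bits of its
result, in addition to the costs of its operands (which include their numbers of bits). -/
def Expr.cost (s : State) : Expr → ℕ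
  | .const c => 1 + Nat.size c
  | .var x => 1 + Nat.size (s.vars x)
  | .get a i => 1 + Nat.size (s.arr a (i.eval s)) + i.cost s
  | .add e f => 1 + Nat.size (e.eval s + f.eval s) + e.cost s + f.cost s
  | .sub e f => 1 + Nat.size (e.eval s - f.eval s) + e.cost s + f.cost s
  | .mul e f => 1 + Nat.size (e.eval s * f.eval s) + e.cost s + f.cost s
  | .div e f => 1 + Nat.size (e.eval s / f.eval s) + e.cost s + f.cost s

/-- Programs. `assign x e` is `x := e`; `store a i e` is `a[i] := e`; `flip x` stores a fresh random
bit in `x`; `ite` and `loop` (a while loop) test whether an expression is nonzero. -/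
inductive Com where
  | skip
  | assign (x : ℕ) (e : Expr)
  | store (a : ℕ) (i e : Expr)
  | flip (x : ℕ)
  | seq (p q : Com)
  | ite (e : Expr) (p q : Com)
  | loop (e : Expr) (p : Com)

/-- The configuration after `x := e`. -/
def State.assign (s : State) (x : ℕ) (e : Expr) : State :=
  { s with vars := Function.update s.vars x (e.eval s) }

/-- The configuration after `a[i] := e`. -/
def State.store (s : State) (a : ℕ) (i e : Expr) : State :=
  { s with arr := Function.update s.arr a (Function.update (s.arr a) (i.eval s) (e.eval s)) }

/-- The configuration after storing the next coin flip in `x`. -/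
def State.flip (s : State) (x : ℕ) : State :=
  { s with vars := Function.update s.vars x (s.coins 0).toNat
           coins := fun j => s.coins (j + 1) }

/-- `Exec p s t s'`: started in configuration `s`, the program `p` halts in configuration `s'`
after running time (total logarithmic cost) `t`. -/
inductive Exec : Com → State → ℕ → State → Prop
  | skip (s : State) : Exec .skip s 1 s
  | assign (s : State) (x : ℕ) (e : Expr) :
      Exec (.assign x e) s (1 + e.cost s) (s.assign x e)
  | store (s : State) (a : ℕ) (i e : Expr) :
      Exec (.store a i e) s (1 + i.cost s + e.cost s) (s.store a i e)
  | flip (s : State) (x : ℕ) : Exec (.flip x) s 1 (s.flip x)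
  | seq {p q : Com} {s s' s'' : State} {t t' : ℕ} :
      Exec p s t s' → Exec q s' t' s'' → Exec (.seq p q) s (t + t') s''
  | ite_true {e : Expr} {p q : Com} {s s' : State} {t : ℕ} :
      e.eval s ≠ 0 → Exec p s t s' → Exec (.ite e p q) s (1 + e.cost s + t) s'
  | ite_false {e : Expr} {p q : Com} {s s' : State} {t : ℕ} :
      e.eval s = 0 → Exec q s t s' → Exec (.ite e p q) s (1 + e.cost s + t) s'
  | loop_stop {e : Expr} {p : Com} {s : State} :
      e.eval s = 0 → Exec (.loop e p) s (1 + e.cost s) s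
  | loop_step {e : Expr} {p : Com} {s s' s'' : State} {t t' : ℕ} :
      e.eval s ≠ 0 → Exec p s t s' → Exec (.loop e p) s' t' s'' →
      Exec (.loop e p) s (1 + e.cost s + t + t') s''

/-- For a fixed sequence of coin flips the outcome and the running time are determined. -/
theorem Exec.unique {p : Com} {s s₁ s₂ : State} {t₁ t₂ : ℕ}
    (h₁ : Exec p s t₁ s₁) (h₂ : Exec p s t₂ s₂) : t₁ = t₂ ∧ s₁ = s₂ := by
  induction h₁ generalizing t₂ s₂ with
  | skip | assign | store | flip => cases h₂; exact ⟨rfl, rfl⟩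
  | seq _ _ ih ih' =>
    cases h₂ with
    | seq a b =>
      obtain ⟨rfl, rfl⟩ := ih a
      obtain ⟨rfl, rfl⟩ := ih' b
      exact ⟨rfl, rfl⟩
  | ite_true h _ ih =>
    cases h₂ with
    | ite_true _ a => obtain ⟨rfl, rfl⟩ := ih a; exact ⟨rfl, rfl⟩
    | ite_false h' _ => exact absurd h' h
  | ite_false h _ ih =>
    cases h₂ with
    | ite_true h' _ => exact absurd h h'
    | ite_false _ a => obtain ⟨rfl, rfl⟩ := ih a; exact ⟨rfl, rfl⟩
  | loop_stop h =>
    cases h₂ with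
    | loop_stop _ => exact ⟨rfl, rfl⟩
    | loop_step h' _ _ => exact absurd h h'
  | loop_step h _ _ ih ih' =>
    cases h₂ with
    | loop_stop h' => exact absurd h' h
    | loop_step _ a b =>
      obtain ⟨rfl, rfl⟩ := ih a
      obtain ⟨rfl, rfl⟩ := ih' b
      exact ⟨rfl, rfl⟩

/-- The distribution of the coin flips: independent and fair. -/
noncomputable def fairCoins : MeasureTheory.Measure (ℕ → Bool) :=
  MeasureTheory.Measure.infinitePi fun _ => (PMF.uniformOfFintype Bool).toMeasure

/-! ### Inputs and outputs -/

/-- An `n × n` matrix stored row by row in an array: entry `(i, j)` is in cell `i * n + j`. -/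
def matrixCells {n : ℕ} (M : Matrix (Fin n) (Fin n) ℕ) (a : ℕ) : ℕ :=
  if h : a < n * n then
    M ⟨a / n, Nat.div_lt_of_lt_mul h⟩ ⟨a % n, Nat.mod_lt a (Nat.pos_of_lt_mul_right h)⟩
  else 0

/-- The initial configuration for the multiplication of `A` and `B`: register `0` holds `n`,
arrays `0` and `1` hold `A` and `B`, everything else is zero. -/
def matMulInput {n : ℕ} (A B : Matrix (Fin n) (Fin n) ℕ) (ρ : ℕ → Bool) : State where
  vars := Function.update (fun _ => 0) 0 n
  arr := Function.update (Function.update (fun _ _ => 0) 0 (matrixCells A)) 1 (matrixCells B)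
  coins := ρ

/-- `n × n` matrices can be multiplied in time `Õ(n^τ)`: some program computes the product, over the
integers, of any two `n × n` matrices with entries in `{0, 1}` within that time, and writes it to
array `2`. (Integer matrices whose entries have `O(log n)` bits reduce to this case by splitting the
entries into bits, at the cost of a polylogarithmic factor.) -/
def MatMulInTime (τ : ℝ) : Prop :=
  ∃ (p : Com) (C : ℝ) (k : ℕ), ∀ n : ℕ, 1 ≤ n → ∀ A B : Matrix (Fin n) (Fin n) ℕ,
    (∀ i j, A i j ≤ 1) → (∀ i j, B i j ≤ 1) → ∀ ρ : ℕ → Bool,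
      ∃ (t : ℕ) (s : State), Exec p (matMulInput A B ρ) t s ∧
        (t : ℝ) ≤ C * (n : ℝ) ^ τ * (1 + Real.log n) ^ k ∧
        ∀ i j : Fin n, s.arr 2 (i * n + j) = (A * B) i j

/-- The matrix multiplication exponent `ω`. -/
noncomputable def matMulExponent : ℝ := sInf {τ : ℝ | MatMulInTime τ}

open scoped Classical in
/-- The adjacency matrix of a digraph. -/
noncomputable def adjMatrix {n : ℕ} (G : Digraph (Fin n)) : Matrix (Fin n) (Fin n) ℕ :=
  fun u v => if G.Adj u v then 1 else 0

/-- The initial configuration for the shortcut problem: registers `0` and `1` hold `n` and `D`,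
array `0` holds the adjacency matrix of `G`, everything else is zero. -/
noncomputable def shortcutInput {n : ℕ} (G : Digraph (Fin n)) (D : ℕ) (ρ : ℕ → Bool) : State where
  vars := Function.update (Function.update (fun _ => 0) 0 n) 1 D
  arr := Function.update (fun _ _ => 0) 0 (matrixCells (adjMatrix G))
  coins := ρ

/-- The edge set whose adjacency matrix (nonzero entries) is in array `1`. -/
def outputEdges (n : ℕ) (s : State) : Finset (Fin n × Fin n) :=
  Finset.univ.filter fun e => s.arr 1 (e.1 * n + e.2) ≠ 0

end Shortcut

/-! The construction samples vertices and then samples chains of the sampled vertices. Let `N ≈ (n /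
L) log n` random vertices be indexed by positions. With high probability every shortest path with
`L` edges meets a sample after its first vertex, so a path of `G` becomes a start of at most `L`
edges, a path in the graph `posGraph` on positions at distance at most `L`, and an end of at most
`L` edges (`within_of_samples`). It remains to shorten long geodesics of the graph on positions.

Order the positions by reachability and cover them by disjoint chains of exactly `K = M / 4`
elements, leaving positions that split into at most `2 K` antichains (`chainCover_spec`). Edges
between chain elements whose indices differ by a power of two give every chain logarithmic diameter,
at a cost of about `N log n` edges. A geodesic with `M` edges then has at most `2 K ≤ M / 2`
vertices outside the chains and logarithmically many on each chain, so it meets about `M / log n`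
chains (`Geo.le_classes`, `le_card_touched`). Hence about `(N / M) log n` random positions hit the
first `M` edges of every long geodesic, and about `(N / (K M)) log² n` random chains hit its last
`M` edges. Join every sampled position to the first vertex that it reaches on every sampled chain. A
long geodesic is replaced by a way to a sampled position, one such jump, hops along the chain, and
the rest of the geodesic (`diam_le_of_hits`).

The distances add up to `2 L + L (2 M + log n) + 1 ≤ D` with `M = D / (8 L)`. Up to logarithms there
are `N + N² / M³` edges, where `N ≈ n / L` and `M ≈ D / L`. The choice `L ≈ max 1 (D / (8 (√(n / D)
+ 4 log n)))` makes this `Õ(s(n, D))`: for `D ≤ n^{1/3}` essentially `L = 1` and the count is `n² /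
D³`; above, `M ≈ √(n / D)` and both terms are about `(n / D)^{3/2}` (`IsParams.card_le`). If `D` is
below `64 log n`, all pairs of the closure are affordable.

For the algorithm, reachability takes logarithmically many Boolean squarings, and everything else
takes `Õ(n²)` steps, which is within `Õ(n^τ)` because writing the product forces `2 ≤ τ`
(`MatMulInTime.two_le`). The delicate point is the chain cover, which is found by a procedure with
`O(N K)` steps controlled by a potential (`Cover.Step.inv`). Programs are written with counted
loops, so that results are given by a function and costs are read off the syntax (`Prog.exec`); the
unknown multiplication program is simulated, each time in a fresh part of the memory (`Sim.exec`).
The size bound holds for all coin flips because it counts stores (`Prog.sparse_run`). The failure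
probability is a union bound over pairs of endpoints (`prob_diam_gt`); it is below one for `n ≥ 2`,
which yields existence. -/

namespace Shortcut

/-! ### Walks, geodesics, and the deterministic part of the shortcut argument. -/

section Walks

variable {V : Type*} {G E : Digraph V}

theorem HasWalk.append {j k : ℕ} {a b c : V} (h : HasWalk G j a b) (h' : HasWalk G k b c) :
    HasWalk G (j + k) a c := by
  induction j generalizing a with
  | zero => obtain rfl : a = b := h; simpa using h'
  | succ j ih =>
    obtain ⟨w, hw, hwb⟩ := h
    rw [Nat.add_right_comm]
    exact ⟨w, hw, ih hwb⟩

theorem HasWalk.split {j k : ℕ} {a c : V} (h : HasWalk G (j + k) a c) :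
    ∃ b, HasWalk G j a b ∧ HasWalk G k b c := by
  induction j generalizing a with
  | zero => exact ⟨a, rfl, by simpa using h⟩
  | succ j ih =>
    rw [Nat.add_right_comm] at h
    obtain ⟨w, hw, hwc⟩ := h
    obtain ⟨b, hb, hbc⟩ := ih hwc
    exact ⟨b, ⟨w, hw, hb⟩, hbc⟩

theorem HasWalk.one {a b : V} (h : G.Adj a b) : HasWalk G 1 a b := ⟨b, h, rfl⟩

theorem HasWalk.mono (h : G ≤ E) {k : ℕ} {a b : V} (hw : HasWalk G k a b) : HasWalk E k a b := by
  induction k generalizing a with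
  | zero => exact hw
  | succ k ih => obtain ⟨w, hw, hb⟩ := hw; exact ⟨w, h hw, ih hb⟩

theorem HasWalk.reflTransGen {k : ℕ} {a b : V} (h : HasWalk G k a b) :
    Relation.ReflTransGen G.Adj a b := by
  induction k generalizing a with
  | zero => obtain rfl : a = b := h; exact .refl
  | succ k ih => obtain ⟨w, hw, hb⟩ := h; exact (ih hb).head hw

theorem exists_hasWalk {a b : V} (h : Relation.ReflTransGen G.Adj a b) : ∃ k, HasWalk G k a b := by
  induction h with
  | refl => exact ⟨0, rfl⟩
  | tail _ h ih => obtain ⟨k, hk⟩ := ih; exact ⟨k + 1, hk.append (.one h)⟩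

/-- There is a walk with at most `k` edges from `a` to `b`. -/
def Within (G : Digraph V) (k : ℕ) (a b : V) : Prop := ∃ j ≤ k, HasWalk G j a b

theorem Within.refl (k : ℕ) (a : V) : Within G k a a := ⟨0, k.zero_le, rfl⟩

theorem Within.trans {j k : ℕ} {a b c : V} (h : Within G j a b) (h' : Within G k b c) :
    Within G (j + k) a c := by
  obtain ⟨i, hi, h⟩ := h
  obtain ⟨i', hi', h'⟩ := h'
  exact ⟨i + i', by omega, h.append h'⟩

theorem Within.mono {j k : ℕ} (hjk : j ≤ k) {a b : V} (h : Within G j a b) : Within G k a b := by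
  obtain ⟨i, hi, h⟩ := h
  exact ⟨i, hi.trans hjk, h⟩

theorem Within.mono_graph (hGE : G ≤ E) {k : ℕ} {a b : V} (h : Within G k a b) : Within E k a b := by
  obtain ⟨i, hi, h⟩ := h
  exact ⟨i, hi, h.mono hGE⟩

theorem HasWalk.within {k : ℕ} {a b : V} (h : HasWalk G k a b) : Within G k a b := ⟨k, le_rfl, h⟩

theorem HasWalk.exists_fun {k : ℕ} {a b : V} (h : HasWalk G k a b) :
    ∃ f : ℕ → V, f 0 = a ∧ f k = b ∧ ∀ i < k, G.Adj (f i) (f (i + 1)) := by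
  induction k generalizing a with
  | zero => exact ⟨fun _ => a, rfl, h, by simp⟩
  | succ k ih =>
    obtain ⟨w, hw, hb⟩ := h
    obtain ⟨f, h0, hk, hf⟩ := ih hb
    refine ⟨fun i => if i = 0 then a else f (i - 1), by simp, by simpa using hk, ?_⟩
    intro i hi
    rcases i with _ | i
    · simpa [h0] using hw
    · simpa using hf i (by omega)

theorem hasWalk_of_fun {f : ℕ → V} {i d : ℕ} (h : ∀ j, i ≤ j → j < i + d → G.Adj (f j) (f (j + 1))) :
    HasWalk G d (f i) (f (i + d)) := by
  induction d with
  | zero => exact rfl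
  | succ d ih =>
    exact (ih fun j h1 h2 => h j h1 (by omega)).append (.one (h (i + d) (by omega) (by omega)))

theorem diam_le_of_within {k : ℕ}
    (h : ∀ u v, Relation.ReflTransGen G.Adj u v → Within G k u v) : diam G ≤ k := by
  refine iSup_le fun u => iSup_le fun v => iSup_le fun huv => ?_
  obtain ⟨j, hj, hw⟩ := h u v (Relation.TransGen.to_reflTransGen huv)
  exact (iInf₂_le j hw).trans (by exact_mod_cast hj)

/-- A walk of length `k` from `a` to `b` exists, and no shorter one does. -/
def Geo (G : Digraph V) (k : ℕ) (a b : V) : Prop := HasWalk G k a b ∧ ∀ j < k, ¬ HasWalk G j a b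

/-- The vertices on walks of length `k` from `a` to `b`. -/
def interval (G : Digraph V) (k : ℕ) (a b : V) : Set V :=
  {x | ∃ j ≤ k, HasWalk G j a x ∧ HasWalk G (k - j) x b}

/-- The vertices after the first one on walks of length `k` from `a` to `b`. -/
def interval₁ (G : Digraph V) (k : ℕ) (a b : V) : Set V :=
  {x | ∃ j ≤ k, 1 ≤ j ∧ HasWalk G j a x ∧ HasWalk G (k - j) x b}

theorem exists_geo {a b : V} (h : Relation.ReflTransGen G.Adj a b) : ∃ k, Geo G k a b := by
  classical
  exact ⟨Nat.find (exists_hasWalk h), Nat.find_spec (exists_hasWalk h),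
    fun j hj => Nat.find_min (exists_hasWalk h) hj⟩

/-- A shorter first part would shorten the whole walk. -/
theorem Geo.left {j k : ℕ} {a b c : V} (h : Geo G (j + k) a c) (h₁ : HasWalk G j a b)
    (h₂ : HasWalk G k b c) : Geo G j a b :=
  ⟨h₁, fun i hi hw => h.2 (i + k) (by omega) (hw.append h₂)⟩

theorem Geo.right {j k : ℕ} {a b c : V} (h : Geo G (j + k) a c) (h₁ : HasWalk G j a b)
    (h₂ : HasWalk G k b c) : Geo G k b c :=
  ⟨h₂, fun i hi hw => h.2 (j + i) (by omega) (h₁.append hw)⟩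

/-- Along a geodesic, index differences are distances, since a shorter connection of two of its
vertices could be spliced in. All counting on geodesics thereby becomes counting of indices. -/
theorem Geo.exists_fun {k : ℕ} {a b : V} (h : Geo G k a b) :
    ∃ f : ℕ → V, (∀ i ≤ k, HasWalk G i a (f i) ∧ HasWalk G (k - i) (f i) b) ∧
      ∀ i j, i ≤ j → j ≤ k → HasWalk G (j - i) (f i) (f j) ∧
        ∀ d, HasWalk G d (f i) (f j) → j - i ≤ d := by
  obtain ⟨f, rfl, rfl, hf⟩ := h.1.exists_fun
  have key : ∀ i j, i ≤ j → j ≤ k → HasWalk G (j - i) (f i) (f j) := by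
    intro i j hij hjk
    have := hasWalk_of_fun (G := G) (f := f) (i := i) (d := j - i) fun m _ h2 => hf m (by omega)
    rwa [Nat.add_sub_cancel' hij] at this
  refine ⟨f, fun i hi => ⟨by simpa using key 0 i (Nat.zero_le _) hi, key i k hi le_rfl⟩, ?_⟩
  refine fun i j hij hjk => ⟨key i j hij hjk, fun d hd => ?_⟩
  by_contra hlt
  refine h.2 (i + d + (k - j)) (by omega) ?_
  have h1 := key 0 i (Nat.zero_le _) (hij.trans hjk)
  rw [Nat.sub_zero] at h1
  exact (h1.append hd).append (key j k hjk le_rfl)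

theorem Geo.injOn {k : ℕ} {f : ℕ → V}
    (h : ∀ i j, i ≤ j → j ≤ k → HasWalk G (j - i) (f i) (f j) ∧
        ∀ d, HasWalk G d (f i) (f j) → j - i ≤ d) : Set.InjOn f (Set.Iic k) := by
  have key : ∀ i j, i ≤ j → j ≤ k → f i = f j → i = j := by
    intro i j hij hjk he
    have := (h i j hij hjk).2 0 he
    omega
  intro i hi j hj he
  rcases le_total i j with hij | hij
  · exact key i j hij hj he
  · exact (key j i hij hi he.symm).symm

/-- The `k + 1` vertices of a geodesic are distinct. One of them is given away, so that the bound is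
the same as for `interval₁`. -/
theorem Geo.le_card_interval [Fintype V] {k : ℕ} {a b : V} (h : Geo G k a b) {S : Finset V}
    (hS : ∀ x ∈ interval G k a b, x ∈ S) : k ≤ S.card := by
  obtain ⟨f, hf, hd⟩ := h.exists_fun
  have := Finset.card_le_card_of_injOn (s := Finset.range k) (t := S) f
    (fun i hi => hS _ ⟨i, (Finset.mem_range.1 hi).le, hf i (Finset.mem_range.1 hi).le⟩)
    ((Geo.injOn hd).mono fun i hi => (Finset.mem_range.1 hi).le)
  simpa using this

theorem Geo.le_card_interval₁ [Fintype V] {k : ℕ} {a b : V} (h : Geo G k a b) {S : Finset V}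
    (hS : ∀ x ∈ interval₁ G k a b, x ∈ S) : k ≤ S.card := by
  obtain ⟨f, hf, hd⟩ := h.exists_fun
  have := Finset.card_le_card_of_injOn (s := Finset.Icc 1 k) (t := S) f
    (fun i hi => hS _ ⟨i, (Finset.mem_Icc.1 hi).2, (Finset.mem_Icc.1 hi).1,
      hf i (Finset.mem_Icc.1 hi).2⟩)
    ((Geo.injOn hd).mono fun i hi => (Finset.mem_Icc.1 hi).2)
  simpa using this

/-- Walks in a graph `S` on indices of vertices become walks in `E`, at a cost of `L` per edge. -/
theorem HasWalk.within_map {ι : Type*} {S : Digraph ι} {X : ι → V} {L : ℕ}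
    (hS : ∀ i j, S.Adj i j → Within E L (X i) (X j)) {k : ℕ} {i j : ι} (h : HasWalk S k i j) :
    Within E (L * k) (X i) (X j) := by
  induction k generalizing i with
  | zero => obtain rfl : i = j := h; exact .refl _ _
  | succ k ih =>
    obtain ⟨w, hw, hb⟩ := h
    exact ((hS _ _ hw).trans (ih hb)).mono (by rw [Nat.mul_succ]; omega)

theorem Within.map {ι : Type*} {S : Digraph ι} {X : ι → V} {L : ℕ}
    (hS : ∀ i j, S.Adj i j → Within E L (X i) (X j)) {k : ℕ} {i j : ι} (h : Within S k i j) :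
    Within E (L * k) (X i) (X j) := by
  obtain ⟨d, hd, h⟩ := h
  exact (h.within_map hS).mono (Nat.mul_le_mul_left _ hd)

/-- Induction on the length of the walk. If it is a geodesic longer than `L`, its first `L` edges
contain a sample from which less of the walk remains; if it is not a geodesic, a shorter walk
exists. -/
theorem exists_last_index {ι : Type*} {S : Digraph ι} {X : ι → V} {L : ℕ}
    (hS : ∀ i j, Within G L (X i) (X j) → S.Adj i j)
    (hit : ∀ a b, Geo G L a b → ∃ i, X i ∈ interval₁ G L a b) (k : ℕ) (i : ι) (v : V)
    (h : HasWalk G k (X i) v) :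
    ∃ i', Relation.ReflTransGen S.Adj i i' ∧ Within G L (X i') v := by
  induction k using Nat.strong_induction_on generalizing i with
  | _ k ih =>
  by_cases hk : k ≤ L
  · exact ⟨i, .refl, k, hk, h⟩
  by_cases hg : Geo G k (X i) v
  · obtain ⟨d, rfl⟩ := Nat.exists_eq_add_of_lt (not_le.1 hk)
    rw [Nat.add_assoc] at h hg
    obtain ⟨y, hy, hyv⟩ := h.split
    obtain ⟨i₂, j, hj, hj1, h1, h2⟩ := hit _ _ (hg.left hy hyv)
    -- The remainder is strictly shorter because the sample is not the first vertex (`hj1`). This is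
    -- the purpose of `interval₁`.
    obtain ⟨i', hi', hv⟩ := ih (L - j + (d + 1)) (by omega) i₂ (h2.append hyv)
    exact ⟨i', hi'.head (hS _ _ ⟨j, hj, h1⟩), hv⟩
  · simp only [Geo, h, true_and, not_forall, not_not] at hg
    obtain ⟨j, hj, hw⟩ := hg
    exact ih j hj i hw

/-- The first `L` edges of a long geodesic supply the first sample, and `exists_last_index` supplies
the last one. -/
theorem within_or_exists_index {ι : Type*} {S : Digraph ι} {X : ι → V} {L : ℕ}
    (hS : ∀ i j, Within G L (X i) (X j) → S.Adj i j)
    (hit : ∀ a b, Geo G L a b → ∃ i, X i ∈ interval₁ G L a b) {u v : V}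
    (h : Relation.ReflTransGen G.Adj u v) :
    Within G L u v ∨ ∃ i i', Within G L u (X i) ∧ Relation.ReflTransGen S.Adj i i' ∧
      Within G L (X i') v := by
  obtain ⟨k, hk⟩ := exists_geo h
  by_cases hkL : k ≤ L
  · exact .inl ⟨k, hkL, hk.1⟩
  obtain ⟨d, rfl⟩ := Nat.exists_eq_add_of_le (not_le.1 hkL).le
  obtain ⟨y, hy, hyv⟩ := hk.1.split
  obtain ⟨i, j, hj, -, h1, h2⟩ := hit _ _ (hk.left hy hyv)
  obtain ⟨i', hi', hv⟩ := exists_last_index hS hit _ i v (h2.append hyv)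
  exact .inr ⟨i, i', ⟨j, hj, h1⟩, hi', hv⟩

/-- Long geodesics of `S` are shortened at both ends by the links between `interval`s. -/
theorem within_of_links {ι : Type*} {S : Digraph ι} {X : ι → V} {L M w : ℕ}
    (hS : ∀ i j, S.Adj i j → Within E L (X i) (X j))
    (link : ∀ i y z i', Geo S M i y → Geo S M z i' → Relation.ReflTransGen S.Adj y z →
      ∃ x ∈ interval S M i y, ∃ q ∈ interval S M z i', Within E (1 + L * w) (X x) (X q))
    {i i' : ι} (h : Relation.ReflTransGen S.Adj i i') :
    Within E (L * (2 * M + w) + 1) (X i) (X i') := by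
  obtain ⟨k, hk⟩ := exists_geo h
  by_cases hkM : k ≤ 2 * M
  · refine (hk.1.within_map hS).mono ?_
    have := Nat.mul_le_mul_left L (show k ≤ 2 * M + w by omega)
    omega
  -- The middle part of `d` edges may be arbitrarily long. The link bypasses it: at most `M` edges
  -- lead to `x`, the link leads to `q`, and at most `M` edges remain.
  obtain ⟨d, rfl⟩ : ∃ d, k = M + (d + M) := ⟨k - 2 * M, by omega⟩
  obtain ⟨y, hy, hyi⟩ := hk.1.split
  obtain ⟨z, hz, hzi⟩ := hyi.split
  obtain ⟨x, ⟨j, hj, hx, -⟩, q, ⟨j', hj', -, hq⟩, hxq⟩ :=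
    link i y z i' (hk.left hy hyi) ((hk.right hy hyi).right hz hzi) hz.reflTransGen
  refine ((((hx.within.mono hj).map hS).trans hxq).trans
    ((hq.within.mono (Nat.sub_le _ _)).map hS)).mono (le_of_eq (by ring))

/-- Each end costs `L`, and `within_of_links` bounds the part between the first and the last sample.
-/
theorem within_of_samples {ι : Type*} {S : Digraph ι} {X : ι → V} {L M w : ℕ} (hGE : G ≤ E)
    (hS : ∀ i j, Within G L (X i) (X j) → S.Adj i j)
    (hS' : ∀ i j, S.Adj i j → Within E L (X i) (X j))
    (hit : ∀ a b, Geo G L a b → ∃ i, X i ∈ interval₁ G L a b)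
    (link : ∀ i y z i', Geo S M i y → Geo S M z i' → Relation.ReflTransGen S.Adj y z →
      ∃ x ∈ interval S M i y, ∃ q ∈ interval S M z i', Within E (1 + L * w) (X x) (X q))
    {u v : V} (h : Relation.ReflTransGen G.Adj u v) :
    Within E (2 * L + (L * (2 * M + w) + 1)) u v := by
  rcases within_or_exists_index hS hit h with h | ⟨i, i', h1, h2, h3⟩
  · exact (h.mono_graph hGE).mono (by omega)
  · refine (((h1.mono_graph hGE).trans (within_of_links hS' link h2)).trans
      (h3.mono_graph hGE)).mono (by omega)

/-- A geodesic meets many classes (chains) when classes have small diameter and the elements outside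
all classes split into few antichains. -/
theorem Geo.le_classes {k c w : ℕ} {a b : V} (h : Geo G k a b) (cov : V → Prop) (cls col : V → ℕ)
    (T : Finset ℕ) (hT : ∀ x ∈ interval G k a b, cov x → cls x ∈ T)
    (hw : ∀ x y, cov x → cov y → cls x = cls y → Relation.ReflTransGen G.Adj x y → Within G w x y)
    (hc : ∀ x, ¬ cov x → col x < c)
    (hcol : ∀ x y, ¬ cov x → ¬ cov y → x ≠ y → Relation.ReflTransGen G.Adj x y → col x ≠ col y) :
    k + 1 ≤ c + T.card * (w + 1) := by
  classical
  obtain ⟨f, hf, hd⟩ := h.exists_fun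
  have hinj := Geo.injOn hd
  set A := (Finset.range (k + 1)).filter fun i => cov (f i)
  set B := (Finset.range (k + 1)).filter fun i => ¬ cov (f i)
  have hAB : A.card + B.card = k + 1 := by
    rw [Finset.card_filter_add_card_filter_not, Finset.card_range]
  have hB : B.card ≤ c := by
    have := Finset.card_le_card_of_injOn (s := B) (t := Finset.range c) (fun i => col (f i))
      (fun i hi => Finset.mem_coe.2 (Finset.mem_range.2 (hc _ (Finset.mem_filter.1 hi).2))) ?_
    · simpa using this
    -- Two vertices of a geodesic are always comparable by reachability, so uncovered ones have
    -- different colours.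
    have key : ∀ i ∈ B, ∀ j ∈ B, i ≤ j → col (f i) = col (f j) → i = j := by
      intro i hi j hj hij he
      simp only [B, Finset.mem_filter, Finset.mem_range] at hi hj
      by_contra hne
      refine hcol _ _ hi.2 hj.2 (fun e => hne (hinj ?_ ?_ e)) (hd i j hij (by omega)).1.reflTransGen he
      · exact Nat.lt_succ_iff.1 hi.1
      · exact Nat.lt_succ_iff.1 hj.1
    intro i hi j hj he
    rcases le_total i j with hij | hij
    · exact key i hi j hj hij he
    · exact (key j hj i hi hij he.symm).symm
  have hA : A.card ≤ T.card * (w + 1) := by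
    rw [Nat.mul_comm]
    refine Finset.card_le_mul_card_image_of_maps_to (f := fun i => cls (f i)) ?_ (w + 1) ?_
    · intro i hi
      simp only [A, Finset.mem_filter, Finset.mem_range] at hi
      exact hT _ ⟨i, by omega, hf i (by omega)⟩ hi.2
    · intro t _
      rcases (A.filter fun i => cls (f i) = t).eq_empty_or_nonempty with he | hne
      · simp [he]
      have hm := Finset.min'_mem _ hne
      set m := Finset.min' _ hne with hmdef
      -- Let `m` be the first index in the class. Any other index `i` of the class satisfies `i ≤ m
      -- + w`, because `i - m` is a distance and two elements of a class are within `w` whenever one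
      -- reaches the other.
      refine (Finset.card_le_card (t := Finset.Icc m (m + w)) ?_).trans
        (by rw [Nat.card_Icc]; omega)
      intro i hi
      have hmi : m ≤ i := Finset.min'_le _ _ hi
      simp only [A, Finset.mem_filter, Finset.mem_range] at hm hi
      have h1 := hd m i hmi (by omega)
      obtain ⟨j, hj, hjw⟩ := hw _ _ hm.1.2 hi.1.2 (hm.2.trans hi.2.symm) h1.1.reflTransGen
      have := h1.2 j hjw
      exact Finset.mem_Icc.2 ⟨hmi, by omega⟩
  omega

/-- One hop for each binary digit of `d`, the leading one first. -/
theorem within_up_of_pow {c : ℕ → V} {lo hi m : ℕ}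
    (h : ∀ e < m, ∀ x, lo ≤ x → x + 2 ^ e ≤ hi → G.Adj (c x) (c (x + 2 ^ e)))
    {x d : ℕ} (hx : lo ≤ x) (hd : x + d ≤ hi) (hdm : d < 2 ^ m) : Within G m (c x) (c (x + d)) := by
  induction m generalizing x d with
  | zero => obtain rfl : d = 0 := by simpa using hdm
            exact .refl _ _
  | succ m ih =>
    have ih' := fun {x d} => ih (x := x) (d := d) fun e he => h e (by omega)
    rcases lt_or_ge d (2 ^ m) with hlt | hge
    · exact (ih' hx hd hlt).mono (Nat.le_succ m)
    · obtain ⟨d', rfl⟩ := Nat.exists_eq_add_of_le hge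
      rw [← Nat.add_assoc, Nat.add_comm m 1]
      refine Within.trans (HasWalk.one (h m (by omega) x hx (by omega))).within (ih' ?_ ?_ ?_)
      all_goals omega

theorem within_down_of_pow {c : ℕ → V} {lo hi m : ℕ}
    (h : ∀ e < m, ∀ x, lo ≤ x → x + 2 ^ e ≤ hi → G.Adj (c (x + 2 ^ e)) (c x))
    {x d : ℕ} (hx : lo ≤ x) (hd : x + d ≤ hi) (hdm : d < 2 ^ m) : Within G m (c (x + d)) (c x) := by
  induction m generalizing x d with
  | zero => obtain rfl : d = 0 := by simpa using hdm
            exact .refl _ _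
  | succ m ih =>
    have ih' := fun {x d} => ih (x := x) (d := d) fun e he => h e (by omega)
    rcases lt_or_ge d (2 ^ m) with hlt | hge
    · exact (ih' hx hd hlt).mono (Nat.le_succ m)
    · obtain ⟨d', rfl⟩ := Nat.exists_eq_add_of_le hge
      rw [← Nat.add_assoc]
      refine Within.trans (ih' (x := x + 2 ^ m) ?_ ?_ ?_)
        (HasWalk.one (h m (by omega) x hx (by omega))).within
      all_goals omega

/-- Steps by powers of two along a chain, in both directions where possible, connect any two of its
elements in a logarithmic number of steps. -/
theorem within_chain {c : ℕ → V} {R : V → V → Prop} (hR : ∀ {x y z}, R x y → R y z → R x z)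
    {K m : ℕ} (hK : K ≤ 2 ^ m) (hc : ∀ i j, i ≤ j → j < K → R (c i) (c j))
    (hup : ∀ e < m, ∀ i, i + 2 ^ e < K → R (c i) (c (i + 2 ^ e)) → G.Adj (c i) (c (i + 2 ^ e)))
    (hdown : ∀ e < m, ∀ i, i + 2 ^ e < K → R (c (i + 2 ^ e)) (c i) → G.Adj (c (i + 2 ^ e)) (c i))
    {i j : ℕ} (hi : i < K) (hj : j < K) (hij : R (c i) (c j)) : Within G m (c i) (c j) := by
  rcases le_total i j with h | h
  · obtain ⟨d, rfl⟩ := Nat.exists_eq_add_of_le h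
    exact within_up_of_pow (lo := 0) (hi := K - 1)
      (fun e he x _ hx => hup e he x (by omega) (hc x (x + 2 ^ e) (Nat.le_add_right _ _) (by omega)))
      (Nat.zero_le _) (by omega) (by omega)
  · obtain ⟨d, rfl⟩ := Nat.exists_eq_add_of_le h
    refine within_down_of_pow (lo := j) (hi := j + d)
      (fun e he x hx hx' => hdown e he x (hx'.trans_lt hi) ?_) le_rfl le_rfl (by omega)
    -- Going down is only asked for when `c i` reaches the earlier element `c j`. Then everything
    -- between them on the chain is mutually reachable, and the downward hops are available.
    exact hR (hc _ _ hx' hi) (hR hij (hc j x hx ((Nat.le_of_add_right_le hx').trans_lt hi)))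

end Walks

end Shortcut
namespace Shortcut

/-! ### Counted programs: semantics, running times, and the number of nonzero stores. -/

section Programs

/-- Programs whose only loops are counted loops: `rep x y p` runs `p` for `x = 0, 1, …, y - 1`, and
`clamp x e f` is `x := min e f`. -/
inductive Prog where
  | skip
  | set (x : ℕ) (e : Expr)
  | clamp (x : ℕ) (e f : Expr)
  | store (a : ℕ) (i e : Expr)
  | flip (x : ℕ)
  | seq (p q : Prog)
  | ite (e : Expr) (p q : Prog)
  | rep (x y : ℕ) (p : Prog)

/-- The configuration with value `v` in register `x`. -/
def State.set (s : State) (x v : ℕ) : State := { s with vars := Function.update s.vars x v }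

@[simp] theorem State.set_vars (s : State) (x v y : ℕ) :
    (s.set x v).vars y = if y = x then v else s.vars y := by
  simp [State.set, Function.update_apply]

@[simp] theorem State.set_arr (s : State) (x v : ℕ) : (s.set x v).arr = s.arr := rfl

@[simp] theorem State.set_coins (s : State) (x v : ℕ) : (s.set x v).coins = s.coins := rfl

@[simp] theorem State.store_vars (s : State) (a : ℕ) (i e : Expr) :
    (s.store a i e).vars = s.vars := rfl

@[simp] theorem State.store_coins (s : State) (a : ℕ) (i e : Expr) :
    (s.store a i e).coins = s.coins := rfl

@[simp] theorem State.store_arr (s : State) (a : ℕ) (i e : Expr) (b j : ℕ) :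
    (s.store a i e).arr b j = if b = a ∧ j = i.eval s then e.eval s else s.arr b j := by
  by_cases h : b = a
  · subst h; simp [State.store, Function.update_apply]
  · simp [State.store, h]

theorem State.store_arr_of_ne (s : State) (a : ℕ) (i e : Expr) {b : ℕ} (h : b ≠ a) :
    (s.store a i e).arr b = s.arr b := by
  funext j; simp [h]

@[simp] theorem State.flip_arr (s : State) (x : ℕ) : (s.flip x).arr = s.arr := rfl

@[simp] theorem State.flip_vars (s : State) (x y : ℕ) :
    (s.flip x).vars y = if y = x then (s.coins 0).toNat else s.vars y := by
  simp [State.flip, Function.update_apply]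

@[simp] theorem State.flip_coins (s : State) (x : ℕ) :
    (s.flip x).coins = fun j => s.coins (j + 1) := rfl

/-- The configuration in which a counted program halts. -/
def Prog.run : Prog → State → State
  | .skip, s => s
  | .set x e, s => s.set x (e.eval s)
  | .clamp x e f, s => s.set x (min (e.eval s) (f.eval s))
  | .store a i e, s => s.store a i e
  | .flip x, s => s.flip x
  | .seq p q, s => q.run (p.run s)
  | .ite e p q, s => if e.eval s ≠ 0 then p.run s else q.run s
  | .rep x y p, s =>
    (fun s => (p.run s).set x ((p.run s).vars x + 1))^[s.vars y] (s.set x 0)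

/-- The translation to programs of the random access machine. -/
def Prog.compile : Prog → Com
  | .skip => .skip
  | .set x e => .assign x e
  | .clamp x e f => .assign x (.sub e (.sub e f))
  | .store a i e => .store a i e
  | .flip x => .flip x
  | .seq p q => .seq p.compile q.compile
  | .ite e p q => .ite e p.compile q.compile
  | .rep x y p => .seq (.assign x (.const 0))
      (.loop (.sub (.var y) (.var x)) (.seq p.compile (.assign x (.add (.var x) (.const 1)))))

/-- Does the program assign to register `z`? -/
def Prog.writes (z : ℕ) : Prog → Bool
  | .skip => false
  | .set x _ => x == z
  | .clamp x _ _ => x == z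
  | .store _ _ _ => false
  | .flip x => x == z
  | .seq p q => p.writes z || q.writes z
  | .ite _ p q => p.writes z || q.writes z
  | .rep x _ p => x == z || p.writes z

/-- Does the program store into array `b`? -/
def Prog.stores (b : ℕ) : Prog → Bool
  | .store a _ _ => a == b
  | .seq p q => p.stores b || q.stores b
  | .ite _ p q => p.stores b || q.stores b
  | .rep _ _ p => p.stores b
  | _ => false

/-- The loop condition: the counter is not the bound, and the body changes neither of them. -/
def Prog.fresh (x y : ℕ) (p : Prog) : Bool := x != y && !p.writes x && !p.writes y

/-- `s'` agrees with `s` on what `p` does not change. -/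
def Frame (p : Prog) (s s' : State) : Prop :=
  (∀ z, p.writes z = false → s'.vars z = s.vars z) ∧
    ∀ b, p.stores b = false → s'.arr b = s.arr b

theorem iterate_invariant {α : Type*} (f : α → α) (P : α → Prop) (h : ∀ s, P s → P (f s)) {s : α}
    (hs : P s) (m : ℕ) : P (f^[m] s) := by
  induction m generalizing s with
  | zero => exact hs
  | succ m ih => exact ih (h s hs)

theorem Prog.run_vars (p : Prog) {z : ℕ} (h : p.writes z = false) (s : State) :
    (p.run s).vars z = s.vars z := by
  induction p generalizing s with
  | skip => rfl
  | store => rfl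
  | set | clamp | flip =>
    simp only [writes, beq_eq_false_iff_ne, ne_eq] at h
    simp [run, Ne.symm h]
  | seq p q ihp ihq =>
    simp only [writes, Bool.or_eq_false_iff] at h
    simp [run, ihp h.1, ihq h.2]
  | ite e p q ihp ihq =>
    simp only [writes, Bool.or_eq_false_iff] at h
    simp only [run]
    split_ifs
    exacts [ihp h.1 s, ihq h.2 s]
  | rep x y p ih =>
    simp only [writes, Bool.or_eq_false_iff, beq_eq_false_iff_ne, ne_eq] at h
    exact iterate_invariant _ (fun s' : State => s'.vars z = s.vars z)
      (fun s' hs' => by simpa [Ne.symm h.1, ih h.2] using hs') (by simp [Ne.symm h.1]) _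

theorem Prog.run_arr (p : Prog) {b : ℕ} (h : p.stores b = false) (s : State) :
    (p.run s).arr b = s.arr b := by
  induction p generalizing s with
  | skip | set | clamp | flip => rfl
  | store a i e =>
    simp only [stores, beq_eq_false_iff_ne, ne_eq] at h
    exact State.store_arr_of_ne _ _ _ _ (Ne.symm h)
  | seq p q ihp ihq =>
    simp only [stores, Bool.or_eq_false_iff] at h
    simp [run, ihp h.1, ihq h.2]
  | ite e p q ihp ihq =>
    simp only [stores, Bool.or_eq_false_iff] at h
    simp only [run]
    split_ifs
    exacts [ihp h.1 s, ihq h.2 s]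
  | rep x y p ih =>
    exact iterate_invariant _ (fun s' : State => s'.arr b = s.arr b)
      (fun s' hs' => by simpa [ih h] using hs') (by simp) _

theorem Prog.frame (p : Prog) (s : State) : Frame p s (p.run s) :=
  ⟨fun _ h => p.run_vars h s, fun _ h => p.run_arr h s⟩

/-- The induction rule for counted loops. The frame condition is handed to the induction step for
free, so an invariant need only mention what the loop changes. -/
theorem Prog.rep_induct {x y : ℕ} {p : Prog} {s : State} (hf : Prog.fresh x y p = true)
    (I : ℕ → State → Prop) (h0 : I 0 (s.set x 0))
    (hs : ∀ k s', k < s.vars y → s'.vars x = k → Frame (.rep x y p) s s' → I k s' →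
      I (k + 1) ((p.run s').set x (k + 1))) : I (s.vars y) ((Prog.rep x y p).run s) := by
  simp only [fresh, Bool.and_eq_true, bne_iff_ne, Bool.not_eq_true'] at hf
  obtain ⟨⟨hxy, hx⟩, hy⟩ := hf
  suffices ∀ k ≤ s.vars y,
      let s' := (fun s => (p.run s).set x ((p.run s).vars x + 1))^[k] (s.set x 0)
      I k s' ∧ s'.vars x = k ∧ Frame (.rep x y p) s s' from (this _ le_rfl).1
  intro k
  induction k with
  | zero =>
    refine fun _ => ⟨h0, by simp, fun z hz => ?_, fun b _ => rfl⟩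
    simp only [writes, Bool.or_eq_false_iff, beq_eq_false_iff_ne, ne_eq] at hz
    simp [Ne.symm hz.1]
  | succ k ih =>
    intro hk
    obtain ⟨h1, h2, h3⟩ := ih (Nat.le_of_succ_le hk)
    simp only [Function.iterate_succ', Function.comp_apply]
    set s' := (fun s => (p.run s).set x ((p.run s).vars x + 1))^[k] (s.set x 0)
    have hvx : (p.run s').vars x = k := by rw [p.run_vars hx, h2]
    rw [hvx]
    refine ⟨hs k s' hk h2 h3 h1, by simp, fun z hz => ?_, fun b hb => ?_⟩
    · have hz' := hz
      simp only [writes, Bool.or_eq_false_iff, beq_eq_false_iff_ne, ne_eq] at hz'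
      simp [Ne.symm hz'.1, p.run_vars hz'.2, h3.1 z hz]
    · rw [State.set_arr, p.run_arr hb, h3.2 b hb]

/-! #### Running times -/

/-- Is the expression a constant? -/
def Expr.isConst : Expr → Bool
  | .const _ => true
  | _ => false

/-- Expressions that exceed the values in memory only by an additive constant. -/
def Expr.lin : Expr → Bool
  | .const _ => true
  | .var _ => true
  | .get _ _ => true
  | .add e f => e.lin && f.isConst
  | .sub e _ => e.lin
  | .mul _ _ => false
  | .div e _ => e.lin

/-- The additive constant for expressions with `Expr.lin`. -/
def Expr.inc : Expr → ℕ
  | .const c => c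
  | .add e f => e.inc + f.inc
  | .sub e _ => e.inc
  | .div e _ => e.inc
  | _ => 0

/-- The expression reads registers below `v` and arrays below `a` only. -/
def Expr.safe (v a : ℕ) : Expr → Bool
  | .const _ => true
  | .var x => x < v
  | .get b i => b < a && i.safe v a
  | .add e f => e.safe v a && f.safe v a
  | .sub e f => e.safe v a && f.safe v a
  | .mul e f => e.safe v a && f.safe v a
  | .div e f => e.safe v a && f.safe v a

/-- The cost of an expression in multiples of the length of the numbers in memory. -/
def Expr.wt : Expr → ℕ
  | .const c => 1 + Nat.size c
  | .var _ => 1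
  | .get _ i => 1 + i.wt
  | .add e f => 2 + 2 * (e.wt + f.wt)
  | .sub e f => 2 + 2 * (e.wt + f.wt)
  | .mul e f => 2 + 2 * (e.wt + f.wt)
  | .div e f => 2 + 2 * (e.wt + f.wt)

/-- The registers below `v` and the arrays below `a` hold numbers that are at most `M`. -/
def Bnd (v a M : ℕ) (s : State) : Prop :=
  (∀ x < v, s.vars x ≤ M) ∧ ∀ b < a, ∀ i, s.arr b i ≤ M

theorem Bnd.mono {v a M M' : ℕ} {s : State} (h : Bnd v a M s) (hM : M ≤ M') : Bnd v a M' s :=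
  ⟨fun x hx => (h.1 x hx).trans hM, fun b hb i => (h.2 b hb i).trans hM⟩

theorem Bnd.set {v a M : ℕ} {s : State} (h : Bnd v a M s) (x : ℕ) {c : ℕ} (hc : c ≤ M) :
    Bnd v a M (s.set x c) := by
  refine ⟨fun y hy => ?_, h.2⟩
  rw [State.set_vars]
  split_ifs
  exacts [hc, h.1 y hy]

theorem Bnd.store {v a M : ℕ} {s : State} (h : Bnd v a M s) (b : ℕ) (i e : Expr)
    (hc : e.eval s ≤ M) : Bnd v a M (s.store b i e) := by
  refine ⟨h.1, fun b' hb' j => ?_⟩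
  rw [State.store_arr]
  split_ifs
  exacts [hc, h.2 b' hb' j]

/-- The reason for restricting stored values to `lin` expressions and for the instruction `clamp`:
numbers in memory grow by a constant per step, hence have logarithmic length after polynomially many
steps, whereas repeated products could double the length each time. -/
theorem Expr.eval_le {v a M : ℕ} {s : State} (h : Bnd v a M s) {e : Expr} (hs : e.safe v a = true)
    (hl : e.lin = true) : e.eval s ≤ M + e.inc := by
  induction e with
  | const c => simp [eval, inc]
  | var x => simpa [eval, inc] using h.1 x (by simpa [safe] using hs)
  | get b i =>
    simp only [safe, Bool.and_eq_true, decide_eq_true_eq] at hs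
    simpa [eval, inc] using h.2 b hs.1 _
  | add e f ihe _ =>
    simp only [safe, lin, Bool.and_eq_true] at hs hl
    have := ihe hs.1 hl.1
    cases f <;> simp only [isConst, Bool.false_eq_true] at hl
    · simp only [eval, inc]; omega
    all_goals exact absurd hl.2 (by simp)
  | sub e f ihe _ =>
    simp only [safe, lin, Bool.and_eq_true] at hs hl
    exact (Nat.sub_le _ _).trans (ihe hs.1 hl)
  | mul => simp [lin] at hl
  | div e f ihe _ =>
    simp only [safe, lin, Bool.and_eq_true] at hs hl
    exact (Nat.div_le_self _ _).trans (ihe hs.1 hl)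

theorem size_add_le (a b : ℕ) : Nat.size (a + b) ≤ Nat.size a + Nat.size b + 1 := by
  rw [Nat.size_le, pow_succ]
  have ha := Nat.lt_size_self a
  have hb := Nat.lt_size_self b
  have h1 : 2 ^ Nat.size a ≤ 2 ^ (Nat.size a + Nat.size b) := Nat.pow_le_pow_right (by simp) (by simp)
  have h2 : 2 ^ Nat.size b ≤ 2 ^ (Nat.size a + Nat.size b) := Nat.pow_le_pow_right (by simp) (by simp)
  omega

theorem size_mul_le (a b : ℕ) : Nat.size (a * b) ≤ Nat.size a + Nat.size b := by
  rw [Nat.size_le, pow_add]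
  exact Nat.mul_lt_mul'' (Nat.lt_size_self a) (Nat.lt_size_self b)

/-- Every expression pays for the length of its value. The lengths of intermediate results, products
included, are thereby bounded by the costs of the operands, and only the numbers in memory need a
bound. -/
theorem Expr.size_eval_le_cost (s : State) (e : Expr) : Nat.size (e.eval s) ≤ e.cost s := by
  cases e <;> simp only [eval, cost] <;> omega

theorem Expr.cost_le {v a Z : ℕ} {s : State} (h : Bnd v a Z s) {e : Expr}
    (hs : e.safe v a = true) : e.cost s ≤ e.wt * (Nat.size Z + 1) := by
  -- The result of an operation is at most one bit longer than the operands together, and those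
  -- lengths are bounded by the operand costs. So each operation at most doubles the cost, up to a
  -- constant.
  have op : ∀ {x cx cy wx wy r : ℕ}, cx ≤ wx * (Nat.size Z + 1) → cy ≤ wy * (Nat.size Z + 1) →
      x ≤ cx + cy + 1 → r = 1 + x + cx + cy → r ≤ (2 + 2 * (wx + wy)) * (Nat.size Z + 1) := by
    intro x cx cy wx wy r h1 h2 h3 h4
    have : (2 + 2 * (wx + wy)) * (Nat.size Z + 1) = 2 * (Nat.size Z + 1) +
      2 * (wx * (Nat.size Z + 1)) + 2 * (wy * (Nat.size Z + 1)) := by ring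
    omega
  induction e with
  | const c => simp only [cost, wt]; exact Nat.le_mul_of_pos_right _ (Nat.succ_pos _)
  | var x =>
    have := Nat.size_le_size (h.1 x (by simpa [safe] using hs))
    simp only [cost, wt]; omega
  | get b i ih =>
    simp only [safe, Bool.and_eq_true, decide_eq_true_eq] at hs
    have := Nat.size_le_size (h.2 b hs.1 (i.eval s))
    have := ih hs.2
    simp only [cost, wt, Nat.add_mul]; omega
  | add e f ihe ihf =>
    simp only [safe, Bool.and_eq_true] at hs
    have h1 := e.size_eval_le_cost s
    have h2 := f.size_eval_le_cost s
    have h3 := size_add_le (e.eval s) (f.eval s)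
    exact op (ihe hs.1) (ihf hs.2) (by omega) rfl
  | sub e f ihe ihf =>
    simp only [safe, Bool.and_eq_true] at hs
    have h1 := e.size_eval_le_cost s
    have h3 := Nat.size_le_size (Nat.sub_le (e.eval s) (f.eval s))
    exact op (ihe hs.1) (ihf hs.2) (by omega) rfl
  | mul e f ihe ihf =>
    simp only [safe, Bool.and_eq_true] at hs
    have h1 := e.size_eval_le_cost s
    have h2 := f.size_eval_le_cost s
    have h3 := size_mul_le (e.eval s) (f.eval s)
    exact op (ihe hs.1) (ihf hs.2) (by omega) rfl
  | div e f ihe ihf =>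
    simp only [safe, Bool.and_eq_true] at hs
    have h1 := e.size_eval_le_cost s
    have h3 := Nat.size_le_size (Nat.div_le_self (e.eval s) (f.eval s))
    exact op (ihe hs.1) (ihf hs.2) (by omega) rfl

/-- The syntactic conditions for `Prog.runs`. -/
def Prog.ok (v a : ℕ) : Prog → Bool
  | .skip => true
  | .set _ e => e.lin && e.safe v a
  | .clamp _ e f => f.lin && e.safe v a && f.safe v a
  | .store _ i e => e.lin && e.safe v a && i.safe v a
  | .flip _ => true
  | .seq p q => p.ok v a && q.ok v a
  | .ite e p q => e.safe v a && p.ok v a && q.ok v a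
  | .rep x y p => x < v && y < v && p.fresh x y && p.ok v a

/-- The largest cost of a single step, in multiples of the length of the numbers in memory. -/
def Prog.wt : Prog → ℕ
  | .skip => 1
  | .set _ e => 1 + e.wt
  | .clamp _ e f => 1 + (Expr.sub e (.sub e f)).wt
  | .store _ i e => 1 + i.wt + e.wt
  | .flip _ => 1
  | .seq p q => max p.wt q.wt
  | .ite e p q => max (1 + e.wt) (max p.wt q.wt)
  | .rep _ _ p => max 12 p.wt

/-- The largest growth of the numbers in memory in a single step. -/
def Prog.gr : Prog → ℕ
  | .skip => 0
  | .set _ e => e.inc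
  | .clamp _ _ f => f.inc
  | .store _ _ e => e.inc
  | .flip _ => 1
  | .seq p q => max p.gr q.gr
  | .ite _ p q => max p.gr q.gr
  | .rep _ _ p => max 1 p.gr

/-- The number of steps, when the loop bounds are given by `ν`. -/
def Prog.cost (ν : ℕ → ℕ) : Prog → ℕ
  | .seq p q => p.cost ν + q.cost ν
  | .ite _ p q => 1 + max (p.cost ν) (q.cost ν)
  | .rep _ y p => ν y * (p.cost ν + 2) + 2
  | _ => 1

/-- The registers that are used as loop bounds. -/
def Prog.bounds : Prog → List ℕ
  | .seq p q => p.bounds ++ q.bounds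
  | .ite _ p q => p.bounds ++ q.bounds
  | .rep _ y p => y :: p.bounds
  | _ => []

/-- The loop bounds are never changed. -/
def Prog.static (p : Prog) : Bool := p.bounds.all fun y => !p.writes y

theorem cost_mul_le {c w W S : ℕ} (h : c ≤ w * S) (hw : w ≤ W) : c ≤ 1 * (W * S) := by
  rw [Nat.one_mul]; exact h.trans (Nat.mul_le_mul_right _ hw)

/-- Each of the `k` rounds consists of a test, the body and an increment, and one final test
follows. The body enters through its bounds under an invariant `Q` only, so the lemma serves
`Prog.exec`, where these bounds come from the syntax, as well as `Prog.rep_runs`, where they come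
from the contents of the memory. -/
theorem Prog.exec_loop {v a W g Z c x y : ℕ} {p : Prog} (hx : x < v) (hy : y < v)
    (hf : p.fresh x y = true) (hW : 12 ≤ W) (hg : 1 ≤ g) {Q : State → Prop}
    (hQ : ∀ s, Q s → ∀ d, Q ((p.run s).set x d))
    (hp : ∀ s M, Q s → s.vars x < s.vars y → Bnd v a M s → M + g * c ≤ Z →
      ∃ t ≤ c * (W * (Nat.size Z + 1)), Exec p.compile s t (p.run s) ∧ Bnd v a (M + g * c) (p.run s))
    (k : ℕ) (s : State) (M : ℕ) (hs : Q s) (hk : s.vars y = s.vars x + k) (hM : Bnd v a M s)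
    (hZ : M + g * (k * (c + 2) + 1) ≤ Z) :
    ∃ t ≤ (k * (c + 2) + 1) * (W * (Nat.size Z + 1)),
      Exec (.loop (.sub (.var y) (.var x))
        (.seq p.compile (.assign x (.add (.var x) (.const 1))))) s t
        ((fun s => (p.run s).set x ((p.run s).vars x + 1))^[k] s) ∧
      Bnd v a (M + g * (k * (c + 2) + 1))
        ((fun s => (p.run s).set x ((p.run s).vars x + 1))^[k] s) := by
  have hf' := hf
  simp only [fresh, Bool.and_eq_true, bne_iff_ne, Bool.not_eq_true'] at hf'
  obtain ⟨⟨hxy, hwx⟩, hwy⟩ := hf'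
  have test : ∀ s, Bnd v a Z s → 1 + (Expr.sub (.var y) (.var x)).cost s ≤ W * (Nat.size Z + 1) := by
    intro s h
    have := Expr.cost_le (e := .sub (.var y) (.var x)) h (by simp [Expr.safe, hx, hy])
    simp only [Expr.wt] at this
    have := Nat.mul_le_mul_right (Nat.size Z + 1) hW
    omega
  induction k generalizing s M with
  | zero =>
    rw [Nat.zero_mul, Nat.zero_add] at *
    refine ⟨_, ?_, Exec.loop_stop (by simp [Expr.eval, hk]), hM.mono (Nat.le_add_right _ _)⟩
    rw [Nat.one_mul]
    exact test s (hM.mono (by omega))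
  | succ k ih =>
    have e1 : g * ((k + 1) * (c + 2) + 1) = g * c + g + g + g * (k * (c + 2) + 1) := by ring
    obtain ⟨t, ht, hex, hb⟩ := hp s M hs (by omega) hM (by omega)
    set s₁ := p.run s with hs₁
    have hvx : s₁.vars x ≤ M + g * c := hb.1 x hx
    have hb' : Bnd v a (M + g * c + g + g) (s₁.set x (s₁.vars x + 1)) :=
      (hb.mono (by omega)).set x (by omega)
    obtain ⟨t', ht', hex', hb''⟩ := ih (s₁.set x (s₁.vars x + 1)) (M + g * c + g + g)
      (hQ s hs _) (by
        simp only [State.set_vars, if_neg (Ne.symm hxy), if_true]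
        rw [hs₁, p.run_vars hwx, p.run_vars hwy, hk]; omega)
      hb' (by omega)
    refine ⟨_, ?_, Exec.loop_step (by simp [Expr.eval, hk]) (Exec.seq hex (Exec.assign _ _ _)) hex',
      hb''.mono (by omega)⟩
    have h1 := test s (hM.mono (by omega))
    have h2 : 1 + (Expr.add (.var x) (.const 1)).cost s₁ ≤ W * (Nat.size Z + 1) := by
      have := Expr.cost_le (e := .add (.var x) (.const 1)) (hb.mono (show _ ≤ Z by omega))
        (by simp [Expr.safe, hx])
      simp only [Expr.wt, Nat.size_one] at this
      have := Nat.mul_le_mul_right (Nat.size Z + 1) hW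
      omega
    have e2 : ((k + 1) * (c + 2) + 1) * (W * (Nat.size Z + 1)) = c * (W * (Nat.size Z + 1)) +
      2 * (W * (Nat.size Z + 1)) + (k * (c + 2) + 1) * (W * (Nat.size Z + 1)) := by ring
    omega

/-- Two bounds for the memory are carried along: `M` is the current one and grows by `g` per step;
`Z` bounds all numbers that ever occur, so each step costs at most `W * (Nat.size Z + 1)`. -/
theorem Prog.exec {v a W g : ℕ} {ν : ℕ → ℕ} {p : Prog} (hok : p.ok v a = true) (hW : p.wt ≤ W)
    (hg : p.gr ≤ g) {Z : ℕ} (hst : ∀ y ∈ p.bounds, p.writes y = false) (s : State) (M : ℕ)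
    (hν : ∀ y ∈ p.bounds, s.vars y = ν y) (hM : Bnd v a M s) (hZ : M + g * p.cost ν ≤ Z) :
    ∃ t ≤ p.cost ν * (W * (Nat.size Z + 1)), Exec p.compile s t (p.run s) ∧
      Bnd v a (M + g * p.cost ν) (p.run s) := by
  induction p generalizing s M with
  | skip =>
    refine ⟨1, ?_, Exec.skip s, hM.mono (Nat.le_add_right _ _)⟩
    simp only [wt, cost] at hW ⊢
    rw [Nat.one_mul]
    exact Nat.mul_pos hW (Nat.succ_pos _)
  | set x e =>
    simp only [ok, Bool.and_eq_true, wt, gr, cost, mul_one] at *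
    refine ⟨_, ?_, Exec.assign _ _ _, (hM.mono (by omega)).set x
      ((Expr.eval_le hM hok.2 hok.1).trans (by omega))⟩
    refine cost_mul_le (w := 1 + e.wt) ?_ hW
    have := Expr.cost_le (hM.mono (show M ≤ Z by omega)) hok.2
    rw [Nat.add_mul]; omega
  | clamp x e f =>
    simp only [ok, Bool.and_eq_true, wt, gr, cost, mul_one] at *
    -- Under truncated subtraction `e - (e - f)` is the minimum.
    have h : (Expr.sub e (.sub e f)).eval s = min (e.eval s) (f.eval s) := by
      simp only [Expr.eval]; omega
    refine ⟨1 + (Expr.sub e (.sub e f)).cost s, ?_, ?_, (hM.mono (by omega)).set x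
      ((min_le_right _ _).trans ((Expr.eval_le hM hok.2 hok.1.1).trans (by omega)))⟩
    · refine cost_mul_le (w := 1 + (Expr.sub e (.sub e f)).wt) ?_ hW
      have := Expr.cost_le (e := Expr.sub e (.sub e f)) (hM.mono (show M ≤ Z by omega))
        (by simp [Expr.safe, hok.1.2, hok.2])
      rw [Nat.add_mul]; omega
    · rw [run, ← h]; exact Exec.assign _ _ _
  | store b i e =>
    simp only [ok, Bool.and_eq_true, wt, gr, cost, mul_one] at *
    refine ⟨_, ?_, Exec.store _ _ _ _, (hM.mono (by omega)).store b i e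
      ((Expr.eval_le hM hok.1.2 hok.1.1).trans (by omega))⟩
    refine cost_mul_le (w := 1 + i.wt + e.wt) ?_ hW
    have h1 := Expr.cost_le (hM.mono (show M ≤ Z by omega)) hok.1.2
    have h2 := Expr.cost_le (hM.mono (show M ≤ Z by omega)) hok.2
    rw [Nat.add_mul, Nat.add_mul]; omega
  | flip x =>
    simp only [wt, gr, cost, mul_one] at *
    refine ⟨1, ?_, Exec.flip _ _, fun y hy => ?_, fun b hb i => (hM.2 b hb i).trans (by omega)⟩
    · rw [Nat.one_mul]
      exact Nat.mul_pos hW (Nat.succ_pos _)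
    · have := hM.1 y hy
      rw [run, State.flip_vars]
      have := (s.coins 0).toNat_le
      split_ifs <;> omega
  | seq p q ihp ihq =>
    simp only [ok, Bool.and_eq_true, wt, gr, cost, bounds, List.mem_append, writes,
      Bool.or_eq_false_iff, max_le_iff] at *
    rw [Nat.mul_add] at hZ
    obtain ⟨t, ht, hex, hb⟩ := ihp hok.1 hW.1 hg.1 (fun y hy => (hst y (.inl hy)).1) s M
      (fun y hy => hν y (.inl hy)) hM (by omega)
    obtain ⟨t', ht', hex', hb'⟩ := ihq hok.2 hW.2 hg.2 (fun y hy => (hst y (.inr hy)).2) (p.run s) _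
      (fun y hy => by rw [p.run_vars (hst y (.inr hy)).1]; exact hν y (.inr hy)) hb (by omega)
    exact ⟨t + t', by rw [Nat.add_mul]; omega, hex.seq hex', by rw [Nat.mul_add, ← Nat.add_assoc]; exact hb'⟩
  | ite e p q ihp ihq =>
    simp only [ok, Bool.and_eq_true, wt, gr, cost, bounds, List.mem_append, writes,
      Bool.or_eq_false_iff, max_le_iff] at *
    have hc := Expr.cost_le (hM.mono (show M ≤ Z by omega)) hok.1.1
    have hc' := Nat.mul_le_mul_right (Nat.size Z + 1) hW.1
    have hp : g * p.cost ν ≤ g * (1 + max (p.cost ν) (q.cost ν)) := Nat.mul_le_mul_left _ (by omega)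
    have hq : g * q.cost ν ≤ g * (1 + max (p.cost ν) (q.cost ν)) := Nat.mul_le_mul_left _ (by omega)
    have hp' : p.cost ν * (W * (Nat.size Z + 1)) ≤
      max (p.cost ν) (q.cost ν) * (W * (Nat.size Z + 1)) := Nat.mul_le_mul_right _ (le_max_left _ _)
    have hq' : q.cost ν * (W * (Nat.size Z + 1)) ≤
      max (p.cost ν) (q.cost ν) * (W * (Nat.size Z + 1)) := Nat.mul_le_mul_right _ (le_max_right _ _)
    simp only [run]
    rw [Nat.add_mul] at hc'
    by_cases h : e.eval s = 0
    · obtain ⟨t, ht, hex, hb⟩ := ihq hok.2 hW.2.2 hg.2 (fun y hy => (hst y (.inr hy)).2) s M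
        (fun y hy => hν y (.inr hy)) hM (by omega)
      rw [if_neg (not_not.2 h)]
      exact ⟨_, by rw [Nat.add_mul, Nat.one_mul]; omega, Exec.ite_false h hex, hb.mono (by omega)⟩
    · obtain ⟨t, ht, hex, hb⟩ := ihp hok.1.2 hW.2.1 hg.1 (fun y hy => (hst y (.inl hy)).1) s M
        (fun y hy => hν y (.inl hy)) hM (by omega)
      rw [if_pos h]
      exact ⟨_, by rw [Nat.add_mul, Nat.one_mul]; omega, Exec.ite_true h hex, hb.mono (by omega)⟩
  | rep x y p ih =>
    simp only [ok, Bool.and_eq_true, wt, gr, cost, bounds, List.mem_cons, writes,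
      Bool.or_eq_false_iff, max_le_iff, decide_eq_true_eq, beq_eq_false_iff_ne] at *
    obtain ⟨⟨⟨hx, hy⟩, hf⟩, hok⟩ := hok
    have e1 : g * (ν y * (p.cost ν + 2) + 2) = g * (ν y * (p.cost ν + 2) + 1) + g := by ring
    have hxy : x ≠ y := (hst y (.inl rfl)).1
    obtain ⟨t, ht, hex, hb⟩ := exec_loop (c := p.cost ν) (Z := Z) hx hy hf hW.1 hg.1
      (Q := fun s => ∀ z ∈ p.bounds, s.vars z = ν z)
      (fun s hs d z hz => by
        have := hst z (.inr hz)
        rw [State.set_vars, if_neg (Ne.symm this.1), p.run_vars this.2, hs z hz])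
      (fun s M hQ _ hM hZ => ih hok hW.2 hg.2 (fun z hz => (hst z (.inr hz)).2) s M hQ hM hZ)
      (ν y) (s.set x 0) (M + g)
      (fun z hz => by
        rw [State.set_vars, if_neg (Ne.symm (hst z (.inr hz)).1), hν z (.inr hz)])
      (by simp [Ne.symm hxy, hν y (.inl rfl)])
      ((hM.mono (Nat.le_add_right _ _)).set x (Nat.zero_le _)) (by omega)
    refine ⟨1 + (Expr.const 0).cost s + t, ?_, Exec.seq (Exec.assign _ _ _) ?_, ?_⟩
    rotate_left 1
    · simp only [run]; rw [hν y (.inl rfl)]; exact hex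
    · simp only [run]; rw [hν y (.inl rfl)]; exact hb.mono (by omega)
    · have : 2 ≤ W * (Nat.size Z + 1) := (show 2 ≤ W by omega).trans (Nat.le_mul_of_pos_right _ (by simp))
      have e2 : (ν y * (p.cost ν + 2) + 2) * (W * (Nat.size Z + 1)) =
        (ν y * (p.cost ν + 2) + 1) * (W * (Nat.size Z + 1)) + W * (Nat.size Z + 1) := by ring
      simp only [Expr.cost, Nat.size_zero]
      omega

/-- `c` leads from `s` to `s'` in `T` steps, each of which costs at most `W` times the length of the
numbers in memory and increases these numbers by at most `g`. -/
def Runs (v a W g : ℕ) (c : Com) (s : State) (T : ℕ) (s' : State) : Prop :=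
  ∀ M Z, Bnd v a M s → M + g * T ≤ Z →
    ∃ t ≤ T * (W * (Nat.size Z + 1)), Exec c s t s' ∧ Bnd v a (M + g * T) s'

theorem Prog.runs {v a W g : ℕ} {p : Prog} (hok : p.ok v a = true) (hW : p.wt ≤ W)
    (hg : p.gr ≤ g) (hst : p.static = true) (s : State) :
    Runs v a W g p.compile s (p.cost s.vars) (p.run s) := fun M Z hM hZ =>
  Prog.exec hok hW hg (fun y hy => by simpa using List.all_eq_true.1 hst y hy) s M
    (fun _ _ => rfl) hM hZ

theorem Runs.seq {v a W g T T' : ℕ} {c c' : Com} {s s' s'' : State} (h : Runs v a W g c s T s')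
    (h' : Runs v a W g c' s' T' s'') : Runs v a W g (.seq c c') s (T + T') s'' := by
  intro M Z hM hZ
  rw [Nat.mul_add] at hZ
  obtain ⟨t, ht, hex, hb⟩ := h M Z hM (by omega)
  obtain ⟨t', ht', hex', hb'⟩ := h' _ Z hb (by omega)
  exact ⟨t + t', by rw [Nat.add_mul]; omega, hex.seq hex', by rw [Nat.mul_add, ← Nat.add_assoc]; exact hb'⟩

theorem Runs.mono {v a W g T T' : ℕ} {c : Com} {s s' : State} (h : Runs v a W g c s T s')
    (hT : T ≤ T') : Runs v a W g c s T' s' := by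
  intro M Z hM hZ
  have := Nat.mul_le_mul_left g hT
  obtain ⟨t, ht, hex, hb⟩ := h M Z hM (by omega)
  exact ⟨t, ht.trans (Nat.mul_le_mul_right _ hT), hex, hb.mono (by omega)⟩

/-! #### Counting nonzero cells -/

/-- Is the expression the constant zero? -/
def Expr.isZero : Expr → Bool
  | .const c => c == 0
  | _ => false

/-- A bound for the number of times that a nonzero value is stored into array `a`. -/
def Prog.fills (a : ℕ) (ν : ℕ → ℕ) : Prog → ℕ
  | .store b _ e => if b == a && !e.isZero then 1 else 0
  | .seq p q => p.fills a ν + q.fills a ν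
  | .ite _ p q => max (p.fills a ν) (q.fills a ν)
  | .rep _ y p => ν y * p.fills a ν
  | _ => 0

/-- At most `m` cells of array `a` are nonzero. -/
def Sparse (a m : ℕ) (s : State) : Prop := ∃ T : Finset ℕ, T.card ≤ m ∧ ∀ i ∉ T, s.arr a i = 0

theorem Sparse.mono {a m m' : ℕ} {s : State} (h : Sparse a m s) (hm : m ≤ m') : Sparse a m' s := by
  obtain ⟨T, hT, h⟩ := h
  exact ⟨T, hT.trans hm, h⟩

theorem Sparse.store {a m : ℕ} {s : State} (h : Sparse a m s) (b : ℕ) (i e : Expr) :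
    Sparse a (m + 1) (s.store b i e) := by
  classical
  obtain ⟨T, hT, h⟩ := h
  refine ⟨insert (i.eval s) T, (Finset.card_insert_le _ _).trans (by omega), fun j hj => ?_⟩
  rw [Finset.mem_insert, not_or] at hj
  rw [State.store_arr, if_neg (fun h => hj.1 h.2), h j hj.2]

/-- Only stores of possibly nonzero values are counted. This bounds the size of the output for every
outcome of the coin flips. -/
theorem Prog.sparse_run {a : ℕ} {ν : ℕ → ℕ} {p : Prog} (hst : ∀ y ∈ p.bounds, p.writes y = false)
    (s : State) (hν : ∀ y ∈ p.bounds, s.vars y = ν y) {m : ℕ} (h : Sparse a m s) :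
    Sparse a (m + p.fills a ν) (p.run s) := by
  induction p generalizing s m with
  | skip | set | clamp | flip => exact h
  | store b i e =>
    simp only [fills, Bool.and_eq_true, beq_iff_eq]
    split_ifs with hc
    · exact h.store b i e
    · obtain ⟨T, hT, h⟩ := h
      refine ⟨T, hT, fun j hj => ?_⟩
      rw [run, State.store_arr, h j hj]
      split_ifs with hc'
      · rw [not_and] at hc
        have := hc hc'.1.symm
        cases e <;> simp_all [Expr.isZero, Expr.eval]
      · rfl
  | seq p q ihp ihq =>
    simp only [bounds, List.mem_append, writes, Bool.or_eq_false_iff, fills, run] at *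
    rw [← Nat.add_assoc]
    exact ihq (fun y hy => (hst y (.inr hy)).2) _
      (fun y hy => by rw [p.run_vars (hst y (.inr hy)).1]; exact hν y (.inr hy))
      (ihp (fun y hy => (hst y (.inl hy)).1) s (fun y hy => hν y (.inl hy)) h)
  | ite e p q ihp ihq =>
    simp only [bounds, List.mem_append, writes, Bool.or_eq_false_iff, fills, run] at *
    split_ifs
    · exact (ihp (fun y hy => (hst y (.inl hy)).1) s (fun y hy => hν y (.inl hy)) h).mono (by omega)
    · exact (ihq (fun y hy => (hst y (.inr hy)).2) s (fun y hy => hν y (.inr hy)) h).mono (by omega)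
  | rep x y p ih =>
    simp only [bounds, List.mem_cons, writes, Bool.or_eq_false_iff, fills, run,
      beq_eq_false_iff_ne] at *
    rw [hν y (.inl rfl)]
    suffices ∀ k, let s' := (fun s => (p.run s).set x ((p.run s).vars x + 1))^[k] (s.set x 0)
        Sparse a (m + k * p.fills a ν) s' ∧ ∀ z ∈ p.bounds, s'.vars z = ν z from (this _).1
    intro k
    induction k with
    | zero =>
      refine ⟨by simpa [Sparse] using h, fun z hz => ?_⟩
      simp [Ne.symm (hst z (.inr hz)).1, hν z (.inr hz)]
    | succ k ihk =>
      simp only [Function.iterate_succ', Function.comp_apply]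
      refine ⟨?_, fun z hz => ?_⟩
      · have := ih (fun z hz => (hst z (.inr hz)).2) _ ihk.2 ihk.1
        rw [Nat.succ_mul, ← Nat.add_assoc]
        exact this
      · rw [State.set_vars, if_neg (Ne.symm (hst z (.inr hz)).1), p.run_vars (hst z (.inr hz)).2]
        exact ihk.2 z hz

theorem Sparse.card_outputEdges_le {m n : ℕ} {s : State} (h : Sparse 1 m s) :
    (outputEdges n s).card ≤ m := by
  obtain ⟨T, hT, h⟩ := h
  refine (Finset.card_le_card_of_injOn (t := T) (fun e => (e.1 : ℕ) * n + e.2) ?_ ?_).trans hT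
  · intro e he
    by_contra hc
    exact (Finset.mem_filter.1 he).2 (h _ hc)
  · rintro ⟨i, j⟩ - ⟨i', j'⟩ - he
    have hn : 0 < n := i.pos
    have h1 := congrArg (· / n) he
    have h2 := congrArg (· % n) he
    simp only [Nat.mul_comm _ n,
      Nat.mul_add_div hn, Nat.div_eq_of_lt j.2, Nat.div_eq_of_lt j'.2, Nat.add_zero,
      Nat.mul_add_mod, Nat.mod_eq_of_lt j.2, Nat.mod_eq_of_lt j'.2] at h1 h2
    exact Prod.ext (Fin.ext h1) (Fin.ext h2)

end Programs

end Shortcut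
namespace Shortcut

/-! ### The chain cover procedure on levels of slots, its invariant and its potential. -/

section ChainCover

/-- The data of the chain cover procedure: `slot (l * cap + s)` is `v + 1` if `v` is in slot `s` of
level `l` (and `0` if the slot is empty), `c` is the stack of slots (from level `K - 1` down to the
current level `i`), `ch` lists the chains, `ptr` elements were loaded and `nch` chains extracted. -/
structure Cover where
  slot : ℕ → ℕ
  c : ℕ → ℕ
  ch : ℕ → ℕ
  i : ℕ
  ptr : ℕ
  nch : ℕ

/-- Where an element is. -/
inductive Place where
  | fresh
  | slot (l s : ℕ)
  | chain (x : ℕ)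
  | aside (t : ℕ)

/-- The weight of an element in the potential function. -/
def Place.wt (K : ℕ) : Place → ℕ
  | .fresh => 2 * K + 2
  | .slot l _ => 2 * l + 2
  | _ => 0

/-- One step of the chain cover procedure. -/
inductive Cover.Step (K cap N : ℕ) (lt : ℕ → ℕ → Prop) (ord : ℕ → ℕ) : Cover → Cover → Prop
  | done (σ : Cover) : σ.i = K → N ≤ σ.ptr → Step K cap N lt ord σ σ
  | load (σ : Cover) : σ.i = K → σ.ptr < N → Step K cap N lt ord σ
      { σ with
        slot := Function.update σ.slot ((K - 1) * cap) (ord σ.ptr + 1)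
        c := Function.update σ.c (K - 1) 0
        i := K - 1
        ptr := σ.ptr + 1 }
  | extract (σ : Cover) (slot' ch' : ℕ → ℕ) : σ.i = 0 →
      (∀ l < K, ∀ s < cap, slot' (l * cap + s) = if s = σ.c l then 0 else σ.slot (l * cap + s)) →
      (∀ j < K, ch' (σ.nch * K + j) = σ.slot (j * cap + σ.c j) - 1) →
      (∀ x < σ.nch * K, ch' x = σ.ch x) → Step K cap N lt ord σ
      { σ with slot := slot', ch := ch', i := K, nch := σ.nch + 1 }
  | push (σ : Cover) (e : ℕ) : 0 < σ.i → σ.i < K → e < cap → σ.slot ((σ.i - 1) * cap + e) ≠ 0 →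
      lt (σ.slot ((σ.i - 1) * cap + e) - 1) (σ.slot (σ.i * cap + σ.c σ.i) - 1) →
      Step K cap N lt ord σ { σ with c := Function.update σ.c (σ.i - 1) e, i := σ.i - 1 }
  | drop (σ : Cover) (e : ℕ) (slot₀ : ℕ → ℕ) : 0 < σ.i → σ.i < K → e < cap →
      (∀ s < cap, σ.slot ((σ.i - 1) * cap + s) ≠ 0 →
        ¬ lt (σ.slot ((σ.i - 1) * cap + s) - 1) (σ.slot (σ.i * cap + σ.c σ.i) - 1)) →
      (slot₀ = σ.slot ∧ σ.slot ((σ.i - 1) * cap + e) = 0 ∨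
        (∀ s < cap, σ.slot ((σ.i - 1) * cap + s) ≠ 0) ∧
        ∀ l < K, ∀ s < cap,
          slot₀ (l * cap + s) = if l = σ.i - 1 then 0 else σ.slot (l * cap + s)) →
      Step K cap N lt ord σ { σ with
        slot := Function.update (Function.update slot₀ ((σ.i - 1) * cap + e)
          (σ.slot (σ.i * cap + σ.c σ.i))) (σ.i * cap + σ.c σ.i) 0
        i := σ.i + 1 }

theorem slot_index_inj {cap l s l' s' : ℕ} (hs : s < cap) (hs' : s' < cap) :
    l * cap + s = l' * cap + s' ↔ l = l' ∧ s = s' := by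
  refine ⟨fun h => ?_, fun ⟨h, h'⟩ => by rw [h, h']⟩
  have hc : 0 < cap := by omega
  have h1 := congrArg (· / cap) h
  simp only [Nat.mul_comm _ cap, Nat.mul_add_div hc, Nat.div_eq_of_lt hs, Nat.div_eq_of_lt hs',
    Nat.add_zero] at h1
  subst h1
  exact ⟨rfl, by omega⟩

/-- The invariant: `st` is the place of each element, and `q` levels were set aside. -/
structure Cover.Inv (K cap N : ℕ) (lt : ℕ → ℕ → Prop) (ord : ℕ → ℕ) (σ : Cover) (st : ℕ → Place)
    (q : ℕ) : Prop where
  slot_iff : ∀ l < K, ∀ s < cap, ∀ v, σ.slot (l * cap + s) = v + 1 ↔ st v = .slot l s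
  slot_lt : ∀ {v l s}, st v = .slot l s → l < K ∧ s < cap
  chain_iff : ∀ x v, (x < σ.nch * K ∧ σ.ch x = v) ↔ st v = .chain x
  fresh_iff : ∀ v, st v ≠ .fresh ↔ ∃ p < σ.ptr, ord p = v
  mono : ∀ {u v l s l' s'}, st u = .slot l s → st v = .slot l' s' → lt u v → l < l'
  top : ∀ {v s}, st v = .slot (K - 1) s → σ.i < K ∧ s = σ.c (K - 1)
  stack : ∀ j, σ.i ≤ j → j < K → ∃ v, st v = .slot j (σ.c j)
  stack_lt : ∀ j u v, σ.i ≤ j → j + 1 < K → st u = .slot j (σ.c j) →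
    st v = .slot (j + 1) (σ.c (j + 1)) → lt u v
  chain_lt : ∀ t < σ.nch, ∀ j, j + 1 < K → lt (σ.ch (t * K + j)) (σ.ch (t * K + (j + 1)))
  aside_lt : ∀ {v t}, st v = .aside t → t < q
  aside : ∀ {u v t}, st u = .aside t → st v = .aside t → ¬ lt u v
  card : ∃ A : Finset ℕ, A ⊆ Finset.range N ∧ A.card = q * cap ∧ ∀ v, v ∈ A ↔ ∃ t, st v = .aside t
  i_le : σ.i ≤ K
  ptr_le : σ.ptr ≤ N

/-- The potential function. -/
def Cover.pot (K N : ℕ) (σ : Cover) (st : ℕ → Place) : ℕ :=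
  ∑ v ∈ Finset.range N, (st v).wt K + σ.i

variable {K cap N : ℕ} {lt : ℕ → ℕ → Prop} {ord : ℕ → ℕ} {σ σ' : Cover} {st : ℕ → Place} {q : ℕ}

theorem Cover.Inv.slot_ne_zero (h : σ.Inv K cap N lt ord st q) {l s : ℕ} (hl : l < K) (hs : s < cap)
    (h0 : σ.slot (l * cap + s) ≠ 0) : st (σ.slot (l * cap + s) - 1) = .slot l s :=
  (h.slot_iff l hl s hs _).1 (by omega)

theorem Cover.Inv.slot_eq (h : σ.Inv K cap N lt ord st q) {v l s : ℕ} (hv : st v = .slot l s) :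
    σ.slot (l * cap + s) = v + 1 :=
  (h.slot_iff l (h.slot_lt hv).1 s (h.slot_lt hv).2 v).2 hv

theorem Cover.Inv.lt_N (h : σ.Inv K cap N lt ord st q) (hord : ∀ p < N, ord p < N) {v : ℕ}
    (hv : st v ≠ .fresh) : v < N := by
  obtain ⟨p, hp, rfl⟩ := (h.fresh_iff v).1 hv
  exact hord p (hp.trans_le h.ptr_le)

theorem sum_update_lt {N v : ℕ} (hv : v < N) {f g : ℕ → ℕ} (hfg : ∀ u, u ≠ v → f u = g u) :
    ∑ u ∈ Finset.range N, f u + g v = ∑ u ∈ Finset.range N, g u + f v := by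
  have h1 := Finset.sum_erase_add (Finset.range N) f (Finset.mem_range.2 hv)
  have h2 := Finset.sum_erase_add (Finset.range N) g (Finset.mem_range.2 hv)
  have h3 : ∑ u ∈ (Finset.range N).erase v, f u = ∑ u ∈ (Finset.range N).erase v, g u :=
    Finset.sum_congr rfl fun u hu => hfg u (Finset.ne_of_mem_erase hu)
  omega

/-- With an empty stack the top level is empty (`top`), so everything below the new element is on a
lower level. Nothing already loaded lies above it, because elements are loaded along a linear
extension. -/
theorem Cover.Inv.load (h : σ.Inv K cap N lt ord st q) (hK : 0 < K) (hcap : 0 < cap)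
    (hord : ∀ p < N, ord p < N) (hinj : ∀ p < N, ∀ p' < N, ord p = ord p' → p = p')
    (htop : ∀ p < N, ∀ p' < N, lt (ord p) (ord p') → p < p') (hi : σ.i = K) (hp : σ.ptr < N) :
    ∃ st', Cover.Inv K cap N lt ord
      { σ with
        slot := Function.update σ.slot ((K - 1) * cap) (ord σ.ptr + 1)
        c := Function.update σ.c (K - 1) 0
        i := K - 1
        ptr := σ.ptr + 1 } st' q ∧
      ∑ v ∈ Finset.range N, (st' v).wt K + (K - 1) + 1 ≤ ∑ v ∈ Finset.range N, (st v).wt K + K := by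
  classical
  set w := ord σ.ptr with hw
  have hwf : st w = .fresh := by
    by_contra hne
    obtain ⟨p, hp', he⟩ := (h.fresh_iff w).1 hne
    have := hinj p (by omega) σ.ptr hp he
    omega
  have htopf : ∀ v s, st v ≠ .slot (K - 1) s := fun v s hv => by
    have := (h.top hv).1; omega
  have hidx : ∀ l < K, ∀ s < cap, (l * cap + s = (K - 1) * cap ↔ l = K - 1 ∧ s = 0) := by
    intro l _ s hs
    have := slot_index_inj (l := l) (l' := K - 1) hs hcap
    simpa using this
  have hold : ∀ {v}, st v ≠ .fresh → v ≠ w := fun {v} hv e => hv (e ▸ hwf)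
  have hst : ∀ v, v ≠ w → Function.update st w (.slot (K - 1) 0) v = st v :=
    fun v hv => Function.update_of_ne hv _ _
  have hstw : Function.update st w (.slot (K - 1) 0) w = .slot (K - 1) 0 := Function.update_self ..
  refine ⟨Function.update st w (.slot (K - 1) 0), ?_, ?_⟩
  · constructor
    · intro l hl s hs v
      simp only [Function.update_apply, hidx l hl s hs]
      by_cases hvw : v = w
      · subst hvw
        simp only [if_true]
        constructor
        · intro h'
          split_ifs at h' with h1
          · rw [h1.1, h1.2]
          · rw [h.slot_iff l hl s hs, hwf] at h'; cases h'
        · intro h'; cases h'; simp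
      · rw [if_neg hvw]
        split_ifs with h1
        · constructor
          · intro h'; exact absurd (by omega) hvw
          · intro h'; rw [h1.1] at h'; exact absurd h' (htopf v s)
        · exact h.slot_iff l hl s hs v
    · intro v l s hv
      by_cases hvw : v = w
      · rw [hvw, hstw] at hv; cases hv; omega
      · rw [hst v hvw] at hv; exact h.slot_lt hv
    · intro x v
      by_cases hvw : v = w
      · rw [hvw, hstw]
        refine ⟨fun h' => ?_, fun h' => by cases h'⟩
        have := (h.chain_iff x w).1 h'
        rw [hwf] at this; cases this
      · rw [hst v hvw]; exact h.chain_iff x v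
    · intro v
      by_cases hvw : v = w
      · rw [hvw, hstw]
        simp only [ne_eq, reduceCtorEq, not_false_iff, true_iff]
        exact ⟨σ.ptr, Nat.lt_succ_self _, rfl⟩
      · rw [hst v hvw, h.fresh_iff v]
        constructor
        · rintro ⟨p, hp, rfl⟩; exact ⟨p, Nat.lt_succ_of_lt hp, rfl⟩
        · rintro ⟨p, hp, rfl⟩
          rcases Nat.lt_succ_iff_lt_or_eq.1 hp with h1 | rfl
          · exact ⟨p, h1, rfl⟩
          · exact absurd rfl hvw
    · intro u v l s l' s' hu hv huv
      by_cases huw : u = w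
      · subst huw
        by_cases hvw : v = ord σ.ptr
        · subst hvw
          exact absurd (htop _ hp _ hp huv) (lt_irrefl _)
        · rw [hst v hvw] at hv
          obtain ⟨p, hp', rfl⟩ := (h.fresh_iff v).1 (by rw [hv]; simp)
          have := htop _ hp _ (by omega) huv
          omega
      · rw [hst u huw] at hu
        by_cases hvw : v = w
        · rw [hvw, hstw] at hv
          cases hv
          have h1 := (h.slot_lt hu).1
          have h2 : l ≠ K - 1 := fun e => htopf u s (e ▸ hu)
          omega
        · rw [hst v hvw] at hv; exact h.mono hu hv huv
    · intro v s hv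
      by_cases hvw : v = w
      · rw [hvw, hstw] at hv; cases hv; simp; omega
      · rw [hst v hvw] at hv; exact absurd hv (htopf v s)
    · intro j hj hjK
      obtain rfl : j = K - 1 := by simp only at hj; omega
      exact ⟨w, by simp⟩
    · intro j u v hj hjK
      simp only at hj; omega
    · exact h.chain_lt
    · intro v t hv
      by_cases hvw : v = w
      · rw [hvw, hstw] at hv; cases hv
      · rw [hst v hvw] at hv; exact h.aside_lt hv
    · intro u v t hu hv
      by_cases huw : u = w
      · rw [huw, hstw] at hu; cases hu
      by_cases hvw : v = w
      · rw [hvw, hstw] at hv; cases hv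
      · rw [hst v hvw] at hv; rw [hst u huw] at hu; exact h.aside hu hv
    · obtain ⟨A, hA, hc, hA'⟩ := h.card
      refine ⟨A, hA, hc, fun v => ?_⟩
      by_cases hvw : v = w
      · rw [hvw, hstw, hA' w, hwf]; simp
      · rw [hst v hvw]; exact hA' v
    · simp
    · exact hp
  · have := sum_update_lt (hord _ hp) (f := fun v => (Function.update st w (.slot (K - 1) 0) v).wt K)
      (g := fun v => (st v).wt K) (fun u hu => by simp only [hst u hu])
    simp only [← hw, hstw, hwf] at this
    have e1 : (Place.slot (K - 1) 0).wt K = 2 * (K - 1) + 2 := rfl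
    have e2 : Place.fresh.wt K = 2 * K + 2 := rfl
    omega

/-- No element moves: the stack, an increasing chain from the current level upwards, is extended by
a smaller element. -/
theorem Cover.Inv.push (h : σ.Inv K cap N lt ord st q) {e : ℕ} (hi : 0 < σ.i) (hiK : σ.i < K)
    (he : e < cap) (hne : σ.slot ((σ.i - 1) * cap + e) ≠ 0)
    (hlt : lt (σ.slot ((σ.i - 1) * cap + e) - 1) (σ.slot (σ.i * cap + σ.c σ.i) - 1)) :
    Cover.Inv K cap N lt ord { σ with c := Function.update σ.c (σ.i - 1) e, i := σ.i - 1 } st q where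
  slot_iff := h.slot_iff
  slot_lt := h.slot_lt
  chain_iff := h.chain_iff
  fresh_iff := h.fresh_iff
  mono := h.mono
  top := fun {v s} hv => by
    have := (h.top hv).2
    simp only
    rw [Function.update_of_ne (by omega)]
    exact ⟨by omega, this⟩
  stack := fun j hj hjK => by
    simp only at hj ⊢
    by_cases hji : j = σ.i - 1
    · subst hji
      rw [Function.update_self]
      exact ⟨_, h.slot_ne_zero hjK he hne⟩
    · rw [Function.update_of_ne hji]
      exact h.stack j (by omega) hjK
  stack_lt := fun j u v hj hjK hu hv => by
    simp only at hj hu hv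
    rw [Function.update_of_ne (by omega)] at hv
    by_cases hji : j = σ.i - 1
    · subst hji
      rw [Function.update_self] at hu
      rw [Nat.sub_add_cancel hi] at hv
      rw [h.slot_eq hu, h.slot_eq hv] at hlt
      simpa using hlt
    · rw [Function.update_of_ne hji] at hu
      exact h.stack_lt j u v (by omega) hjK hu hv
  chain_lt := h.chain_lt
  aside_lt := h.aside_lt
  aside := h.aside
  card := h.card
  i_le := by simp only; omega
  ptr_le := h.ptr_le

/-- Levels are antichains, by monotonicity. A full level is set aside as antichain number `q`, with
exactly `cap` elements; the stack lives on higher levels and is not affected. -/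
theorem Cover.Inv.clear (h : σ.Inv K cap N lt ord st q) (hord : ∀ p < N, ord p < N) (hi : 0 < σ.i)
    (hiK : σ.i < K) (hfull : ∀ s < cap, σ.slot ((σ.i - 1) * cap + s) ≠ 0) {slot₀ : ℕ → ℕ}
    (hs₀ : ∀ l < K, ∀ s < cap,
      slot₀ (l * cap + s) = if l = σ.i - 1 then 0 else σ.slot (l * cap + s)) :
    ∃ st' q', Cover.Inv K cap N lt ord { σ with slot := slot₀ } st' q' ∧
      ∑ v ∈ Finset.range N, (st' v).wt K ≤ ∑ v ∈ Finset.range N, (st v).wt K := by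
  classical
  have hst : ∀ v, ∃ p : Place, (∀ s, st v = .slot (σ.i - 1) s → p = .aside q) ∧
      ((∀ s, st v ≠ .slot (σ.i - 1) s) → p = st v) := by
    intro v
    by_cases hv : ∃ s, st v = .slot (σ.i - 1) s
    · exact ⟨_, fun _ _ => rfl, fun h => absurd hv.choose_spec (h _)⟩
    · exact ⟨_, fun s hs => absurd ⟨s, hs⟩ hv, fun _ => rfl⟩
  choose st' h1 h2 using hst
  have hslot : ∀ {v l s}, st' v = .slot l s ↔ st v = .slot l s ∧ l ≠ σ.i - 1 := by
    intro v l s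
    by_cases hv : ∃ s, st v = .slot (σ.i - 1) s
    · obtain ⟨s', hs'⟩ := hv
      rw [h1 v s' hs', hs']
      refine ⟨fun h => (by cases h), fun ⟨h, h'⟩ => ?_⟩
      cases h; exact absurd rfl h'
    · rw [h2 v fun s hs => hv ⟨s, hs⟩]
      exact ⟨fun h => ⟨h, fun e => hv ⟨s, e ▸ h⟩⟩, fun h => h.1⟩
  have hother : ∀ {v} {p : Place}, (∀ l s, p ≠ .slot l s) → (∀ t, p ≠ .aside t) →
      (st' v = p ↔ st v = p) := by
    intro v p hp hp'
    by_cases hv : ∃ s, st v = .slot (σ.i - 1) s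
    · obtain ⟨s', hs'⟩ := hv
      rw [h1 v s' hs', hs']
      exact ⟨fun h => absurd h.symm (hp' _), fun h => absurd h.symm (hp _ _)⟩
    · rw [h2 v fun s hs => hv ⟨s, hs⟩]
  have haside : ∀ {v t}, st' v = .aside t ↔ st v = .aside t ∨ t = q ∧ ∃ s, st v = .slot (σ.i - 1) s := by
    intro v t
    by_cases hv : ∃ s, st v = .slot (σ.i - 1) s
    · obtain ⟨s', hs'⟩ := hv
      rw [h1 v s' hs', hs']
      simp [eq_comm]
    · rw [h2 v fun s hs => hv ⟨s, hs⟩]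
      simp [hv]
  refine ⟨st', q + 1, ?_, Finset.sum_le_sum fun v _ => ?_⟩
  · constructor
    · intro l hl s hs v
      simp only [hs₀ l hl s hs, hslot]
      split_ifs with hli
      · simp [hli]
      · simp [hli, h.slot_iff l hl s hs]
    · intro v l s hv; exact h.slot_lt (hslot.1 hv).1
    · intro x v; rw [hother (by simp) (by simp)]; exact h.chain_iff x v
    · intro v; rw [ne_eq, hother (by simp) (by simp)]; exact h.fresh_iff v
    · intro u v l s l' s' hu hv; exact h.mono (hslot.1 hu).1 (hslot.1 hv).1
    · intro v s hv; exact h.top (hslot.1 hv).1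
    · intro j hj hjK
      obtain ⟨v, hv⟩ := h.stack j hj hjK
      simp only at hj
      exact ⟨v, hslot.2 ⟨hv, by omega⟩⟩
    · intro j u v hj hjK hu hv; exact h.stack_lt j u v hj hjK (hslot.1 hu).1 (hslot.1 hv).1
    · exact h.chain_lt
    · intro v t hv
      rcases haside.1 hv with h' | h'
      · exact (h.aside_lt h').trans (Nat.lt_succ_self q)
      · omega
    · intro u v t hu hv huv
      rcases haside.1 hu with h' | ⟨ht, s, h'⟩ <;> rcases haside.1 hv with h'' | ⟨ht', s', h''⟩
      · exact h.aside h' h'' huv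
      · exact absurd (h.aside_lt h') (by omega)
      · exact absurd (h.aside_lt h'') (by omega)
      · exact absurd (h.mono h' h'' huv) (lt_irrefl _)
    · obtain ⟨A, hA, hc, hA'⟩ := h.card
      have hB : ∀ s < cap, st (σ.slot ((σ.i - 1) * cap + s) - 1) = .slot (σ.i - 1) s :=
        fun s hs => h.slot_ne_zero (by omega) hs (hfull s hs)
      have hinj : Set.InjOn (fun s => σ.slot ((σ.i - 1) * cap + s) - 1) (Finset.range cap) := by
        intro s hs s' hs' hss
        have e1 := hB s (by simpa using hs)
        have e2 := hB s' (by simpa using hs')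
        simp only at hss
        rw [hss, e2] at e1
        cases e1; rfl
      refine ⟨A ∪ (Finset.range cap).image fun s => σ.slot ((σ.i - 1) * cap + s) - 1, ?_, ?_, ?_⟩
      · refine Finset.union_subset hA fun v hv => ?_
        obtain ⟨s, hs, rfl⟩ := Finset.mem_image.1 hv
        exact Finset.mem_range.2 (h.lt_N hord (by rw [hB s (Finset.mem_range.1 hs)]; simp))
      · rw [Finset.card_union_of_disjoint, Finset.card_image_of_injOn hinj, hc, Finset.card_range]
        · ring
        · refine Finset.disjoint_left.2 fun v hv hv' => ?_
          obtain ⟨s, hs, rfl⟩ := Finset.mem_image.1 hv'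
          obtain ⟨t, ht⟩ := (hA' _).1 hv
          rw [hB s (Finset.mem_range.1 hs)] at ht
          cases ht
      · intro v
        simp only [Finset.mem_union, hA', Finset.mem_image, Finset.mem_range, haside]
        constructor
        · rintro (⟨t, ht⟩ | ⟨s, hs, rfl⟩)
          · exact ⟨t, .inl ht⟩
          · exact ⟨q, .inr ⟨rfl, s, hB s hs⟩⟩
        · rintro ⟨t, ht | ⟨-, s, hs⟩⟩
          · exact .inl ⟨t, ht⟩
          · exact .inr ⟨s, (h.slot_lt hs).2, by rw [h.slot_eq hs]; rfl⟩
    · exact h.i_le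
    · exact h.ptr_le
  · by_cases hv : ∃ s, st v = .slot (σ.i - 1) s
    · obtain ⟨s', hs'⟩ := hv
      rw [h1 v s' hs']; simp [Place.wt]
    · rw [h2 v fun s hs => hv ⟨s, hs⟩]

/-- Moving the current element one level down keeps the levels monotone: what lies above it is on a
level above `σ.i`, and by `hno` nothing on level `σ.i - 1` lies below it. Its weight falls by two,
which pays for increasing the level counter by one. -/
theorem Cover.Inv.drop (h : σ.Inv K cap N lt ord st q) (hord : ∀ p < N, ord p < N) {e : ℕ}
    (hi : 0 < σ.i) (hiK : σ.i < K) (he : e < cap)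
    (hno : ∀ s < cap, σ.slot ((σ.i - 1) * cap + s) ≠ 0 →
        ¬ lt (σ.slot ((σ.i - 1) * cap + s) - 1) (σ.slot (σ.i * cap + σ.c σ.i) - 1))
    (hirr : ∀ v < N, ¬ lt v v)
    (h0 : σ.slot ((σ.i - 1) * cap + e) = 0) :
    ∃ st', Cover.Inv K cap N lt ord { σ with
        slot := Function.update (Function.update σ.slot ((σ.i - 1) * cap + e)
          (σ.slot (σ.i * cap + σ.c σ.i))) (σ.i * cap + σ.c σ.i) 0
        i := σ.i + 1 } st' q ∧
      ∑ v ∈ Finset.range N, (st' v).wt K + 2 ≤ ∑ v ∈ Finset.range N, (st v).wt K := by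
  classical
  obtain ⟨w, hw⟩ := h.stack σ.i le_rfl hiK
  have hwslot := h.slot_eq hw
  have hc := (h.slot_lt hw).2
  have hst : ∀ v, v ≠ w → Function.update st w (.slot (σ.i - 1) e) v = st v :=
    fun v hv => Function.update_of_ne hv _ _
  have hstw : Function.update st w (.slot (σ.i - 1) e) w = .slot (σ.i - 1) e :=
    Function.update_self ..
  have hidx1 : ∀ l, ∀ s < cap, (l * cap + s = σ.i * cap + σ.c σ.i ↔ l = σ.i ∧ s = σ.c σ.i) :=
    fun l s hs => slot_index_inj hs hc
  have hidx2 : ∀ l, ∀ s < cap, (l * cap + s = (σ.i - 1) * cap + e ↔ l = σ.i - 1 ∧ s = e) :=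
    fun l s hs => slot_index_inj hs he
  have huniq : ∀ v, st v = .slot σ.i (σ.c σ.i) → v = w := fun v hv => by
    have := h.slot_eq hv; omega
  have hfree : ∀ v, st v ≠ .slot (σ.i - 1) e := fun v hv => by
    have := h.slot_eq hv; omega
  have hwf : st w ≠ .fresh := by rw [hw]; simp
  refine ⟨Function.update st w (.slot (σ.i - 1) e), ?_, ?_⟩
  · constructor
    · intro l hl s hs v
      simp only [Function.update_apply, hidx1 l s hs, hidx2 l s hs]
      by_cases hvw : v = w
      · subst hvw
        simp only [if_true]
        split_ifs with h1 h2
        · refine ⟨fun h => by simp at h, fun h => ?_⟩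
          cases h; omega
        · rw [h2.1, h2.2]; simp [hwslot]
        · rw [h.slot_iff l hl s hs, hw]
          refine ⟨fun h => ?_, fun h => ?_⟩
          · cases h; exact absurd ⟨rfl, rfl⟩ h1
          · cases h; exact absurd ⟨rfl, rfl⟩ h2
      · rw [if_neg hvw]
        split_ifs with h1 h2
        · refine ⟨fun h => by simp at h, fun h => ?_⟩
          rw [h1.1, h1.2] at h; exact absurd (huniq v h) hvw
        · refine ⟨fun h => ?_, fun h => ?_⟩
          · omega
          · rw [h2.1, h2.2] at h; exact absurd h (hfree v)
        · exact h.slot_iff l hl s hs v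
    · intro v l s hv
      by_cases hvw : v = w
      · rw [hvw, hstw] at hv; cases hv; omega
      · rw [hst v hvw] at hv; exact h.slot_lt hv
    · intro x v
      by_cases hvw : v = w
      · rw [hvw, hstw]
        refine ⟨fun h' => ?_, fun h' => by cases h'⟩
        have := (h.chain_iff x w).1 h'
        rw [hw] at this; cases this
      · rw [hst v hvw]; exact h.chain_iff x v
    · intro v
      by_cases hvw : v = w
      · rw [hvw, hstw, ← h.fresh_iff w]; simp [hwf]
      · rw [hst v hvw]; exact h.fresh_iff v
    · intro u v l s l' s' hu hv huv
      by_cases huw : u = w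
      · by_cases hvw : v = w
        · rw [huw, hvw] at huv; exact absurd huv (hirr w (h.lt_N hord hwf))
        · rw [huw, hstw] at hu
          cases hu
          rw [hst v hvw] at hv
          rw [huw] at huv
          have := h.mono hw hv huv
          omega
      · rw [hst u huw] at hu
        by_cases hvw : v = w
        · rw [hvw, hstw] at hv
          cases hv
          rw [hvw] at huv
          have h1 := h.mono hu hw huv
          have h2 : l ≠ σ.i - 1 := by
            rintro rfl
            have h3 := h.slot_eq hu
            refine hno s (h.slot_lt hu).2 (by omega) ?_
            rw [h3, hwslot]; exact huv
          omega
        · rw [hst v hvw] at hv; exact h.mono hu hv huv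
    · intro v s hv
      by_cases hvw : v = w
      · rw [hvw, hstw] at hv
        simp only [Place.slot.injEq] at hv
        omega
      · rw [hst v hvw] at hv
        have := h.top hv
        refine ⟨?_, this.2⟩
        simp only
        by_contra hlt
        have hK : K - 1 = σ.i := by omega
        rw [hK] at hv
        rw [this.2, hK] at hv
        exact hvw (huniq v hv)
    · intro j hj hjK
      simp only at hj
      obtain ⟨v, hv⟩ := h.stack j (by omega) hjK
      refine ⟨v, ?_⟩
      rw [hst v]
      · exact hv
      · rintro rfl; rw [hw] at hv; simp only [Place.slot.injEq] at hv; omega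
    · intro j u v hj hjK hu hv
      simp only at hj hu hv
      have huw : u ≠ w := by
        rintro rfl; rw [hstw] at hu; simp only [Place.slot.injEq] at hu; omega
      have hvw : v ≠ w := by
        rintro rfl; rw [hstw] at hv; simp only [Place.slot.injEq] at hv; omega
      rw [hst u huw] at hu
      rw [hst v hvw] at hv
      exact h.stack_lt j u v (by omega) hjK hu hv
    · exact h.chain_lt
    · intro v t hv
      by_cases hvw : v = w
      · rw [hvw, hstw] at hv; cases hv
      · rw [hst v hvw] at hv; exact h.aside_lt hv
    · intro u v t hu hv
      by_cases huw : u = w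
      · rw [huw, hstw] at hu; cases hu
      by_cases hvw : v = w
      · rw [hvw, hstw] at hv; cases hv
      · rw [hst v hvw] at hv; rw [hst u huw] at hu; exact h.aside hu hv
    · obtain ⟨A, hA, hc, hA'⟩ := h.card
      refine ⟨A, hA, hc, fun v => ?_⟩
      by_cases hvw : v = w
      · rw [hvw, hstw, hA' w, hw]; simp
      · rw [hst v hvw]; exact hA' v
    · exact hiK
    · exact h.ptr_le
  · have := sum_update_lt (h.lt_N hord hwf)
      (f := fun v => (Function.update st w (.slot (σ.i - 1) e) v).wt K)
      (g := fun v => (st v).wt K) (fun u hu => by simp only [hst u hu])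
    simp only [hstw, hw] at this
    have e1 : (Place.slot (σ.i - 1) e).wt K = 2 * (σ.i - 1) + 2 := rfl
    have e2 : (Place.slot σ.i (σ.c σ.i)).wt K = 2 * σ.i + 2 := rfl
    omega

/-- The stack now has one element on each of the `K` levels and becomes a chain. Each of these
elements had weight at least two, which pays for resetting the level counter from `0` to `K`. -/
theorem Cover.Inv.extract (h : σ.Inv K cap N lt ord st q) (hK : 0 < K) (hord : ∀ p < N, ord p < N)
    (hi : σ.i = 0) {slot' ch' : ℕ → ℕ}
    (hs : ∀ l < K, ∀ s < cap,
      slot' (l * cap + s) = if s = σ.c l then 0 else σ.slot (l * cap + s))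
    (hch : ∀ j < K, ch' (σ.nch * K + j) = σ.slot (j * cap + σ.c j) - 1)
    (hch' : ∀ x < σ.nch * K, ch' x = σ.ch x) :
    ∃ st', Cover.Inv K cap N lt ord
      { σ with slot := slot', ch := ch', i := K, nch := σ.nch + 1 } st' q ∧
      ∑ v ∈ Finset.range N, (st' v).wt K + 2 * K ≤ ∑ v ∈ Finset.range N, (st v).wt K := by
  classical
  have hst : ∀ v, ∃ p : Place, (∀ j, st v = .slot j (σ.c j) → p = .chain (σ.nch * K + j)) ∧
      ((∀ j, st v ≠ .slot j (σ.c j)) → p = st v) := by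
    intro v
    by_cases hv : ∃ j, st v = .slot j (σ.c j)
    · obtain ⟨j, hj⟩ := hv
      refine ⟨.chain (σ.nch * K + j), fun j' hj' => ?_, fun h => absurd hj (h _)⟩
      rw [hj] at hj'; cases hj'; rfl
    · exact ⟨_, fun s hs => absurd ⟨s, hs⟩ hv, fun _ => rfl⟩
  choose st' h1 h2 using hst
  have hstack : ∀ j < K, ∃ v, st v = .slot j (σ.c j) := fun j hj => h.stack j (by omega) hj
  have hstk : ∀ {v j}, st v = .slot j (σ.c j) → j < K ∧ σ.slot (j * cap + σ.c j) = v + 1 :=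
    fun {v j} hv => ⟨(h.slot_lt hv).1, h.slot_eq hv⟩
  have hslot : ∀ {v l s}, st' v = .slot l s ↔ st v = .slot l s ∧ s ≠ σ.c l := by
    intro v l s
    by_cases hv : ∃ j, st v = .slot j (σ.c j)
    · obtain ⟨j, hj⟩ := hv
      rw [h1 v j hj, hj]
      refine ⟨fun h => (by cases h), fun ⟨h, h'⟩ => ?_⟩
      cases h; exact absurd rfl h'
    · rw [h2 v fun j hj => hv ⟨j, hj⟩]
      exact ⟨fun h => ⟨h, fun e => hv ⟨l, e ▸ h⟩⟩, fun h => h.1⟩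
  have hother : ∀ {v} {p : Place}, (∀ l s, p ≠ .slot l s) → (∀ t, p ≠ .chain t) →
      (st' v = p ↔ st v = p) := by
    intro v p hp hp'
    by_cases hv : ∃ j, st v = .slot j (σ.c j)
    · obtain ⟨j, hj⟩ := hv
      rw [h1 v j hj, hj]
      exact ⟨fun h => absurd h.symm (hp' _), fun h => absurd h.symm (hp _ _)⟩
    · rw [h2 v fun s hs => hv ⟨s, hs⟩]
  have hother' : ∀ {v t}, st' v = .aside t → st v = .aside t := fun {v t} hv =>
    (hother (by simp) (by simp)).1 hv
  have hchain : ∀ {v x}, st' v = .chain x ↔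
      st v = .chain x ∨ ∃ j, x = σ.nch * K + j ∧ st v = .slot j (σ.c j) := by
    intro v x
    by_cases hv : ∃ j, st v = .slot j (σ.c j)
    · obtain ⟨j, hj⟩ := hv
      rw [h1 v j hj, hj]
      constructor
      · intro h; cases h; exact .inr ⟨j, rfl, rfl⟩
      · rintro (h | ⟨j', rfl, h⟩)
        · cases h
        · cases h; rfl
    · rw [h2 v fun s hs => hv ⟨s, hs⟩]
      exact ⟨.inl, fun h => h.resolve_right fun ⟨j, _, hj⟩ => hv ⟨j, hj⟩⟩
  refine ⟨st', ?_, ?_⟩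
  · constructor
    · intro l hl s hs' v
      simp only [hs l hl s hs', hslot]
      split_ifs with hli
      · simp [hli]
      · simp [hli, h.slot_iff l hl s hs']
    · intro v l s hv; exact h.slot_lt (hslot.1 hv).1
    · intro x v
      simp only
      rw [hchain, ← h.chain_iff, Nat.succ_mul]
      constructor
      · rintro ⟨hx, hxv⟩
        by_cases hlt : x < σ.nch * K
        · exact .inl ⟨hlt, by rw [← hxv, hch' x hlt]⟩
        · obtain ⟨j, rfl⟩ := Nat.exists_eq_add_of_le (not_lt.1 hlt)
          obtain ⟨w, hw⟩ := hstack j (by omega)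
          refine .inr ⟨j, rfl, ?_⟩
          rw [hch j (by omega), (hstk hw).2] at hxv
          rwa [← hxv]
      · rintro (⟨hx, hxv⟩ | ⟨j, rfl, hj⟩)
        · exact ⟨by omega, by rw [hch' x hx, hxv]⟩
        · have := hstk hj
          exact ⟨by omega, by rw [hch j this.1, this.2]; rfl⟩
    · intro v; rw [ne_eq, hother (by simp) (by simp)]; exact h.fresh_iff v
    · intro u v l s l' s' hu hv; exact h.mono (hslot.1 hu).1 (hslot.1 hv).1
    · intro v s hv; exact absurd (h.top (hslot.1 hv).1).2 (hslot.1 hv).2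
    · intro j hj hjK; simp only at hj; omega
    · intro j u v hj hjK; simp only at hj; omega
    · intro t ht j hj
      simp only at ht ⊢
      rcases Nat.lt_succ_iff_lt_or_eq.1 ht with ht | rfl
      · have : (t + 1) * K ≤ σ.nch * K := Nat.mul_le_mul_right _ ht
        rw [Nat.add_mul] at this
        rw [hch' _ (by omega), hch' _ (by omega)]
        exact h.chain_lt t ht j hj
      · obtain ⟨u, hu⟩ := hstack j (by omega)
        obtain ⟨v, hv⟩ := hstack (j + 1) hj
        rw [hch j (by omega), hch (j + 1) hj, (hstk hu).2, (hstk hv).2]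
        exact h.stack_lt j u v (by omega) hj hu hv
    · intro v t hv; exact h.aside_lt ((hother' hv))
    · intro u v t hu hv; exact h.aside (hother' hu) (hother' hv)
    · obtain ⟨A, hA, hc, hA'⟩ := h.card
      refine ⟨A, hA, hc, fun v => ?_⟩
      rw [hA']
      simp only [hother (v := v) (p := .aside _) (by simp) (by simp)]
    · simp
    · exact h.ptr_le
  · choose! f hf using hstack
    have hfi : Set.InjOn f (Finset.range K) := by
      intro j hj j' hj' he
      have e1 := hf j (by simpa using hj)
      rw [he, hf j' (by simpa using hj')] at e1
      cases e1; rfl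
    have hsub : (Finset.range K).image f ⊆ Finset.range N := by
      intro v hv
      obtain ⟨j, hj, rfl⟩ := Finset.mem_image.1 hv
      exact Finset.mem_range.2 (h.lt_N hord (by rw [hf j (Finset.mem_range.1 hj)]; simp))
    rw [← Finset.sum_sdiff hsub, ← Finset.sum_sdiff (f := fun v => (st v).wt K) hsub,
      Finset.sum_image hfi, Finset.sum_image hfi]
    have e1 : ∑ x ∈ Finset.range K, (st' (f x)).wt K = 0 := by
      refine Finset.sum_eq_zero fun j hj => ?_
      rw [h1 _ j (hf j (Finset.mem_range.1 hj))]; rfl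
    have e2 : 2 * K ≤ ∑ x ∈ Finset.range K, (st (f x)).wt K := by
      calc 2 * K = ∑ x ∈ Finset.range K, 2 := by simp [Nat.mul_comm]
        _ ≤ _ := Finset.sum_le_sum fun j hj => by
            rw [hf j (Finset.mem_range.1 hj)]; simp [Place.wt]
    have e3 : ∑ x ∈ Finset.range N \ (Finset.range K).image f, (st' x).wt K ≤
        ∑ x ∈ Finset.range N \ (Finset.range K).image f, (st x).wt K := by
      refine Finset.sum_le_sum fun v _ => ?_
      by_cases hv : ∃ j, st v = .slot j (σ.c j)
      · obtain ⟨j, hj⟩ := hv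
        rw [h1 v j hj]; simp [Place.wt]
      · rw [h2 v fun j hj => hv ⟨j, hj⟩]
    omega

/-- Every step except the idle one lowers the potential. A drop into a full level is `clear`
followed by a drop into an empty one. -/
theorem Cover.Step.inv (hstep : Cover.Step K cap N lt ord σ σ') (h : σ.Inv K cap N lt ord st q)
    (hK : 0 < K) (hcap : 0 < cap) (hord : ∀ p < N, ord p < N)
    (hinj : ∀ p < N, ∀ p' < N, ord p = ord p' → p = p')
    (htop : ∀ p < N, ∀ p' < N, lt (ord p) (ord p') → p < p') (hirr : ∀ v < N, ¬ lt v v) :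
    ∃ st' q', σ'.Inv K cap N lt ord st' q' ∧
      (σ'.pot K N st' + 1 ≤ σ.pot K N st ∨ σ.i = K ∧ N ≤ σ.ptr ∧ σ' = σ) := by
  cases hstep with
  | done h1 h2 => exact ⟨st, q, h, .inr ⟨h1, h2, rfl⟩⟩
  | load h1 h2 =>
    obtain ⟨st', h', hw⟩ := h.load hK hcap hord hinj htop h1 h2
    exact ⟨st', q, h', .inl (by simp only [pot]; omega)⟩
  | extract slot' ch' h1 h2 h3 h4 =>
    obtain ⟨st', h', hw⟩ := h.extract hK hord h1 h2 h3 h4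
    exact ⟨st', q, h', .inl (by simp only [pot]; omega)⟩
  | push e h1 h2 h3 h4 h5 =>
    exact ⟨st, q, h.push h1 h2 h3 h4 h5, .inl (by simp only [pot]; omega)⟩
  | drop e slot₀ h1 h2 h3 h4 h5 =>
    rcases h5 with ⟨rfl, h5⟩ | ⟨h5, h6⟩
    · obtain ⟨st', h', hw⟩ := h.drop hord h1 h2 h3 h4 hirr h5
      exact ⟨st', q, h', .inl (by simp only [pot]; omega)⟩
    · obtain ⟨st', q', h', hw⟩ := h.clear hord h1 h2 h5 h6
      obtain ⟨w, hw'⟩ := h.stack σ.i le_rfl h2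
      have hc := (h.slot_lt hw').2
      have h0 : ∀ s < cap, slot₀ ((σ.i - 1) * cap + s) = 0 := fun s hs => by
        rw [h6 _ (by omega) s hs, if_pos rfl]
      obtain ⟨st'', h'', hw''⟩ := h'.drop hord (e := e) h1 h2 h3
        (fun s hs hne => absurd (h0 s hs) hne) hirr (h0 e h3)
      have e1 : slot₀ (σ.i * cap + σ.c σ.i) = σ.slot (σ.i * cap + σ.c σ.i) := by
        rw [h6 _ h2 _ hc, if_neg (by omega)]
      simp only [e1] at h''
      exact ⟨st'', q', h'', .inl (by simp only [pot]; omega)⟩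

theorem Cover.inv_start (hσ : ∀ x, σ.slot x = 0) (hi : σ.i = K) (hp : σ.ptr = 0)
    (hn : σ.nch = 0) : σ.Inv K cap N lt ord (fun _ => .fresh) 0 where
  slot_iff := by simp [hσ]
  slot_lt := by simp
  chain_iff := by simp [hn]
  fresh_iff := by simp [hp]
  mono := by simp
  top := by simp
  stack := by intros; omega
  stack_lt := by intros; omega
  chain_lt := by simp [hn]
  aside_lt := by simp
  aside := by simp
  card := ⟨∅, by simp⟩
  i_le := hi.le
  ptr_le := by omega

/-- The chains of the cover are disjoint and increasing, and the elements outside of them split into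
at most `2 * K` antichains. -/
structure IsChainCover (K N : ℕ) (lt : ℕ → ℕ → Prop) (nch : ℕ) (ch : ℕ → ℕ) : Prop where
  card_le : nch * K ≤ N
  ch_lt : ∀ x < nch * K, ch x < N
  chain : ∀ t < nch, ∀ j, j + 1 < K → lt (ch (t * K + j)) (ch (t * K + (j + 1)))
  col : ∃ col : ℕ → ℕ, (∀ v < N, (∀ x < nch * K, ch x ≠ v) → col v < 2 * K) ∧
    ∀ u v, u < N → v < N → (∀ x < nch * K, ch x ≠ u) → (∀ x < nch * K, ch x ≠ v) → lt u v →
      col u ≠ col v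

/-- The potential starts at `(2 * K + 2) * N + K`, so after more steps than that the procedure is
idle: everything is loaded and the stack is empty. The elements outside the chains are then on one
of the `K` levels, with colours below `K`, or in a set-aside antichain, with colours from `K` on. -/
theorem Cover.isChainCover {τ : ℕ → Cover} {T : ℕ} (hK : 0 < K) (hcap : N < cap * K)
    (hord : ∀ p < N, ord p < N) (hinj : ∀ p < N, ∀ p' < N, ord p = ord p' → p = p')
    (htop : ∀ p < N, ∀ p' < N, lt (ord p) (ord p') → p < p') (hirr : ∀ v < N, ¬ lt v v)
    (hslot : ∀ x, (τ 0).slot x = 0) (hi : (τ 0).i = K) (hp : (τ 0).ptr = 0) (hn : (τ 0).nch = 0)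
    (hT : (2 * K + 2) * N + K < T) (hstep : ∀ k < T, (τ k).i ≤ K → (∀ j, (τ k).i ≤ j → j < K → (τ k).c j < cap) →
      Cover.Step K cap N lt ord (τ k) (τ (k + 1))) :
    IsChainCover K N lt (τ T).nch (τ T).ch := by
  have hcap0 : 0 < cap := Nat.pos_of_lt_mul_right hcap
  have key : ∀ k ≤ T, ∃ st q, (τ k).Inv K cap N lt ord st q ∧
      ((τ k).pot K N st + k ≤ (2 * K + 2) * N + K ∨ (τ k).i = K ∧ N ≤ (τ k).ptr) := by
    intro k
    induction k with
    | zero =>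
      refine fun _ => ⟨_, _, Cover.inv_start hslot hi hp hn, .inl ?_⟩
      simp only [pot, Place.wt, hi, Finset.sum_const, Finset.card_range, smul_eq_mul]
      exact le_of_eq (by ring)
    | succ k ih =>
      intro hk
      obtain ⟨st, q, h, hpot⟩ := ih (by omega)
      have hs := hstep k (by omega) h.i_le fun j hj hjK => by
        obtain ⟨v, hv⟩ := h.stack j hj hjK
        exact (h.slot_lt hv).2
      obtain ⟨st', q', h', hd⟩ := hs.inv h hK hcap0 hord hinj htop hirr
      refine ⟨st', q', h', ?_⟩
      rcases hd with hd | ⟨h1, h2, h3⟩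
      · rcases hpot with hpot | ⟨h1, h2⟩
        · exact .inl (by omega)
        · generalize τ (k + 1) = σ' at hs
          cases hs with
          | done _ _ => exact .inr ⟨h1, h2⟩
          | load _ _ => omega
          | extract _ _ _ _ _ _ => omega
          | push _ _ _ _ _ _ => omega
          | drop _ _ _ _ _ _ _ => omega
      · rw [h3]; exact .inr ⟨h1, h2⟩
  obtain ⟨st, q, h, hd⟩ := key T le_rfl
  obtain ⟨hiK, hptr⟩ : (τ T).i = K ∧ N ≤ (τ T).ptr := by
    rcases hd with hd | hd
    · omega
    · exact hd
  -- Set-aside antichains are disjoint and have `cap` elements each, so `N < cap * K` leaves room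
  -- for fewer than `K` of them.
  have hq : q < K := by
    obtain ⟨A, hA, hc, -⟩ := h.card
    have := Finset.card_le_card hA
    rw [hc, Finset.card_range] at this
    exact Nat.lt_of_mul_lt_mul_left (a := cap) (by rw [Nat.mul_comm cap q]; omega)
  have hch : ∀ x < (τ T).nch * K, st ((τ T).ch x) = .chain x :=
    fun x hx => (h.chain_iff x _).1 ⟨hx, rfl⟩
  have hsurj : ∀ v < N, ∃ p < N, ord p = v := by
    intro v hv
    have := Finset.surj_on_of_inj_on_of_card_le (s := Finset.range N) (t := Finset.range N)
      (fun p _ => ord p) (fun p hp => Finset.mem_range.2 (hord p (Finset.mem_range.1 hp)))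
      (fun p p' hp hp' he => hinj p (Finset.mem_range.1 hp) p' (Finset.mem_range.1 hp') he) le_rfl
      v (Finset.mem_range.2 hv)
    obtain ⟨p, hp, he⟩ := this
    exact ⟨p, Finset.mem_range.1 hp, he.symm⟩
  have hplace : ∀ v < N, (∀ x < (τ T).nch * K, (τ T).ch x ≠ v) →
      (∃ l s, st v = .slot l s ∧ l < K) ∨ ∃ t, st v = .aside t ∧ t < q := by
    intro v hv hx
    obtain ⟨p, hp, rfl⟩ := hsurj v hv
    have hf := (h.fresh_iff (ord p)).2 ⟨p, by omega, rfl⟩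
    rcases hs : st (ord p) with _ | ⟨l, s⟩ | x | t
    · exact absurd hs hf
    · exact .inl ⟨l, s, rfl, (h.slot_lt hs).1⟩
    · have := (h.chain_iff x _).2 hs
      exact absurd this.2 (hx x this.1)
    · exact .inr ⟨t, rfl, h.aside_lt hs⟩
  refine ⟨?_, fun x hx => h.lt_N hord (by rw [hch x hx]; simp), h.chain_lt, ?_⟩
  · have := Finset.card_le_card_of_injOn (s := Finset.range ((τ T).nch * K)) (t := Finset.range N)
      (τ T).ch (fun x hx => Finset.mem_coe.2 (Finset.mem_range.2
        (h.lt_N hord (by rw [hch x (Finset.mem_range.1 hx)]; simp)))) ?_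
    · simpa using this
    · intro x hx y hy he
      have e1 := hch x (by simpa using hx)
      rw [he, hch y (by simpa using hy)] at e1
      cases e1; rfl
  · refine ⟨fun v => match st v with
      | .slot l _ => l
      | .aside t => K + t
      | _ => 0, fun v hv hx => ?_, fun u v hu hv hxu hxv huv => ?_⟩
    · rcases hplace v hv hx with ⟨l, s, he, hl⟩ | ⟨t, he, ht⟩ <;> simp only [he] <;> omega
    · rcases hplace u hu hxu with ⟨l, s, he, hl⟩ | ⟨t, he, ht⟩ <;>
        rcases hplace v hv hxv with ⟨l', s', he', hl'⟩ | ⟨t', he', ht'⟩ <;> simp only [he, he']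
      · exact (h.mono he he' huv).ne
      · omega
      · omega
      · intro hc
        obtain rfl : t = t' := by omega
        exact h.aside he he' huv

end ChainCover

end Shortcut
namespace Shortcut

/-! ### Specifications of the recurring loops: searching and filling. -/

section Loops

/-- Set register `z` to `e + 1` for the last `e < y` that satisfies the condition, or to `0`. -/
def Prog.find (z x y : ℕ) (C : Expr) : Prog :=
  .seq (.set z (.const 0)) (.rep x y (.ite C (.set z (.add (.var x) (.const 1))) .skip))

/-- Later hits overwrite earlier ones, so the last one survives. The caller evaluates the condition
in any state that differs from `s` in the counter and the result register only. -/
theorem Prog.find_spec {z x y : ℕ} {C : Expr} (s : State) (cond : ℕ → ℕ)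
    (hxy : x ≠ y) (hzx : z ≠ x) (hzy : z ≠ y)
    (hC : ∀ k < s.vars y, ∀ s' : State, (∀ u, u ≠ x → u ≠ z → s'.vars u = s.vars u) →
      s'.vars x = k → s'.arr = s.arr → C.eval s' = cond k) :
    (((find z x y C).run s).vars z = 0 ∧ ∀ k < s.vars y, cond k = 0) ∨
      ∃ e < s.vars y, ((find z x y C).run s).vars z = e + 1 ∧ cond e ≠ 0 ∧
        ∀ k, e < k → k < s.vars y → cond k = 0 := by
  have hy : (s.set z 0).vars y = s.vars y := by simp [Ne.symm hzy]
  have := Prog.rep_induct (x := x) (y := y)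
    (p := .ite C (.set z (.add (.var x) (.const 1))) .skip) (s := s.set z 0)
    (by simp [fresh, writes, hxy, hzx, hzy])
    (fun m s' => (s'.vars z = 0 ∧ ∀ k < m, cond k = 0) ∨
      ∃ e < m, s'.vars z = e + 1 ∧ cond e ≠ 0 ∧ ∀ k, e < k → k < m → cond k = 0)
    (by simp [hzx]) ?_
  · rwa [hy] at this
  · intro k s' hk hx hfr hI
    rw [hy] at hk
    have hc : C.eval s' = cond k := by
      refine hC k hk s' (fun u hu hu' => ?_) hx ?_
      · rw [hfr.1 u (by simp [writes, Ne.symm hu, Ne.symm hu'])]; simp [hu']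
      · funext b; rw [hfr.2 b (by simp [stores])]; simp
    by_cases h0 : cond k = 0
    · simp only [run, hc, h0, ne_eq, not_true_eq_false, if_false, State.set_vars, if_neg hzx]
      rcases hI with ⟨h1, h2⟩ | ⟨e, he, h1, h2, h3⟩
      · refine .inl ⟨h1, fun j hj => ?_⟩
        rcases Nat.lt_succ_iff_lt_or_eq.1 hj with hj | rfl
        exacts [h2 j hj, h0]
      · refine .inr ⟨e, by omega, h1, h2, fun j hj hj' => ?_⟩
        rcases Nat.lt_succ_iff_lt_or_eq.1 hj' with hj' | rfl
        exacts [h3 j hj hj', h0]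
    · simp only [run, hc, h0, ne_eq, not_false_eq_true, if_true, State.set_vars, if_neg hzx]
      exact .inr ⟨k, by omega, by simp [Expr.eval, hx], h0, fun j hj hj' => by omega⟩

/-- A loop with a single store, at pairwise different positions. -/
theorem Prog.fill_spec {x y a : ℕ} {i e : Expr} (s : State) (pos val : ℕ → ℕ) (hxy : x ≠ y)
    (hpos : ∀ k < s.vars y, ∀ k' < s.vars y, pos k = pos k' → k = k')
    (h : ∀ k < s.vars y, ∀ s' : State, (∀ u, u ≠ x → s'.vars u = s.vars u) → s'.vars x = k →
      (∀ b, b ≠ a → s'.arr b = s.arr b) → s'.arr a (pos k) = s.arr a (pos k) →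
      i.eval s' = pos k ∧ e.eval s' = val k) :
    (∀ k < s.vars y, ((rep x y (.store a i e)).run s).arr a (pos k) = val k) ∧
      ∀ j, (∀ k < s.vars y, j ≠ pos k) → ((rep x y (.store a i e)).run s).arr a j = s.arr a j := by
  have := Prog.rep_induct (x := x) (y := y) (p := .store a i e) (s := s)
    (by simp [fresh, writes, hxy])
    (fun m s' => (∀ k < m, s'.arr a (pos k) = val k) ∧
      ∀ j, (∀ k < m, j ≠ pos k) → s'.arr a j = s.arr a j) (by simp) ?_
  · exact this
  · intro k s' hk hx hfr hI
    obtain ⟨h1, h2⟩ := h k hk s' (fun u hu => hfr.1 u (by simp [writes, Ne.symm hu])) hx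
      (fun b hb => hfr.2 b (by simp [stores, Ne.symm hb]))
      (hI.2 _ fun k' hk' he => by have := hpos k hk k' (by omega) he; omega)
    refine ⟨fun j hj => ?_, fun j hj => ?_⟩
    · simp only [run, State.set_arr, State.store_arr, h1, h2, true_and]
      rcases Nat.lt_succ_iff_lt_or_eq.1 hj with hj' | rfl
      · rw [if_neg fun he => by have := hpos j (by omega) k hk he; omega, hI.1 j hj']
      · rw [if_pos rfl]
    · simp only [run, State.set_arr, State.store_arr, h1, true_and]
      rw [if_neg (hj k (Nat.lt_succ_self k)), hI.2 j fun k' hk' => hj k' (by omega)]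

/-- A double loop that fills a matrix. -/
theorem Prog.fill_matrix_spec {x x' y y' a : ℕ} {i e : Expr} (s : State) (val : ℕ → ℕ → ℕ)
    (hd : x ≠ x' ∧ x ≠ y ∧ x ≠ y' ∧ x' ≠ y ∧ x' ≠ y')
    (h : ∀ k < s.vars y, ∀ k' < s.vars y', ∀ s' : State,
      (∀ u, u ≠ x → u ≠ x' → s'.vars u = s.vars u) → s'.vars x = k → s'.vars x' = k' →
      (∀ b, b ≠ a → s'.arr b = s.arr b) →
      s'.arr a (k * s.vars y' + k') = s.arr a (k * s.vars y' + k') →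
      i.eval s' = k * s.vars y' + k' ∧ e.eval s' = val k k') :
    ∀ k < s.vars y, ∀ k' < s.vars y',
      ((rep x y (.rep x' y' (.store a i e))).run s).arr a (k * s.vars y' + k') = val k k' := by
  obtain ⟨hxx, hxy, hxy', hx'y, hx'y'⟩ := hd
  have := Prog.rep_induct (x := x) (y := y) (p := .rep x' y' (.store a i e)) (s := s)
    (by simp [fresh, writes, hxy, Ne.symm hxx, hx'y])
    (fun m s' => (∀ k < m, ∀ k' < s.vars y', s'.arr a (k * s.vars y' + k') = val k k') ∧
      ∀ k, m ≤ k → ∀ k' < s.vars y', s'.arr a (k * s.vars y' + k') = s.arr a (k * s.vars y' + k'))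
    (by simp) ?_
  · exact this.1
  · intro k s' hk hx hfr hI
    have hy' : s'.vars y' = s.vars y' := hfr.1 y' (by simp [writes, hxy', hx'y'])
    obtain ⟨h1, h2⟩ := Prog.fill_spec (x := x') (y := y') (a := a) (i := i) (e := e) s'
      (fun k' => k * s.vars y' + k') (val k) hx'y' (fun _ _ _ _ he => by simpa using he)
      (fun k' hk' s'' hv hx'' ha hcell => by
        refine h k hk k' (hy' ▸ hk') s'' (fun u hu hu' => ?_) ?_ hx'' (fun b hb => ?_) ?_
        · rw [hv u hu', hfr.1 u (by simp [writes, Ne.symm hu, Ne.symm hu'])]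
        · rw [hv x hxx, hx]
        · rw [ha b hb, hfr.2 b (by simp [stores, Ne.symm hb])]
        · rw [hcell, hI.2 k le_rfl k' (hy' ▸ hk')])
    rw [hy'] at h1 h2
    refine ⟨fun j hj k' hk' => ?_, fun j hj k' hk' => ?_⟩
    · rw [State.set_arr]
      rcases Nat.lt_succ_iff_lt_or_eq.1 hj with hj' | rfl
      · rw [h2 _ fun k'' hk'' he => by have := ((slot_index_inj hk' hk'').1 he).1; omega,
          hI.1 j hj' k' hk']
      · exact h1 k' hk'
    · rw [State.set_arr, h2 _ fun k'' hk'' he => by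
        have := ((slot_index_inj hk' hk'').1 he).1; omega, hI.2 j (by omega) k' hk']

end Loops

/-! ### A program for one step of the chain cover procedure. -/

section ChainCoverProgram

/-! Registers: `2` number of elements, `3` chain length, `4` capacity of the levels, `20` current
level, `21` loaded elements, `22` extracted chains. Arrays: `5` strict order, `6` loading order,
`7` slots, `8` stack, `9` chains. -/

/-- The index of the slot of the current element. -/
def curIdx : Expr := .add (.mul (.var 20) (.var 4)) (.get 8 (.var 20))

/-- The index of slot `e` of the level below the current one. -/
def belowIdx (e : Expr) : Expr := .add (.mul (.sub (.var 20) (.const 1)) (.var 4)) e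

/-- One step of the chain cover procedure. -/
def coverStep : Prog :=
  .ite (.sub (.var 3) (.var 20))
    (.ite (.var 20)
      (.seq (.set 25 (.sub (.get 7 curIdx) (.const 1)))
      (.seq (.find 24 23 4 (.mul (.get 7 (belowIdx (.var 23)))
          (.get 5 (.add (.mul (.sub (.get 7 (belowIdx (.var 23))) (.const 1)) (.var 2)) (.var 25)))))
      (.ite (.var 24)
        (.seq (.store 8 (.sub (.var 20) (.const 1)) (.sub (.var 24) (.const 1)))
          (.set 20 (.sub (.var 20) (.const 1))))
        (.seq (.find 24 23 4 (.sub (.const 1) (.get 7 (belowIdx (.var 23)))))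
        (.seq (.ite (.var 24) .skip
          (.seq (.rep 23 4 (.store 7 (belowIdx (.var 23)) (.const 0))) (.set 24 (.const 1))))
        (.seq (.store 7 (belowIdx (.sub (.var 24) (.const 1))) (.get 7 curIdx))
        (.seq (.store 7 curIdx (.const 0))
          (.set 20 (.add (.var 20) (.const 1))))))))))
      (.seq (.rep 23 3 (.store 9 (.add (.mul (.var 22) (.var 3)) (.var 23))
          (.sub (.get 7 (.add (.mul (.var 23) (.var 4)) (.get 8 (.var 23)))) (.const 1))))
      (.seq (.rep 23 3 (.store 7 (.add (.mul (.var 23) (.var 4)) (.get 8 (.var 23))) (.const 0)))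
      (.seq (.set 20 (.var 3)) (.set 22 (.add (.var 22) (.const 1)))))))
    (.ite (.sub (.var 2) (.var 21))
      (.seq (.store 7 (.mul (.sub (.var 3) (.const 1)) (.var 4))
        (.add (.get 6 (.var 21)) (.const 1)))
      (.seq (.store 8 (.sub (.var 3) (.const 1)) (.const 0))
      (.seq (.set 20 (.sub (.var 3) (.const 1))) (.set 21 (.add (.var 21) (.const 1))))))
      .skip)

/-- The chain cover data in memory. -/
def State.cover (s : State) : Cover := ⟨s.arr 7, s.arr 8, s.arr 9, s.vars 20, s.vars 21, s.vars 22⟩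

theorem Cover.ext' {σ σ' : Cover} (h1 : σ.slot = σ'.slot) (h2 : σ.c = σ'.c) (h3 : σ.ch = σ'.ch)
    (h4 : σ.i = σ'.i) (h5 : σ.ptr = σ'.ptr) (h6 : σ.nch = σ'.nch) : σ = σ' := by
  cases σ; cases σ'; simp_all

theorem State.store_arr_self (s : State) (a : ℕ) (i e : Expr) :
    (s.store a i e).arr a = Function.update (s.arr a) (i.eval s) (e.eval s) := by
  simp [State.store]

/-- The program refines the abstract step. The bound `hc` on the stack entries, which the invariant
provides, keeps the slots of different levels at different addresses. -/
theorem coverStep_step {K cap N : ℕ} (s : State) (h3 : s.vars 3 = K)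
    (h4 : s.vars 4 = cap) (h2 : s.vars 2 = N)
    (hiK : s.vars 20 ≤ K) (hc : ∀ j, s.vars 20 ≤ j → j < K → s.arr 8 j < cap) :
    Cover.Step K cap N (fun u v => s.arr 5 (u * N + v) ≠ 0) (s.arr 6) s.cover
      (coverStep.run s).cover := by
  by_cases hi : s.vars 20 = K
  · have e1 : (Expr.sub (.var 3) (.var 20)).eval s = 0 := by simp [Expr.eval, h3, hi]
    rw [coverStep, Prog.run, if_neg (by rw [e1]; simp)]
    by_cases hp : s.vars 21 < N
    · have e2 : (Expr.sub (.var 2) (.var 21)).eval s ≠ 0 := by simp only [Expr.eval, h2]; omega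
      rw [Prog.run, if_pos e2]
      convert Cover.Step.load s.cover hi hp using 1
      apply Cover.ext' <;>
        simp [Prog.run, State.cover, State.store_arr_self, State.store_arr_of_ne, Expr.eval, h3, h4]
    · have e2 : ¬ (Expr.sub (.var 2) (.var 21)).eval s ≠ 0 := by simp only [Expr.eval, h2]; omega
      rw [Prog.run, if_neg e2]
      exact Cover.Step.done s.cover hi (not_lt.1 hp)
  have hiK' : s.vars 20 < K := by omega
  have e1 : (Expr.sub (.var 3) (.var 20)).eval s ≠ 0 := by simp only [Expr.eval, h3]; omega
  rw [coverStep, Prog.run, if_pos e1]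
  by_cases hi0 : s.vars 20 = 0
  · rw [Prog.run, if_neg (by simp [Expr.eval, hi0])]
    have hcj : ∀ j < K, s.arr 8 j < cap := fun j hj => hc j (by omega) hj
    simp only [Prog.run.eq_6]
    set p₁ : Prog := .rep 23 3 (.store 9 (.add (.mul (.var 22) (.var 3)) (.var 23))
          (.sub (.get 7 (.add (.mul (.var 23) (.var 4)) (.get 8 (.var 23)))) (.const 1))) with hp₁
    set p₂ : Prog := .rep 23 3
      (.store 7 (.add (.mul (.var 23) (.var 4)) (.get 8 (.var 23))) (.const 0)) with hp₂
    obtain ⟨a1, a2⟩ := Prog.fill_spec (x := 23) (y := 3) (a := 9)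
      (i := .add (.mul (.var 22) (.var 3)) (.var 23))
      (e := .sub (.get 7 (.add (.mul (.var 23) (.var 4)) (.get 8 (.var 23)))) (.const 1)) s
      (fun k => s.vars 22 * K + k) (fun k => s.arr 7 (k * cap + s.arr 8 k) - 1) (by simp)
      (fun _ _ _ _ he => by simpa using he)
      (fun k hk s' hv hx ha _ => by
        simp [Expr.eval, hx, hv 22, hv 3, hv 4, h3, h4, ha 7, ha 8])
    rw [← hp₁, h3] at a1 a2
    have f1 := p₁.frame s
    set s₁ := p₁.run s
    have f2 := p₂.frame s₁
    have g3 : s₁.vars 3 = K := (f1.1 3 rfl).trans h3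
    obtain ⟨b1, b2⟩ := Prog.fill_spec (x := 23) (y := 3) (a := 7)
      (i := .add (.mul (.var 23) (.var 4)) (.get 8 (.var 23))) (e := .const 0) s₁
      (fun k => k * cap + s.arr 8 k) (fun _ => 0) (by simp)
      (fun k hk k' hk' he =>
        ((slot_index_inj (hcj k (g3 ▸ hk)) (hcj k' (g3 ▸ hk'))).1 he).1)
      (fun k hk s' hv hx ha _ => by
        simp [Expr.eval, hx, hv 4, (f1.1 4 rfl).trans h4, ha 8, f1.2 8 rfl])
    rw [← hp₂, g3] at b1 b2
    set s₂ := p₂.run s₁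
    convert Cover.Step.extract s.cover (s₂.arr 7) (s₂.arr 9) hi0 ?_ ?_ ?_ using 1
    · apply Cover.ext'
      · simp [State.cover, Prog.run]
      · simp [State.cover, Prog.run, f1.2 8 rfl, f2.2 8 rfl]
      · simp [State.cover, Prog.run]
      · simp [State.cover, Prog.run, Expr.eval, f2.1 3 rfl, g3]
      · simp [State.cover, Prog.run, f1.1 21 rfl, f2.1 21 rfl]
      · simp [State.cover, Prog.run, Expr.eval, f1.1 22 rfl, f2.1 22 rfl]
    · intro l hl t ht
      by_cases htc : t = s.cover.c l
      · rw [if_pos htc, show t = s.arr 8 l from htc]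
        exact b1 l hl
      · rw [if_neg htc]
        refine (b2 _ fun k hk he => htc ?_).trans (congrFun (f1.2 7 rfl) _)
        have := (slot_index_inj ht (hcj k hk)).1 he
        rw [this.2, this.1]; rfl
    · intro j hj
      rw [f2.2 9 rfl]
      exact a1 j hj
    · intro x hx
      simp only [State.cover] at hx ⊢
      rw [f2.2 9 rfl]
      exact a2 x fun k _ he => by omega
  · rw [Prog.run, if_pos (by simpa [Expr.eval] using hi0)]
    have hcur : s.arr 8 (s.vars 20) < cap := hc _ le_rfl hiK'
    set i := s.vars 20 with hidef
    rw [Prog.run.eq_6, Prog.run.eq_6]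
    set s₁ := (Prog.set 25 (.sub (.get 7 curIdx) (.const 1))).run s with hs₁
    have v25 : s₁.vars 25 = s.arr 7 (i * cap + s.arr 8 i) - 1 := by
      simp [hs₁, Prog.run, Expr.eval, curIdx, h4, hidef]
    have f1 := (Prog.set 25 (.sub (.get 7 curIdx) (.const 1))).frame s
    rw [← hs₁] at f1
    have q4 : s₁.vars 4 = cap := (f1.1 4 rfl).trans h4
    set C : Expr := .mul (.get 7 (belowIdx (.var 23)))
      (.get 5 (.add (.mul (.sub (.get 7 (belowIdx (.var 23))) (.const 1)) (.var 2)) (.var 25))) with hC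
    have find1 := Prog.find_spec (z := 24) (x := 23) (y := 4) (C := C) s₁
      (fun k => s.arr 7 ((i - 1) * cap + k) *
        s.arr 5 ((s.arr 7 ((i - 1) * cap + k) - 1) * N + (s.arr 7 (i * cap + s.arr 8 i) - 1)))
      (by simp) (by simp) (by simp)
      (fun k hk s' hv hx ha => by
        simp [hC, Expr.eval, belowIdx, hx, hv 20, hv 4, hv 2, hv 25, ha, v25, f1.1 20 rfl, f1.1 4 rfl,
          f1.1 2 rfl, h4, h2, f1.2 7 rfl, f1.2 5 rfl, hidef])
    have f2 := (Prog.find 24 23 4 C).frame s₁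
    rw [q4] at find1
    set s₂ := (Prog.find 24 23 4 C).run s₁
    have ev : ∀ z, z ≠ 23 → z ≠ 24 → z ≠ 25 → s₂.vars z = s.vars z := fun z h1 h2 h3 => by
      rw [f2.1 z (by simp [Prog.find, Prog.writes, Ne.symm h1, Ne.symm h2]),
        f1.1 z (by simp [Prog.writes, Ne.symm h3])]
    have ea : s₂.arr = s.arr := by
      funext b; rw [f2.2 b (by simp [Prog.find, Prog.stores]), f1.2 b (by simp [Prog.stores])]
    rcases find1 with ⟨z0, hall⟩ | ⟨e, he, ze, hne, -⟩
    · rw [Prog.run, if_neg (by simpa [Expr.eval] using z0)]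
      simp only [Prog.run.eq_6]
      have q4' : s₂.vars 4 = cap := (ev 4 (by simp) (by simp) (by simp)).trans h4
      have q20 : s₂.vars 20 = i := ev 20 (by simp) (by simp) (by simp)
      have find2 := Prog.find_spec (z := 24) (x := 23) (y := 4)
        (C := .sub (.const 1) (.get 7 (belowIdx (.var 23)))) s₂
        (fun k => 1 - s.arr 7 ((i - 1) * cap + k)) (by simp) (by simp) (by simp)
        (fun k hk s' hv hx ha => by
          simp [Expr.eval, belowIdx, hx, hv 20, hv 4, ha, q20, q4', ea])
      have f3 := (Prog.find 24 23 4 (.sub (.const 1) (.get 7 (belowIdx (.var 23))))).frame s₂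
      rw [q4'] at find2
      set s₃ := (Prog.find 24 23 4 (.sub (.const 1) (.get 7 (belowIdx (.var 23))))).run s₂
      have ev3 : ∀ z, z ≠ 23 → z ≠ 24 → z ≠ 25 → s₃.vars z = s.vars z := fun z h1 h2 h3 => by
        rw [f3.1 z (by simp [Prog.find, Prog.writes, Ne.symm h1, Ne.symm h2]), ev z h1 h2 h3]
      have ea3 : s₃.arr = s.arr := by
        funext b; rw [f3.2 b (by simp [Prog.find, Prog.stores]), ea]
      have hno : ∀ t < cap, s.cover.slot ((s.cover.i - 1) * cap + t) ≠ 0 →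
          ¬ s.arr 5 ((s.cover.slot ((s.cover.i - 1) * cap + t) - 1) * N +
            (s.cover.slot (s.cover.i * cap + s.cover.c s.cover.i) - 1)) ≠ 0 := by
        intro t ht hne
        have := hall t ht
        rw [Nat.mul_eq_zero] at this
        exact not_not.2 (this.resolve_left hne)
      -- The move of the current element to slot `e` of the level below. It is shared by the case of
      -- a free slot and the case of a level that has just been cleared.
      have fin : ∀ (s₄ : State) (e : ℕ), (∀ z, z ≠ 23 → z ≠ 24 → z ≠ 25 → s₄.vars z = s.vars z) →
          (∀ b, b ≠ 7 → s₄.arr b = s.arr b) → s₄.vars 24 = e + 1 → e < cap →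
          s₄.arr 7 (i * cap + s.arr 8 i) = s.arr 7 (i * cap + s.arr 8 i) →
          (s₄.arr 7 = s.arr 7 ∧ s.arr 7 ((i - 1) * cap + e) = 0 ∨
            (∀ t < cap, s.arr 7 ((i - 1) * cap + t) ≠ 0) ∧ ∀ l < K, ∀ t < cap,
              s₄.arr 7 (l * cap + t) = if l = i - 1 then 0 else s.arr 7 (l * cap + t)) →
          Cover.Step K cap N (fun u v => s.arr 5 (u * N + v) ≠ 0) (s.arr 6) s.cover
            ((Prog.set 20 ((Expr.var 20).add (Expr.const 1))).run
              ((Prog.store 7 curIdx (Expr.const 0)).run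
                ((Prog.store 7 (belowIdx ((Expr.var 24).sub (Expr.const 1)))
                  (Expr.get 7 curIdx)).run s₄))).cover := by
        intro s₄ e hv ha h24 he hcell hor
        convert Cover.Step.drop (lt := fun u v => s.arr 5 (u * N + v) ≠ 0) s.cover e
          (s₄.arr 7) (Nat.pos_of_ne_zero hi0) hiK' he hno hor using 1
        have w20 := hv 20 (by simp) (by simp) (by simp)
        have w4 := (hv 4 (by simp) (by simp) (by simp)).trans h4
        have c1 : curIdx.eval s₄ = i * cap + s.arr 8 i := by
          simp [curIdx, Expr.eval, w20, w4, ha 8, hidef]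
        have c2 : (belowIdx ((Expr.var 24).sub (Expr.const 1))).eval s₄ = (i - 1) * cap + e := by
          simp [belowIdx, Expr.eval, w20, w4, h24, hidef]
        have c3 : curIdx.eval (s₄.store 7 (belowIdx ((Expr.var 24).sub (Expr.const 1)))
            (Expr.get 7 curIdx)) = i * cap + s.arr 8 i := by
          rw [← c1]; simp [curIdx, Expr.eval]
        apply Cover.ext'
        · simp only [State.cover, Prog.run, State.set_arr, State.store_arr_self, c2, c3]
          simp only [Expr.eval, c1, hcell]
          rfl
        · simp [State.cover, Prog.run, State.store_arr_of_ne, ha]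
        · simp [State.cover, Prog.run, State.store_arr_of_ne, ha]
        · simp [State.cover, Prog.run, Expr.eval, w20]
        · simp [State.cover, Prog.run, hv]
        · simp [State.cover, Prog.run, hv]
      rcases find2 with ⟨y0, hfull⟩ | ⟨e, he, ye, hz, -⟩
      · have hite : (Prog.ite (.var 24) .skip
            (.seq (.rep 23 4 (.store 7 (belowIdx (.var 23)) (.const 0))) (.set 24 (.const 1)))).run s₃ =
            (Prog.set 24 (.const 1)).run
              ((Prog.rep 23 4 (.store 7 (belowIdx (.var 23)) (.const 0))).run s₃) := by
          simp only [Prog.run.eq_7, Expr.eval, y0, ne_eq, not_true_eq_false, if_false, Prog.run.eq_6]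
        rw [hite]
        have w4 : s₃.vars 4 = cap := (ev3 4 (by simp) (by simp) (by simp)).trans h4
        obtain ⟨b1, b2⟩ := Prog.fill_spec (x := 23) (y := 4) (a := 7)
          (i := belowIdx (.var 23)) (e := .const 0) s₃
          (fun k => (i - 1) * cap + k) (fun _ => 0) (by simp)
          (fun k hk k' hk' he => by simpa using he)
          (fun k hk s' hv hx ha _ => by
            simp [Expr.eval, belowIdx, hx, hv 4, hv 20, ev3 20, ev3 4, h4, hidef])
        have f4 := (Prog.rep 23 4 (.store 7 (belowIdx (.var 23)) (.const 0))).frame s₃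
        rw [w4] at b1 b2
        set s₄ := (Prog.rep 23 4 (.store 7 (belowIdx (.var 23)) (.const 0))).run s₃
        refine fin _ 0 (fun z h1 h2 h3 => ?_) (fun b hb => ?_) (by simp [Prog.run, Expr.eval])
          (by omega) ?_ (.inr ⟨fun t ht => ?_, fun l hl t ht => ?_⟩)
        · simp only [Prog.run, State.set_vars, if_neg h2]
          rw [f4.1 z (by simp [Prog.writes, Ne.symm h1]), ev3 z h1 h2 h3]
        · simp only [Prog.run, State.set_arr]
          rw [f4.2 b (by simp [Prog.stores, Ne.symm hb]), ea3]
        · simp only [Prog.run, State.set_arr]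
          rw [b2 _ fun k hk he => ?_, ea3]
          have := ((slot_index_inj hcur hk).1 he).1
          omega
        · have := hfull t ht
          omega
        · simp only [Prog.run, State.set_arr]
          split_ifs with hl'
          · rw [hl', b1 t ht]
          · rw [b2 _ fun k hk he => hl' ((slot_index_inj ht hk).1 he).1, ea3]
      · have hite : (Prog.ite (.var 24) .skip
            (.seq (.rep 23 4 (.store 7 (belowIdx (.var 23)) (.const 0))) (.set 24 (.const 1)))).run s₃ =
            s₃ := by
          simp only [Prog.run.eq_7, Expr.eval, ye, ne_eq, Nat.succ_ne_zero, not_false_eq_true, if_true,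
            Prog.run.eq_1]
        rw [hite]
        exact fin s₃ e ev3 (fun b _ => by rw [ea3]) ye he (by rw [ea3])
          (.inl ⟨by rw [ea3], by omega⟩)
    · rw [Prog.run, if_pos (by simp [Expr.eval, ze])]
      rw [Nat.mul_ne_zero_iff] at hne
      convert Cover.Step.push (lt := fun u v => s.arr 5 (u * N + v) ≠ 0) s.cover e
        (Nat.pos_of_ne_zero hi0) hiK' he hne.1 hne.2 using 1
      have w20 := ev 20 (by simp) (by simp) (by simp)
      apply Cover.ext'
      · simp [State.cover, Prog.run, State.store_arr_of_ne, ea]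
      · simp [State.cover, Prog.run, State.store_arr_self, Expr.eval, ze, w20, ea]
      · simp [State.cover, Prog.run, State.store_arr_of_ne, ea]
      · simp [State.cover, Prog.run, Expr.eval, w20]
      · simp [State.cover, Prog.run, ev]
      · simp [State.cover, Prog.run, ev]

end ChainCoverProgram

end Shortcut
namespace Shortcut

/-! ### A linear extension by bucket sort, and the complete chain cover program. -/

section OrderProgram

/-- Count the predecessors of each element, in array `10`. -/
def countProg : Prog :=
  .rep 26 2 (.rep 23 2 (.ite (.get 5 (.add (.mul (.var 23) (.var 2)) (.var 26)))
    (.store 10 (.var 26) (.add (.get 10 (.var 26)) (.const 1))) .skip))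

/-- List the elements in array `6` in the order of their numbers of predecessors. -/
def orderProg : Prog :=
  .seq (.set 21 (.const 0)) (.rep 26 2 (.rep 23 2
    (.ite (.sub (.const 1) (.add (.sub (.get 10 (.var 23)) (.var 26))
        (.sub (.var 26) (.get 10 (.var 23)))))
      (.seq (.store 6 (.var 21) (.var 23)) (.set 21 (.add (.var 21) (.const 1)))) .skip)))

/-- The number of predecessors. -/
def predCount (N : ℕ) (a : ℕ → ℕ) (v m : ℕ) : ℕ :=
  ((Finset.range m).filter fun u => a (u * N + v) ≠ 0).card

theorem predCount_succ (N : ℕ) (a : ℕ → ℕ) (v m : ℕ) :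
    predCount N a v (m + 1) = predCount N a v m + if a (m * N + v) ≠ 0 then 1 else 0 := by
  rw [predCount, Finset.range_add_one, Finset.filter_insert]
  split_ifs with h
  · rw [Finset.card_insert_of_notMem (by simp)]; rfl
  · rfl

theorem countProg_spec {N : ℕ} (s : State) (hN : s.vars 2 = N) (h0 : ∀ v < N, s.arr 10 v = 0) :
    ∀ v < N, (countProg.run s).arr 10 v = predCount N (s.arr 5) v N := by
  have := Prog.rep_induct (x := 26) (y := 2)
    (p := .rep 23 2 (.ite (.get 5 (.add (.mul (.var 23) (.var 2)) (.var 26)))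
      (.store 10 (.var 26) (.add (.get 10 (.var 26)) (.const 1))) .skip)) (s := s) rfl
    (fun m s' => (∀ v < m, s'.arr 10 v = predCount N (s.arr 5) v N) ∧
      ∀ v, m ≤ v → v < N → s'.arr 10 v = 0) (by simpa using h0) ?_
  · rw [hN] at this; exact this.1
  intro k s' hk hx hfr hI
  rw [hN] at hk
  have h2 : s'.vars 2 = N := (hfr.1 2 rfl).trans hN
  have h5 : s'.arr 5 = s.arr 5 := hfr.2 5 rfl
  have inner := Prog.rep_induct (x := 23) (y := 2)
    (p := .ite (.get 5 (.add (.mul (.var 23) (.var 2)) (.var 26)))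
      (.store 10 (.var 26) (.add (.get 10 (.var 26)) (.const 1))) .skip) (s := s') rfl
    (fun m s'' => s''.arr 10 k = predCount N (s.arr 5) k m ∧
      ∀ v, v ≠ k → s''.arr 10 v = s'.arr 10 v)
    (by simp [predCount, hI.2 k le_rfl hk]) ?_
  · rw [h2] at inner
    refine ⟨fun v hv => ?_, fun v hv hvN => ?_⟩
    · rcases Nat.lt_succ_iff_lt_or_eq.1 hv with hv | rfl
      · exact (inner.2 v (by omega)).trans (hI.1 v hv)
      · exact inner.1
    · exact (inner.2 v (by omega)).trans (hI.2 v (by omega) hvN)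
  · intro j s'' hj hx' hfr' hI'
    have e2 : s''.vars 2 = N := (hfr'.1 2 rfl).trans h2
    have e26 : s''.vars 26 = k := (hfr'.1 26 rfl).trans hx
    have e5 : s''.arr 5 = s.arr 5 := (hfr'.2 5 rfl).trans h5
    have ec : (Expr.get 5 (.add (.mul (.var 23) (.var 2)) (.var 26))).eval s'' =
        s.arr 5 (j * N + k) := by simp [Expr.eval, e2, e26, e5, hx']
    rw [predCount_succ, Prog.run, ec]
    by_cases hc : s.arr 5 (j * N + k) = 0
    · simpa [hc, Prog.run] using hI'
    · simp only [ne_eq, hc, not_false_eq_true, if_true, Prog.run, State.set_arr, State.store_arr,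
        Expr.eval, e26, true_and, hI'.1]
      exact fun v hv => by rw [if_neg hv]; exact hI'.2 v hv

/-- Pass `d` lists the elements with `d` predecessors. All counts are below `N`, so `N` passes over
`N` elements list everything. -/
theorem orderProg_spec {N : ℕ} (s : State) (hN : s.vars 2 = N) (hc : ∀ v < N, s.arr 10 v < N) :
    let ord := (orderProg.run s).arr 6
    (∀ p < N, ord p < N) ∧ (∀ p < N, ∀ p' < N, ord p = ord p' → p = p') ∧
      ∀ p < N, ∀ p' < N, s.arr 10 (ord p) < s.arr 10 (ord p') → p < p' := by
  set body : Prog := .ite (.sub (.const 1) (.add (.sub (.get 10 (.var 23)) (.var 26))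
        (.sub (.var 26) (.get 10 (.var 23)))))
      (.seq (.store 6 (.var 21) (.var 23)) (.set 21 (.add (.var 21) (.const 1)))) .skip with hbody
  let cnt := s.arr 10
  -- `J d w` describes the list when pass `d` has reached element `w`: it contains exactly the
  -- elements treated so far, without repetitions and in nondecreasing order of their counts.
  let J : ℕ → ℕ → State → Prop := fun d w s' =>
    (∀ p < s'.vars 21, s'.arr 6 p < N ∧
      (cnt (s'.arr 6 p) < d ∨ cnt (s'.arr 6 p) = d ∧ s'.arr 6 p < w)) ∧
    (∀ p p', p < p' → p' < s'.vars 21 →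
      cnt (s'.arr 6 p) ≤ cnt (s'.arr 6 p') ∧ s'.arr 6 p ≠ s'.arr 6 p') ∧
    (∀ v < N, (cnt v < d ∨ cnt v = d ∧ v < w) → ∃ p < s'.vars 21, s'.arr 6 p = v)
  have hJ : ∀ d s', J d N s' → J (d + 1) 0 s' := by
    rintro d s' ⟨h1, h2, h3⟩
    refine ⟨fun p hp => ⟨(h1 p hp).1, ?_⟩, h2, fun v hv hvd => h3 v hv ?_⟩
    · have := (h1 p hp).2; omega
    · omega
  have main : J N 0 (orderProg.run s) := by
    have := Prog.rep_induct (x := 26) (y := 2) (p := .rep 23 2 body) (s := s.set 21 0) rfl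
      (fun d s' => J d 0 s') (by simp [J]) ?_
    · rw [show (s.set 21 0).vars 2 = N by simp [hN]] at this; exact this
    intro d s' hd hx hfr hI
    have e2 : s'.vars 2 = N := (hfr.1 2 rfl).trans (by simp [hN])
    have e10 : s'.arr 10 = cnt := (hfr.2 10 rfl).trans (by simp [cnt])
    have inner := Prog.rep_induct (x := 23) (y := 2) (p := body) (s := s') rfl
      (fun w s'' => J d w s'') (by simpa [J] using hI) ?_
    · rw [e2] at inner
      have := hJ d _ inner
      simpa [J] using this
    intro w s'' hw hx' hfr' hI'
    rw [e2] at hw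
    have f26 : s''.vars 26 = d := (hfr'.1 26 rfl).trans hx
    have f10 : s''.arr 10 = cnt := (hfr'.2 10 rfl).trans e10
    obtain ⟨h1, h2, h3⟩ := hI'
    by_cases hcd : cnt w = d
    · have hev : (Expr.sub (.const 1) (.add (.sub (.get 10 (.var 23)) (.var 26))
        (.sub (.var 26) (.get 10 (.var 23))))).eval s'' ≠ 0 := by
        simp [Expr.eval, f26, f10, hx', hcd]
      have hr : body.run s'' = (s''.store 6 (.var 21) (.var 23)).set 21 (s''.vars 21 + 1) := by
        rw [hbody, Prog.run, if_pos hev]; rfl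
      have hv21 : ((body.run s'').set 23 (w + 1)).vars 21 = s''.vars 21 + 1 := by simp [hr]
      have ha6 : ∀ p, ((body.run s'').set 23 (w + 1)).arr 6 p =
          if p = s''.vars 21 then w else s''.arr 6 p := by simp [hr, Expr.eval, hx']
      simp only [J, hv21, ha6]
      refine ⟨fun p hp => ?_, fun p p' hpp hp' => ?_, fun v hv hvd => ?_⟩
      · rcases Nat.lt_succ_iff_lt_or_eq.1 hp with hp | rfl
        · rw [if_neg hp.ne]
          have := h1 p hp
          omega
        · simp only [if_true]; exact ⟨hw, .inr ⟨hcd, Nat.lt_succ_self w⟩⟩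
      · have hp : p < s''.vars 21 := by omega
        rw [if_neg hp.ne]
        rcases Nat.lt_succ_iff_lt_or_eq.1 hp' with hp' | rfl
        · rw [if_neg hp'.ne]; exact h2 p p' hpp hp'
        · rw [if_pos rfl]
          have := h1 p hp
          refine ⟨by omega, fun he => ?_⟩
          rw [he] at this; omega
      · by_cases hvw : v = w
        · exact ⟨s''.vars 21, Nat.lt_succ_self _, by rw [if_pos rfl, hvw]⟩
        · obtain ⟨p, hp, he⟩ := h3 v hv (by omega)
          exact ⟨p, by omega, by rw [if_neg hp.ne, he]⟩
    · have hev : ¬ (Expr.sub (.const 1) (.add (.sub (.get 10 (.var 23)) (.var 26))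
        (.sub (.var 26) (.get 10 (.var 23))))).eval s'' ≠ 0 := by
        simp only [Expr.eval, f26, f10, hx']; omega
      have hr : body.run s'' = s'' := by rw [hbody, Prog.run, if_neg hev]; rfl
      have hv21 : ((body.run s'').set 23 (w + 1)).vars 21 = s''.vars 21 := by simp [hr]
      have ha6 : ((body.run s'').set 23 (w + 1)).arr 6 = s''.arr 6 := by simp [hr]
      simp only [J, hv21, ha6]
      refine ⟨fun p hp => ?_, h2, fun v hv hvd => ?_⟩
      · have := h1 p hp; omega
      · refine h3 v hv ?_
        rcases hvd with hvd | ⟨hvd, hvw⟩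
        · exact .inl hvd
        · rcases Nat.lt_succ_iff_lt_or_eq.1 hvw with hvw | rfl
          · exact .inr ⟨hvd, hvw⟩
          · exact absurd hvd hcd
  obtain ⟨h1, h2, h3⟩ := main
  set s' := orderProg.run s
  -- The list is injective with image `Finset.range N`, so it has exactly `N` entries.
  have hlen : s'.vars 21 = N := by
    have hinj : Set.InjOn (s'.arr 6) (Finset.range (s'.vars 21)) := by
      intro p hp p' hp' he
      simp only [Finset.coe_range, Set.mem_Iio] at hp hp'
      by_contra hne
      rcases Nat.lt_or_gt_of_ne hne with hlt | hlt
      · exact (h2 p p' hlt hp').2 he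
      · exact (h2 p' p hlt hp).2 he.symm
    have himg : (Finset.range (s'.vars 21)).image (s'.arr 6) = Finset.range N := by
      ext v
      simp only [Finset.mem_image, Finset.mem_range]
      constructor
      · rintro ⟨p, hp, rfl⟩; exact (h1 p hp).1
      · intro hv; exact h3 v hv (.inl (hc v hv))
    have := congrArg Finset.card himg
    rwa [Finset.card_image_of_injOn hinj, Finset.card_range, Finset.card_range] at this
  rw [hlen] at h1 h2
  refine ⟨fun p hp => (h1 p hp).1, fun p hp p' hp' he => ?_, fun p hp p' hp' hlt => ?_⟩
  · by_contra hne
    rcases Nat.lt_or_gt_of_ne hne with h | h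
    · exact (h2 p p' h hp').2 he
    · exact (h2 p' p h hp).2 he.symm
  · by_contra hle
    rcases Nat.lt_or_eq_of_le (not_lt.1 hle) with h | h
    · have := (h2 p' p h hp).1
      simp only [cnt] at this
      omega
    · rw [h] at hlt; omega

/-- Add `N (2K + 2)` to register `15`. -/
def coverSteps : Prog :=
  .rep 26 2 (.seq (.rep 23 3 (.set 15 (.add (.var 15) (.const 2))))
    (.set 15 (.add (.var 15) (.const 2))))

/-- Prepare the chain cover procedure; register `15` gets the number of steps. -/
def coverInit : Prog :=
  .seq countProg (.seq orderProg (.seq (.set 20 (.var 3)) (.seq (.set 21 (.const 0))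
    (.seq (.set 22 (.const 0)) (.seq (.set 15 (.add (.var 3) (.const 1))) coverSteps)))))

/-- The chain cover procedure. -/
def coverLoop : Prog := .rep 26 15 coverStep

theorem rep_add_spec {x y z c : ℕ} (s : State) (hxy : x ≠ y) (hzx : z ≠ x) (hzy : z ≠ y) :
    ((Prog.rep x y (.set z (.add (.var z) (.const c)))).run s).vars z = s.vars z + s.vars y * c := by
  refine Prog.rep_induct (x := x) (y := y) (s := s) (by simp [Prog.fresh, Prog.writes, hxy, hzx, hzy])
    (fun m s' => s'.vars z = s.vars z + m * c) (by simp [hzx]) fun k s' _ _ _ hI => ?_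
  simp [Prog.run, Expr.eval, hzx, hI, Nat.succ_mul, Nat.add_assoc]

/-- One more than the initial potential, as `Cover.isChainCover` asks for. -/
theorem coverInit_steps (s : State) :
    (coverInit.run s).vars 15 = (2 * s.vars 3 + 2) * s.vars 2 + s.vars 3 + 1 := by
  simp only [coverInit, Prog.run.eq_6, coverSteps]
  set s₁ := (Prog.set 15 (.add (.var 3) (.const 1))).run ((Prog.set 22 (.const 0)).run
    ((Prog.set 21 (.const 0)).run ((Prog.set 20 (.var 3)).run (orderProg.run (countProg.run s)))))
    with hs₁
  have e3 : s₁.vars 3 = s.vars 3 := by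
    simp [hs₁, Prog.run, Prog.run_vars orderProg (z := 3) rfl, Prog.run_vars countProg (z := 3) rfl]
  have e2 : s₁.vars 2 = s.vars 2 := by
    simp [hs₁, Prog.run, Prog.run_vars orderProg (z := 2) rfl, Prog.run_vars countProg (z := 2) rfl]
  have e15 : s₁.vars 15 = s.vars 3 + 1 := by
    simp [hs₁, Prog.run, Expr.eval, Prog.run_vars orderProg (z := 3) rfl,
      Prog.run_vars countProg (z := 3) rfl]
  have := Prog.rep_induct (x := 26) (y := 2) (s := s₁)
    (p := .seq (.rep 23 3 (.set 15 (.add (.var 15) (.const 2)))) (.set 15 (.add (.var 15) (.const 2))))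
    rfl (fun m s' => s'.vars 15 = s.vars 3 + 1 + m * (2 * s.vars 3 + 2)) (by simp [e15]) ?_
  · rw [this, e2]; ring
  · intro k s' _ _ hfr hI
    have h3 : s'.vars 3 = s.vars 3 := (hfr.1 3 rfl).trans e3
    rw [Prog.run.eq_6]
    simp only [Prog.run.eq_2, State.set_vars, Expr.eval]
    norm_num
    rw [rep_add_spec _ (by simp) (by simp) (by simp), hI, h3]
    ring

/-- In a strict order, `u < v` makes the predecessors of `u` a proper subset of those of `v`.
Sorting by the number of predecessors therefore gives the linear extension that the loading step
needs. -/
theorem chainCover_spec {K cap N : ℕ} (s : State) (hK : 0 < K) (h2 : s.vars 2 = N)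
    (h3 : s.vars 3 = K) (h4 : s.vars 4 = cap) (hcap : N < cap * K) (h7 : ∀ x, s.arr 7 x = 0)
    (h10 : ∀ x, s.arr 10 x = 0) (hirr : ∀ v < N, s.arr 5 (v * N + v) = 0)
    (htr : ∀ u < N, ∀ v < N, ∀ w < N, s.arr 5 (u * N + v) ≠ 0 → s.arr 5 (v * N + w) ≠ 0 →
      s.arr 5 (u * N + w) ≠ 0) :
    IsChainCover K N (fun u v => s.arr 5 (u * N + v) ≠ 0)
      ((coverLoop.run (coverInit.run s)).vars 22) ((coverLoop.run (coverInit.run s)).arr 9) := by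
  set s₁ := coverInit.run s with hs₁
  have f1 : Frame coverInit s s₁ := coverInit.frame s
  have hT := coverInit_steps s
  rw [← hs₁, h2, h3] at hT
  have hc := countProg_spec s h2 fun v _ => h10 v
  have hlt : ∀ v < N, predCount N (s.arr 5) v N < N := by
    intro v hv
    calc predCount N (s.arr 5) v N < (Finset.range N).card := by
          refine Finset.card_lt_card (Finset.filter_ssubset.2 ⟨v, Finset.mem_range.2 hv, ?_⟩)
          simpa using hirr v hv
      _ = N := Finset.card_range N
  have hmono : ∀ u < N, ∀ v < N, s.arr 5 (u * N + v) ≠ 0 →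
      predCount N (s.arr 5) u N < predCount N (s.arr 5) v N := by
    intro u hu v hv huv
    refine Finset.card_lt_card (Finset.ssubset_iff_of_subset ?_ |>.2 ⟨u, ?_, ?_⟩)
    · intro w hw
      simp only [Finset.mem_filter, Finset.mem_range] at hw ⊢
      exact ⟨hw.1, htr w hw.1 u hu v hv hw.2 huv⟩
    · simp [hu, huv]
    · simp [hirr u hu]
  obtain ⟨o1, o2, o3⟩ := orderProg_spec (countProg.run s)
    ((countProg.run_vars (z := 2) rfl s).trans h2) (fun v hv => by rw [hc v hv]; exact hlt v hv)
  have hord : s₁.arr 6 = (orderProg.run (countProg.run s)).arr 6 := by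
    simp [hs₁, coverInit, Prog.run.eq_6, Prog.run.eq_2, Prog.run_arr coverSteps (b := 6) rfl]
  rw [← hord] at o1 o2 o3
  let f : State → State := fun s => (coverStep.run s).set 26 ((coverStep.run s).vars 26 + 1)
  have hinv : ∀ k, let σ := f^[k] (s₁.set 26 0)
      σ.vars 2 = N ∧ σ.vars 3 = K ∧ σ.vars 4 = cap ∧ σ.arr 5 = s.arr 5 ∧ σ.arr 6 = s₁.arr 6 := by
    intro k
    refine iterate_invariant f (fun σ : State => σ.vars 2 = N ∧ σ.vars 3 = K ∧ σ.vars 4 = cap ∧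
      σ.arr 5 = s.arr 5 ∧ σ.arr 6 = s₁.arr 6) (fun σ hσ => ?_) ?_ k
    · have g := coverStep.frame σ
      simp only [f, State.set_vars, State.set_arr, g.1 2 rfl, g.1 3 rfl, g.1 4 rfl, g.2 5 rfl,
        g.2 6 rfl]
      simpa using hσ
    · simp [f1.1 2 rfl, f1.1 3 rfl, f1.1 4 rfl, f1.2 5 rfl, h2, h3, h4]
  have hcov := Cover.isChainCover (K := K) (cap := cap) (N := N)
    (lt := fun u v => s.arr 5 (u * N + v) ≠ 0) (ord := s₁.arr 6)
    (τ := fun k => (f^[k] (s₁.set 26 0)).cover) (T := s₁.vars 15) hK hcap o1 o2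
    (fun p hp p' hp' hl => o3 p hp p' hp' (by
      rw [hc _ (o1 p hp), hc _ (o1 p' hp')]
      exact hmono _ (o1 p hp) _ (o1 p' hp') hl))
    (fun v hv => by simpa using hirr v hv)
    (fun x => by simp [State.cover, f1.2 7 rfl, h7])
    (by simp [State.cover, hs₁, coverInit, Prog.run.eq_6, Prog.run.eq_2, Expr.eval,
      Prog.run_vars coverSteps (z := 20) rfl, Prog.run_vars orderProg (z := 3) rfl,
      Prog.run_vars countProg (z := 3) rfl, h3])
    (by simp [State.cover, hs₁, coverInit, Prog.run.eq_6, Prog.run.eq_2, Expr.eval,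
      Prog.run_vars coverSteps (z := 21) rfl])
    (by simp [State.cover, hs₁, coverInit, Prog.run.eq_6, Prog.run.eq_2, Expr.eval,
      Prog.run_vars coverSteps (z := 22) rfl])
    (by omega) (fun k hk hiK hstk => by
      obtain ⟨i2, i3, i4, i5, i6⟩ := hinv k
      have := coverStep_step (f^[k] (s₁.set 26 0)) i3 i4 i2 hiK hstk
      rw [i5, i6] at this
      have e : (f^[k + 1] (s₁.set 26 0)).cover = (coverStep.run (f^[k] (s₁.set 26 0))).cover := by
        rw [Function.iterate_succ_apply']
        simp [f, State.cover]
      rw [e]; exact this)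
  exact hcov

end OrderProgram

end Shortcut
namespace Shortcut

/-! ### The graph on sampled positions, and the diameter bound once all samples hit. -/

section Samples

variable {n : ℕ}

/-- Reachability in `G`. -/
def Reach (G : Digraph (Fin n)) : Fin n → Fin n → Prop := Relation.ReflTransGen G.Adj

/-- The strict order on the positions of a list of vertices: reachability, where positions that
reach each other are ordered by number. -/
def PosLt (G : Digraph (Fin n)) (X : ℕ → Fin n) (i j : ℕ) : Prop :=
  Reach G (X i) (X j) ∧ (¬ Reach G (X j) (X i) ∨ i < j)

theorem PosLt.irrefl {G : Digraph (Fin n)} {X : ℕ → Fin n} (i : ℕ) : ¬ PosLt G X i i := by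
  rintro ⟨h, h' | h'⟩
  exacts [h' h, lt_irrefl _ h']

/-- If `X k` reached `X i`, all three vertices would be mutually reachable, and there the order is
that of the numbers. -/
theorem PosLt.trans {G : Digraph (Fin n)} {X : ℕ → Fin n} {i j k : ℕ} (h : PosLt G X i j)
    (h' : PosLt G X j k) : PosLt G X i k := by
  refine ⟨Relation.ReflTransGen.trans h.1 h'.1, or_iff_not_imp_left.2 fun hk => ?_⟩
  rw [not_not] at hk
  rcases h.2 with h2 | h2
  · exact absurd (Relation.ReflTransGen.trans h'.1 hk) h2
  · rcases h'.2 with h3 | h3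
    · exact absurd (Relation.ReflTransGen.trans hk h.1) h3
    · omega

/-- `G` may have cycles and samples may repeat. The tie-break makes any two distinct positions
comparable as soon as one reaches the other, so that antichains of `PosLt` contain no reachable
pair. -/
theorem PosLt.of_reach {G : Digraph (Fin n)} {X : ℕ → Fin n} {i j : ℕ} (h : Reach G (X i) (X j))
    (hij : i ≠ j) : PosLt G X i j ∨ PosLt G X j i := by
  by_cases h' : Reach G (X j) (X i)
  · rcases Nat.lt_or_gt_of_ne hij with hl | hl
    exacts [.inl ⟨h, .inr hl⟩, .inr ⟨h', .inr hl⟩]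
  · exact .inl ⟨h, .inl h'⟩

/-- The pairs of positions on a common chain that are a power of two apart, in either order. -/
def Hop (K nch w : ℕ) (ch : ℕ → ℕ) (a b : ℕ) : Prop :=
  ∃ t < nch, ∃ e < w, ∃ i, i + 2 ^ e < K ∧
    ((a = ch (t * K + i) ∧ b = ch (t * K + (i + 2 ^ e))) ∨
      (a = ch (t * K + (i + 2 ^ e)) ∧ b = ch (t * K + i)))

/-- Positions are adjacent when the distance between them is at most `L` or when they are a power
of two apart on a chain. -/
def posGraph (G : Digraph (Fin n)) (X : ℕ → Fin n) (L K N nch w : ℕ) (ch : ℕ → ℕ) :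
    Digraph (Fin N) :=
  ⟨fun a b => Within G L (X a) (X b) ∨ (Reach G (X a) (X b) ∧ Hop K nch w ch a b)⟩

variable {G E : Digraph (Fin n)} {X : ℕ → Fin n} {L K M N nch w : ℕ} {ch : ℕ → ℕ}

theorem Within.reach {k : ℕ} {a b : Fin n} (h : Within G k a b) : Reach G a b := by
  obtain ⟨j, -, h⟩ := h
  exact h.reflTransGen

theorem posGraph_reach {a b : Fin N}
    (h : Relation.ReflTransGen (posGraph G X L K N nch w ch).Adj a b) : Reach G (X a) (X b) := by
  induction h with
  | refl => exact Relation.ReflTransGen.refl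
  | tail _ h ih =>
    rcases h with h | h
    exacts [ih.trans h.reach, ih.trans h.1]

theorem IsChainCover.reach_of_le (hc : IsChainCover K N (PosLt G X) nch ch) {t i j : ℕ}
    (ht : t < nch) (hij : i ≤ j) (hj : j < K) :
    Reach G (X (ch (t * K + i))) (X (ch (t * K + j))) := by
  induction j, hij using Nat.le_induction with
  | base => exact Relation.ReflTransGen.refl
  | succ j _ ih => exact (ih (by omega)).trans (hc.chain t ht j hj).1

theorem index_lt {t nch K j : ℕ} (ht : t < nch) (hj : j < K) : t * K + j < nch * K := by
  calc t * K + j < (t + 1) * K := by rw [Nat.succ_mul]; omega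
    _ ≤ nch * K := Nat.mul_le_mul_right _ ht

theorem IsChainCover.within (hc : IsChainCover K N (PosLt G X) nch ch) (hK : K ≤ 2 ^ w)
    {t i j : ℕ} (ht : t < nch) (hi : i < K) (hj : j < K) {a b : Fin N}
    (ha : (a : ℕ) = ch (t * K + i)) (hb : (b : ℕ) = ch (t * K + j)) (hab : Reach G (X a) (X b)) :
    Within (posGraph G X L K N nch w ch) w a b := by
  have hN : 0 < N := a.pos
  -- The reduction modulo `N` only produces an element of `Fin N`; for indices below `K` it changes
  -- nothing.
  let c : ℕ → Fin N := fun i => ⟨ch (t * K + i) % N, Nat.mod_lt _ hN⟩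
  have hcv : ∀ i < K, ((c i : Fin N) : ℕ) = ch (t * K + i) := fun i hi =>
    Nat.mod_eq_of_lt (hc.ch_lt _ (index_lt ht hi))
  have hca : c i = a := Fin.ext ((hcv i hi).trans ha.symm)
  have hcb : c j = b := Fin.ext ((hcv j hj).trans hb.symm)
  rw [← hca, ← hcb] at hab ⊢
  refine within_chain (c := c) (R := fun a b : Fin N => Reach G (X a) (X b)) (fun h h' => h.trans h') hK
    (fun i j hij hj => ?_) (fun e he i hi hr => Or.inr ⟨hr, t, ht, e, he, i, hi, Or.inl ?_⟩)
    (fun e he i hi hr => Or.inr ⟨hr, t, ht, e, he, i, hi, Or.inr ?_⟩) hi hj hab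
  · rw [hcv i (by omega), hcv j hj]; exact hc.reach_of_le ht hij hj
  · exact ⟨hcv _ ((Nat.le_add_right _ _).trans_lt hi), hcv _ hi⟩
  · exact ⟨hcv _ hi, hcv _ ((Nat.le_add_right _ _).trans_lt hi)⟩

open scoped Classical in
/-- The chains that meet an interval. -/
noncomputable def touched (S : Digraph (Fin N)) (M K nch : ℕ) (ch : ℕ → ℕ) (z i : Fin N) : Finset ℕ :=
  (Finset.range nch).filter fun c => ∃ j < K, ∃ x ∈ interval S M z i, (x : ℕ) = ch (c * K + j)

theorem mem_touched {S : Digraph (Fin N)} {z i : Fin N} {c : ℕ} :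
    c ∈ touched S M K nch ch z i ↔
      c < nch ∧ ∃ j < K, ∃ x ∈ interval S M z i, (x : ℕ) = ch (c * K + j) := by
  simp [touched]

/-- This is `Geo.le_classes` with the chains as classes: by the hops, two elements of a chain are
within `w` whenever one reaches the other, and the uncovered positions use `2 * K` colours. -/
theorem le_card_touched (hc : IsChainCover K N (PosLt G X) nch ch) (hK : K ≤ 2 ^ w) {z i : Fin N}
    (h : Geo (posGraph G X L K N nch w ch) M z i) :
    M + 1 ≤ 2 * K + (touched (posGraph G X L K N nch w ch) M K nch ch z i).card * (w + 1) := by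
  classical
  obtain ⟨col, hcol, hcol'⟩ := hc.col
  rcases Nat.eq_zero_or_pos K with rfl | hK0
  · have hz := hcol z z.2 (by simp)
    exact absurd hz (by simp)
  let cov : Fin N → Prop := fun v => ∃ x < nch * K, ch x = v
  let idx : Fin N → ℕ := fun v => if hv : cov v then hv.choose else 0
  have hidx : ∀ v, cov v → idx v < nch * K ∧ ch (idx v) = v := fun v hv => by
    simp only [idx, dif_pos hv]; exact hv.choose_spec
  have hdiv : ∀ v, cov v → idx v / K < nch := fun v hv =>
    Nat.div_lt_of_lt_mul (by rw [Nat.mul_comm]; exact (hidx v hv).1)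
  have hch : ∀ v, cov v → (v : ℕ) = ch (idx v / K * K + idx v % K) := fun v hv => by
    rw [Nat.div_add_mod']; exact (hidx v hv).2.symm
  refine h.le_classes cov (fun v => idx v / K) (fun v => col v) _ (fun x hx hxc => ?_)
    (fun x y hx hy he hxy => ?_) (fun x hx => hcol x x.2 fun y hy he => hx ⟨y, hy, he⟩)
    (fun x y hx hy hne hxy => ?_)
  · exact mem_touched.2 ⟨hdiv x hxc, _, Nat.mod_lt _ hK0, x, hx, hch x hxc⟩
  · exact hc.within hK (hdiv x hx) (Nat.mod_lt _ hK0) (Nat.mod_lt _ hK0) (hch x hx)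
      (by rw [he]; exact hch y hy) (posGraph_reach hxy)
  · have hx' : ∀ z < nch * K, ch z ≠ x := fun z hz he => hx ⟨z, hz, he⟩
    have hy' : ∀ z < nch * K, ch z ≠ y := fun z hz he => hy ⟨z, hz, he⟩
    rcases PosLt.of_reach (posGraph_reach hxy) (fun he => hne (Fin.ext he)) with hl | hl
    · exact hcol' x y x.2 y.2 hx' hy' hl
    · exact (hcol' y x y.2 x.2 hy' hx' hl).symm

/-- The deterministic core. A sampled position `x` on the first `M` edges of a long geodesic reaches
every vertex on its last `M` edges, in particular a vertex `q` on a sampled chain. One jump leads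
from `x` to the first vertex of that chain that it reaches, and hops lead from there to `q`. -/
theorem diam_le_of_hits {Y Z : ℕ → ℕ} {m₂ m₃ : ℕ} (hL : 1 ≤ L) (hK : K ≤ 2 ^ w)
    (hc : IsChainCover K N (PosLt G X) nch ch) (hGE : G ≤ E) (hEG : E ≤ transClosure G)
    (hop : ∀ a b, Hop K nch w ch a b → Reach G (X a) (X b) → Within E 1 (X a) (X b))
    (jump : ∀ t < m₂, ∀ t' < m₃, Z t' < nch → ∀ j < K,
      Reach G (X (Y t)) (X (ch (Z t' * K + j))) →
      (∀ j' < j, ¬ Reach G (X (Y t)) (X (ch (Z t' * K + j')))) →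
      Within E 1 (X (Y t)) (X (ch (Z t' * K + j))))
    (hit₁ : ∀ a b, Geo G L a b → ∃ i < N, X i ∈ interval₁ G L a b)
    (hit₂ : ∀ i y, Geo (posGraph G X L K N nch w ch) M i y →
      ∃ t < m₂, ∃ x ∈ interval (posGraph G X L K N nch w ch) M i y, Y t = x)
    (hit₃ : ∀ z i, Geo (posGraph G X L K N nch w ch) M z i →
      ∃ t < m₃, Z t ∈ touched (posGraph G X L K N nch w ch) M K nch ch z i) :
    diam E ≤ ((2 * L + (L * (2 * M + w) + 1) : ℕ) : ℕ∞) := by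
  classical
  set S := posGraph G X L K N nch w ch with hS
  have hSE : ∀ i j, S.Adj i j → Within E L (X i) (X j) := by
    rintro i j (h | ⟨h, h'⟩)
    · exact h.mono_graph hGE
    · exact (hop _ _ h' h).mono hL
  have hEG' : ∀ u v, Reach E u v → Reach G u v := fun u v h => by
    induction h with
    | refl => exact Relation.ReflTransGen.refl
    | tail _ h ih => exact ih.trans (Relation.TransGen.to_reflTransGen (hEG h))
  refine diam_le_of_within fun u v huv => ?_
  refine within_of_samples (ι := Fin N) (S := S) (X := fun i => X i) hGE (fun i j h => .inl h) hSE
    (fun a b h => ?_) (fun i y z i' hiy hzi hyz => ?_) (hEG' _ _ huv)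
  · obtain ⟨i, hi, h⟩ := hit₁ a b h
    exact ⟨⟨i, hi⟩, h⟩
  · obtain ⟨t, ht, x, hx, hxt⟩ := hit₂ i y hiy
    obtain ⟨t', ht', hZ⟩ := hit₃ z i' hzi
    obtain ⟨hn, j, hj, q, hq, hqc⟩ := mem_touched.1 hZ
    have hxq : Reach G (X x) (X q) := by
      obtain ⟨k, -, -, h1⟩ := hx
      obtain ⟨k', -, h2, -⟩ := hq
      exact posGraph_reach (h1.reflTransGen.trans (hyz.trans h2.reflTransGen))
    have hex : ∃ j, j < K ∧ Reach G (X x) (X (ch (Z t' * K + j))) := ⟨j, hj, hqc ▸ hxq⟩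
    obtain ⟨hf, hfr⟩ := Nat.find_spec hex
    have hmin : ∀ j' < Nat.find hex, ¬ Reach G (X x) (X (ch (Z t' * K + j'))) := fun j' hj' hr =>
      Nat.find_min hex hj' ⟨hj'.trans hf, hr⟩
    -- The landing point of the jump does not come after `q` on the chain, hence reaches `q`.
    have hfj : Nat.find hex ≤ j := Nat.find_min' hex ⟨hj, hqc ▸ hxq⟩
    have hjump := jump t ht t' ht' hn _ hf (by rwa [hxt]) (by rwa [hxt])
    have hlt := hc.ch_lt _ (index_lt hn hf)
    have hw : Within S w ⟨_, hlt⟩ q := hc.within hK hn hf hj rfl hqc (by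
      rw [hqc]; exact hc.reach_of_le hn hfj hj)
    refine ⟨x, hx, q, hq, ?_⟩
    rw [hxt] at hjump
    exact hjump.trans (hw.map hSE)

end Samples

end Shortcut
namespace Shortcut

/-! ### Fair coins: the probability that random residues miss a set. -/

section Probability

open MeasureTheory

/-- The number with the binary digits `c 0, …, c (b - 1)`, most significant first. -/
def coinVal (c : ℕ → Bool) : ℕ → ℕ
  | 0 => 0
  | b + 1 => 2 * coinVal c b + (c b).toNat

theorem coinVal_lt (c : ℕ → Bool) (b : ℕ) : coinVal c b < 2 ^ b := by
  induction b with
  | zero => simp [coinVal]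
  | succ b ih =>
    have := (c b).toNat_le
    rw [coinVal, pow_succ]; omega

theorem coinVal_congr {c c' : ℕ → Bool} {b : ℕ} (h : ∀ i < b, c i = c' i) :
    coinVal c b = coinVal c' b := by
  induction b with
  | zero => rfl
  | succ b ih => rw [coinVal, coinVal, ih fun i hi => h i (by omega), h b (by omega)]

theorem coinVal_inj {c c' : ℕ → Bool} {b : ℕ} (h : coinVal c b = coinVal c' b) :
    ∀ i < b, c i = c' i := by
  induction b with
  | zero => intro i hi; omega
  | succ b ih =>
    rw [coinVal, coinVal] at h
    have h1 := (c b).toNat_le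
    have h2 := (c' b).toNat_le
    have h3 : (c b).toNat = (c' b).toNat := by omega
    intro i hi
    rcases Nat.lt_succ_iff_lt_or_eq.1 hi with hi | rfl
    · exact ih (by omega) i hi
    · revert h3; cases c i <;> cases c' i <;> simp

/-- The first `u` coins determine the value of `F`. -/
def DeterminedBy {α : Type*} (u : ℕ) (F : (ℕ → Bool) → α) : Prop :=
  ∀ ρ ρ' : ℕ → Bool, (∀ i < u, ρ i = ρ' i) → F ρ = F ρ'

/-- Infinitely many coins, all but the first `u` of which are `false`. -/
def extendCoins {u : ℕ} (w : Fin u → Bool) : ℕ → Bool := fun i => if h : i < u then w ⟨i, h⟩ else false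

theorem extendCoins_restrict {u : ℕ} (ρ : ℕ → Bool) {i : ℕ} (hi : i < u) :
    extendCoins (fun i : Fin u => ρ i) i = ρ i := by
  simp [extendCoins, hi]

open scoped Classical in
/-- The number of outcomes of the first `u` coins in an event. -/
noncomputable def countCoins (u : ℕ) (F : (ℕ → Bool) → Prop) : ℕ :=
  (Finset.univ.filter fun w : Fin u → Bool => F (extendCoins w)).card

/-- The event is covered by finitely many cylinders of measure `2 ^ (-u)`. Only an upper bound is
needed, so measurability of the event plays no role. -/
theorem fairCoins_le {u : ℕ} {F : (ℕ → Bool) → Prop} (hF : DeterminedBy u F) :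
    fairCoins {ρ | F ρ} ≤ ENNReal.ofReal (countCoins u F / 2 ^ u) := by
  classical
  let cyl : (Fin u → Bool) → Set (ℕ → Bool) := fun w =>
    Set.pi (Finset.range u) fun i => {extendCoins w i}
  have hcyl : ∀ w, fairCoins (cyl w) = ENNReal.ofReal ((1 / 2) ^ u) := by
    intro w
    rw [fairCoins, Measure.infinitePi_pi _ (fun i _ => MeasurableSet.singleton _)]
    have : ∀ b : Bool, (PMF.uniformOfFintype Bool).toMeasure {b} = ENNReal.ofReal (1 / 2) := by
      intro b
      rw [PMF.toMeasure_apply_singleton _ _ (MeasurableSet.singleton _)]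
      simp [PMF.uniformOfFintype_apply, ENNReal.ofReal_inv_of_pos]
    simp only [this, Finset.prod_const, Finset.card_range]
    rw [ENNReal.ofReal_pow (by norm_num)]
  have hsub : {ρ | F ρ} ⊆ ⋃ w ∈ Finset.univ.filter fun w : Fin u → Bool => F (extendCoins w), cyl w := by
    intro ρ hρ
    simp only [Set.mem_iUnion]
    refine ⟨fun i => ρ i, Finset.mem_filter.2 ⟨Finset.mem_univ _, ?_⟩, fun i hi => ?_⟩
    · rw [← hF ρ _ fun i hi => (extendCoins_restrict ρ hi).symm]; exact hρ
    · exact (extendCoins_restrict ρ (Finset.mem_range.1 (Finset.mem_coe.1 hi))).symm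
  refine (measure_mono hsub).trans ((measure_biUnion_finset_le _ _).trans ?_)
  simp only [hcyl, Finset.sum_const, nsmul_eq_mul]
  rw [countCoins, div_eq_mul_one_div (Nat.cast _) ((2 : ℝ) ^ u),
    ENNReal.ofReal_mul (Nat.cast_nonneg _), ENNReal.ofReal_natCast, one_div_pow]

/-- Each residue modulo `q` is attained at least `B / q` times below `B`. -/
theorem card_filter_mod_le {q B : ℕ} (hq : 0 < q) {S : Finset ℕ} (hS : S ⊆ Finset.range q) :
    ((Finset.range B).filter fun z => z % q ∉ S).card + S.card * (B / q) ≤ B := by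
  have h1 : S.card * (B / q) ≤ ((Finset.range B).filter fun z => z % q ∈ S).card := by
    rw [← Finset.card_range (B / q), ← Finset.card_product]
    refine Finset.card_le_card_of_injOn (fun p => p.1 + q * p.2) ?_ ?_
    · rintro ⟨s, k⟩ hp
      obtain ⟨hs, hk⟩ := Finset.mem_product.1 hp
      have hsq := Finset.mem_range.1 (hS hs)
      have hk := Finset.mem_range.1 hk
      simp only [Finset.coe_filter, Finset.mem_range, Set.mem_ofPred_eq, Nat.add_mul_mod_self_left,
        Nat.mod_eq_of_lt hsq]
      refine ⟨?_, hs⟩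
      calc s + q * k < q * (k + 1) := by rw [Nat.mul_succ]; omega
        _ ≤ q * (B / q) := Nat.mul_le_mul_left _ hk
        _ ≤ B := Nat.mul_div_le _ _
    · rintro ⟨s, k⟩ hp ⟨s', k'⟩ hp' he
      have hs := Finset.mem_range.1 (hS (Finset.mem_product.1 hp).1)
      have hs' := Finset.mem_range.1 (hS (Finset.mem_product.1 hp').1)
      have e1 := congrArg (· % q) he
      have e2 := congrArg (· / q) he
      simp only [Nat.add_mul_mod_self_left, Nat.mod_eq_of_lt hs, Nat.mod_eq_of_lt hs',
        Nat.add_mul_div_left _ _ hq, Nat.div_eq_of_lt hs, Nat.div_eq_of_lt hs', Nat.zero_add] at e1 e2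
      exact Prod.ext e1 e2
  have h2 := Finset.card_filter_add_card_filter_not (s := Finset.range B) fun z => z % q ∈ S
  rw [Finset.card_range] at h2
  omega

/-- One more trial. Reducing a uniform `b`-bit number modulo `q` is not uniform, but as `q ≤ 2 ^ b`
every residue still has at least `2 ^ b / (2 * q)` preimages; this explains the factor `2`. The
target set is fixed before the new coins are read. -/
theorem countCoins_step {u b q h : ℕ} {F : (ℕ → Bool) → Prop} {S : (ℕ → Bool) → Finset ℕ}
    (hF : DeterminedBy u F) (hS : DeterminedBy u S) (hq : 0 < q) (hqb : q ≤ 2 ^ b)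
    (hsub : ∀ ρ, F ρ → S ρ ⊆ Finset.range q) (hcard : ∀ ρ, F ρ → h ≤ (S ρ).card) :
    (countCoins (u + b) fun ρ => F ρ ∧ coinVal (fun i => ρ (u + i)) b % q ∉ S ρ : ℝ) ≤
      countCoins u F * (2 ^ b * (1 - h / (2 * q))) := by
  classical
  have hag : ∀ w : Fin (u + b) → Bool, ∀ i < u,
      extendCoins w i = extendCoins (fun i : Fin u => extendCoins w i) i :=
    fun w i hi => (extendCoins_restrict _ hi).symm
  have key : (countCoins (u + b) fun ρ => F ρ ∧ coinVal (fun i => ρ (u + i)) b % q ∉ S ρ) ≤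
      ((Finset.univ.filter fun w : Fin u → Bool => F (extendCoins w)).sigma fun w =>
        (Finset.range (2 ^ b)).filter fun z => z % q ∉ S (extendCoins w)).card := by
    rw [countCoins]
    refine Finset.card_le_card_of_injOn (fun w => ⟨fun i => extendCoins w i,
      coinVal (fun i => extendCoins w (u + i)) b⟩) ?_ ?_
    · intro w hw
      simp only [Finset.coe_filter, Finset.mem_univ, true_and, Set.mem_ofPred_eq] at hw
      obtain ⟨h1, h2⟩ := hw
      simp only [Finset.coe_sigma, Set.mem_sigma_iff, Finset.mem_coe, Finset.mem_filter,
        Finset.mem_univ, true_and, Finset.mem_range]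
      rw [← hF _ _ (hag w), ← hS _ _ (hag w)]
      exact ⟨h1, coinVal_lt _ _, h2⟩
    · intro w _ w' _ he
      simp only [Sigma.mk.injEq, heq_eq_eq] at he
      have h2 := coinVal_inj he.2
      funext i
      have hi : extendCoins w i = extendCoins w' i := by
        rcases lt_or_ge (i : ℕ) u with hi | hi
        · exact congrFun he.1 ⟨i, hi⟩
        · have := h2 (i - u) (by omega)
          rwa [Nat.add_sub_cancel' hi] at this
      simpa [extendCoins] using hi
  rw [Finset.card_sigma] at key
  refine (Nat.cast_le.2 key).trans ?_
  rw [Nat.cast_sum, countCoins, ← nsmul_eq_mul]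
  refine Finset.sum_le_card_nsmul _ _ _ fun w hw => ?_
  have hw := (Finset.mem_filter.1 hw).2
  have h1 := card_filter_mod_le (B := 2 ^ b) hq (hsub _ hw)
  have h2 := hcard _ hw
  have h3 : 2 ^ b ≤ 2 * q * (2 ^ b / q) := by
    have := Nat.div_add_mod (2 ^ b) q
    have := Nat.mod_lt (2 ^ b) hq
    have h4 : q * 1 ≤ q * (2 ^ b / q) := Nat.mul_le_mul_left _ (Nat.div_pos hqb hq)
    have : 2 * q * (2 ^ b / q) = 2 * (q * (2 ^ b / q)) := by ring
    omega
  have h1' : ((((Finset.range (2 ^ b)).filter fun z => z % q ∉ S (extendCoins w)).card : ℕ) : ℝ) +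
      (S (extendCoins w)).card * ((2 ^ b / q : ℕ) : ℝ) ≤ 2 ^ b := by exact_mod_cast h1
  have h3' : (2 : ℝ) ^ b ≤ 2 * q * ((2 ^ b / q : ℕ) : ℝ) := by exact_mod_cast h3
  have hq' : (0 : ℝ) < q := by exact_mod_cast hq
  have h4 : (h : ℝ) * (2 ^ b / (2 * q)) ≤ (S (extendCoins w)).card * ((2 ^ b / q : ℕ) : ℝ) := by
    refine mul_le_mul (by exact_mod_cast h2) ?_ (by positivity) (by positivity)
    rw [div_le_iff₀ (by positivity)]; linarith
  have h5 : (2 : ℝ) ^ b * (1 - h / (2 * q)) = 2 ^ b - h * (2 ^ b / (2 * q)) := by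
    field_simp
  rw [h5]; linarith

/-- Consecutive blocks of `b` coins are independent trials, each missing with probability at most `1
- h / (2 q) ≤ exp (-h / (2 q))`. The set `S` may be random, as long as the coins before position `u`
determine it. -/
theorem fairCoins_miss_le {u b q h m a : ℕ} {F : (ℕ → Bool) → Prop} {S : (ℕ → Bool) → Finset ℕ}
    (hF : DeterminedBy u F) (hS : DeterminedBy u S) (hq : 0 < q) (hqb : q ≤ 2 ^ b)
    (hsub : ∀ ρ, F ρ → S ρ ⊆ Finset.range q) (hcard : ∀ ρ, F ρ → h ≤ (S ρ).card)
    (ha : a * q ≤ m * h) :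
    fairCoins {ρ | F ρ ∧ ∀ j < m, coinVal (fun i => ρ (u + j * b + i)) b % q ∉ S ρ} ≤
      ENNReal.ofReal (Real.exp (-(a / 2))) := by
  by_cases hne : ∃ ρ, F ρ
  swap
  · push Not at hne
    simp [hne]
  obtain ⟨ρ₀, hρ₀⟩ := hne
  have hhq : h ≤ q := (hcard _ hρ₀).trans ((Finset.card_le_card (hsub _ hρ₀)).trans (by simp))
  have hq' : (0 : ℝ) < q := by exact_mod_cast hq
  -- Nonnegativity is needed to raise `1 - h / (2 q) ≤ exp (-h / (2 q))` to the power `m`.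
  have hθ : (0 : ℝ) ≤ 1 - h / (2 * q) := by
    rw [sub_nonneg, div_le_one (by positivity)]
    have : (h : ℝ) ≤ q := by exact_mod_cast hhq
    linarith
  let E : ℕ → (ℕ → Bool) → Prop := fun m ρ =>
    F ρ ∧ ∀ j < m, coinVal (fun i => ρ (u + j * b + i)) b % q ∉ S ρ
  have hE : ∀ m, DeterminedBy (u + m * b) (E m) := by
    intro m ρ ρ' hρ
    simp only [E]
    rw [hF ρ ρ' fun i hi => hρ i (by omega), hS ρ ρ' fun i hi => hρ i (by omega)]
    refine propext (and_congr_right fun _ => forall₂_congr fun j hj => ?_)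
    rw [coinVal_congr fun i hi => hρ (u + j * b + i) ?_]
    have : (j + 1) * b ≤ m * b := Nat.mul_le_mul_right _ hj
    rw [Nat.succ_mul] at this
    omega
  have hcount : ∀ m, (countCoins (u + m * b) (E m) : ℝ) ≤ 2 ^ u * (2 ^ b * (1 - h / (2 * q))) ^ m := by
    intro m
    induction m with
    | zero =>
      have : countCoins (u + 0 * b) (E 0) ≤ 2 ^ (u + 0 * b) := by
        refine (Finset.card_le_univ _).trans ?_
        simp
      rw [pow_zero, mul_one]
      simpa using (Nat.cast_le (α := ℝ)).2 this
    | succ m ih =>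
      have := countCoins_step (hE m) (fun ρ ρ' hρ => hS ρ ρ' fun i hi => hρ i (by omega)) hq hqb
        (fun ρ hρ => hsub ρ hρ.1) (fun ρ hρ => hcard ρ hρ.1) (u := u + m * b)
      have he : (fun ρ => E m ρ ∧ coinVal (fun i => ρ (u + m * b + i)) b % q ∉ S ρ) = E (m + 1) := by
        funext ρ
        refine propext ⟨fun h => ⟨h.1.1, fun j hj => ?_⟩,
          fun h => ⟨⟨h.1, fun j hj => h.2 j (by omega)⟩, h.2 m (by omega)⟩⟩
        rcases Nat.lt_succ_iff_lt_or_eq.1 hj with hj | rfl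
        exacts [h.1.2 j hj, h.2]
      rw [he, Nat.add_assoc, ← Nat.succ_mul] at this
      refine this.trans ((mul_le_mul_of_nonneg_right ih (by positivity)).trans (le_of_eq ?_))
      rw [pow_succ, mul_assoc]
  refine (fairCoins_le (hE m)).trans (ENNReal.ofReal_le_ofReal ?_)
  rw [div_le_iff₀ (by positivity)]
  refine (hcount m).trans ?_
  have h1 : (1 : ℝ) - h / (2 * q) ≤ Real.exp (-(h / (2 * q))) := by
    have := Real.add_one_le_exp (-((h : ℝ) / (2 * q)))
    linarith
  have h2 : ((1 : ℝ) - h / (2 * q)) ^ m ≤ Real.exp (-(a / 2)) := by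
    refine (pow_le_pow_left₀ hθ h1 m).trans ?_
    rw [← Real.exp_nat_mul, Real.exp_le_exp]
    have : (a : ℝ) * q ≤ m * h := by exact_mod_cast ha
    rw [mul_neg, neg_le_neg_iff, ← mul_div_assoc, div_le_div_iff₀ (by norm_num) (by positivity)]
    linarith
  rw [mul_pow, pow_add, pow_mul', ← mul_assoc]
  calc _ ≤ (2 : ℝ) ^ u * (2 ^ b) ^ m * Real.exp (-(a / 2)) :=
        mul_le_mul_of_nonneg_left h2 (by positivity)
    _ = _ := by ring

end Probability

end Shortcut
namespace Shortcut

/-! ### Cells that are marked and never cleared. -/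

section Marks

/-- Only nonzero constants are stored into array `a`. -/
def Prog.marks (a : ℕ) : Prog → Bool
  | .store b _ e => b != a || (match e with | .const c => c != 0 | _ => false)
  | .seq p q => p.marks a && q.marks a
  | .ite _ p q => p.marks a && q.marks a
  | .rep _ _ p => p.marks a
  | _ => true

theorem Prog.run_ne_zero {a i : ℕ} (p : Prog) (h : p.marks a = true) (s : State)
    (hs : s.arr a i ≠ 0) : (p.run s).arr a i ≠ 0 := by
  induction p generalizing s with
  | skip | set | clamp | flip => exact hs
  | store b j e =>
    simp only [marks, Bool.or_eq_true, bne_iff_ne] at h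
    simp only [run, State.store_arr]
    split_ifs with hc
    · rcases h with h | h
      · exact absurd hc.1.symm h
      · cases e <;> simp_all [Expr.eval]
    · exact hs
  | seq p q ihp ihq =>
    simp only [marks, Bool.and_eq_true] at h
    exact ihq h.2 _ (ihp h.1 s hs)
  | ite e p q ihp ihq =>
    simp only [marks, Bool.and_eq_true] at h
    simp only [run]
    split_ifs
    exacts [ihp h.1 s hs, ihq h.2 s hs]
  | rep x y p ih =>
    exact iterate_invariant _ (fun s' : State => s'.arr a i ≠ 0) (fun s' hs' => by simpa using ih h s' hs') (by simpa using hs) _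

/-- Since marks are never erased, it is enough to look at the single round that sets the mark, and
no invariant about the other rounds is required. -/
theorem Prog.rep_marked {x y a c k : ℕ} {p : Prog} {s : State} (hf : Prog.fresh x y p = true)
    (hm : p.marks a = true) (hk : k < s.vars y)
    (h : ∀ s', Frame (.rep x y p) s s' → s'.vars x = k → (p.run s').arr a c ≠ 0) :
    ((Prog.rep x y p).run s).arr a c ≠ 0 := by
  refine Prog.rep_induct hf (fun m s' => k < m → s'.arr a c ≠ 0) (fun h => absurd h (by omega))
    (fun j s' _ hx hfr hI hkj => ?_) hk
  rcases Nat.lt_succ_iff_lt_or_eq.1 hkj with hkj | rfl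
  · exact p.run_ne_zero hm s' (hI hkj)
  · exact h s' hfr hx

end Marks

/-! ### Which coin flips a program depends on. -/

section Coins

/-- Is the program deterministic? -/
def Prog.flipFree : Prog → Bool
  | .flip _ => false
  | .seq p q => p.flipFree && q.flipFree
  | .ite _ p q => p.flipFree && q.flipFree
  | .rep _ _ p => p.flipFree
  | _ => true

/-- The states agree up to coins, and on the first `m` coins. -/
def Agree (m : ℕ) (s s' : State) : Prop :=
  s.vars = s'.vars ∧ s.arr = s'.arr ∧ ∀ i < m, s.coins i = s'.coins i

theorem Expr.eval_congr {s s' : State} (hv : s.vars = s'.vars) (ha : s.arr = s'.arr) (e : Expr) :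
    e.eval s = e.eval s' := by
  induction e <;> simp_all [eval]

theorem Agree.set {m : ℕ} {s s' : State} (h : Agree m s s') (x v : ℕ) :
    Agree m (s.set x v) (s'.set x v) :=
  ⟨by simp [State.set, h.1], h.2.1, h.2.2⟩

theorem Agree.store {m : ℕ} {s s' : State} (h : Agree m s s') (a : ℕ) (i e : Expr) :
    Agree m (s.store a i e) (s'.store a i e) :=
  ⟨h.1, by simp [State.store, h.2.1, Expr.eval_congr h.1 h.2.1], h.2.2⟩

theorem Prog.agree_run {m : ℕ} {p : Prog} (hp : p.flipFree = true) {s s' : State}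
    (h : Agree m s s') : Agree m (p.run s) (p.run s') := by
  induction p generalizing s s' with
  | skip => exact h
  | set x e => simp only [run, Expr.eval_congr h.1 h.2.1 e]; exact h.set _ _
  | clamp x e f =>
    simp only [run, Expr.eval_congr h.1 h.2.1 e, Expr.eval_congr h.1 h.2.1 f]; exact h.set _ _
  | store a i e => exact h.store a i e
  | flip => simp [flipFree] at hp
  | seq p q ihp ihq =>
    simp only [flipFree, Bool.and_eq_true] at hp
    exact ihq hp.2 (ihp hp.1 h)
  | ite e p q ihp ihq =>
    simp only [flipFree, Bool.and_eq_true] at hp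
    simp only [run, Expr.eval_congr h.1 h.2.1 e]
    split_ifs
    exacts [ihp hp.1 h, ihq hp.2 h]
  | rep x y p ih =>
    simp only [run, h.1]
    generalize s'.vars y = k
    replace h : Agree m (s.set x 0) (s'.set x 0) := h.set x 0
    generalize s.set x 0 = σ at h
    generalize s'.set x 0 = σ' at h
    induction k generalizing σ σ' with
    | zero => exact h
    | succ k ihk =>
      have h1 := ih hp h
      refine ihk _ _ ?_
      simp only [h1.1]
      exact h1.set _ _

theorem Prog.run_coins {p : Prog} (hp : p.flipFree = true) (s : State) :
    (p.run s).coins = s.coins := by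
  induction p generalizing s with
  | skip | set | clamp | store => rfl
  | flip => simp [flipFree] at hp
  | seq p q ihp ihq =>
    simp only [flipFree, Bool.and_eq_true] at hp
    exact (ihq hp.2 _).trans (ihp hp.1 s)
  | ite e p q ihp ihq =>
    simp only [flipFree, Bool.and_eq_true] at hp
    simp only [run]
    split_ifs
    exacts [ihp hp.1 s, ihq hp.2 s]
  | rep x y p ih =>
    exact iterate_invariant _ (fun s' : State => s'.coins = s.coins)
      (fun s' hs' => by simpa [ih hp] using hs') (by simp) _

/-- Is the number of coin flips independent of the outcomes? -/
def Prog.steady : Prog → Bool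
  | .seq p q => p.steady && q.steady
  | .ite _ p q => p.flipFree && q.flipFree
  | .rep _ _ p => p.steady
  | _ => true

/-- The number of coin flips. -/
def Prog.flips (ν : ℕ → ℕ) : Prog → ℕ
  | .flip _ => 1
  | .seq p q => p.flips ν + q.flips ν
  | .rep _ y p => ν y * p.flips ν
  | _ => 0

/-- The resulting memory depends on the first `p.flips ν` coins only, and the coins after them are
passed on. Steady programs do not flip coins under a conditional, so this number is known
beforehand. -/
theorem Prog.agree_run_of_steady {ν : ℕ → ℕ} {p : Prog} (hp : p.steady = true)
    (hst : ∀ y ∈ p.bounds, p.writes y = false) {m : ℕ} {s s' : State}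
    (hν : ∀ y ∈ p.bounds, s.vars y = ν y) (h : Agree (p.flips ν + m) s s') :
    Agree m (p.run s) (p.run s') := by
  induction p generalizing s s' m with
  | skip | set | clamp | store => exact Prog.agree_run rfl (by simpa [flips] using h)
  | ite => exact Prog.agree_run (by simpa [steady, flipFree] using hp) (by simpa [flips] using h)
  | flip x =>
    refine ⟨?_, h.2.1, fun i hi => h.2.2 (i + 1) (by simp only [flips]; omega)⟩
    simp [run, State.flip, h.1, h.2.2 0 (by simp [flips])]
  | seq p q ihp ihq =>
    simp only [bounds, List.mem_append, writes, Bool.or_eq_false_iff, flips, steady,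
      Bool.and_eq_true] at *
    rw [Nat.add_assoc] at h
    exact ihq hp.2 (fun y hy => (hst y (.inr hy)).2)
      (fun y hy => by rw [p.run_vars (hst y (.inr hy)).1]; exact hν y (.inr hy))
      (ihp hp.1 (fun y hy => (hst y (.inl hy)).1) (fun y hy => hν y (.inl hy)) h)
  | rep x y p ih =>
    simp only [bounds, List.mem_cons, writes, Bool.or_eq_false_iff, flips, steady, run,
      beq_eq_false_iff_ne] at *
    rw [← h.1, hν y (.inl rfl)]
    replace hν : ∀ z ∈ p.bounds, (s.set x 0).vars z = ν z := fun z hz => by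
      rw [State.set_vars, if_neg (Ne.symm (hst z (.inr hz)).1), hν z (.inr hz)]
    replace h := h.set x 0
    generalize s.set x 0 = σ at h hν
    generalize s'.set x 0 = σ' at h
    generalize ν y = k at h
    induction k generalizing σ σ' with
    | zero => simpa using h
    | succ k ihk =>
      rw [Nat.succ_mul, Nat.add_comm (k * _), Nat.add_assoc] at h
      have h1 := ih hp (fun z hz => (hst z (.inr hz)).2) hν h
      refine ihk _ (fun z hz => ?_) _ ?_
      · rw [State.set_vars, if_neg (Ne.symm (hst z (.inr hz)).1), p.run_vars (hst z (.inr hz)).2,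
          hν z hz]
      · simp only [h1.1]; exact h1.set _ _

end Coins

end Shortcut
namespace Shortcut

/-! ### Programs that compute the parameters. -/

section Parameters

theorem size_eq_size_half {m : ℕ} (hm : m ≠ 0) : Nat.size m = Nat.size (m / 2) + 1 := by
  refine le_antisymm ?_ ?_
  · rw [Nat.size_le, pow_succ]
    have := Nat.lt_size_self (m / 2)
    omega
  · obtain ⟨k, hk⟩ : ∃ k, Nat.size m = k + 1 :=
      Nat.exists_eq_succ_of_ne_zero (by rwa [Ne, Nat.size_eq_zero])
    have h := Nat.lt_size_self m
    rw [hk, pow_succ] at h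
    rw [hk]
    have : Nat.size (m / 2) ≤ k := Nat.size_le.2 (by omega)
    omega

theorem size_le_self (m : ℕ) : Nat.size m ≤ m := Nat.size_le.2 Nat.lt_two_pow_self

/-- Set register `z` to the length of the number in register `t`. -/
def sizeProg (z t x y : ℕ) : Prog :=
  .seq (.set z (.const 0)) (.rep x y
    (.ite (.var t) (.seq (.set z (.add (.var z) (.const 1))) (.set t (.div (.var t) (.const 2)))) .skip))

/-- A nonzero number loses exactly one bit when halved, and it decreases by at least one, so as many
rounds as its value suffice. -/
theorem sizeProg_spec {z t x y : ℕ} (s : State) (hd : [z, t, x, y].Nodup)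
    (h : s.vars t ≤ s.vars y) : ((sizeProg z t x y).run s).vars z = Nat.size (s.vars t) := by
  simp only [List.nodup_cons, List.mem_cons, List.not_mem_nil, or_false, not_or, List.nodup_nil,
    not_false_iff, and_true] at hd
  obtain ⟨⟨hzt, hzx, hzy⟩, ⟨htx, hty⟩, hxy⟩ := hd
  have := Prog.rep_induct (x := x) (y := y) (s := s.set z 0)
    (p := .ite (.var t) (.seq (.set z (.add (.var z) (.const 1)))
      (.set t (.div (.var t) (.const 2)))) .skip)
    (by simp [Prog.fresh, Prog.writes, hxy, hzx, htx, hzy, hty])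
    (fun m s' => s'.vars z + Nat.size (s'.vars t) = Nat.size (s.vars t) ∧
      (s'.vars t = 0 ∨ s'.vars t + m ≤ s.vars t)) (by simp [hzx, htx, Ne.symm hzt]) ?_
  · simp only [State.set_vars, if_neg (Ne.symm hzy)] at this
    obtain ⟨h1, h2⟩ := this
    have h3 : ((Prog.rep x y (.ite (.var t) (.seq (.set z (.add (.var z) (.const 1)))
      (.set t (.div (.var t) (.const 2)))) .skip)).run (s.set z 0)).vars t = 0 := by omega
    rw [h3, Nat.size_zero, Nat.add_zero] at h1
    exact h1
  · intro k s' _ _ _ hI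
    by_cases h0 : s'.vars t = 0
    · simp [Prog.run, Expr.eval, h0, hzx, htx] at hI ⊢
      exact hI
    · have := size_eq_size_half h0
      simp [Prog.run, Expr.eval, h0, hzx, htx, hzt, Ne.symm hzt]
      omega

theorem Prog.rep_adds {x y z c : ℕ} {p : Prog} {s : State} (hf : Prog.fresh x y p = true)
    (hzx : z ≠ x)
    (h : ∀ s', Frame (.rep x y p) s s' → (p.run s').vars z = s'.vars z + c) :
    ((Prog.rep x y p).run s).vars z = s.vars z + s.vars y * c := by
  refine Prog.rep_induct hf (fun m s' => s'.vars z = s.vars z + m * c) (by simp [hzx])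
    fun k s' _ _ hfr hI => ?_
  rw [State.set_vars, if_neg hzx, h s' hfr, hI, Nat.succ_mul, Nat.add_assoc]

/-- Set register `17` to the least `m` with `n < m² D`. -/
def rootProg : Prog :=
  .seq (.set 17 (.const 1)) (.rep 23 0
    (.ite (.sub (.add (.var 0) (.const 1)) (.mul (.mul (.var 17) (.var 17)) (.var 1)))
      (.set 17 (.add (.var 17) (.const 1))) .skip))

/-- The number `m` is `√(n / D)` rounded down. At most `n` increments are needed because `n < (n +
1)² D`. -/
theorem rootProg_spec {n D : ℕ} (s : State) (h0 : s.vars 0 = n) (h1 : s.vars 1 = D) (hD : 1 ≤ D) :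
    ∃ m, (rootProg.run s).vars 17 = m + 1 ∧ m ≤ n ∧ n < (m + 1) * (m + 1) * D ∧ m * m * D ≤ n := by
  have := Prog.rep_induct (x := 23) (y := 0) (s := s.set 17 1)
    (p := .ite (.sub (.add (.var 0) (.const 1)) (.mul (.mul (.var 17) (.var 17)) (.var 1)))
      (.set 17 (.add (.var 17) (.const 1))) .skip) rfl
    (fun k s' => ∃ m, s'.vars 17 = m + 1 ∧ m ≤ k ∧ m * m * D ≤ n ∧
      (n < (m + 1) * (m + 1) * D ∨ m = k)) ⟨0, by simp⟩ ?_
  · simp only [State.set_vars, h0] at this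
    obtain ⟨m, e1, e2, e3, e4⟩ := this
    refine ⟨m, e1, by simpa using e2, ?_, e3⟩
    rcases e4 with e4 | e4
    · exact e4
    · have hm : m = n := by simpa using e4
      subst hm
      calc m < (m + 1) * 1 * 1 := by omega
        _ ≤ _ := Nat.mul_le_mul (Nat.mul_le_mul_left _ (by omega)) hD
  · rintro k s' _ hx hfr ⟨m, e1, e2, e3, e4⟩
    have f0 : s'.vars 0 = n := (hfr.1 0 rfl).trans (by simp [h0])
    have f1 : s'.vars 1 = D := (hfr.1 1 rfl).trans (by simp [h1])
    by_cases hc : (m + 1) * (m + 1) * D ≤ n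
    · have : n + 1 - (m + 1) * (m + 1) * D ≠ 0 := by omega
      refine ⟨m + 1, ?_, by omega, hc, .inr (by omega)⟩
      simp only [Prog.run, Expr.eval, f0, f1, e1, if_pos this]
      simp
    · have : ¬ n + 1 - (m + 1) * (m + 1) * D ≠ 0 := by omega
      refine ⟨m, ?_, by omega, e3, .inl (by omega)⟩
      simp only [Prog.run, Expr.eval, f0, f1, e1, if_neg this]
      simp [e1]

/-- Set register `19` to a bound for the parameters. -/
def capProg (A : ℕ) : Prog :=
  .seq (.set 19 (.const 0)) (.rep 23 0 (.rep 26 7 (.rep 27 7 (.rep 28 7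
    (.set 19 (.add (.var 19) (.const (16 * A * A))))))))

/-- A product may not be assigned directly, so the bound is accumulated by additions in nested
loops, in about `n log³ n` rounds. It then licenses the products in later `clamp`s. -/
theorem capProg_spec (A : ℕ) (s : State) :
    ((capProg A).run s).vars 19 = s.vars 0 * (s.vars 7 * (s.vars 7 * (s.vars 7 * (16 * A * A)))) := by
  have h := Prog.rep_adds (x := 23) (y := 0) (z := 19) (s := s.set 19 0)
    (c := s.vars 7 * (s.vars 7 * (s.vars 7 * (16 * A * A))))
    (p := .rep 26 7 (.rep 27 7 (.rep 28 7 (.set 19 (.add (.var 19) (.const (16 * A * A)))))))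
    rfl (by simp) fun s₁ h₁ => ?_
  · simp only [State.set_vars, if_true, Nat.zero_add, OfNat.zero_ne_ofNat, if_false] at h
    exact h
  have e₁ : s₁.vars 7 = s.vars 7 := by rw [h₁.1 7 rfl]; simp
  rw [← e₁]
  refine Prog.rep_adds rfl (by simp) fun s₂ h₂ => ?_
  rw [← h₂.1 7 rfl]
  refine Prog.rep_adds rfl (by simp) fun s₃ h₃ => ?_
  rw [← h₃.1 7 rfl]
  exact Prog.rep_adds rfl (by simp) fun s₄ h₄ => by simp [Prog.run, Expr.eval]

/-- Compute the parameters. -/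
def paramProg (A : ℕ) : Prog :=
  .seq rootProg <| .seq (capProg A) <|
  .seq (.clamp 18 (.add (.var 17) (.mul (.const 4) (.var 7))) (.var 19)) <|
  .seq (.clamp 6 (.add (.div (.var 1) (.mul (.const 8) (.var 18)))
    (.sub (.const 1) (.div (.var 1) (.mul (.const 8) (.var 18))))) (.var 19)) <|
  .seq (.set 5 (.div (.var 1) (.mul (.const 8) (.var 6)))) <|
  .seq (.set 3 (.div (.var 5) (.const 4))) <|
  .seq (.clamp 2 (.mul (.mul (.const A) (.var 7)) (.add (.div (.var 0) (.var 6)) (.const 1))) (.var 19)) <|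
  .seq (.set 4 (.add (.div (.var 2) (.var 3)) (.const 1))) <|
  .seq (.clamp 8 (.mul (.mul (.const A) (.var 7)) (.add (.div (.var 2) (.var 5)) (.const 1))) (.var 19)) <|
  .seq (.clamp 9 (.mul (.mul (.const (2 * A)) (.mul (.var 7) (.add (.var 7) (.const 1))))
    (.add (.div (.var 4) (.var 5)) (.const 1))) (.var 19)) <|
  .seq (.clamp 11 (.mul (.const 2) (.add (.var 0) (.var 2))) (.var 19))
    (.clamp 12 (.add (.var 0) (.var 2)) (.var 19))

/-- The parameters: sampling distance `L`, geodesic length `M`, chain length `K`, number of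
positions `N`, capacity `q`, and the numbers `m₂`, `m₃` of sampled positions and chains. -/
structure IsParams (A n D : ℕ) (L M K N q m₂ m₃ : ℕ) : Prop where
  root : ∃ m, m ≤ n ∧ n < (m + 1) * (m + 1) * D ∧ m * m * D ≤ n ∧
    L = max 1 (D / (8 * (m + 1 + 4 * Nat.size n)))
  M_eq : M = D / (8 * L)
  K_eq : K = M / 4
  N_eq : N = A * Nat.size n * (n / L + 1)
  q_eq : q = N / K + 1
  m₂_eq : m₂ = A * Nat.size n * (N / M + 1)
  m₃_eq : m₃ = 2 * A * (Nat.size n * (Nat.size n + 1)) * (q / M + 1)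

/-- All parameters are at most `16 A² n (log n)³`, the value of register `19`, so none of the
`clamp`s changes a value. -/
theorem paramProg_spec {A n D : ℕ} (s : State) (hA : 1 ≤ A) (hD : 1 ≤ D) (hDn : D ≤ n)
    (h0 : s.vars 0 = n) (h1 : s.vars 1 = D) (h7 : s.vars 7 = Nat.size n) :
    let s' := (paramProg A).run s
    IsParams A n D (s'.vars 6) (s'.vars 5) (s'.vars 3) (s'.vars 2) (s'.vars 4) (s'.vars 8) (s'.vars 9) ∧
      s'.vars 11 = 2 * (n + s'.vars 2) ∧ s'.vars 12 = n + s'.vars 2 ∧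
      s'.vars 19 = n * (Nat.size n * (Nat.size n * (Nat.size n * (16 * A * A)))) := by
  intro s'
  have hn : 1 ≤ n := hD.trans hDn
  set l := Nat.size n with hl
  have hl1 : 1 ≤ l := Nat.size_pos.2 hn
  obtain ⟨m, e17, hm1, hm2, hm3⟩ := rootProg_spec s h0 h1 hD
  set s₁ := rootProg.run s with hs₁
  have f0 : s₁.vars 0 = n := (rootProg.run_vars rfl s).trans h0
  have f1 : s₁.vars 1 = D := (rootProg.run_vars rfl s).trans h1
  have f7 : s₁.vars 7 = l := (rootProg.run_vars rfl s).trans h7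
  have e19 := capProg_spec A s₁
  set s₂ := (capProg A).run s₁ with hs₂
  have g0 : s₂.vars 0 = n := ((capProg A).run_vars rfl s₁).trans f0
  have g1 : s₂.vars 1 = D := ((capProg A).run_vars rfl s₁).trans f1
  have g7 : s₂.vars 7 = l := ((capProg A).run_vars rfl s₁).trans f7
  have g17 : s₂.vars 17 = m + 1 := ((capProg A).run_vars rfl s₁).trans e17
  rw [f0, f7] at e19
  set B := n * (l * (l * (l * (16 * A * A)))) with hB
  have hBA : ∀ x, x ≤ 16 * (A * A * (l * l * l * n)) → x ≤ B := fun x hx =>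
    hx.trans (le_of_eq (by rw [hB]; ring))
  have p1 : 1 ≤ A * A := Nat.mul_le_mul hA hA
  have p2 : n ≤ l * l * l * n := Nat.le_mul_of_pos_left _ (by positivity)
  have p3 : l * n ≤ l * l * l * n := Nat.mul_le_mul_right _ (Nat.le_mul_of_pos_left _ (by positivity))
  have p4 : l * l * n ≤ l * l * l * n :=
    Nat.mul_le_mul_right _ (Nat.le_mul_of_pos_right _ (by positivity))
  have p5 : l * l * l * n ≤ A * A * (l * l * l * n) := Nat.le_mul_of_pos_left _ p1
  have p6 : A * (l * n) ≤ A * A * (l * l * l * n) :=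
    Nat.mul_le_mul (Nat.le_mul_of_pos_left _ hA) p3
  have p7 : A * (l * l * n) ≤ A * A * (l * l * l * n) :=
    Nat.mul_le_mul (Nat.le_mul_of_pos_left _ hA) p4
  have p7' : A * (l * l * l * n) ≤ A * A * (l * l * l * n) :=
    Nat.mul_le_mul_right _ (Nat.le_mul_of_pos_left _ hA)
  have p8 : A * A * (l * l * n) ≤ A * A * (l * l * l * n) := Nat.mul_le_mul_left _ p4
  have p9 : l ≤ n := size_le_self n
  set M0 := m + 1 + 4 * l with hM0
  set L := max 1 (D / (8 * M0)) with hL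
  set M := D / (8 * L) with hM
  set K := M / 4 with hK
  set N := A * l * (n / L + 1) with hN
  set q := N / K + 1 with hq
  set m₂ := A * l * (N / M + 1) with hm₂
  set m₃ := 2 * A * (l * (l + 1)) * (q / M + 1) with hm₃
  have bM0 : M0 ≤ B := hBA _ (by omega)
  have bL : L ≤ B := by
    have : D / (8 * M0) ≤ D := Nat.div_le_self _ _
    exact hBA _ (by omega)
  have hN' : N ≤ 2 * (A * (l * n)) := by
    calc N ≤ A * l * (n + n) := Nat.mul_le_mul_left _ (by have := Nat.div_le_self n L; omega)
      _ = _ := by ring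
  have bN : n + N ≤ 3 * (A * (l * n)) := by
    have : n ≤ A * (l * n) := by
      calc n = 1 * (1 * n) := by ring
        _ ≤ _ := Nat.mul_le_mul hA (Nat.mul_le_mul_right _ hl1)
    omega
  have bm₂ : m₂ ≤ B := hBA _ <| by
    calc m₂ ≤ A * l * (3 * (A * (l * n))) := Nat.mul_le_mul_left _ (by
          have := Nat.div_le_self N M; omega)
      _ = 3 * (A * A * (l * l * n)) := by ring
      _ ≤ _ := by omega
  have bm₃ : m₃ ≤ B := hBA _ <| by
    have e1 : q / M + 1 ≤ 4 * (A * (l * n)) := by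
      have h1 := Nat.div_le_self q M
      have h2 := Nat.div_le_self N K
      have : 1 ≤ A * (l * n) := Nat.mul_pos hA (Nat.mul_pos hl1 hn)
      omega
    calc m₃ ≤ 2 * A * (l * (l + l)) * (4 * (A * (l * n))) :=
          Nat.mul_le_mul (Nat.mul_le_mul_left _ (Nat.mul_le_mul_left _ (by omega))) e1
      _ = 16 * (A * A * (l * l * l * n)) := by ring
  have r18 : min (m + 1 + 4 * l) B = M0 := min_eq_left bM0
  -- Under truncated subtraction `x + (1 - x)` is `max 1 x`.
  have r6 : min (D / (8 * M0) + (1 - D / (8 * M0))) B = L := by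
    rw [show D / (8 * M0) + (1 - D / (8 * M0)) = L by rw [hL]; omega]; exact min_eq_left bL
  have r2 : min (A * l * (n / L + 1)) B = N := min_eq_left (hBA _ (by omega))
  have r8 : min (A * l * (N / M + 1)) B = m₂ := min_eq_left bm₂
  have r9 : min (2 * A * (l * (l + 1)) * (q / M + 1)) B = m₃ := min_eq_left bm₃
  have r11 : min (2 * (n + N)) B = 2 * (n + N) := min_eq_left (hBA _ (by omega))
  have r12 : min (n + N) B = n + N := min_eq_left (hBA _ (by omega))
  have main : s'.vars 6 = L ∧ s'.vars 5 = M ∧ s'.vars 3 = K ∧ s'.vars 2 = N ∧ s'.vars 4 = q ∧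
      s'.vars 8 = m₂ ∧ s'.vars 9 = m₃ ∧ s'.vars 11 = 2 * (n + N) ∧ s'.vars 12 = n + N ∧
      s'.vars 19 = B := by
    simp [s', paramProg, Prog.run, ← hs₁, ← hs₂, Expr.eval, g0, g1, g7, g17, e19, r18, r6, ← hM,
      ← hK, r2, ← hq, r8, r9, r11, r12]
  obtain ⟨a1, a2, a3, a4, a5, a6, a7, a8, a9, a10⟩ := main
  rw [a1, a2, a3, a4, a5, a6, a7, a8, a9, a10]
  exact ⟨⟨⟨m, hm1, hm2, hm3, rfl⟩, rfl, rfl, rfl, rfl, rfl, rfl⟩, rfl, rfl, rfl⟩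

end Parameters

end Shortcut
namespace Shortcut

/-! ### Drawing random residues. -/

section Sampling

/-- Fill array `a` with random numbers, one for each number below the value of register `y`, reduced
modulo the value of register `md`. -/
def sampleProg (y md a : ℕ) : Prog :=
  .rep 23 y (.seq (.set 28 (.const 0)) (.seq
    (.rep 26 10 (.seq (.flip 27) (.clamp 28 (.add (.mul (.const 2) (.var 28)) (.var 27)) (.var 11))))
    (.store a (.var 23) (.sub (.var 28) (.mul (.var md) (.div (.var 28) (.var md)))))))

/-- The binary digits are accumulated by doubling. Partial values stay below `2 ^ b ≤ s.vars 11`, so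
the `clamp` has no effect; it is there to bound the growth of the numbers. -/
theorem sampleProg_spec {y md a b : ℕ} (s : State) (hy : y < 23) (hmd : md < 23)
    (hb : s.vars 10 = b) (hP : 2 ^ b ≤ s.vars 11) :
    (∀ j < s.vars y, ((sampleProg y md a).run s).arr a j =
      coinVal (fun i => s.coins (j * b + i)) b % s.vars md) ∧
      ((sampleProg y md a).run s).coins = fun i => s.coins (s.vars y * b + i) := by
  have hfr : Prog.fresh 23 y (.seq (.set 28 (.const 0)) (.seq
    (.rep 26 10 (.seq (.flip 27) (.clamp 28 (.add (.mul (.const 2) (.var 28)) (.var 27)) (.var 11))))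
    (.store a (.var 23) (.sub (.var 28) (.mul (.var md) (.div (.var 28) (.var md))))))) = true := by
    simp only [Prog.fresh, Prog.writes, Bool.and_eq_true, bne_iff_ne, Bool.not_eq_true',
      Bool.or_eq_false_iff, beq_eq_false_iff_ne, and_true]
    omega
  have hw : ∀ z < 23, Prog.writes z (sampleProg y md a) = false := fun z hz => by
    simp only [sampleProg, Prog.writes, Bool.or_eq_false_iff, beq_eq_false_iff_ne, and_true]
    omega
  refine Prog.rep_induct hfr (fun m s' => (∀ j < m, s'.arr a j =
    coinVal (fun i => s.coins (j * b + i)) b % s.vars md) ∧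
      s'.coins = fun i => s.coins (m * b + i)) (by simp) fun k s' _ hx hf hI => ?_
  obtain ⟨hI1, hI2⟩ := hI
  have f10 : s'.vars 10 = b := (hf.1 10 (hw 10 (by simp))).trans hb
  have f11 : s'.vars 11 = s.vars 11 := hf.1 11 (hw 11 (by simp))
  have fmd : s'.vars md = s.vars md := hf.1 md (hw md hmd)
  have inner := Prog.rep_induct (x := 26) (y := 10) (s := s'.set 28 0)
    (p := .seq (.flip 27) (.clamp 28 (.add (.mul (.const 2) (.var 28)) (.var 27)) (.var 11))) rfl
    (fun m s'' => s''.vars 28 = coinVal (fun i => s.coins (k * b + i)) m ∧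
      s''.coins = fun i => s.coins (k * b + m + i)) (by simp [coinVal, hI2]) ?_
  · set σ := (Prog.rep 26 10 (.seq (.flip 27)
      (.clamp 28 (.add (.mul (.const 2) (.var 28)) (.var 27)) (.var 11)))).run (s'.set 28 0) with hσ
    have g23 : σ.vars 23 = k := by rw [hσ, Prog.run_vars _ rfl]; simpa using hx
    have gmd : σ.vars md = s.vars md := by
      rw [hσ, Prog.run_vars, State.set_vars, if_neg (by omega), fmd]
      simp only [Prog.writes, Bool.or_eq_false_iff, beq_eq_false_iff_ne]
      omega
    have ga : σ.arr a = s'.arr a := by rw [hσ, Prog.run_arr _ rfl]; rfl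
    simp only [State.set_vars, Nat.reduceEqDiff, if_false, f10] at inner
    have hval : (Expr.sub (.var 28) (.mul (.var md) (.div (.var 28) (.var md)))).eval σ =
        coinVal (fun i => s.coins (k * b + i)) b % s.vars md := by
      simp only [Expr.eval, inner.1, gmd]
      have := Nat.div_add_mod (coinVal (fun i => s.coins (k * b + i)) b) (s.vars md)
      omega
    have hrun : ∀ e, (Prog.seq (.set 28 (.const 0)) (.seq
      (.rep 26 10 (.seq (.flip 27)
        (.clamp 28 (.add (.mul (.const 2) (.var 28)) (.var 27)) (.var 11))))
      (.store a (.var 23) e))).run s' = σ.store a (.var 23) e := fun e => rfl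
    rw [hrun]
    refine ⟨fun j hj => ?_, ?_⟩
    · simp only [State.set_arr, State.store_arr, true_and]
      rw [show (Expr.var 23).eval σ = k from g23, hval, ga]
      split_ifs with hjk
      · rw [hjk]
      · exact hI1 j (by omega)
    · simp only [State.set_coins, State.store_coins, inner.2, Nat.succ_mul]
  · intro t s'' ht hx' hf' hJ
    simp only [State.set_vars, Nat.reduceEqDiff, if_false, f10] at ht
    have h11 : s''.vars 11 = s.vars 11 := by rw [hf'.1 11 rfl]; simpa using f11
    have hlt := coinVal_lt (fun i => s.coins (k * b + i)) (t + 1)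
    have hle : 2 ^ (t + 1) ≤ 2 ^ b := Nat.pow_le_pow_right (by simp) ht
    rw [coinVal] at hlt
    simp only [Prog.run, State.set_vars, State.set_coins, State.flip_vars, State.flip_coins, Expr.eval,
      hJ.1, hJ.2, h11]
    simp
    refine ⟨?_, ?_⟩
    · rw [coinVal, min_eq_left (by omega)]
    · funext i; congr 1; omega

end Sampling

/-! ### Filling the order matrix, marking hops and jumps, and masking. -/

section Edges

/-- The cell of the matrix entry for the vertices at two positions. -/
def pairCell (e f : Expr) : Expr := .add (.mul (.get 4 e) (.var 0)) (.get 4 f)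

/-- Fill the matrix of the strict order on positions. -/
def posLtProg : Prog :=
  .rep 23 2 (.rep 26 2 (.store 5 (.add (.mul (.var 23) (.var 2)) (.var 26))
    (.sub (.const 1) (.sub (.const 1) (.mul (.get 2 (pairCell (.var 23) (.var 26)))
      (.add (.sub (.const 1) (.get 2 (pairCell (.var 26) (.var 23)))) (.sub (.var 26) (.var 23))))))))

open scoped Classical in
/-- Array `2` holds the reachability matrix of `G`. -/
def IsReach {n : ℕ} (G : Digraph (Fin n)) (s : State) : Prop :=
  ∀ i j : Fin n, s.arr 2 (i * n + j) = if Reach G i j then 1 else 0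

/-- The first `N` cells of array `4` hold the vertices of `X`. -/
def IsSample {n : ℕ} (X : ℕ → Fin n) (N : ℕ) (s : State) : Prop := ∀ i < N, s.arr 4 i = X i

variable {n N : ℕ} {G : Digraph (Fin n)} {X : ℕ → Fin n}

theorem get_pairCell {s : State} (hG : IsReach G s) (hX : IsSample X N s) (h0 : s.vars 0 = n)
    {e f : Expr} {i j : ℕ} (he : e.eval s = i) (hf : f.eval s = j) (hi : i < N) (hj : j < N) :
    (pairCell e f).eval s = X i * n + X j ∧
      ((Expr.get 2 (pairCell e f)).eval s ≠ 0 ↔ Reach G (X i) (X j)) ∧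
      (Expr.get 2 (pairCell e f)).eval s ≤ 1 := by
  classical
  have h1 : (pairCell e f).eval s = X i * n + X j := by
    simp only [pairCell, Expr.eval, h0, he, hf, hX _ hi, hX _ hj]
  have h2 : (Expr.get 2 (pairCell e f)).eval s = if Reach G (X i) (X j) then 1 else 0 := by
    rw [Expr.eval, h1, hG]
  refine ⟨h1, ?_⟩
  rw [h2]
  split_ifs with h <;> simp [h]

theorem IsReach.congr {s s' : State} (h : IsReach G s) (ha : s'.arr 2 = s.arr 2) : IsReach G s' := by
  intro i j
  rw [ha]
  exact h i j

theorem IsSample.congr {s s' : State} (h : IsSample X N s) (ha : s'.arr 4 = s.arr 4) :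
    IsSample X N s' := by
  intro i hi
  rw [ha]
  exact h i hi

theorem posLtProg_spec (s : State) (h0 : s.vars 0 = n) (h2 : s.vars 2 = N) (hG : IsReach G s)
    (hX : IsSample X N s) :
    ∀ i < N, ∀ j < N, (posLtProg.run s).arr 5 (i * N + j) ≠ 0 ↔ PosLt G X i j := by
  classical
  have := Prog.fill_matrix_spec (x := 23) (x' := 26) (y := 2) (y' := 2) (a := 5)
    (i := .add (.mul (.var 23) (.var 2)) (.var 26))
    (e := .sub (.const 1) (.sub (.const 1) (.mul (.get 2 (pairCell (.var 23) (.var 26)))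
      (.add (.sub (.const 1) (.get 2 (pairCell (.var 26) (.var 23)))) (.sub (.var 26) (.var 23))))))
    s (fun i j => if PosLt G X i j then 1 else 0) (by simp) ?_
  · rw [h2] at this
    intro i hi j hj
    rw [posLtProg, this i hi j hj]
    simp
  intro i hi j hj s' hv h23 h26 ha _
  rw [h2] at hi hj ⊢
  have e0 : s'.vars 0 = n := (hv 0 (by simp) (by simp)).trans h0
  have e2 : s'.vars 2 = N := (hv 2 (by simp) (by simp)).trans h2
  have hG' : IsReach G s' := hG.congr (ha 2 (by simp))
  have hX' : IsSample X N s' := hX.congr (ha 4 (by simp))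
  obtain ⟨-, a1, a2⟩ := get_pairCell (e := .var 23) (f := .var 26) hG' hX' e0 h23 h26 hi hj
  obtain ⟨-, b1, b2⟩ := get_pairCell (e := .var 26) (f := .var 23) hG' hX' e0 h26 h23 hj hi
  refine ⟨by simp [Expr.eval, h23, h26, e2], ?_⟩
  set x := (Expr.get 2 (pairCell (.var 23) (.var 26))).eval s'
  set y := (Expr.get 2 (pairCell (.var 26) (.var 23))).eval s'
  -- Boolean algebra by truncated subtraction: `1 - (1 - t)` is the indicator of `t ≠ 0`, and `1 - y
  -- + (j - i)` is nonzero when `j` does not reach `i` or `i < j`.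
  have hev : (Expr.sub (.const 1) (.sub (.const 1) (.mul (.get 2 (pairCell (.var 23) (.var 26)))
      (.add (.sub (.const 1) (.get 2 (pairCell (.var 26) (.var 23))))
        (.sub (.var 26) (.var 23)))))).eval s' = 1 - (1 - x * (1 - y + (j - i))) := by
    rw [← h23, ← h26]; rfl
  rw [hev]
  by_cases hx : x = 0
  · rw [if_neg fun h => a1.2 h.1 hx, hx]; simp
  · rw [show x = 1 by omega, Nat.one_mul]
    by_cases hy : y = 0
    · rw [if_pos ⟨a1.1 hx, .inl fun h => b1.2 h hy⟩, hy]; omega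
    · by_cases hij : i < j
      · rw [if_pos ⟨a1.1 hx, .inr hij⟩]; omega
      · rw [if_neg fun h => h.2.elim (fun h => h (b1.1 hy)) hij]; omega

/-- Position `j` on chain `t`. -/
def chainAt (t j : Expr) : Expr := .get 9 (.add (.mul t (.var 3)) j)

/-- Mark the pairs of chain elements at index `i` and at an index that is larger by a power of
two. -/
def hopInner : Prog :=
  .rep 28 7 (.seq (.ite (.sub (.var 3) (.add (.var 26) (.var 27)))
    (.seq (.store 1 (pairCell (chainAt (.var 23) (.var 26))
        (chainAt (.var 23) (.add (.var 26) (.var 27)))) (.const 1))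
      (.store 1 (pairCell (chainAt (.var 23) (.add (.var 26) (.var 27)))
        (chainAt (.var 23) (.var 26))) (.const 1))) .skip)
    (.clamp 27 (.add (.var 27) (.var 27)) (.var 3)))

/-- Mark the pairs of chain elements whose indices differ by a power of two. -/
def hopProg : Prog := .rep 23 22 (.rep 26 3 (.seq (.set 27 (.const 1)) hopInner))

/-- Register `27` runs through `min (2 ^ m) K`. The truncation keeps the numbers small and loses no
pair, as `i + 2 ^ e < K` forces `2 ^ e < K`. -/
theorem hopInner_spec {K : ℕ} {ch : ℕ → ℕ} (s : State) (h0 : s.vars 0 = n) (h3 : s.vars 3 = K)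
    (hX : IsSample X N s) (h9 : s.arr 9 = ch) {t i e : ℕ} (h23 : s.vars 23 = t) (h26 : s.vars 26 = i)
    (h27 : s.vars 27 = min 1 K) (hch : ∀ j < K, ch (t * K + j) < N) (he : e < s.vars 7)
    (hie : i + 2 ^ e < K) :
    (hopInner.run s).arr 1 (X (ch (t * K + i)) * n + X (ch (t * K + (i + 2 ^ e)))) ≠ 0 ∧
      (hopInner.run s).arr 1 (X (ch (t * K + (i + 2 ^ e))) * n + X (ch (t * K + i))) ≠ 0 := by
  have := Prog.rep_induct (x := 28) (y := 7) (s := s)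
    (p := .seq (.ite (.sub (.var 3) (.add (.var 26) (.var 27)))
      (.seq (.store 1 (pairCell (chainAt (.var 23) (.var 26))
          (chainAt (.var 23) (.add (.var 26) (.var 27)))) (.const 1))
        (.store 1 (pairCell (chainAt (.var 23) (.add (.var 26) (.var 27)))
          (chainAt (.var 23) (.var 26))) (.const 1))) .skip)
      (.clamp 27 (.add (.var 27) (.var 27)) (.var 3))) rfl
    (fun m s' => s'.vars 27 = min (2 ^ m) K ∧ (e < m →
      s'.arr 1 (X (ch (t * K + i)) * n + X (ch (t * K + (i + 2 ^ e)))) ≠ 0 ∧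
      s'.arr 1 (X (ch (t * K + (i + 2 ^ e))) * n + X (ch (t * K + i))) ≠ 0)) (by simp [h27]) ?_
  · exact this.2 he
  intro k s' hk hx hfr hI
  obtain ⟨e27, hI⟩ := hI
  have e0 : s'.vars 0 = n := (hfr.1 0 rfl).trans h0
  have e3 : s'.vars 3 = K := (hfr.1 3 rfl).trans h3
  have e23 : s'.vars 23 = t := (hfr.1 23 rfl).trans h23
  have e26 : s'.vars 26 = i := (hfr.1 26 rfl).trans h26
  have e9 : s'.arr 9 = ch := (hfr.2 9 rfl).trans h9
  have hX' : IsSample X N s' := hX.congr (hfr.2 4 rfl)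
  set ifp : Prog := .ite (.sub (.var 3) (.add (.var 26) (.var 27)))
      (.seq (.store 1 (pairCell (chainAt (.var 23) (.var 26))
          (chainAt (.var 23) (.add (.var 26) (.var 27)))) (.const 1))
        (.store 1 (pairCell (chainAt (.var 23) (.add (.var 26) (.var 27)))
          (chainAt (.var 23) (.var 26))) (.const 1))) .skip with hifp
  have hr : ((Prog.seq ifp (.clamp 27 (.add (.var 27) (.var 27)) (.var 3))).run s') =
      (ifp.run s').set 27 (min (min (2 ^ k) K + min (2 ^ k) K) K) := by
    simp only [Prog.run.eq_6, Prog.run.eq_3, Expr.eval, ifp.run_vars (z := 27) rfl,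
      ifp.run_vars (z := 3) rfl, e27, e3]
  rw [hr]
  refine ⟨?_, fun hek => ?_⟩
  · simp only [State.set_vars]
    norm_num
    rw [pow_succ]
    omega
  · simp only [State.set_arr]
    rcases Nat.lt_succ_iff_lt_or_eq.1 hek with hek | rfl
    · exact ⟨ifp.run_ne_zero rfl s' (hI hek).1, ifp.run_ne_zero rfl s' (hI hek).2⟩
    · have hp : min (2 ^ e) K = 2 ^ e := min_eq_left ((Nat.le_add_left _ _).trans hie.le)
      rw [hp] at e27
      have hi : i < K := (Nat.le_add_right _ _).trans_lt hie
      have hc : (Expr.sub (.var 3) (.add (.var 26) (.var 27))).eval s' ≠ 0 := by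
        simp only [Expr.eval, e3, e26, e27]
        exact Nat.sub_ne_zero_of_lt hie
      have key : ∀ s'' : State, s''.vars = s'.vars → s''.arr 9 = ch → IsSample X N s'' →
          (pairCell (chainAt (.var 23) (.var 26)) (chainAt (.var 23) (.add (.var 26) (.var 27)))).eval
            s'' = X (ch (t * K + i)) * n + X (ch (t * K + (i + 2 ^ e))) ∧
          (pairCell (chainAt (.var 23) (.add (.var 26) (.var 27))) (chainAt (.var 23) (.var 26))).eval
            s'' = X (ch (t * K + (i + 2 ^ e))) * n + X (ch (t * K + i)) := by
        intro s'' hv h9'' hX''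
        have c1 : (chainAt (.var 23) (.var 26)).eval s'' = ch (t * K + i) := by
          simp [chainAt, Expr.eval, hv, e23, e3, e26, h9'']
        have c2 : (chainAt (.var 23) (.add (.var 26) (.var 27))).eval s'' =
            ch (t * K + (i + 2 ^ e)) := by
          simp [chainAt, Expr.eval, hv, e23, e3, e26, e27, h9'']
        simp only [pairCell, Expr.eval, c1, c2, hX'' _ (hch i hi), hX'' _ (hch _ hie), hv, e0,
          and_self]
      obtain ⟨k1, -⟩ := key s' rfl e9 hX'
      have hrun : ifp.run s' = (s'.store 1 (pairCell (chainAt (.var 23) (.var 26))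
          (chainAt (.var 23) (.add (.var 26) (.var 27)))) (.const 1)).store 1
          (pairCell (chainAt (.var 23) (.add (.var 26) (.var 27)))
          (chainAt (.var 23) (.var 26))) (.const 1) := by
        rw [hifp, Prog.run, if_pos hc]; rfl
      obtain ⟨-, k2⟩ := key (s'.store 1 (pairCell (chainAt (.var 23) (.var 26))
          (chainAt (.var 23) (.add (.var 26) (.var 27)))) (.const 1)) rfl
        (by rw [State.store_arr_of_ne _ _ _ _ (by simp), e9])
        (hX'.congr (State.store_arr_of_ne _ _ _ _ (by simp)))
      rw [hrun]
      simp only [State.store_arr, k1, k2, Expr.eval, true_and]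
      refine ⟨?_, by simp⟩
      split_ifs <;> simp

theorem hopProg_spec {K nch w : ℕ} {ch : ℕ → ℕ} (s : State) (h0 : s.vars 0 = n) (h3 : s.vars 3 = K)
    (h7 : s.vars 7 = w) (h22 : s.vars 22 = nch) (hX : IsSample X N s) (h9 : s.arr 9 = ch)
    (hch : ∀ x < nch * K, ch x < N) {a b : ℕ} (hab : Hop K nch w ch a b) :
    (hopProg.run s).arr 1 (X a * n + X b) ≠ 0 := by
  obtain ⟨t, ht, e, he, i, hie, hab⟩ := hab
  have hi : i < K := (Nat.le_add_right _ _).trans_lt hie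
  refine Prog.rep_marked (k := t) rfl rfl (by rwa [h22]) fun s₁ f₁ e₁ => ?_
  refine Prog.rep_marked (k := i) rfl rfl (by rw [f₁.1 3 rfl, h3]; exact hi) fun s₂ f₂ e₂ => ?_
  have e0 : s₂.vars 0 = n := (f₂.1 0 rfl).trans ((f₁.1 0 rfl).trans h0)
  have e3 : s₂.vars 3 = K := (f₂.1 3 rfl).trans ((f₁.1 3 rfl).trans h3)
  have e7 : s₂.vars 7 = w := (f₂.1 7 rfl).trans ((f₁.1 7 rfl).trans h7)
  have e23 : s₂.vars 23 = t := (f₂.1 23 rfl).trans e₁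
  have e9 : s₂.arr 9 = ch := (f₂.2 9 rfl).trans ((f₁.2 9 rfl).trans h9)
  have hX' : IsSample X N s₂ := hX.congr ((f₂.2 4 rfl).trans (f₁.2 4 rfl))
  have := hopInner_spec (s₂.set 27 1) (t := t) (i := i) (e := e) (K := K) (ch := ch) (X := X)
    (by simpa using e0) (by simpa using e3) hX' e9 (by simpa using e23) (by simpa using e₂)
    (by simp; omega) (fun j hj => hch _ (index_lt ht hj)) (by simpa [e7] using he) hie
  have hrun : (Prog.seq (.set 27 (.const 1)) hopInner).run s₂ = hopInner.run (s₂.set 27 1) := rfl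
  rw [hrun]
  rcases hab with ⟨rfl, rfl⟩ | ⟨rfl, rfl⟩
  exacts [this.1, this.2]

/-- The test whether the sampled position reaches the position on the sampled chain whose index is
`28` places before the last one. -/
def jumpCond : Expr :=
  .get 2 (pairCell (.get 11 (.var 23))
    (chainAt (.get 12 (.var 26)) (.sub (.sub (.var 3) (.const 1)) (.var 28))))

/-- Mark the pairs of a sampled position and its first successor on a sampled chain. -/
def jumpProg : Prog :=
  .rep 23 8 (.rep 26 9 (.seq (.find 27 28 3 jumpCond) (.ite (.var 27)
    (.store 1 (pairCell (.get 11 (.var 23))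
      (chainAt (.get 12 (.var 26)) (.sub (.var 3) (.var 27)))) (.const 1)) .skip)))

/-- `Prog.find` returns the last hit, so the chain is scanned from its end: the last hit is then the
first chain element that the sampled position reaches. For the index `j` of that element, the search
leaves `K - j` in register `27`. -/
theorem jumpProg_spec {K nch m₂ m₃ : ℕ} {ch Y Z : ℕ → ℕ} (s : State) (h0 : s.vars 0 = n)
    (h3 : s.vars 3 = K) (h8 : s.vars 8 = m₂) (h9 : s.vars 9 = m₃) (hX : IsSample X N s)
    (hG : IsReach G s) (hch : s.arr 9 = ch) (hY : ∀ t < m₂, s.arr 11 t = Y t)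
    (hZ : ∀ t < m₃, s.arr 12 t = Z t) (hYN : ∀ t < m₂, Y t < N) (hchN : ∀ x < nch * K, ch x < N)
    {t t' j : ℕ} (ht : t < m₂) (ht' : t' < m₃) (hn : Z t' < nch) (hj : j < K)
    (hr : Reach G (X (Y t)) (X (ch (Z t' * K + j))))
    (hmin : ∀ j' < j, ¬ Reach G (X (Y t)) (X (ch (Z t' * K + j')))) :
    (jumpProg.run s).arr 1 (X (Y t) * n + X (ch (Z t' * K + j))) ≠ 0 := by
  refine Prog.rep_marked (k := t) rfl rfl (by rwa [h8]) fun s₁ f₁ e₁ => ?_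
  refine Prog.rep_marked (k := t') rfl rfl (by rw [f₁.1 9 rfl, h9]; exact ht') fun s₂ f₂ e₂ => ?_
  have e0 : s₂.vars 0 = n := (f₂.1 0 rfl).trans ((f₁.1 0 rfl).trans h0)
  have e3 : s₂.vars 3 = K := (f₂.1 3 rfl).trans ((f₁.1 3 rfl).trans h3)
  have e23 : s₂.vars 23 = t := (f₂.1 23 rfl).trans e₁
  have e9 : s₂.arr 9 = ch := (f₂.2 9 rfl).trans ((f₁.2 9 rfl).trans hch)
  have e11 : s₂.arr 11 t = Y t := by rw [f₂.2 11 rfl, f₁.2 11 rfl, hY t ht]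
  have e12 : s₂.arr 12 t' = Z t' := by rw [f₂.2 12 rfl, f₁.2 12 rfl, hZ t' ht']
  have hX' : IsSample X N s₂ := hX.congr ((f₂.2 4 rfl).trans (f₁.2 4 rfl))
  have hG' : IsReach G s₂ := hG.congr ((f₂.2 2 rfl).trans (f₁.2 2 rfl))
  have hchain : ∀ s' : State, (∀ u, u ≠ 28 → u ≠ 27 → s'.vars u = s₂.vars u) → s'.arr = s₂.arr →
      ∀ (f : Expr) (i : ℕ), f.eval s' = i →
      (Expr.get 11 (.var 23)).eval s' = Y t ∧
        (chainAt (.get 12 (.var 26)) f).eval s' = ch (Z t' * K + i) := by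
    intro s' hv ha f i hf
    simp [chainAt, Expr.eval, hf, ha, hv 23, hv 26, hv 3, e23, e₂, e3, e11, e12, e9]
  have hcond : ∀ k < s₂.vars 3, ∀ s' : State, (∀ u, u ≠ 28 → u ≠ 27 → s'.vars u = s₂.vars u) →
      s'.vars 28 = k → s'.arr = s₂.arr → jumpCond.eval s' =
        (Expr.get 2 (.const (X (Y t) * n + X (ch (Z t' * K + (K - 1 - k)))))).eval s₂ := by
    intro k hk s' hv hk' ha
    obtain ⟨c1, c2⟩ := hchain s' hv ha (.sub (.sub (.var 3) (.const 1)) (.var 28)) (K - 1 - k)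
      (by simp [Expr.eval, hv 3, e3, hk'])
    have := (get_pairCell (hG'.congr (s' := s') (by rw [ha])) (hX'.congr (by rw [ha]))
      (by rw [hv 0 (by simp) (by simp), e0]) c1 c2 (hYN t ht)
      (hchN _ (index_lt hn (by omega)))).1
    rw [jumpCond, Expr.eval, this, ha]
    rfl
  have hval : ∀ i < K, (Expr.get 2 (.const (X (Y t) * n + X (ch (Z t' * K + i))))).eval s₂ ≠ 0 ↔
      Reach G (X (Y t)) (X (ch (Z t' * K + i))) := by
    classical
    intro i hi
    simp only [Expr.eval]
    rw [hG']
    split_ifs with h <;> simp [h]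
  have hfind := Prog.find_spec (z := 27) (x := 28) (y := 3) (C := jumpCond) s₂ _ (by simp) (by simp)
    (by simp) hcond
  rw [e3] at hfind
  have hpos : ((Prog.find 27 28 3 jumpCond).run s₂).vars 27 = K - j := by
    rcases hfind with ⟨-, hf⟩ | ⟨e, he, hv, hc, hl⟩
    · have := hf (K - 1 - j) (by omega)
      rw [show K - 1 - (K - 1 - j) = j by omega] at this
      exact absurd ((hval j hj).2 hr) (not_not.2 this)
    · rw [hv]
      have h1 : ¬ e < K - 1 - j := fun h => by
        have := hl (K - 1 - j) h (by omega)
        rw [show K - 1 - (K - 1 - j) = j by omega] at this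
        exact absurd ((hval j hj).2 hr) (not_not.2 this)
      have h2 : ¬ K - 1 - j < e := fun h => hmin (K - 1 - e) (by omega) ((hval _ (by omega)).1 hc)
      omega
  set s₃ := (Prog.find 27 28 3 jumpCond).run s₂ with hs₃
  have hrun : (Prog.seq (.find 27 28 3 jumpCond) (.ite (.var 27)
    (.store 1 (pairCell (.get 11 (.var 23))
      (chainAt (.get 12 (.var 26)) (.sub (.var 3) (.var 27)))) (.const 1)) .skip)).run s₂ =
      s₃.store 1 (pairCell (.get 11 (.var 23))
      (chainAt (.get 12 (.var 26)) (.sub (.var 3) (.var 27)))) (.const 1) := by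
    rw [Prog.run, Prog.run, if_pos]
    · rfl
    · simp only [Expr.eval, ← hs₃, hpos]; omega
  have ha : s₃.arr = s₂.arr := by
    funext b
    exact Prog.run_arr _ rfl s₂
  obtain ⟨c1, c2⟩ := hchain s₃ (fun u h1 h2 => Prog.run_vars _ (by
    simp [Prog.find, Prog.writes, Ne.symm h1, Ne.symm h2]) s₂) ha (.sub (.var 3) (.var 27)) j (by
      simp only [Expr.eval, hpos]
      rw [hs₃, Prog.run_vars _ rfl, e3]; omega)
  have := (get_pairCell (hG'.congr (s' := s₃) (by rw [ha])) (hX'.congr (by rw [ha]))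
    (by rw [hs₃, Prog.run_vars _ rfl, e0]) c1 c2 (hYN t ht) (hchN _ (index_lt hn hj))).1
  rw [hrun, State.store_arr, this]
  simp [Expr.eval]

/-- Clear the entries of array `1` that are on the diagonal or are not in the transitive closure. -/
def maskProg : Prog :=
  .rep 23 0 (.rep 26 0 (.store 1 (.add (.mul (.var 23) (.var 0)) (.var 26))
    (.sub (.get 1 (.add (.mul (.var 23) (.var 0)) (.var 26)))
      (.mul (.get 1 (.add (.mul (.var 23) (.var 0)) (.var 26)))
        (.sub (.const 1) (.mul (.get 2 (.add (.mul (.var 23) (.var 0)) (.var 26)))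
          (.add (.sub (.var 23) (.var 26)) (.sub (.var 26) (.var 23)))))))))

/-- Hops are marked in both directions without a test of reachability; the mask confines the output
to the transitive closure whatever the coins are. The diagonal is removed because `Reach` is
reflexive while the closure need not contain loops. -/
theorem maskProg_spec (s : State) (h0 : s.vars 0 = n) (hG : IsReach G s) (i j : Fin n) :
    (maskProg.run s).arr 1 (i * n + j) ≠ 0 ↔
      s.arr 1 (i * n + j) ≠ 0 ∧ Reach G i j ∧ i ≠ j := by
  classical
  let val : ℕ → ℕ → ℕ := fun i j => if s.arr 2 (i * n + j) ≠ 0 ∧ i ≠ j then s.arr 1 (i * n + j) else 0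
  have := Prog.fill_matrix_spec (x := 23) (x' := 26) (y := 0) (y' := 0) (a := 1)
    (i := .add (.mul (.var 23) (.var 0)) (.var 26))
    (e := .sub (.get 1 (.add (.mul (.var 23) (.var 0)) (.var 26)))
      (.mul (.get 1 (.add (.mul (.var 23) (.var 0)) (.var 26)))
        (.sub (.const 1) (.mul (.get 2 (.add (.mul (.var 23) (.var 0)) (.var 26)))
          (.add (.sub (.var 23) (.var 26)) (.sub (.var 26) (.var 23))))))) s val
    (by simp) ?_
  · rw [h0] at this
    have h2 := hG i j
    rw [maskProg, this i i.2 j j.2]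
    simp only [val, h2, ne_eq, Fin.val_inj]
    by_cases hr : Reach G i j <;> by_cases hij : i = j <;> simp [hr, hij]
  intro i hi j hj s' hv h23 h26 ha hcell
  have e0 : s'.vars 0 = s.vars 0 := hv 0 (by simp) (by simp)
  refine ⟨by simp [Expr.eval, h23, h26, e0], ?_⟩
  simp only [Expr.eval, h23, h26, e0, hcell, ha 2 (by simp), val, ← h0]
  generalize s.arr 1 (i * s.vars 0 + j) = v
  generalize s.arr 2 (i * s.vars 0 + j) = r
  by_cases hr : r = 0
  · simp [hr]
  · by_cases hij : i = j
    · simp [hij]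
    · have : 1 - r * (i - j + (j - i)) = 0 := by
        have : 0 < r * (i - j + (j - i)) := Nat.mul_pos (by omega) (by omega)
        omega
      simp [hr, hij, this]

end Edges

end Shortcut
namespace Shortcut

/-! ### Inequalities between the parameters. -/

section ParameterBounds

variable {A n D L M K N q m₂ m₃ : ℕ}

theorem IsParams.one_le_L (h : IsParams A n D L M K N q m₂ m₃) : 1 ≤ L := by
  obtain ⟨m, -, -, -, rfl⟩ := h.root
  exact le_max_left _ _

/-- The summand `4 * Nat.size n` in the definition of `L` is there for this bound, which makes the
hops along a chain, at a cost of `L` each, affordable. For `L = 1` the lower bound on `D` is used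
instead. -/
theorem IsParams.L_mul_le (h : IsParams A n D L M K N q m₂ m₃) (hD : 64 * Nat.size n ≤ D) :
    L * (32 * Nat.size n) ≤ D := by
  obtain ⟨m, -, -, -, rfl⟩ := h.root
  rcases le_total (D / (8 * (m + 1 + 4 * Nat.size n))) 1 with h1 | h1
  · rw [max_eq_left h1]; omega
  · rw [max_eq_right h1]
    calc _ ≤ D / (8 * (m + 1 + 4 * Nat.size n)) * (8 * (m + 1 + 4 * Nat.size n)) :=
          Nat.mul_le_mul_left _ (by omega)
      _ ≤ D := Nat.div_mul_le_self _ _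

theorem IsParams.le_M (h : IsParams A n D L M K N q m₂ m₃) (hD : 64 * Nat.size n ≤ D) :
    4 * Nat.size n ≤ M := by
  have := h.one_le_L
  have h2 := h.L_mul_le hD
  rw [h.M_eq, Nat.le_div_iff_mul_le (by omega)]
  calc _ = L * (32 * Nat.size n) := by ring
    _ ≤ D := h2

/-- The two ends of a geodesic contribute `2 L M ≤ D / 4`, and `L * Nat.size n` is at most `D / 32`.
-/
theorem IsParams.diam_bound (h : IsParams A n D L M K N q m₂ m₃) (hn : 1 ≤ n)
    (hD : 64 * Nat.size n ≤ D) : 2 * L + (L * (2 * M + Nat.size n) + 1) ≤ D := by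
  have h1 := h.one_le_L
  have h2 := h.L_mul_le hD
  have hl : 1 ≤ Nat.size n := Nat.size_pos.2 hn
  have h3 : M * (8 * L) ≤ D := by rw [h.M_eq]; exact Nat.div_mul_le_self _ _
  have h4 : L * 1 ≤ L * Nat.size n := Nat.mul_le_mul_left _ hl
  have e1 : L * (2 * M + Nat.size n) = 2 * (L * M) + L * Nat.size n := by ring
  have e2 : M * (8 * L) = 8 * (L * M) := by ring
  have e3 : L * (32 * Nat.size n) = 32 * (L * Nat.size n) := by ring
  omega

theorem IsParams.one_le_K (h : IsParams A n D L M K N q m₂ m₃) (hn : 1 ≤ n)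
    (hD : 64 * Nat.size n ≤ D) : 1 ≤ K := by
  have := h.le_M hD
  have hl : 1 ≤ Nat.size n := Nat.size_pos.2 hn
  rw [h.K_eq]; omega

theorem IsParams.K_le (h : IsParams A n D L M K N q m₂ m₃) (hDn : D ≤ n) : K ≤ 2 ^ Nat.size n := by
  have h1 : K ≤ M := by rw [h.K_eq]; exact Nat.div_le_self _ _
  have h2 : M ≤ D := by rw [h.M_eq]; exact Nat.div_le_self _ _
  exact (h1.trans (h2.trans hDn)).trans (Nat.lt_size_self n).le

theorem lt_succ_div_mul (a b : ℕ) (hb : 0 < b) : a < (a / b + 1) * b := by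
  have := Nat.div_add_mod a b
  have := Nat.mod_lt a hb
  rw [Nat.add_mul, Nat.mul_comm]; omega

theorem IsParams.lt_cap (h : IsParams A n D L M K N q m₂ m₃) (hn : 1 ≤ n)
    (hD : 64 * Nat.size n ≤ D) : N < q * K := by
  rw [h.q_eq]
  exact lt_succ_div_mul _ _ (h.one_le_K hn hD)

theorem IsParams.N_le (h : IsParams A n D L M K N q m₂ m₃) (hn : 1 ≤ n) :
    N ≤ 2 * A * Nat.size n * n := by
  have := Nat.div_le_self n L
  calc N = A * Nat.size n * (n / L + 1) := h.N_eq
    _ ≤ A * Nat.size n * (2 * n) := Nat.mul_le_mul_left _ (by omega)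
    _ = _ := by ring

theorem IsParams.N_pos (h : IsParams A n D L M K N q m₂ m₃) (hA : 1 ≤ A) (hn : 1 ≤ n) : 0 < N := by
  rw [h.N_eq]
  have hl : 1 ≤ Nat.size n := Nat.size_pos.2 hn
  positivity

/-- With `hits₂` and `hits₃`, this is the hypothesis `a * q ≤ m * h` of `fairCoins_miss_le` for the
three rounds of sampling, with `a = A * Nat.size n`. -/
theorem IsParams.hits₁ (h : IsParams A n D L M K N q m₂ m₃) : A * Nat.size n * n ≤ N * L := by
  rw [h.N_eq, Nat.mul_assoc (A * Nat.size n)]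
  exact Nat.mul_le_mul_left _ (lt_succ_div_mul _ _ h.one_le_L).le

theorem IsParams.hits₂ (h : IsParams A n D L M K N q m₂ m₃) (hM : 0 < M) :
    A * Nat.size n * N ≤ m₂ * M := by
  rw [h.m₂_eq, Nat.mul_assoc (A * Nat.size n)]
  exact Nat.mul_le_mul_left _ (lt_succ_div_mul _ _ hM).le

/-- As `K = M / 4`, at most about half of a geodesic is uncovered, which leaves `M ≤ 2 t (Nat.size n
+ 1)`. The extra factor `2 (Nat.size n + 1)` in `m₃` compensates for this. -/
theorem IsParams.hits₃ (h : IsParams A n D L M K N q m₂ m₃) (hM : 0 < M) {t : ℕ}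
    (ht : M + 1 ≤ 2 * K + t * (Nat.size n + 1)) : A * Nat.size n * q ≤ m₃ * t := by
  have h1 : 2 * K ≤ M + 1 - 2 * K := by have := h.K_eq; omega
  have h2 : M ≤ 2 * (t * (Nat.size n + 1)) := by have := h.K_eq; omega
  rw [h.m₃_eq]
  calc A * Nat.size n * q ≤ A * Nat.size n * ((q / M + 1) * M) :=
        Nat.mul_le_mul_left _ (lt_succ_div_mul _ _ hM).le
    _ ≤ A * Nat.size n * ((q / M + 1) * (2 * (t * (Nat.size n + 1)))) :=
        Nat.mul_le_mul_left _ (Nat.mul_le_mul_left _ h2)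
    _ = _ := by ring

/-- From `exp (-Nat.size n) ≤ 2 ^ (-Nat.size n) ≤ 1 / n`. -/
theorem exp_neg_le {c n : ℕ} (hn : 1 ≤ n) :
    Real.exp (-(((4 * c + 24) * Nat.size n : ℕ) / 2)) ≤ (1 / (n : ℝ)) ^ (2 * c + 12) := by
  have hn' : (0 : ℝ) < n := by exact_mod_cast hn
  have h1 : Real.exp (-(Nat.size n : ℝ)) ≤ 1 / n := by
    have h2 : (n : ℝ) ≤ 2 ^ Nat.size n := by exact_mod_cast (Nat.lt_size_self n).le
    have h3 : (2 : ℝ) ^ Nat.size n ≤ Real.exp (Nat.size n) := by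
      rw [← mul_one (Nat.size n : ℝ), Real.exp_nat_mul]
      exact pow_le_pow_left₀ (by norm_num) (by have := Real.add_one_le_exp 1; linarith) _
    rw [Real.exp_neg, ← one_div]
    exact one_div_le_one_div_of_le hn' (h2.trans h3)
  calc _ = Real.exp (-(Nat.size n : ℝ)) ^ (2 * c + 12) := by
        rw [← Real.exp_nat_mul]; congr 1; push_cast; ring
    _ ≤ _ := pow_le_pow_left₀ (Real.exp_pos _).le h1 _

/-- There are `n² + 2 N² ≤ n ^ (c + 12)` bad events of probability at most `n ^ (-(2 c + 12))`; this
determines the choice `A = 4 c + 24`. The assumption `64 ≤ n` absorbs the constants that depend on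
`c` into a power of `n`. -/
theorem union_bound {c : ℕ} (h : IsParams (4 * c + 24) n D L M K N q m₂ m₃) (hn : 64 ≤ n) :
    ((n * n + 2 * (N * N) : ℕ) : ℝ) * Real.exp (-(((4 * c + 24) * Nat.size n : ℕ) / 2)) ≤
      1 / (n : ℝ) ^ c := by
  have hn' : (0 : ℝ) < n := by exact_mod_cast (show 0 < n by omega)
  have hN : N ≤ 2 * (4 * c + 24) * (n * n) := (h.N_le (by omega)).trans (by
    rw [Nat.mul_assoc _ (Nat.size n)]
    exact Nat.mul_le_mul_left _ (Nat.mul_le_mul_right _ (size_le_self n)))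
  have h1 : n * n + 2 * (N * N) ≤ n ^ (c + 12) := by
    have h2 : 1 + 8 * (4 * c + 24) ^ 2 ≤ n ^ (c + 8) := by
      have e1 : c + 6 ≤ 2 ^ (c + 6) := Nat.lt_two_pow_self.le
      have e2 : (c + 6) ^ 2 ≤ 4 ^ (c + 6) := by
        calc _ ≤ (2 ^ (c + 6)) ^ 2 := Nat.pow_le_pow_left e1 2
          _ = (2 ^ 2) ^ (c + 6) := by rw [← pow_mul, ← pow_mul, mul_comm]
          _ = _ := by norm_num
      have e3 : 1 ≤ 4 ^ (c + 6) := Nat.one_le_pow _ _ (by norm_num)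
      calc 1 + 8 * (4 * c + 24) ^ 2 = 1 + 128 * (c + 6) ^ 2 := by ring
        _ ≤ 4096 * 4 ^ (c + 6) := by omega
        _ ≤ 4096 * 64 ^ (c + 6) := Nat.mul_le_mul_left _ (Nat.pow_le_pow_left (by norm_num) _)
        _ = 64 ^ (c + 8) := by rw [pow_add 64 c 8, pow_add 64 c 6]; ring
        _ ≤ n ^ (c + 8) := Nat.pow_le_pow_left hn _
    have h3 : n * n ≤ n ^ 4 := by
      rw [← sq]; exact Nat.pow_le_pow_right (by omega) (by norm_num)
    calc n * n + 2 * (N * N)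
        ≤ n ^ 4 + 2 * ((2 * (4 * c + 24) * (n * n)) * (2 * (4 * c + 24) * (n * n))) :=
          Nat.add_le_add h3 (Nat.mul_le_mul_left _ (Nat.mul_le_mul hN hN))
      _ = n ^ 4 * (1 + 8 * (4 * c + 24) ^ 2) := by ring
      _ ≤ n ^ 4 * n ^ (c + 8) := Nat.mul_le_mul_left _ h2
      _ = n ^ (c + 12) := by rw [← pow_add]; congr 1; omega
  calc _ ≤ (n : ℝ) ^ (c + 12) * (1 / (n : ℝ)) ^ (2 * c + 12) :=
        mul_le_mul (by exact_mod_cast h1) (exp_neg_le (by omega)) (Real.exp_pos _).le (by positivity)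
    _ = 1 / (n : ℝ) ^ c := by
        rw [show 2 * c + 12 = c + 12 + c by omega, pow_add (1 / (n : ℝ)), ← mul_assoc, ← mul_pow,
          mul_one_div_cancel hn'.ne', one_pow, one_mul, one_div_pow]

end ParameterBounds

section Probability

/-- The size of the random set varies with the coins; the smallest size that occurs takes the role
of `h`. -/
theorem fairCoins_miss_le_of_card {u b q m a : ℕ} {F : (ℕ → Bool) → Prop}
    {S : (ℕ → Bool) → Finset ℕ} (hF : DeterminedBy u F) (hS : DeterminedBy u S) (hq : 0 < q)
    (hqb : q ≤ 2 ^ b) (hsub : ∀ ρ, F ρ → S ρ ⊆ Finset.range q)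
    (ha : ∀ ρ, F ρ → a * q ≤ m * (S ρ).card) :
    fairCoins {ρ | F ρ ∧ ∀ j < m, coinVal (fun i => ρ (u + (j * b + i))) b % q ∉ S ρ} ≤
      ENNReal.ofReal (Real.exp (-(a / 2))) := by
  classical
  by_cases hne : ∃ h ρ, F ρ ∧ (S ρ).card = h
  · obtain ⟨ρ₁, h1, h2⟩ := Nat.find_spec hne
    have := fairCoins_miss_le (h := Nat.find hne) (m := m) (a := a) hF hS hq hqb hsub
      (fun ρ hρ => Nat.find_min' hne ⟨ρ, hρ, rfl⟩) (h2 ▸ ha ρ₁ h1)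
    simpa only [Nat.add_assoc] using this
  · push Not at hne
    have : ∀ ρ, ¬ F ρ := fun ρ hρ => hne _ ρ hρ rfl
    simp [this]

end Probability

end Shortcut
namespace Shortcut

/-! ### The program after the computation of reachability, and the case of small `D`. -/

section PostProg

/-- Mark all pairs. -/
def allProg : Prog :=
  .rep 23 0 (.rep 26 0 (.store 1 (.add (.mul (.var 23) (.var 0)) (.var 26)) (.const 1)))

/-- Sample the positions and prepare the chain cover procedure. -/
def headProg : Prog := .seq (sampleProg 2 0 4) (.seq posLtProg coverInit)

/-- Mark the shortcuts. -/
def finProg : Prog :=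
  .seq (sampleProg 8 2 11) (.seq (sampleProg 9 4 12) (.seq hopProg jumpProg))

/-- Compute all parameters. -/
def preProg (A : ℕ) : Prog := .seq (paramProg A) (sizeProg 10 12 23 19)

/-- Mark the shortcuts when the diameter bound is not too small. -/
def mainProg (A : ℕ) : Prog := .seq (preProg A) (.seq headProg (.seq coverLoop finProg))

/-- The computation of the shortcuts from the reachability matrix. -/
def postProg (A : ℕ) : Prog :=
  .seq (.ite (.sub (.mul (.const 64) (.var 7)) (.var 1)) allProg (mainProg A)) maskProg

/-- The configuration with coins `ρ`. -/
def State.withCoins (s : State) (ρ : ℕ → Bool) : State := { s with coins := ρ }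

/-- A configuration in which the reachability matrix has been computed. -/
structure Ready {n : ℕ} (G : Digraph (Fin n)) (D : ℕ) (s : State) : Prop where
  n_eq : s.vars 0 = n
  D_eq : s.vars 1 = D
  size_eq : s.vars 7 = Nat.size n
  reach : IsReach G s
  zero : ∀ a ∈ [1, 7, 10], ∀ i, s.arr a i = 0

variable {n D : ℕ} {G : Digraph (Fin n)}

theorem Ready.withCoins {s : State} (h : Ready G D s) (ρ : ℕ → Bool) : Ready G D (s.withCoins ρ) :=
  ⟨h.n_eq, h.D_eq, h.size_eq, h.reach, h.zero⟩

theorem mem_outputEdges_postProg {A : ℕ} {s : State} (h : Ready G D s) (u v : Fin n) :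
    (u, v) ∈ outputEdges n ((postProg A).run s) ↔
      (Prog.run (.ite (.sub (.mul (.const 64) (.var 7)) (.var 1)) allProg (mainProg A)) s).arr 1
        (u * n + v) ≠ 0 ∧ Reach G u v ∧ u ≠ v := by
  set p : Prog := .ite (.sub (.mul (.const 64) (.var 7)) (.var 1)) allProg (mainProg A)
  have := maskProg_spec (n := n) (G := G) (p.run s) ((p.run_vars rfl s).trans h.n_eq)
    (h.reach.congr (p.run_arr rfl s)) u v
  rw [← this, outputEdges, Finset.mem_filter]
  simp only [Finset.mem_univ, true_and]
  rfl

theorem outputEdges_le_transClosure {A : ℕ} {s : State} (h : Ready G D s) :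
    ofEdges (outputEdges n ((postProg A).run s)) ≤ transClosure G := by
  intro u v huv
  obtain ⟨-, hr, hne⟩ := (mem_outputEdges_postProg h u v).1 huv
  exact (Relation.reflTransGen_iff_eq_or_transGen.1 hr).resolve_left (Ne.symm hne)

theorem sup_le_transClosure {A : ℕ} {s : State} (h : Ready G D s) :
    G ⊔ ofEdges (outputEdges n ((postProg A).run s)) ≤ transClosure G :=
  sup_le (fun _ _ h => Relation.TransGen.single h) (outputEdges_le_transClosure h)

theorem allProg_spec {s : State} (h0 : s.vars 0 = n) (i j : Fin n) :
    (allProg.run s).arr 1 (i * n + j) ≠ 0 := by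
  have := Prog.fill_matrix_spec (x := 23) (x' := 26) (y := 0) (y' := 0) (a := 1)
    (i := .add (.mul (.var 23) (.var 0)) (.var 26)) (e := .const 1) s (fun _ _ => 1) (by simp)
    fun i hi j hj s' hv h23 h26 _ _ => ⟨by simp [Expr.eval, h23, h26, hv], rfl⟩
  rw [h0] at this
  rw [allProg, this i i.2 j j.2]
  simp

/-- Every reachable pair of distinct vertices becomes an edge. -/
theorem diam_le_of_all {A : ℕ} {s : State} (h : Ready G D s) (hD : 1 ≤ D)
    (hDl : D < 64 * Nat.size n) :
    diam (G ⊔ ofEdges (outputEdges n ((postProg A).run s))) ≤ (D : ℕ∞) := by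
  refine diam_le_of_within fun u v huv => ?_
  have hr : Reach G u v := by
    induction huv with
    | refl => exact Relation.ReflTransGen.refl
    | tail _ h' ih => exact ih.trans (Relation.TransGen.to_reflTransGen (sup_le_transClosure h h'))
  rcases eq_or_ne u v with rfl | hne
  · exact Within.refl _ _
  · refine Within.mono hD (HasWalk.within (HasWalk.one ?_))
    right
    refine (mem_outputEdges_postProg h u v).2 ⟨?_, hr, hne⟩
    have hc : (Expr.sub (.mul (.const 64) (.var 7)) (.var 1)).eval s ≠ 0 := by
      simp only [Expr.eval, h.D_eq, h.size_eq]; omega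
    rw [Prog.run, if_pos hc]
    exact allProg_spec h.n_eq u v

theorem IsChainCover.congr {K N nch : ℕ} {ch : ℕ → ℕ} {lt lt' : ℕ → ℕ → Prop}
    (h : IsChainCover K N lt nch ch) (hlt : ∀ u < N, ∀ v < N, lt u v ↔ lt' u v) :
    IsChainCover K N lt' nch ch := by
  obtain ⟨col, h1, h2⟩ := h.col
  refine ⟨h.card_le, h.ch_lt, fun t ht j hj => ?_, col, h1,
    fun u v hu hv hu' hv' huv => h2 u v hu hv hu' hv' ((hlt u hu v hv).2 huv)⟩
  exact (hlt _ (h.ch_lt _ (index_lt ht (by omega))) _ (h.ch_lt _ (index_lt ht hj))).1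
    (h.chain t ht j hj)

/-- The parameters are in their registers. -/
structure Tuned (A n D L M K N q m₂ m₃ b : ℕ) (s : State) : Prop where
  params : IsParams A n D L M K N q m₂ m₃
  N_reg : s.vars 2 = N
  K_reg : s.vars 3 = K
  q_reg : s.vars 4 = q
  m₂_reg : s.vars 8 = m₂
  m₃_reg : s.vars 9 = m₃
  b_reg : s.vars 10 = b
  b_eq : b = Nat.size (n + N)
  P_reg : s.vars 11 = 2 * (n + N)
  B_reg : s.vars 19 = n * (Nat.size n * (Nat.size n * (Nat.size n * (16 * A * A))))

theorem preProg_spec {A : ℕ} {s : State} (h : Ready G D s) (hA : 1 ≤ A) (hD : 1 ≤ D) (hDn : D ≤ n) :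
    Ready G D ((preProg A).run s) ∧
      ∃ L M K N q m₂ m₃ b, Tuned A n D L M K N q m₂ m₃ b ((preProg A).run s) := by
  obtain ⟨hp, h11, h12, h19⟩ := paramProg_spec s hA hD hDn h.n_eq h.D_eq h.size_eq
  set s₁ := (paramProg A).run s
  have hs := sizeProg_spec (z := 10) (t := 12) (x := 23) (y := 19) s₁ (by simp) (by
    have hn : 1 ≤ n := hD.trans hDn
    have hl : 1 ≤ Nat.size n := Nat.size_pos.2 hn
    have hN := hp.N_le hn
    rw [h12, h19]
    have p1 : 1 ≤ A * A := Nat.mul_le_mul hA hA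
    calc n + s₁.vars 2 ≤ n * 1 + 2 * A * Nat.size n * n := by omega
      _ ≤ n * (A * Nat.size n) + 2 * A * Nat.size n * n :=
          Nat.add_le_add_right (Nat.mul_le_mul_left _ (Nat.mul_pos hA hl)) _
      _ = n * (Nat.size n * (1 * (1 * (3 * A * 1)))) := by ring
      _ ≤ _ := by gcongr; omega)
  set f : Frame (preProg A) s ((preProg A).run s) := (preProg A).frame s
  have g : ∀ z, (sizeProg 10 12 23 19).writes z = false → ((preProg A).run s).vars z = s₁.vars z :=
    fun z hz => Prog.run_vars _ hz s₁
  refine ⟨⟨(f.1 0 rfl).trans h.n_eq, (f.1 1 rfl).trans h.D_eq, (f.1 7 rfl).trans h.size_eq,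
    h.reach.congr (f.2 2 rfl), fun a ha i => ?_⟩, _, _, _, _, _, _, _, _, hp, g 2 rfl, g 3 rfl, g 4 rfl,
    g 8 rfl, g 9 rfl, rfl, ?_, (g 11 rfl).trans h11, (g 19 rfl).trans h19⟩
  · rw [f.2 a (by fin_cases ha <;> rfl)]; exact h.zero a ha i
  · rw [← h12, ← hs]; rfl

end PostProg

end Shortcut
namespace Shortcut

/-! ### The state after the chain cover has been computed. -/

section Main

variable {n D A L M K N q m₂ m₃ b : ℕ} {G : Digraph (Fin n)}

theorem Prog.run_withCoins {p : Prog} (hp : p.flipFree = true) (s : State) (ρ : ℕ → Bool) :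
    p.run (s.withCoins ρ) = (p.run s).withCoins ρ := by
  have h := Prog.agree_run (m := 0) hp (s := s.withCoins ρ) (s' := s) ⟨rfl, rfl, by simp⟩
  have hc := Prog.run_coins hp (s.withCoins ρ)
  rcases hr : p.run (s.withCoins ρ) with ⟨v, a, c⟩
  rw [hr] at h hc
  simp only [State.withCoins] at hc ⊢
  rw [← h.1, ← h.2.1, hc]

theorem Ready.congr {s s' : State} (h : Ready G D s) {p : Prog} (f : Frame p s s')
    (hv : (p.writes 0 || p.writes 1 || p.writes 7) = false) (ha : p.stores 2 = false)
    (hz : ∀ a ∈ [1, 7, 10], p.stores a = false) : Ready G D s' := by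
  simp only [Bool.or_eq_false_iff] at hv
  exact ⟨(f.1 0 hv.1.1).trans h.n_eq, (f.1 1 hv.1.2).trans h.D_eq, (f.1 7 hv.2).trans h.size_eq,
    h.reach.congr (f.2 2 ha), fun a ha i => by rw [f.2 a (hz a ha)]; exact h.zero a ha i⟩

/-- The sampled vertices in array `4`. -/
def sampleVertex (hn : 0 < n) (s : State) (i : ℕ) : Fin n := ⟨s.arr 4 i % n, Nat.mod_lt _ hn⟩

/-- The configuration after the computation of the chain cover. -/
def coverState (s : State) (ρ : ℕ → Bool) : State := coverLoop.run (headProg.run (s.withCoins ρ))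

theorem coverState_frame (s : State) (ρ : ℕ → Bool) :
    Frame (.seq headProg coverLoop) (s.withCoins ρ) (coverState s ρ) :=
  Prog.frame (.seq headProg coverLoop) (s.withCoins ρ)

theorem Tuned.two_pow_le {s : State} (ht : Tuned A n D L M K N q m₂ m₃ b s) (hn : 0 < n) :
    2 ^ b ≤ 2 * (n + N) := by
  rw [ht.b_eq]
  obtain ⟨k, hk⟩ : ∃ k, Nat.size (n + N) = k + 1 :=
    Nat.exists_eq_succ_of_ne_zero (by rw [Ne, Nat.size_eq_zero]; omega)
  have : 2 ^ k ≤ n + N := Nat.lt_size.1 (by omega)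
  rw [hk, pow_succ]; omega

theorem Tuned.le_two_pow {s : State} (ht : Tuned A n D L M K N q m₂ m₃ b s) : n + N ≤ 2 ^ b := by
  rw [ht.b_eq]; exact (Nat.lt_size_self _).le

/-- The first round of sampling reads exactly the first `N * b` coins, and the chain cover is then
computed without coins. -/
theorem coverState_spec {s : State} (h : Ready G D s) (ht : Tuned A n D L M K N q m₂ m₃ b s)
    (hn : 0 < n) (hD : 64 * Nat.size n ≤ D) (ρ : ℕ → Bool) :
    IsSample (sampleVertex hn (coverState s ρ)) N (coverState s ρ) ∧
    (∀ i < N, (sampleVertex hn (coverState s ρ) i : ℕ) =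
      coinVal (fun t => ρ (i * b + t)) b % n) ∧
    IsChainCover K N (PosLt G (sampleVertex hn (coverState s ρ))) ((coverState s ρ).vars 22)
      ((coverState s ρ).arr 9) ∧
    (coverState s ρ).coins = fun i => ρ (N * b + i) := by
  obtain ⟨a1, a2⟩ := sampleProg_spec (y := 2) (md := 0) (a := 4) (b := b) (s.withCoins ρ) (by simp)
    (by simp) ht.b_reg ((ht.two_pow_le hn).trans ht.P_reg.ge)
  set s₁ := (sampleProg 2 0 4).run (s.withCoins ρ) with hs₁
  have g₁ : Frame (sampleProg 2 0 4) (s.withCoins ρ) s₁ := Prog.frame _ _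
  have h₁ : Ready G D s₁ := (h.withCoins ρ).congr g₁ rfl rfl (by simp [sampleProg, Prog.stores])
  set s₂ := posLtProg.run s₁ with hs₂
  have g₂ : Frame posLtProg s₁ s₂ := Prog.frame _ _
  have h₂ : Ready G D s₂ := h₁.congr g₂ rfl rfl (by simp [posLtProg, Prog.stores])
  have hcs : coverState s ρ = coverLoop.run (coverInit.run s₂) := rfl
  have g₃ : Frame (.seq coverInit coverLoop) s₂ (coverState s ρ) := Prog.frame (.seq coverInit coverLoop) s₂
  have e2 : s₂.vars 2 = N := (g₂.1 2 rfl).trans ((g₁.1 2 rfl).trans ht.N_reg)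
  have e3 : s₂.vars 3 = K := (g₂.1 3 rfl).trans ((g₁.1 3 rfl).trans ht.K_reg)
  have e4 : s₂.vars 4 = q := (g₂.1 4 rfl).trans ((g₁.1 4 rfl).trans ht.q_reg)
  have har : (coverState s ρ).arr 4 = s₁.arr 4 := (g₃.2 4 rfl).trans (g₂.2 4 rfl)
  have hN : (s.withCoins ρ).vars 2 = N := ht.N_reg
  have hn0 : (s.withCoins ρ).vars 0 = n := h.n_eq
  rw [hN, hn0] at a1
  rw [hN] at a2
  have hval : ∀ i < N, (sampleVertex hn (coverState s ρ) i : ℕ) =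
      coinVal (fun t => ρ (i * b + t)) b % n := fun i hi => by
    change (coverState s ρ).arr 4 i % n = _
    rw [har, a1 i hi]
    exact Nat.mod_mod _ _
  have hX : IsSample (sampleVertex hn (coverState s ρ)) N (coverState s ρ) := fun i hi => by
    rw [hval i hi, har, a1 i hi]; rfl
  refine ⟨hX, hval, ?_, ?_⟩
  · have hlt := posLtProg_spec s₁ h₁.n_eq ((g₁.1 2 rfl).trans ht.N_reg) h₁.reach
      (hX.congr (s := coverState s ρ) har.symm)
    rw [← hs₂] at hlt
    have := chainCover_spec s₂ (ht.params.one_le_K hn hD) e2 e3 e4 (ht.params.lt_cap hn hD)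
      (h₂.zero 7 (by simp)) (h₂.zero 10 (by simp))
      (fun v hv => not_not.1 fun hc => PosLt.irrefl v ((hlt v hv v hv).1 hc))
      (fun u hu v hv w hw h1 h2 => (hlt u hu w hw).2
        (((hlt u hu v hv).1 h1).trans ((hlt v hv w hw).1 h2)))
    exact this.congr hlt
  · rw [hcs, Prog.run_coins (by rfl), Prog.run_coins (by rfl), hs₂, Prog.run_coins (by rfl), a2]
    rfl

/-- The graph on positions and its chains are fixed by the first `N * b` coins. The coins of the two
later rounds are therefore independent of the sets that they have to hit. -/
theorem coverState_determined {s : State} (ht : Tuned A n D L M K N q m₂ m₃ b s) :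
    DeterminedBy (N * b) fun ρ => ((coverState s ρ).vars, (coverState s ρ).arr) := by
  intro ρ ρ' hρ
  have h1 : Agree 0 (headProg.run (s.withCoins ρ)) (headProg.run (s.withCoins ρ')) := by
    refine Prog.agree_run_of_steady (ν := s.vars) rfl (by simp +decide) (fun _ _ => rfl)
      ⟨rfl, rfl, fun i hi => hρ i ?_⟩
    have hfl : headProg.flips s.vars = N * b := by
      rw [← ht.N_reg, ← ht.b_reg]
      simp [headProg, sampleProg, posLtProg, coverInit, countProg, orderProg, coverSteps, Prog.flips]
    omega
  have h2 := Prog.agree_run (p := coverLoop) rfl h1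
  exact Prod.ext h2.1 h2.2.1

attribute [irreducible] coverState

end Main

end Shortcut
namespace Shortcut

/-! ### Correctness with high probability. -/

section Main

variable {n D A L M K N q m₂ m₃ b : ℕ} {G : Digraph (Fin n)}

/-- The sampled positions. -/
def samplePos (N b : ℕ) (ρ : ℕ → Bool) (t : ℕ) : ℕ := coinVal (fun i => ρ (N * b + (t * b + i))) b % N

/-- The sampled chains. -/
def sampleChain (N m₂ b q : ℕ) (ρ : ℕ → Bool) (t : ℕ) : ℕ :=
  coinVal (fun i => ρ (N * b + m₂ * b + (t * b + i))) b % q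

/-- After the first `N * b` coins, the next `m₂ * b` select the positions and the following `m₃ * b`
the chains. A residue modulo `q` may exceed the number of chains, hence the hypothesis that it is
below `nch`. -/
theorem finProg_spec {s σ : State} {X : ℕ → Fin n} {ch : ℕ → ℕ} {nch : ℕ} {ρ : ℕ → Bool}
    (h : Ready G D s)
    (ht : Tuned A n D L M K N q m₂ m₃ b s) (hN : 0 < N) (hn : 0 < n)
    (f : Frame (.seq headProg coverLoop) (s.withCoins ρ) σ) (hX : IsSample X N σ)
    (hch : σ.arr 9 = ch) (hnch : σ.vars 22 = nch) (hchN : ∀ x < nch * K, ch x < N)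
    (hco : σ.coins = fun i => ρ (N * b + i)) :
    (∀ a c, Hop K nch (Nat.size n) ch a c → (finProg.run σ).arr 1 (X a * n + X c) ≠ 0) ∧
      ∀ t < m₂, ∀ t' < m₃, sampleChain N m₂ b q ρ t' < nch → ∀ j < K,
        Reach G (X (samplePos N b ρ t)) (X (ch (sampleChain N m₂ b q ρ t' * K + j))) →
        (∀ j' < j, ¬ Reach G (X (samplePos N b ρ t)) (X (ch (sampleChain N m₂ b q ρ t' * K + j')))) →
        (finProg.run σ).arr 1
          (X (samplePos N b ρ t) * n + X (ch (sampleChain N m₂ b q ρ t' * K + j))) ≠ 0 := by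
  have hP := (ht.two_pow_le hn).trans ht.P_reg.ge
  obtain ⟨a1, a2⟩ := sampleProg_spec (y := 8) (md := 2) (a := 11) (b := b) σ (by simp)
    (by simp) ((f.1 10 rfl).trans ht.b_reg) (hP.trans (f.1 11 rfl).ge)
  set s₁ := (sampleProg 8 2 11).run σ with hs₁
  have g₁ : Frame (sampleProg 8 2 11) σ s₁ := Prog.frame _ _
  obtain ⟨b1, -⟩ := sampleProg_spec (y := 9) (md := 4) (a := 12) (b := b) s₁ (by simp)
    (by simp) ((g₁.1 10 rfl).trans ((f.1 10 rfl).trans ht.b_reg))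
    (hP.trans ((f.1 11 rfl).ge.trans (g₁.1 11 rfl).ge))
  set s₂ := (sampleProg 9 4 12).run s₁ with hs₂
  have g₂ : Frame (sampleProg 9 4 12) s₁ s₂ := Prog.frame _ _
  have g : Frame (.seq (sampleProg 8 2 11) (sampleProg 9 4 12)) σ s₂ :=
    Prog.frame (.seq (sampleProg 8 2 11) (sampleProg 9 4 12)) σ
  rw [show σ.vars 8 = m₂ from (f.1 8 rfl).trans ht.m₂_reg,
    show σ.vars 2 = N from (f.1 2 rfl).trans ht.N_reg, hco] at a1
  rw [show σ.vars 8 = m₂ from (f.1 8 rfl).trans ht.m₂_reg, hco] at a2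
  rw [show s₁.vars 9 = m₃ from (g₁.1 9 rfl).trans ((f.1 9 rfl).trans ht.m₃_reg),
    show s₁.vars 4 = q from (g₁.1 4 rfl).trans ((f.1 4 rfl).trans ht.q_reg), a2] at b1
  have hY : ∀ t < m₂, s₂.arr 11 t = samplePos N b ρ t := fun t ht => by
    rw [g₂.2 11 rfl, a1 t ht]; rfl
  have hZ : ∀ t < m₃, s₂.arr 12 t = sampleChain N m₂ b q ρ t := fun t ht => by
    rw [b1 t ht, sampleChain]
    simp only [← Nat.add_assoc]
  have e0 : s₂.vars 0 = n := (g.1 0 rfl).trans ((f.1 0 rfl).trans h.n_eq)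
  have e3 : s₂.vars 3 = K := (g.1 3 rfl).trans ((f.1 3 rfl).trans ht.K_reg)
  have e7 : s₂.vars 7 = Nat.size n := (g.1 7 rfl).trans ((f.1 7 rfl).trans h.size_eq)
  have e8 : s₂.vars 8 = m₂ := (g.1 8 rfl).trans ((f.1 8 rfl).trans ht.m₂_reg)
  have e9 : s₂.vars 9 = m₃ := (g.1 9 rfl).trans ((f.1 9 rfl).trans ht.m₃_reg)
  have hX₂ : IsSample X N s₂ := hX.congr (g.2 4 rfl)
  have hG₂ : IsReach G s₂ := h.reach.congr ((g.2 2 rfl).trans (f.2 2 rfl))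
  set s₃ := hopProg.run s₂ with hs₃
  have g₃ : Frame hopProg s₂ s₃ := Prog.frame _ _
  have hrun : finProg.run σ = jumpProg.run s₃ := rfl
  rw [hrun]
  refine ⟨fun a c hac => ?_, fun t ht₁ t' ht' hnc j hj hr hmin => ?_⟩
  · have := hopProg_spec s₂ e0 e3 e7 ((g.1 22 rfl).trans hnch) hX₂ ((g.2 9 rfl).trans hch) hchN hac
    exact Prog.run_ne_zero jumpProg rfl s₃ this
  · exact jumpProg_spec (Y := samplePos N b ρ) (Z := sampleChain N m₂ b q ρ) s₃ ((g₃.1 0 rfl).trans e0) ((g₃.1 3 rfl).trans e3) ((g₃.1 8 rfl).trans e8)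
      ((g₃.1 9 rfl).trans e9) (hX₂.congr (g₃.2 4 rfl)) (hG₂.congr (g₃.2 2 rfl))
      ((g₃.2 9 rfl).trans ((g.2 9 rfl).trans hch)) (fun t ht => by rw [g₃.2 11 rfl, hY t ht])
      (fun t ht => by rw [g₃.2 12 rfl, hZ t ht]) (fun t _ => Nat.mod_lt _ hN) hchN ht₁ ht' hnc hj
      hr hmin

/-- The graph on positions after the computation of the chain cover. -/
def coverGraph (G : Digraph (Fin n)) (hn : 0 < n) (L K N : ℕ) (σ : State) : Digraph (Fin N) :=
  posGraph G (sampleVertex hn σ) L K N (σ.vars 22) (Nat.size n) (σ.arr 9)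

theorem postProg_run_of_le {s : State} (h : Ready G D s) (hD : 64 * Nat.size n ≤ D) (ρ : ℕ → Bool) :
    Prog.run (.ite (.sub (.mul (.const 64) (.var 7)) (.var 1)) allProg (mainProg A)) (s.withCoins ρ) =
      finProg.run (coverState ((preProg A).run s) ρ) := by
  have hc : ¬ (Expr.sub (.mul (.const 64) (.var 7)) (.var 1)).eval (s.withCoins ρ) ≠ 0 := by
    simp only [Expr.eval, (h.withCoins ρ).D_eq, (h.withCoins ρ).size_eq]; omega
  rw [Prog.run, if_neg hc, coverState, ← Prog.run_withCoins (by rfl)]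
  rfl

/-- The instance of `diam_le_of_hits` for the output: marked pairs that are reachable survive the
mask, and `IsParams.diam_bound` turns the resulting length into `D`. -/
theorem diam_le_of_samples {s : State} (h : Ready G D s) (hA : 1 ≤ A) (hn : 0 < n) (hDn : D ≤ n)
    (hD : 64 * Nat.size n ≤ D)
    (ht : Tuned A n D L M K N q m₂ m₃ b ((preProg A).run s)) (ρ : ℕ → Bool)
    (hit₁ : ∀ a c, Geo G L a c → ∃ j < N, ∃ x ∈ interval₁ G L a c,
      coinVal (fun i => ρ (j * b + i)) b % n = x)
    (hit₂ : ∀ i y, Geo (coverGraph G hn L K N (coverState ((preProg A).run s) ρ)) M i y →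
      ∃ t < m₂, ∃ x ∈ interval (coverGraph G hn L K N (coverState ((preProg A).run s) ρ)) M i y,
        samplePos N b ρ t = x)
    (hit₃ : ∀ z i, Geo (coverGraph G hn L K N (coverState ((preProg A).run s) ρ)) M z i →
      ∃ t < m₃, sampleChain N m₂ b q ρ t ∈
        touched (coverGraph G hn L K N (coverState ((preProg A).run s) ρ)) M K
          ((coverState ((preProg A).run s) ρ).vars 22)
          ((coverState ((preProg A).run s) ρ).arr 9) z i) :
    diam (G ⊔ ofEdges (outputEdges n ((postProg A).run (s.withCoins ρ)))) ≤ (D : ℕ∞) := by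
  have hr : Ready G D ((preProg A).run s) :=
    (preProg_spec h hA ((Nat.mul_pos (by simp) (Nat.size_pos.2 hn)).trans_le hD) hDn).1
  obtain ⟨hX, hval, hcov, hco⟩ := coverState_spec hr ht hn hD ρ
  obtain ⟨hop, jump⟩ := finProg_spec hr ht (ht.params.N_pos hA hn) hn (coverState_frame _ ρ) hX rfl rfl
    hcov.ch_lt hco
  have hpost := postProg_run_of_le (A := A) h hD ρ
  generalize coverState ((preProg A).run s) ρ = σ at *
  have hadj : ∀ u v, Reach G u v →
      (finProg.run σ).arr 1 (u * n + v) ≠ 0 →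
      Within (G ⊔ ofEdges (outputEdges n ((postProg A).run (s.withCoins ρ)))) 1 u v := by
    intro u v huv hm
    rcases eq_or_ne u v with rfl | hne
    · exact Within.refl _ _
    · refine HasWalk.within (HasWalk.one ?_)
      right
      refine (mem_outputEdges_postProg (h.withCoins ρ) u v).2 ⟨?_, huv, hne⟩
      rwa [hpost]
  have hle := sup_le_transClosure (A := A) (h.withCoins ρ)
  generalize outputEdges n ((postProg A).run (s.withCoins ρ)) = H at hadj hle ⊢
  refine (diam_le_of_hits ht.params.one_le_L (ht.params.K_le hDn) hcov le_sup_left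
    hle (fun a c hac hr => hadj _ _ hr (hop a c hac))
    (fun t h1 t' h2 h3 j hj hr hmin => hadj _ _ hr (jump t h1 t' h2 h3 j hj hr hmin))
    (fun a c hac => ?_) hit₂ hit₃).trans (by exact_mod_cast ht.params.diam_bound hn hD)
  obtain ⟨j, hj, x, hx, he⟩ := hit₁ a c hac
  refine ⟨j, hj, ?_⟩
  rwa [show sampleVertex hn σ j = x from
    Fin.ext ((hval j hj).trans he)]

-- The diameter can only be too large if one of the three rounds misses: the interval of a geodesic
-- of `G` (`B₁`), the interval of a geodesic on positions (`B₂`), or the chains touched by such a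
-- geodesic (`B₃`). These events are indexed by pairs of endpoints, and each has probability at most
-- `θ`.
open MeasureTheory in
theorem prob_diam_gt {c : ℕ} {s : State} (h : Ready G D s) (hD1 : 1 ≤ D) (hDn : D ≤ n) :
    fairCoins {ρ | ¬ diam (G ⊔ ofEdges (outputEdges n ((postProg (4 * c + 24)).run
      (s.withCoins ρ)))) ≤ (D : ℕ∞)} ≤ ENNReal.ofReal (1 / (n : ℝ) ^ c) := by
  classical
  have hn : 0 < n := hD1.trans hDn
  rcases lt_or_ge D (64 * Nat.size n) with hD | hD
  · have : {ρ | ¬ diam (G ⊔ ofEdges (outputEdges n ((postProg (4 * c + 24)).run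
      (s.withCoins ρ)))) ≤ (D : ℕ∞)} = ∅ := by
      ext ρ
      simpa using diam_le_of_all (h.withCoins ρ) hD1 hD
    rw [this]
    simp
  have hn64 : 64 ≤ n := by
    have : 1 ≤ Nat.size n := Nat.size_pos.2 hn
    omega
  obtain ⟨hr, L, M, K, N, q, m₂, m₃, b, ht⟩ := preProg_spec (A := 4 * c + 24) h (by omega) hD1 hDn
  set s₀ := (preProg (4 * c + 24)).run s with hs₀
  have hp := ht.params
  have hN : 0 < N := hp.N_pos (by omega) hn
  have hM : 0 < M := by
    have := hp.le_M hD
    have : 1 ≤ Nat.size n := Nat.size_pos.2 hn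
    omega
  have hb := ht.le_two_pow
  have hq : 0 < q := by rw [hp.q_eq]; exact Nat.succ_pos _
  have hqN : q ≤ n + N := by
    rw [hp.q_eq]; have := Nat.div_le_self N K; omega
  set θ := ENNReal.ofReal (Real.exp (-(((4 * c + 24) * Nat.size n : ℕ) / 2))) with hθ
  let S : (ℕ → Bool) → Digraph (Fin N) := fun ρ => coverGraph G hn L K N (coverState s₀ ρ)
  have hS : DeterminedBy (N * b) S := fun ρ ρ' hρ => by
    have := coverState_determined ht ρ ρ' hρ
    simp only [Prod.mk.injEq] at this
    have hX : sampleVertex hn (coverState s₀ ρ) = sampleVertex hn (coverState s₀ ρ') := by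
      funext i
      exact Fin.ext (congrArg (fun a : ℕ → ℕ → ℕ => a 4 i % n) this.2)
    simp only [S, coverGraph, hX, this.1, this.2]
  let T : Fin N → Fin N → (ℕ → Bool) → Finset ℕ := fun z i ρ =>
    touched (S ρ) M K ((coverState s₀ ρ).vars 22) ((coverState s₀ ρ).arr 9) z i
  have hT : ∀ z i, DeterminedBy (N * b) (T z i) := fun z i ρ ρ' hρ => by
    have := coverState_determined ht ρ ρ' hρ
    simp only [Prod.mk.injEq] at this
    simp only [T, this.1, this.2, hS ρ ρ' hρ]
  let I₁ : Fin n → Fin n → Finset ℕ := fun a v =>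
    (Finset.univ.filter fun x => x ∈ interval₁ G L a v).map Fin.valEmbedding
  let I₂ : Fin N → Fin N → (ℕ → Bool) → Finset ℕ := fun i y ρ =>
    (Finset.univ.filter fun x => x ∈ interval (S ρ) M i y).map Fin.valEmbedding
  let B₁ : Fin n × Fin n → Set (ℕ → Bool) := fun p =>
    {ρ | Geo G L p.1 p.2 ∧ ∀ j < N, coinVal (fun i => ρ (0 + (j * b + i))) b % n ∉ I₁ p.1 p.2}
  let B₂ : Fin N × Fin N → Set (ℕ → Bool) := fun p =>
    {ρ | Geo (S ρ) M p.1 p.2 ∧ ∀ t < m₂, samplePos N b ρ t ∉ I₂ p.1 p.2 ρ}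
  let B₃ : Fin N × Fin N → Set (ℕ → Bool) := fun p =>
    {ρ | Geo (S ρ) M p.1 p.2 ∧ ∀ t < m₃, sampleChain N m₂ b q ρ t ∉ T p.1 p.2 ρ}
  have hB₁ : ∀ p, fairCoins (B₁ p) ≤ θ := fun p => by
    refine fairCoins_miss_le_of_card (F := fun _ => Geo G L p.1 p.2) (S := fun _ => I₁ p.1 p.2)
      (fun _ _ _ => rfl) (fun _ _ _ => rfl) hn (by omega) (fun _ _ => ?_) (fun _ hg => ?_)
    · intro x hx
      obtain ⟨y, -, rfl⟩ := Finset.mem_map.1 hx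
      exact Finset.mem_range.2 y.2
    · refine hp.hits₁.trans (Nat.mul_le_mul_left _ ?_)
      rw [Finset.card_map]
      exact hg.le_card_interval₁ fun x hx => by simpa using hx
  have hB₂ : ∀ p, fairCoins (B₂ p) ≤ θ := fun p => by
    refine fairCoins_miss_le_of_card (F := fun ρ => Geo (S ρ) M p.1 p.2) (S := I₂ p.1 p.2)
      (fun ρ ρ' hρ => by simp only [hS ρ ρ' hρ]) (fun ρ ρ' hρ => by simp only [I₂, hS ρ ρ' hρ]) hN (by omega)
      (fun ρ _ => ?_) (fun ρ hg => ?_)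
    · intro x hx
      obtain ⟨y, -, rfl⟩ := Finset.mem_map.1 hx
      exact Finset.mem_range.2 y.2
    · refine (hp.hits₂ hM).trans (Nat.mul_le_mul_left _ ?_)
      rw [Finset.card_map]
      exact hg.le_card_interval fun x hx => by simpa using hx
  have hB₃ : ∀ p, fairCoins (B₃ p) ≤ θ := fun p => by
    refine fairCoins_miss_le_of_card (u := N * b + m₂ * b) (F := fun ρ => Geo (S ρ) M p.1 p.2)
      (S := T p.1 p.2) (fun ρ ρ' hρ => by simp only [hS ρ ρ' fun i hi => hρ i (by omega)])
      (fun ρ ρ' hρ => hT _ _ ρ ρ' fun i hi => hρ i (by omega)) hq (by omega)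
      (fun ρ _ => ?_) (fun ρ hg => ?_)
    · intro x hx
      have h1 := (mem_touched.1 hx).1
      obtain ⟨-, -, hcov, -⟩ := coverState_spec hr ht hn hD ρ
      have h2 := hcov.card_le
      -- The chains have `K` elements each, so `nch * K ≤ N < q * K`: every chain number is a
      -- residue modulo `q`.
      have h3 : (coverState s₀ ρ).vars 22 < q := by
        have := hp.lt_cap hn hD
        exact lt_of_mul_lt_mul_right (h2.trans_lt this) (Nat.zero_le _)
      exact Finset.mem_range.2 (h1.trans h3)
    · obtain ⟨-, -, hcov, -⟩ := coverState_spec hr ht hn hD ρ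
      exact hp.hits₃ hM (le_card_touched hcov (hp.K_le hDn) hg)
  have hsub : {ρ | ¬ diam (G ⊔ ofEdges (outputEdges n ((postProg (4 * c + 24)).run
      (s.withCoins ρ)))) ≤ (D : ℕ∞)} ⊆
      (⋃ p ∈ Finset.univ, B₁ p) ∪ ((⋃ p ∈ Finset.univ, B₂ p) ∪ ⋃ p ∈ Finset.univ, B₃ p) := by
    intro ρ hρ
    by_contra hc
    simp only [Set.mem_union, Set.mem_iUnion, Finset.mem_univ, exists_true_left, not_or, not_exists,
      Prod.forall] at hc
    obtain ⟨h1, h2, h3⟩ := hc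
    apply hρ
    clear hρ
    refine diam_le_of_samples h (by omega) hn hDn hD ht ρ (fun a v hg => ?_) (fun i y hg => ?_)
      (fun z i hg => ?_)
    · by_contra hno
      refine h1 a v ⟨hg, fun j hj hmem => hno ?_⟩
      obtain ⟨x, hx, he⟩ := Finset.mem_map.1 hmem
      refine ⟨j, hj, x, by simpa using hx, ?_⟩
      simp only [Nat.zero_add] at he
      exact he.symm
    · by_contra hno
      refine h2 i y ⟨hg, fun j hj hmem => hno ?_⟩
      obtain ⟨x, hx, he⟩ := Finset.mem_map.1 hmem
      exact ⟨j, hj, x, by simpa using hx, he.symm⟩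
    · by_contra hno
      exact h3 z i ⟨hg, fun j hj hmem => hno ⟨j, hj, hmem⟩⟩
  have hcount : fairCoins {ρ | ¬ diam (G ⊔ ofEdges (outputEdges n ((postProg (4 * c + 24)).run
      (s.withCoins ρ)))) ≤ (D : ℕ∞)} ≤ ((n * n + 2 * (N * N) : ℕ) : ENNReal) * θ := by
    refine (measure_mono hsub).trans ((measure_union_le _ _).trans ?_)
    refine (add_le_add ((measure_biUnion_finset_le _ _).trans (Finset.sum_le_card_nsmul _ _ θ
      fun p _ => hB₁ p)) ((measure_union_le _ _).trans (add_le_add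
      ((measure_biUnion_finset_le _ _).trans (Finset.sum_le_card_nsmul _ _ θ fun p _ => hB₂ p))
      ((measure_biUnion_finset_le _ _).trans (Finset.sum_le_card_nsmul _ _ θ fun p _ => hB₃ p))))).trans
      (le_of_eq ?_)
    simp only [Finset.card_univ, Fintype.card_prod, Fintype.card_fin, nsmul_eq_mul]
    push_cast
    ring
  refine hcount.trans ?_
  rw [hθ, ← ENNReal.ofReal_natCast, ← ENNReal.ofReal_mul (Nat.cast_nonneg _)]
  exact ENNReal.ofReal_le_ofReal (union_bound hp hn64)

end Main

end Shortcut
namespace Shortcut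

/-! ### The number of shortcut edges. -/

section SizeBound

variable {n D A L M K N q m₂ m₃ b : ℕ} {G : Digraph (Fin n)}

theorem Sparse.congr {a m : ℕ} {s s' : State} (h : Sparse a m s) (ha : s'.arr a = s.arr a) :
    Sparse a m s' := by
  obtain ⟨T, hT, h⟩ := h
  exact ⟨T, hT, fun i hi => by rw [ha, h i hi]⟩

/-- Hops take two stores for each chain element and exponent, and there are at most `N` chain
elements; jumps take one store for each sampled position and sampled chain. Masking can only remove
edges. -/
theorem card_outputEdges_postProg {s : State} (h : Ready G D s) (hA : 1 ≤ A) (hD1 : 1 ≤ D)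
    (hDn : D ≤ n) :
    (D < 64 * Nat.size n ∧ (outputEdges n ((postProg A).run s)).card ≤ n * n) ∨
      (64 * Nat.size n ≤ D ∧ ∃ L M K N q m₂ m₃, IsParams A n D L M K N q m₂ m₃ ∧
        (outputEdges n ((postProg A).run s)).card ≤ 2 * (N * Nat.size n) + m₂ * m₃) := by
  have h0 : Sparse 1 0 s := ⟨∅, by simp, fun i _ => h.zero 1 (by simp) i⟩
  set σ := Prog.run (.ite (.sub (.mul (.const 64) (.var 7)) (.var 1)) allProg (mainProg A)) s with hσ
  have hsub : outputEdges n ((postProg A).run s) ⊆ outputEdges n σ := by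
    rintro ⟨u, v⟩ huv
    simp only [outputEdges, Finset.mem_filter, Finset.mem_univ, true_and]
    exact ((mem_outputEdges_postProg h u v).1 huv).1
  rcases lt_or_ge D (64 * Nat.size n) with hD | hD
  · refine .inl ⟨hD, (Finset.card_le_card hsub).trans (Sparse.card_outputEdges_le ?_)⟩
    have hc : (Expr.sub (.mul (.const 64) (.var 7)) (.var 1)).eval s ≠ 0 := by
      simp only [Expr.eval, h.D_eq, h.size_eq]; omega
    rw [hσ, Prog.run, if_pos hc]
    refine (Prog.sparse_run (ν := s.vars) (p := allProg) (by decide) s (fun _ _ => rfl) h0).mono ?_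
    simp [allProg, Prog.fills, Expr.isZero, h.n_eq]
  · obtain ⟨hr, L, M, K, N, q, m₂, m₃, b, ht⟩ := preProg_spec (A := A) h hA hD1 hDn
    refine .inr ⟨hD, L, M, K, N, q, m₂, m₃, ht.params,
      (Finset.card_le_card hsub).trans (Sparse.card_outputEdges_le ?_)⟩
    have hn : 0 < n := hD1.trans hDn
    obtain ⟨-, -, hcov, -⟩ := coverState_spec hr ht hn hD s.coins
    have f := coverState_frame ((preProg A).run s) s.coins
    have hrun : σ = finProg.run (coverState ((preProg A).run s) s.coins) :=
      postProg_run_of_le h hD s.coins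
    rw [hrun]
    have e1 : (coverState ((preProg A).run s) s.coins).arr 1 = s.arr 1 :=
      (f.2 1 rfl).trans (Prog.run_arr _ rfl s)
    generalize coverState ((preProg A).run s) s.coins = τ at *
    set τ₁ := (Prog.seq (sampleProg 8 2 11) (sampleProg 9 4 12)).run τ with hτ₁
    have g : Frame (.seq (sampleProg 8 2 11) (sampleProg 9 4 12)) τ τ₁ := Prog.frame _ _
    have h1 : Sparse 1 0 τ₁ := h0.congr ((g.2 1 rfl).trans e1)
    have h2 := Prog.sparse_run (ν := τ₁.vars) (p := .seq hopProg jumpProg) (by decide) τ₁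
      (fun _ _ => rfl) h1
    refine Sparse.mono (m := 0 + Prog.fills 1 τ₁.vars (.seq hopProg jumpProg)) h2 ?_
    have e22 : τ₁.vars 22 * τ₁.vars 3 ≤ N := by
      rw [g.1 22 rfl, g.1 3 rfl, f.1 3 rfl]
      rw [show ((preProg A).run s |>.withCoins s.coins).vars 3 = K from ht.K_reg]
      exact hcov.card_le
    have e7 : τ₁.vars 7 = Nat.size n := (g.1 7 rfl).trans ((f.1 7 rfl).trans hr.size_eq)
    have e8 : τ₁.vars 8 = m₂ := (g.1 8 rfl).trans ((f.1 8 rfl).trans ht.m₂_reg)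
    have e9 : τ₁.vars 9 = m₃ := (g.1 9 rfl).trans ((f.1 9 rfl).trans ht.m₃_reg)
    have hf : Prog.fills 1 τ₁.vars (.seq hopProg jumpProg) =
        2 * (τ₁.vars 22 * τ₁.vars 3 * τ₁.vars 7) + τ₁.vars 8 * τ₁.vars 9 := by
      simp [hopProg, hopInner, jumpProg, Prog.find, Prog.fills, Expr.isZero]
      ring
    rw [Nat.zero_add, hf, e7, e8, e9]
    exact Nat.add_le_add_right (Nat.mul_le_mul_left _ (Nat.mul_le_mul_right _ e22)) _

/-- From `2 ^ (Nat.size n - 1) ≤ n` and `log 2 > 1 / 2`. -/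
theorem size_le_log {n : ℕ} (hn : 1 ≤ n) : (Nat.size n : ℝ) ≤ 2 * (1 + Real.log n) := by
  obtain ⟨k, hk⟩ : ∃ k, Nat.size n = k + 1 :=
    Nat.exists_eq_succ_of_ne_zero (by rw [Ne, Nat.size_eq_zero]; omega)
  have h1 : 2 ^ k ≤ n := Nat.lt_size.1 (by omega)
  have h2 : (2 : ℝ) ^ k ≤ n := by exact_mod_cast h1
  have h3 := Real.log_le_log (by positivity) h2
  rw [Real.log_pow] at h3
  have h4 := Real.log_two_gt_d9
  rw [hk]
  push_cast
  have : (0 : ℝ) ≤ k := Nat.cast_nonneg k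
  nlinarith

/-- With `y = √(n / D)`, the two expressions are `y³ * (y / D)` and `y³`, and `D ≤ n^{1/3}` means `D
≤ y`. So the size bound is the larger of the two, and later estimates may use whichever is
convenient. -/
theorem sizeBound_ge {n D : ℕ} (hD : 1 ≤ D) (hDn : D ≤ n) :
    (n : ℝ) ^ 2 / (D : ℝ) ^ 3 ≤ sizeBound n D ∧
      Real.sqrt (n / D) ^ 3 ≤ sizeBound n D := by
  have hD0 : (0 : ℝ) < D := by exact_mod_cast hD
  have hn0 : (0 : ℝ) < n := by exact_mod_cast hD.trans hDn
  set y := Real.sqrt (n / D) with hy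
  have hy2 : y ^ 2 = n / D := Real.sq_sqrt (by positivity)
  have hy0 : 0 < y := Real.sqrt_pos.2 (by positivity)
  have hyD : (n : ℝ) = y ^ 2 * D := by rw [hy2]; field_simp
  have hcube : ((D : ℝ) ≤ (n : ℝ) ^ (1 / 3 : ℝ)) ↔ (D : ℝ) ^ 3 ≤ n := by
    have h1 : ((n : ℝ) ^ (1 / 3 : ℝ)) ^ 3 = n := by
      rw [← Real.rpow_natCast, ← Real.rpow_mul hn0.le]; norm_num
    constructor
    · intro h
      rw [← h1]; exact pow_le_pow_left₀ hD0.le h 3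
    · intro h
      rw [← h1] at h
      exact le_of_pow_le_pow_left₀ (by norm_num) (by positivity) h
  have hpow : ((n : ℝ) / D) ^ (3 / 2 : ℝ) = y ^ 3 := by
    rw [← hy2, ← Real.rpow_natCast, ← Real.rpow_natCast, ← Real.rpow_mul hy0.le]; norm_num
  have hq : (n : ℝ) ^ 2 / (D : ℝ) ^ 3 = y ^ 3 * (y / D) := by
    rw [hyD]; field_simp
  have hn3 : (D : ℝ) ^ 3 ≤ n ↔ (D : ℝ) ≤ y := by
    rw [hyD, show (D : ℝ) ^ 3 = D ^ 2 * D by ring, mul_le_mul_iff_left₀ hD0]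
    exact pow_le_pow_iff_left₀ hD0.le hy0.le (by norm_num)
  rw [sizeBound, hpow]
  split_ifs with h <;> rw [hcube, hn3] at h
  · refine ⟨le_rfl, ?_⟩
    rw [hq]
    exact le_mul_of_one_le_right (by positivity) ((one_le_div hD0).2 h)
  · refine ⟨?_, le_rfl⟩
    rw [hq]
    exact mul_le_of_le_one_right (by positivity) ((div_le_one hD0).2 (not_le.1 h).le)

theorem half_le_div {a b : ℕ} (hb : 0 < b) (h : b ≤ a) : (a : ℝ) / b ≤ 2 * ((a / b : ℕ) : ℝ) := by
  have h1 := lt_succ_div_mul a b hb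
  have h2 := Nat.div_pos h hb
  have h3 : a ≤ 2 * (a / b) * b := h1.le.trans (Nat.mul_le_mul_right _ (by omega))
  rw [div_le_iff₀ (by exact_mod_cast hb)]
  exact_mod_cast h3

-- Up to logarithms the count is `N + N² / M³`, with `N ≈ n / L` and `M ≈ D / L`. Its first term is
-- at most about `y³` because `L` is at least about `D / (y log n)`, and its second is about `n² L /
-- D³` (`hLs`).
set_option maxHeartbeats 1000000 in
theorem IsParams.card_le (hp : IsParams A n D L M K N q m₂ m₃) (hA : 1 ≤ A) (hDn : D ≤ n)
    (hn : 1 ≤ n) (hD : 64 * Nat.size n ≤ D) :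
    (2 * (N * Nat.size n) + m₂ * m₃ : ℝ) ≤
      (384 * A + 1536 * A ^ 3 + 1179648 * A ^ 4) * (Nat.size n : ℝ) ^ 5 * sizeBound n D := by
  obtain ⟨m, -, hm1, hm2, hL⟩ := hp.root
  have hl : 1 ≤ Nat.size n := Nat.size_pos.2 hn
  have hLl := hp.L_mul_le hD
  have hL1 := hp.one_le_L
  have hM4 := hp.le_M hD
  obtain ⟨hs1, hs2⟩ := sizeBound_ge (n := n) (D := D) (by omega) hDn
  set l := Nat.size n
  set s := sizeBound n D
  have hD0 : (0 : ℝ) < D := by exact_mod_cast (show 0 < D by omega)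
  have hn0 : (0 : ℝ) < n := by exact_mod_cast hn
  have hL0 : (0 : ℝ) < L := by exact_mod_cast hL1
  have hl0 : (1 : ℝ) ≤ l := by exact_mod_cast hl
  have hA0 : (1 : ℝ) ≤ A := by exact_mod_cast hA
  have hM0 : (0 : ℝ) < M := by exact_mod_cast (show 0 < M by omega)
  set y := Real.sqrt (n / D) with hy
  have hy2 : y ^ 2 = n / D := Real.sq_sqrt (by positivity)
  have hy1 : 1 ≤ y := by
    rw [hy, Real.one_le_sqrt, one_le_div hD0]; exact_mod_cast hDn
  have hyD : (n : ℝ) = y ^ 2 * D := by rw [hy2]; field_simp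
  have hmy : (m : ℝ) ≤ y := by
    have : (m : ℝ) * m * D ≤ n := by exact_mod_cast hm2
    rw [hyD, mul_le_mul_iff_left₀ hD0] at this
    exact le_of_pow_le_pow_left₀ (n := 2) (by norm_num) (by linarith) (by rw [pow_two]; exact this)
  have hym : y ≤ m + 1 := by
    have : (n : ℝ) ≤ (m + 1) * (m + 1) * D := by exact_mod_cast hm1.le
    rw [hyD, mul_le_mul_iff_left₀ hD0] at this
    exact le_of_pow_le_pow_left₀ (n := 2) (by norm_num) (by positivity)
      (by rw [pow_two ((m : ℝ) + 1)]; exact this)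
  set M0 : ℕ := m + 1 + 4 * l with hM0d
  have hM0y : (M0 : ℝ) ≤ 6 * l * y := by
    rw [hM0d]; push_cast
    nlinarith
  have hyM0 : y ≤ M0 := by
    rw [hM0d]; push_cast
    linarith
  have hLn : 32 * L ≤ D := by
    calc 32 * L = L * (32 * 1) := by ring
      _ ≤ L * (32 * l) := by gcongr
      _ ≤ D := hLl
  -- the sampling distance from below and from above
  have hDL : (D : ℝ) ≤ 16 * M0 * L := by
    have : D ≤ 16 * M0 * L := by
      have h1 := lt_succ_div_mul D (8 * M0) (by omega)
      calc D ≤ (D / (8 * M0) + 1) * (8 * M0) := h1.le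
        _ ≤ (2 * L) * (8 * M0) := Nat.mul_le_mul_right _ (by omega)
        _ = _ := by ring
    exact_mod_cast this
  have hnL : (n : ℝ) / L ≤ 96 * l * s := by
    rw [div_le_iff₀ hL0]
    calc (n : ℝ) = y ^ 2 * D := hyD
      _ ≤ y ^ 2 * (16 * (6 * l * y) * L) := by
          refine mul_le_mul_of_nonneg_left (hDL.trans ?_) (by positivity)
          gcongr
      _ = 96 * l * y ^ 3 * L := by ring
      _ ≤ 96 * l * s * L := by gcongr
  -- For `L = 1` this is the first expression in the size bound. Otherwise `L * y ≤ D` reduces it to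
  -- `y³`.
  have hLs : (n : ℝ) ^ 2 * L / D ^ 3 ≤ s := by
    rcases le_total (D / (8 * M0)) 1 with h1 | h1
    · rw [hL, max_eq_left h1, Nat.cast_one, mul_one]; exact hs1
    · refine le_trans ?_ hs2
      have : L * (8 * M0) ≤ D := by
        rw [hL, max_eq_right h1]; exact Nat.div_mul_le_self _ _
      have hc : (L : ℝ) * (8 * M0) ≤ D := by exact_mod_cast this
      have h2 : (L : ℝ) * y ≤ D := by
        have : (L : ℝ) * y ≤ L * M0 := by gcongr
        nlinarith [mul_pos hL0 (show (0 : ℝ) < M0 by linarith)]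
      rw [div_le_iff₀ (by positivity), hyD]
      calc (y ^ 2 * D) ^ 2 * L = y ^ 3 * D ^ 2 * (L * y) := by ring
        _ ≤ y ^ 3 * D ^ 2 * D := by gcongr
        _ = y ^ 3 * D ^ 3 := by ring
  -- the numbers of samples
  have hNu : (N : ℝ) ≤ 2 * A * l * (n / L) := by
    have h1 : ((n / L : ℕ) : ℝ) ≤ n / L := Nat.cast_div_le
    have h2 : (1 : ℝ) ≤ n / L := by
      rw [one_le_div hL0]; exact_mod_cast (show L ≤ n by omega)
    rw [hp.N_eq]; push_cast
    calc (A : ℝ) * l * (((n / L : ℕ) : ℝ) + 1) ≤ A * l * (n / L + n / L) := by gcongr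
      _ = _ := by ring
  have hNM : (M : ℝ) ≤ N := by
    have : M ≤ N := by
      rw [hp.M_eq, hp.N_eq]
      have h1 : D / (8 * L) ≤ n / L := Nat.div_le_div hDn (by omega) (by omega)
      calc D / (8 * L) ≤ 1 * (n / L + 1) := by omega
        _ ≤ _ := Nat.mul_le_mul_right _ (Nat.mul_pos hA hl)
    exact_mod_cast this
  have hMD : (D : ℝ) ≤ 16 * L * M := by
    have := half_le_div (a := D) (b := 8 * L) (by omega) (by omega)
    rw [← hp.M_eq, div_le_iff₀ (by positivity)] at this
    push_cast at this
    linarith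
  have hm₂ : (m₂ : ℝ) ≤ 2 * A * l * (N / M) := by
    have h1 : ((N / M : ℕ) : ℝ) ≤ N / M := Nat.cast_div_le
    have h2 : (1 : ℝ) ≤ N / M := by rwa [one_le_div hM0]
    rw [hp.m₂_eq]; push_cast
    calc (A : ℝ) * l * (((N / M : ℕ) : ℝ) + 1) ≤ A * l * (N / M + N / M) := by gcongr
      _ = _ := by ring
  have hKM : (M : ℝ) ≤ 8 * K := by
    have : M ≤ 8 * K := by rw [hp.K_eq]; omega
    exact_mod_cast this
  have hK0 : (0 : ℝ) < K := by linarith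
  have hq : (q : ℝ) ≤ 9 * (N / M) := by
    have h1 : ((N / K : ℕ) : ℝ) ≤ N / K := Nat.cast_div_le
    have h2 : (1 : ℝ) ≤ N / M := by rwa [one_le_div hM0]
    have h3 : (N : ℝ) / K ≤ 8 * (N / M) := by
      rw [← mul_div_assoc, div_le_div_iff₀ hK0 hM0]
      nlinarith [Nat.cast_nonneg (α := ℝ) N]
    rw [hp.q_eq]; push_cast
    linarith
  have hm₃ : (m₃ : ℝ) ≤ 4 * A * l ^ 2 * (9 * (N / M) / M + 1) := by
    have h1 : ((q / M : ℕ) : ℝ) ≤ q / M := Nat.cast_div_le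
    rw [hp.m₃_eq]; push_cast
    calc (2 : ℝ) * A * (l * (l + 1)) * (((q / M : ℕ) : ℝ) + 1)
        ≤ 2 * A * (l * (l + l)) * (9 * (N / M) / M + 1) := by
          have : (q : ℝ) / M ≤ 9 * (N / M) / M := by gcongr
          gcongr
          linarith
      _ = _ := by ring
  have hNs : (N : ℝ) ≤ 192 * A * l ^ 2 * s := by
    calc (N : ℝ) ≤ 2 * A * l * (96 * l * s) := hNu.trans (by gcongr)
      _ = _ := by ring
  have hs0 : 0 ≤ s := (by positivity : (0 : ℝ) ≤ y ^ 3).trans hs2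
  -- Inserting `N ≤ 2 A l n / L` and `M ≥ D / (16 L)` leaves the quantity `n² L / D³` from `hLs`.
  have hN2 : (N : ℝ) ^ 2 / M ^ 3 ≤ 16384 * A ^ 2 * l ^ 2 * s := by
    rw [div_le_iff₀ (by positivity)]
    have h1 : (D : ℝ) ^ 3 ≤ (16 * L * M) ^ 3 := pow_le_pow_left₀ hD0.le hMD 3
    have h2 : (n : ℝ) ^ 2 * L ≤ s * D ^ 3 := by rwa [div_le_iff₀ (by positivity)] at hLs
    have h3 : (n : ℝ) ^ 2 * L ≤ s * (16 * L * M) ^ 3 := h2.trans (by gcongr)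
    have h4 : ((n : ℝ) / L) ^ 2 ≤ 4096 * s * M ^ 3 := by
      rw [div_pow, div_le_iff₀ (by positivity)]
      have : (n : ℝ) ^ 2 * L ≤ 4096 * s * M ^ 3 * L ^ 2 * L := h3.trans (le_of_eq (by ring))
      exact le_of_mul_le_mul_right this hL0
    calc (N : ℝ) ^ 2 ≤ (2 * A * l * (n / L)) ^ 2 := pow_le_pow_left₀ (by positivity) hNu 2
      _ = 4 * A ^ 2 * l ^ 2 * (n / L) ^ 2 := by ring
      _ ≤ 4 * A ^ 2 * l ^ 2 * (4096 * s * M ^ 3) := by gcongr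
      _ = _ := by ring
  have hNM1 : (N : ℝ) / M ≤ N := div_le_self (by positivity) (by
    have : 1 ≤ M := by omega
    exact_mod_cast this)
  have hNM3 : (N : ℝ) ^ 2 / M ^ 3 = (N / M) * (N / M) / M := by
    rw [div_mul_div_comm, div_div, pow_two, pow_succ, pow_two]
  have hprod : (m₂ : ℝ) * m₃ ≤ 8 * A ^ 2 * l ^ 3 * N + 72 * A ^ 2 * l ^ 3 * (N ^ 2 / M ^ 3) := by
    have h1 : (m₂ : ℝ) * m₃ ≤ (2 * A * l * (N / M)) * (4 * A * l ^ 2 * (9 * (N / M) / M + 1)) :=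
      mul_le_mul hm₂ hm₃ (Nat.cast_nonneg _) ((Nat.cast_nonneg _).trans hm₂)
    have h2 : 8 * (A : ℝ) ^ 2 * l ^ 3 * (N / M) ≤ 8 * A ^ 2 * l ^ 3 * N :=
      mul_le_mul_of_nonneg_left hNM1 (by positivity)
    rw [hNM3]
    generalize (N : ℝ) / M = x at h1 h2 ⊢
    have h3 : 2 * (A : ℝ) * l * x * (4 * A * l ^ 2 * (9 * x / M + 1)) =
        8 * A ^ 2 * l ^ 3 * x + 72 * A ^ 2 * l ^ 3 * (x * x / M) := by ring
    linarith
  have hlp : (l : ℝ) ^ 3 ≤ l ^ 5 := pow_le_pow_right₀ hl0 (by norm_num)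
  calc (2 * (N * l) + m₂ * m₃ : ℝ)
      ≤ 2 * (192 * A * l ^ 2 * s * l) + (8 * A ^ 2 * l ^ 3 * (192 * A * l ^ 2 * s) +
          72 * A ^ 2 * l ^ 3 * (16384 * A ^ 2 * l ^ 2 * s)) := by
        refine add_le_add (by gcongr) (hprod.trans (by gcongr))
    _ = (384 * A * l ^ 3 + 1536 * A ^ 3 * l ^ 5 + 1179648 * A ^ 4 * l ^ 5) * s := by ring
    _ ≤ (384 * A * l ^ 5 + 1536 * A ^ 3 * l ^ 5 + 1179648 * A ^ 4 * l ^ 5) * s := by gcongr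
    _ = _ := by ring

/-- For `D < 64 * Nat.size n` all `n²` pairs are allowed, since `n² ≤ s D³`; this contributes `64³ =
262144`. The factor `32 = 2⁵` comes from replacing `Nat.size n` by `2 (1 + log n)`. -/
theorem exists_card_le (hA : 1 ≤ A) : ∃ C : ℝ, 0 ≤ C ∧ ∀ {n D : ℕ} {G : Digraph (Fin n)} {s : State},
    Ready G D s → 1 ≤ D → D ≤ n → ((outputEdges n ((postProg A).run s)).card : ℝ) ≤
      C * sizeBound n D * (1 + Real.log n) ^ 5 := by
  refine ⟨32 * (262144 + (384 * A + 1536 * A ^ 3 + 1179648 * A ^ 4)), by positivity, ?_⟩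
  intro n D G s h hD1 hDn
  have hn : 1 ≤ n := hD1.trans hDn
  obtain ⟨hs1, hs2⟩ := sizeBound_ge hD1 hDn
  have hs0 : 0 ≤ sizeBound n D := (by positivity : (0 : ℝ) ≤ Real.sqrt (n / D) ^ 3).trans hs2
  have hl0 : (1 : ℝ) ≤ Nat.size n := by exact_mod_cast Nat.size_pos.2 hn
  have hD0 : (0 : ℝ) < D := by exact_mod_cast hD1
  suffices hmain : ((outputEdges n ((postProg A).run s)).card : ℝ) ≤
      (262144 + (384 * A + 1536 * A ^ 3 + 1179648 * A ^ 4)) * (Nat.size n : ℝ) ^ 5 * sizeBound n D by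
    have hl : (Nat.size n : ℝ) ^ 5 ≤ (2 * (1 + Real.log n)) ^ 5 :=
      pow_le_pow_left₀ (by positivity) (size_le_log hn) 5
    calc _ ≤ _ := hmain
      _ ≤ (262144 + (384 * A + 1536 * A ^ 3 + 1179648 * A ^ 4)) * (2 * (1 + Real.log n)) ^ 5 *
          sizeBound n D := by gcongr
      _ = _ := by ring
  rcases card_outputEdges_postProg (A := A) h hA hD1 hDn with ⟨hD, hc⟩ | ⟨hD, L, M, K, N, q, m₂, m₃, hp, hc⟩
  · have h1 : (n : ℝ) ^ 2 ≤ sizeBound n D * D ^ 3 := by rwa [div_le_iff₀ (by positivity)] at hs1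
    have h2 : (D : ℝ) ≤ 64 * Nat.size n := by exact_mod_cast hD.le
    have h3 : (Nat.size n : ℝ) ^ 3 ≤ (Nat.size n : ℝ) ^ 5 := pow_le_pow_right₀ hl0 (by norm_num)
    calc ((outputEdges n ((postProg A).run s)).card : ℝ) ≤ ((n * n : ℕ) : ℝ) := by exact_mod_cast hc
      _ = (n : ℝ) ^ 2 := by push_cast; ring
      _ ≤ sizeBound n D * (64 * Nat.size n) ^ 3 := h1.trans (by gcongr)
      _ = 262144 * (Nat.size n : ℝ) ^ 3 * sizeBound n D := by ring
      _ ≤ 262144 * (Nat.size n : ℝ) ^ 5 * sizeBound n D := by gcongr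
      _ ≤ _ := by
        refine mul_le_mul_of_nonneg_right (mul_le_mul_of_nonneg_right ?_ (by positivity)) hs0
        have : (0 : ℝ) ≤ 384 * A + 1536 * A ^ 3 + 1179648 * A ^ 4 := by positivity
        linarith
  · have h1 : ((outputEdges n ((postProg A).run s)).card : ℝ) ≤
        (2 * (N * Nat.size n) + m₂ * m₃ : ℝ) := by exact_mod_cast hc
    refine (h1.trans (hp.card_le hA hDn hn hD)).trans ?_
    refine mul_le_mul_of_nonneg_right (mul_le_mul_of_nonneg_right ?_ (by positivity)) hs0
    linarith

end SizeBound

end Shortcut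
namespace Shortcut

/-! ### The running time after the computation of reachability. -/

section PostTime

theorem Runs.ite_true {v a W g T : ℕ} {c c' : Com} {e : Expr} {s s' : State}
    (he : e.safe v a = true) (hW : 1 + e.wt ≤ W) (h0 : e.eval s ≠ 0) (h : Runs v a W g c s T s') :
    Runs v a W g (.ite e c c') s (T + 1) s' := by
  intro M Z hM hZ
  rw [Nat.mul_add, Nat.mul_one] at hZ
  have hc := Expr.cost_le (hM.mono (show M ≤ Z by omega)) he
  have hc' := Nat.mul_le_mul_right (Nat.size Z + 1) hW
  rw [Nat.add_mul] at hc'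
  obtain ⟨t, ht, hex, hb⟩ := h M Z hM (by omega)
  exact ⟨_, by rw [Nat.add_mul, Nat.one_mul]; omega, Exec.ite_true h0 hex,
    hb.mono (by rw [Nat.mul_add]; omega)⟩

theorem Runs.ite_false {v a W g T : ℕ} {c c' : Com} {e : Expr} {s s' : State}
    (he : e.safe v a = true) (hW : 1 + e.wt ≤ W) (h0 : e.eval s = 0) (h : Runs v a W g c' s T s') :
    Runs v a W g (.ite e c c') s (T + 1) s' := by
  intro M Z hM hZ
  rw [Nat.mul_add, Nat.mul_one] at hZ
  have hc := Expr.cost_le (hM.mono (show M ≤ Z by omega)) he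
  have hc' := Nat.mul_le_mul_right (Nat.size Z + 1) hW
  rw [Nat.add_mul] at hc'
  obtain ⟨t, ht, hex, hb⟩ := h M Z hM (by omega)
  exact ⟨_, by rw [Nat.add_mul, Nat.one_mul]; omega, Exec.ite_false h0 hex,
    hb.mono (by rw [Nat.mul_add]; omega)⟩

theorem Prog.runs_seq {v a W g T T' : ℕ} {p q : Prog} {s : State}
    (h : Runs v a W g p.compile s T (p.run s))
    (h' : Runs v a W g q.compile (p.run s) T' (q.run (p.run s))) :
    Runs v a W g (Prog.seq p q).compile s (T + T') ((Prog.seq p q).run s) := h.seq h'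

variable {n D A L M K N q m₂ m₃ b : ℕ} {G : Digraph (Fin n)}

/-- Bounds for the parameters in terms of `n` and `E = A * Nat.size n`. -/
structure SmallParams (n E N K q m₂ m₃ : ℕ) : Prop where
  N_le : N ≤ 2 * E * n
  K_pos : 1 ≤ K
  K_le : K ≤ n
  K_sq : K * K ≤ 54 * E ^ 2 * n
  q_mul : q * K ≤ 3 * E * n
  m₂_mul : m₂ * K ≤ 3 * E ^ 2 * n
  m₃_le : m₃ ≤ 16 * E ^ 3 * n

/-- The bound `K² ≲ n` comes from `M ≤ 2 (√(n / D) + 1 + 4 log n)`. The chain cover makes about `N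
K` steps of cost `q + K`; with `q K ≲ n` and `K² ≲ n`, this stays within `Õ(n²)`. -/
theorem IsParams.small (hp : IsParams A n D L M K N q m₂ m₃) (hA : 1 ≤ A) (hD1 : 1 ≤ D) (hDn : D ≤ n)
    (hD : 64 * Nat.size n ≤ D) : SmallParams n (A * Nat.size n) N K q m₂ m₃ := by
  have hn : 1 ≤ n := hD1.trans hDn
  have hl : 1 ≤ Nat.size n := Nat.size_pos.2 hn
  have hE : 1 ≤ A * Nat.size n := Nat.mul_pos hA hl
  have hlE : Nat.size n ≤ A * Nat.size n := Nat.le_mul_of_pos_left _ hA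
  have hAE : A ≤ A * Nat.size n := Nat.le_mul_of_pos_right _ hl
  have hN : N ≤ 2 * (A * Nat.size n) * n := by rw [← mul_assoc]; exact hp.N_le hn
  have hK1 := hp.one_le_K hn hD
  have hM4 := hp.le_M hD
  have hL1 := hp.one_le_L
  have hMn : M ≤ n := by rw [hp.M_eq]; exact (Nat.div_le_self _ _).trans hDn
  have hKM : K ≤ M := by rw [hp.K_eq]; exact Nat.div_le_self _ _
  have hE2 : A * Nat.size n ≤ (A * Nat.size n) ^ 2 := Nat.le_self_pow (by norm_num) _
  have hqK : q * K ≤ 3 * (A * Nat.size n) * n := by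
    rw [hp.q_eq, Nat.add_mul, Nat.one_mul]
    have h1 := Nat.div_mul_le_self N K
    have h2 : n ≤ A * Nat.size n * n := Nat.le_mul_of_pos_left _ hE
    linarith
  set E := A * Nat.size n
  have hEn : n ≤ E * n := Nat.le_mul_of_pos_left _ hE
  refine ⟨hN, hK1, hKM.trans hMn, ?_, hqK, ?_, ?_⟩
  · obtain ⟨m, -, -, hm2, hL⟩ := hp.root
    set M0 := m + 1 + 4 * Nat.size n with hM0
    have hM2 : M ≤ 2 * M0 := by
      have h1 := lt_succ_div_mul D (8 * M0) (by omega)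
      have h2 : D / (8 * M0) + 1 ≤ 2 * L := by omega
      have h3 : D < 2 * L * (8 * M0) := h1.trans_le (Nat.mul_le_mul_right _ h2)
      rw [hp.M_eq]
      refine Nat.div_le_of_le_mul ?_
      calc D ≤ 2 * L * (8 * M0) := h3.le
        _ = _ := by ring
    have hK0 : K ≤ M0 := by rw [hp.K_eq]; omega
    have hm : m * m ≤ n := (Nat.le_mul_of_pos_right _ hD1).trans hm2
    have hl2 : Nat.size n * Nat.size n ≤ E ^ 2 := by rw [pow_two]; exact Nat.mul_le_mul hlE hlE
    calc K * K ≤ M0 * M0 := Nat.mul_le_mul hK0 hK0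
      -- The square of a sum of three terms is at most three times the sum of their squares.
      _ ≤ 3 * (m * m + 1 + 16 * (Nat.size n * Nat.size n)) := by
          rw [hM0]
          zify
          nlinarith [sq_nonneg ((m : ℤ) - 1), sq_nonneg ((m : ℤ) - 4 * Nat.size n),
            sq_nonneg (1 - 4 * (Nat.size n : ℤ))]
      _ ≤ 3 * (E ^ 2 * n + E ^ 2 * n + 16 * (E ^ 2 * n)) := by
          have h1 : 1 ≤ E ^ 2 := Nat.one_le_pow _ _ hE
          have h2 : n ≤ E ^ 2 * n := Nat.le_mul_of_pos_left _ h1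
          have h3 : E ^ 2 ≤ E ^ 2 * n := Nat.le_mul_of_pos_right _ hn
          omega
      _ = _ := by ring
  · calc m₂ * K ≤ m₂ * M := Nat.mul_le_mul_left _ hKM
      _ = E * (N / M * M + M) := by rw [hp.m₂_eq]; ring
      _ ≤ E * (2 * E * n + E * n) := by
          have := Nat.div_mul_le_self N M
          exact Nat.mul_le_mul_left _ (by omega)
      _ = _ := by ring
  · have hq : q / M + 1 ≤ 4 * (E * n) := by
      have h1 : q / M ≤ q := Nat.div_le_self _ _
      have h2 : q ≤ q * K := Nat.le_mul_of_pos_right _ hK1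
      have : 3 * E * n = 3 * (E * n) := by ring
      omega
    rw [hp.m₃_eq]
    calc 2 * A * (Nat.size n * (Nat.size n + 1)) * (q / M + 1)
        ≤ 2 * A * (Nat.size n * (Nat.size n + Nat.size n)) * (4 * (E * n)) := by gcongr
      _ = 16 * (E * Nat.size n * E) * n := by simp only [E]; ring
      _ ≤ 16 * (E * E * E) * n := by gcongr
      _ = _ := by ring

/-- The monomials that occur in the running times. -/
theorem SmallParams.monomials {E nch : ℕ} (h : SmallParams n E N K q m₂ m₃) (hE : 1 ≤ E) (hn : 1 ≤ n)
    (hb : b ≤ n + N) (hch : nch * K ≤ N) (hl : Nat.size n ≤ E) :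
    let S := E ^ 5 * n ^ 2
    1 ≤ S ∧ n ≤ S ∧ N ≤ 2 * S ∧ N * N ≤ 4 * S ∧ N * K ≤ 2 * S ∧ N * b ≤ 6 * S ∧
    N * K * K ≤ 108 * S ∧ N * K * q ≤ 6 * S ∧ N * q ≤ 6 * S ∧ K * q ≤ 3 * S ∧ K * K ≤ 54 * S ∧
    m₂ ≤ 3 * S ∧ m₂ * b ≤ 9 * S ∧ m₃ ≤ 16 * S ∧ m₃ * b ≤ 48 * S ∧ m₂ * m₃ ≤ 48 * S ∧
    m₂ * m₃ * K ≤ 48 * S ∧ nch ≤ 2 * S ∧ nch * K ≤ 2 * S ∧ nch * K * Nat.size n ≤ 2 * S ∧ q ≤ 3 * S ∧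
    K ≤ S := by
  intro S
  obtain ⟨h1, h2, h3, h4, h5, h6, h7⟩ := h
  have key : ∀ {x i j c : ℕ}, i ≤ 5 → j ≤ 2 → x ≤ c * E ^ i * n ^ j → x ≤ c * S := by
    intro x i j c hi hj hx
    refine hx.trans ?_
    rw [mul_assoc]
    exact Nat.mul_le_mul_left _
      (Nat.mul_le_mul (Nat.pow_le_pow_right hE hi) (Nat.pow_le_pow_right hn hj))
  have hS : 1 ≤ S := Nat.mul_pos (Nat.pow_pos hE) (Nat.pow_pos hn)
  have hEn : n ≤ E * n := Nat.le_mul_of_pos_left _ hE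
  have hb' : b ≤ 3 * E * n := by linarith
  have hm₂ : m₂ ≤ 3 * E ^ 2 * n := (Nat.le_mul_of_pos_right _ h2).trans h6
  have hq : q ≤ 3 * E * n := (Nat.le_mul_of_pos_right _ h2).trans h5
  have hch' : nch ≤ 2 * E * n := ((Nat.le_mul_of_pos_right _ h2).trans hch).trans h1
  refine ⟨hS, ?_, ?_, ?_, ?_, ?_, ?_, ?_, ?_, ?_, ?_, ?_, ?_, ?_, ?_, ?_, ?_, ?_, ?_, ?_, ?_, ?_⟩
  · simpa using key (x := n) (c := 1) (i := 0) (j := 1) (by simp) (by simp) (by simp)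
  · exact key (i := 1) (j := 1) (by simp) (by simp) (by simpa using h1)
  · refine key (i := 2) (j := 2) (by simp) (by simp) ((Nat.mul_le_mul h1 h1).trans (le_of_eq (by ring)))
  · refine key (i := 1) (j := 2) (by simp) (by simp) ((Nat.mul_le_mul h1 h3).trans (le_of_eq (by ring)))
  · refine key (i := 2) (j := 2) (by simp) (by simp) ((Nat.mul_le_mul h1 hb').trans (le_of_eq (by ring)))
  · rw [mul_assoc]
    exact key (i := 3) (j := 2) (by simp) (by simp) ((Nat.mul_le_mul h1 h4).trans (le_of_eq (by ring)))
  · rw [mul_assoc, mul_comm K]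
    exact key (i := 2) (j := 2) (by simp) (by simp) ((Nat.mul_le_mul h1 h5).trans (le_of_eq (by ring)))
  · exact key (i := 2) (j := 2) (by simp) (by simp) ((Nat.mul_le_mul h1 hq).trans (le_of_eq (by ring)))
  · rw [mul_comm]
    exact key (i := 1) (j := 1) (by simp) (by simp) (by simpa using h5)
  · exact key (i := 2) (j := 1) (by simp) (by simp) (by simpa using h4)
  · exact key (i := 2) (j := 1) (by simp) (by simp) (by simpa using hm₂)
  · exact key (i := 3) (j := 2) (by simp) (by simp) ((Nat.mul_le_mul hm₂ hb').trans (le_of_eq (by ring)))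
  · exact key (i := 3) (j := 1) (by simp) (by simp) (by simpa using h7)
  · exact key (i := 4) (j := 2) (by simp) (by simp) ((Nat.mul_le_mul h7 hb').trans (le_of_eq (by ring)))
  · exact key (i := 5) (j := 2) (by simp) (by simp) ((Nat.mul_le_mul hm₂ h7).trans (le_of_eq (by ring)))
  · rw [mul_right_comm]
    exact key (i := 5) (j := 2) (by simp) (by simp) ((Nat.mul_le_mul h6 h7).trans (le_of_eq (by ring)))
  · exact key (i := 1) (j := 1) (by simp) (by simp) (by simpa using hch')
  · exact key (i := 1) (j := 1) (by simp) (by simp) (by simpa using hch.trans h1)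
  · exact key (i := 2) (j := 1) (by simp) (by simp)
      ((Nat.mul_le_mul (hch.trans h1) hl).trans (le_of_eq (by ring)))
  · exact key (i := 1) (j := 1) (by simp) (by simp) (by simpa using hq)
  · simpa using key (x := K) (c := 1) (i := 0) (j := 1) (by simp) (by simp) (by simpa using h3)

theorem coverStep_cost_le (ν : ℕ → ℕ) : coverStep.cost ν ≤ 20 * (ν 4 + ν 3 + 1) := by
  simp only [coverStep, Prog.find, Prog.cost]
  norm_num
  omega

theorem SmallParams.cost_le {E nch : ℕ} (h : SmallParams n E N K q m₂ m₃) (hE : 1 ≤ E) (hn : 1 ≤ n)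
    (hb : b ≤ n + N) (hch : nch * K ≤ N) (hl : Nat.size n ≤ E) {ν : ℕ → ℕ} (h3 : ν 3 = K)
    (h7 : ν 7 = Nat.size n) :
    (ν 2 = N → ν 10 = b → headProg.cost ν ≤ 1000 * (E ^ 5 * n ^ 2)) ∧
    (ν 4 = q → ν 15 = (2 * K + 2) * N + K + 1 → coverLoop.cost ν ≤ 10000 * (E ^ 5 * n ^ 2)) ∧
    (ν 8 = m₂ → ν 9 = m₃ → ν 10 = b → ν 22 = nch → finProg.cost ν ≤ 1000 * (E ^ 5 * n ^ 2)) := by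
  obtain ⟨f0, f1, f2, f3, f4, f5, f6, f7, f8, f9, f10, f11, f12, f13, f14, f15, f16, f17, f18, f19, f20,
    f21⟩ := h.monomials hE hn hb hch hl
  generalize E ^ 5 * n ^ 2 = S at *
  refine ⟨fun h2 h10 => ?_, fun h4 h15 => ?_, fun h8 h9 h10 h22 => ?_⟩
  · simp only [headProg, sampleProg, posLtProg, coverInit, countProg, orderProg, coverSteps, Prog.cost,
      h2, h3, h10]
    norm_num
    linarith
  · have hc := coverStep_cost_le ν
    rw [h4, h3] at hc
    simp only [coverLoop, Prog.cost, h15]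
    refine (Nat.add_le_add_right (Nat.mul_le_mul_left _ (Nat.add_le_add_right hc 2)) 2).trans ?_
    linarith
  · simp only [finProg, sampleProg, hopProg, hopInner, jumpProg, Prog.find, Prog.cost, h8, h9, h10, h22,
      h3, h7]
    norm_num
    linarith

theorem paramProg_cost {ν : ℕ → ℕ} (h0 : ν 0 = n) (h7 : ν 7 = Nat.size n) :
    (paramProg A).cost ν = 3 * (n * Nat.size n ^ 3) + 4 * (n * Nat.size n ^ 2) +
      4 * (n * Nat.size n) + 8 * n + 16 := by
  simp [paramProg, rootProg, capProg, Prog.cost, h0, h7]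
  ring

theorem sizeProg_cost {z t x y : ℕ} (ν : ℕ → ℕ) : (sizeProg z t x y).cost ν = 5 * ν y + 3 := by
  simp [sizeProg, Prog.cost]
  ring

theorem maskProg_cost {ν : ℕ → ℕ} (h0 : ν 0 = n) : maskProg.cost ν = 3 * n ^ 2 + 4 * n + 2 := by
  simp [maskProg, Prog.cost, h0]
  ring

theorem allProg_cost {ν : ℕ → ℕ} (h0 : ν 0 = n) : allProg.cost ν = 3 * n ^ 2 + 4 * n + 2 := by
  simp [allProg, Prog.cost, h0]
  ring

theorem preProg_runs {W : ℕ} {s : State} (hA : 1 ≤ A) (hn : 1 ≤ n) (h0 : s.vars 0 = n)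
    (h7 : s.vars 7 = Nat.size n) (hW : (preProg A).wt ≤ W) {g : ℕ} (hg : (preProg A).gr ≤ g)
    (h19 : ((paramProg A).run s).vars 19 = n * (Nat.size n * (Nat.size n * (Nat.size n * (16 * A * A))))) :
    Runs 64 16 W g (preProg A).compile s (200 * ((A * Nat.size n) ^ 5 * n ^ 2)) ((preProg A).run s) := by
  simp only [preProg, Prog.wt, Prog.gr, max_le_iff] at hW hg
  refine ((Prog.runs (p := paramProg A) rfl hW.1 hg.1 rfl s).seq
    (Prog.runs (p := sizeProg 10 12 23 19) rfl hW.2 hg.2 rfl ((paramProg A).run s))).mono ?_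
  rw [paramProg_cost h0 h7, sizeProg_cost, h19]
  have hl : 1 ≤ Nat.size n := Nat.size_pos.2 hn
  have hE : 1 ≤ A * Nat.size n := Nat.mul_pos hA hl
  have hlE : Nat.size n ≤ A * Nat.size n := Nat.le_mul_of_pos_left _ hA
  have key : (A * Nat.size n) ^ 3 * n ≤ (A * Nat.size n) ^ 5 * n ^ 2 :=
    Nat.mul_le_mul (Nat.pow_le_pow_right hE (by norm_num)) (Nat.le_self_pow (by norm_num) n)
  have e1 : n * Nat.size n ≤ n * Nat.size n ^ 3 := Nat.mul_le_mul_left _ (Nat.le_self_pow (by norm_num) _)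
  have e2 : n * Nat.size n ^ 2 ≤ n * Nat.size n ^ 3 :=
    Nat.mul_le_mul_left _ (Nat.pow_le_pow_right hl (by norm_num))
  have e3 : n ≤ n * Nat.size n ^ 3 := Nat.le_mul_of_pos_right _ (Nat.pow_pos hl)
  have e4 : n * Nat.size n ^ 3 ≤ (A * Nat.size n) ^ 3 * n := by
    rw [mul_comm]
    exact Nat.mul_le_mul_right _ (Nat.pow_le_pow_left hlE 3)
  have e5 : n * (Nat.size n * (Nat.size n * (Nat.size n * (16 * A * A)))) ≤
      16 * ((A * Nat.size n) ^ 3 * n) := by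
    have h1 : (A * Nat.size n) ^ 2 * Nat.size n ≤ (A * Nat.size n) ^ 3 := by
      rw [pow_succ _ 2]; exact Nat.mul_le_mul_left _ hlE
    have h2 := Nat.mul_le_mul_left 16 (Nat.mul_le_mul_right n h1)
    linarith
  generalize n * (Nat.size n * (Nat.size n * (Nat.size n * (16 * A * A)))) = x1 at *
  generalize (A * Nat.size n) ^ 5 * n ^ 2 = x2 at *
  generalize (A * Nat.size n) ^ 3 * n = x3 at *
  generalize n * Nat.size n ^ 3 = x4 at *
  generalize n * Nat.size n ^ 2 = x5 at *
  generalize n * Nat.size n = x6 at *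
  have : 1 ≤ n := hn
  omega

/-- The pieces are timed separately because `Prog.cost` reads the loop bounds in the initial state,
and the bounds used by each piece (parameters, the number of steps, the number of chains) are
computed by the pieces before it. -/
theorem postProg_runs {s : State} (hr : Ready G D s) (hA : 1 ≤ A) (hD1 : 1 ≤ D) (hDn : D ≤ n) :
    Runs 64 16 (postProg A).wt (postProg A).gr (postProg A).compile s
      (20000 * ((A * Nat.size n) ^ 5 * n ^ 2)) ((postProg A).run s) := by
  have hn : 1 ≤ n := hD1.trans hDn
  have hl : 1 ≤ Nat.size n := Nat.size_pos.2 hn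
  have hE : 1 ≤ A * Nat.size n := Nat.mul_pos hA hl
  have hlE : Nat.size n ≤ A * Nat.size n := Nat.le_mul_of_pos_left _ hA
  obtain ⟨hr', L, M, K, N, q, m₂, m₃, b, ht⟩ := preProg_spec (A := A) hr hA hD1 hDn
  set W := (postProg A).wt with hW
  set g := (postProg A).gr with hg
  have hWs := hW.ge
  have hgs := hg.ge
  simp only [postProg, mainProg, Prog.wt, Prog.gr, max_le_iff] at hWs hgs
  obtain ⟨⟨w0, w1, w2, w3, w4, w5⟩, w6⟩ := hWs
  obtain ⟨⟨g1, g2, g3, g4, g5⟩, g6⟩ := hgs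
  set S := (A * Nat.size n) ^ 5 * n ^ 2 with hS
  have hnS : n ^ 2 ≤ S := Nat.le_mul_of_pos_left _ (Nat.pow_pos hE)
  have hnn : n ≤ n ^ 2 := Nat.le_self_pow (by norm_num) n
  set σ := Prog.run (.ite (.sub (.mul (.const 64) (.var 7)) (.var 1)) allProg (mainProg A)) s with hσ
  have hv0 : σ.vars 0 = n := (Prog.run_vars _ rfl s).trans hr.n_eq
  have hmask : Runs 64 16 W g maskProg.compile σ (9 * S) ((postProg A).run s) :=
    (Prog.runs (p := maskProg) (show maskProg.ok 64 16 = true by decide) w6 g6 rfl σ).mono (by rw [maskProg_cost hv0]; omega)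
  suffices h : Runs 64 16 W g
      (Prog.ite (.sub (.mul (.const 64) (.var 7)) (.var 1)) allProg (mainProg A)).compile s
      (19000 * S) σ from (h.seq hmask).mono (by omega)
  by_cases hc : (Expr.sub (.mul (.const 64) (.var 7)) (.var 1)).eval s = 0
  · have hD : 64 * Nat.size n ≤ D := by
      simp only [Expr.eval, hr.D_eq, hr.size_eq] at hc; omega
    rw [hσ, Prog.run, if_neg (not_not.2 hc)]
    refine (Runs.ite_false (T := 18000 * S) rfl w0 hc ?_).mono (by omega)
    have hp := preProg_runs (n := n) hA hn hr.n_eq hr.size_eq w2 g2 (by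
      rw [← ht.B_reg]; exact (Prog.run_vars (sizeProg 10 12 23 19) rfl _).symm)
    obtain ⟨-, -, hcov, -⟩ := coverState_spec hr' ht hn hD ((preProg A).run s).coins
    have f := coverState_frame ((preProg A).run s) ((preProg A).run s).coins
    have e : coverState ((preProg A).run s) ((preProg A).run s).coins =
      coverLoop.run (headProg.run ((preProg A).run s)) := by unfold coverState; rfl
    rw [e] at hcov f
    set σ₁ := (preProg A).run s with hσ₁
    set σ₂ := headProg.run σ₁ with hσ₂
    set σ₃ := coverLoop.run σ₂ with hσ₃
    have hsm := ht.params.small hA hD1 hDn hD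
    have hb : b ≤ n + N := by rw [ht.b_eq]; exact size_le_self _
    have f₂ : Frame headProg σ₁ σ₂ := Prog.frame _ _
    have h3 : σ₃.vars 3 = K := (f.1 3 rfl).trans ht.K_reg
    have k₁ := hsm.cost_le (nch := 0) hE hn hb (by simp) hlE ht.K_reg hr'.size_eq
    have k₂ := hsm.cost_le (nch := 0) hE hn hb (by simp) hlE ((f₂.1 3 rfl).trans ht.K_reg)
      ((f₂.1 7 rfl).trans hr'.size_eq)
    have k₃ := hsm.cost_le hE hn hb hcov.card_le hlE h3 ((f.1 7 rfl).trans hr'.size_eq)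
    have h15 : σ₂.vars 15 = (2 * K + 2) * N + K + 1 := by
      set τ := (Prog.seq (sampleProg 2 0 4) posLtProg).run σ₁ with hτ
      have fτ : Frame (.seq (sampleProg 2 0 4) posLtProg) σ₁ τ := Prog.frame _ _
      have := coverInit_steps τ
      rw [fτ.1 3 rfl, fτ.1 2 rfl, ht.K_reg, ht.N_reg] at this
      exact this
    have r₁ := (Prog.runs (p := headProg) (show headProg.ok 64 16 = true by decide) w3 g3 rfl σ₁).mono (k₁.1 ht.N_reg ht.b_reg)
    have r₂ := (Prog.runs (p := coverLoop) (show coverLoop.ok 64 16 = true by decide) w4 g4 rfl σ₂).mono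
      (k₂.2.1 ((f₂.1 4 rfl).trans ht.q_reg) h15)
    have r₃ := (Prog.runs (p := finProg) (show finProg.ok 64 16 = true by decide) w5 g5 rfl σ₃).mono
      (k₃.2.2 ((f.1 8 rfl).trans ht.m₂_reg) ((f.1 9 rfl).trans ht.m₃_reg)
        ((f.1 10 rfl).trans ht.b_reg) rfl)
    have r : Runs 64 16 W g (mainProg A).compile s
        (200 * S + (1000 * S + (10000 * S + 1000 * S))) ((mainProg A).run s) :=
      Prog.runs_seq hp (Prog.runs_seq r₁ (Prog.runs_seq r₂ r₃))
    exact r.mono (by clear_value S; clear r k₁ k₂ k₃ hsm; omega)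
  · rw [hσ, Prog.run, if_pos hc]
    exact (Runs.ite_true (T := 9 * S) rfl w0 hc
      ((Prog.runs (p := allProg) (show allProg.ok 64 16 = true by decide) w1 g1 rfl s).mono
        (by rw [allProg_cost hr.n_eq]; omega))).mono (by omega)

end PostTime

end Shortcut
namespace Shortcut

/-! ### Simulation of an arbitrary program in one residue class of the memory. -/

section Simulation

/-! Registers of the simulated program become cells of arrays, and its arrays are stored in the
residue class `r` modulo `R` of arrays of the host, where `R` and `r` are in registers `7` and `14`;
hence several simulations do not interfere. -/

/-- The host index of cell `i` of a simulated array. -/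
def Expr.host (i : Expr) : Expr := .add (.mul i (.var 7)) (.var 14)

/-- The simulation of an expression. -/
def Expr.sim : Expr → Expr
  | .const c => .const c
  | .var x => .get (2 * x + 16) (.var 14)
  | .get a i => .get (2 * a + 17) i.sim.host
  | .add e f => .add e.sim f.sim
  | .sub e f => .sub e.sim f.sim
  | .mul e f => .mul e.sim f.sim
  | .div e f => .div e.sim f.sim

/-- The simulation of a program; all coin flips are tails. -/
def Com.sim : Com → Com
  | .skip => .skip
  | .assign x e => .store (2 * x + 16) (.var 14) e.sim
  | .store a i e => .store (2 * a + 17) i.sim.host e.sim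
  | .flip x => .store (2 * x + 16) (.var 14) (.const 0)
  | .seq p q => .seq p.sim q.sim
  | .ite e p q => .ite e.sim p.sim q.sim
  | .loop e p => .loop e.sim p.sim

/-- The configuration `s'` of the host represents the configuration `s` of the simulated program. -/
structure Sim (R r : ℕ) (s s' : State) : Prop where
  R_reg : s'.vars 7 = R
  r_reg : s'.vars 14 = r
  coins : ∀ i, s.coins i = false
  vars : ∀ x, s'.arr (2 * x + 16) r = s.vars x
  arr : ∀ a i, s'.arr (2 * a + 17) (i * R + r) = s.arr a i

/-- The simulation changes the residue class `r` of the arrays from `16` on only. -/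
structure Untouched (R r : ℕ) (s s' : State) : Prop where
  vars : s'.vars = s.vars
  coins : s'.coins = s.coins
  arr : ∀ a i, (a < 16 ∨ i % R ≠ r) → s'.arr a i = s.arr a i

variable {R r : ℕ}

theorem Sim.eval {s s' : State} (h : Sim R r s s') (e : Expr) : e.sim.eval s' = e.eval s := by
  induction e with
  | const c => rfl
  | var x => simpa [Expr.sim, Expr.eval, h.r_reg] using h.vars x
  | get a i ih => simp [Expr.sim, Expr.host, Expr.eval, h.r_reg, h.R_reg, ih, h.arr]
  | add e f ihe ihf | sub e f ihe ihf | mul e f ihe ihf | div e f ihe ihf =>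
    simp [Expr.sim, Expr.eval, ihe, ihf]

/-- The factor by which the simulation increases the running time. -/
def simFactor (R r : ℕ) : ℕ := 8 + 3 * (Nat.size R + Nat.size r)

theorem Sim.cost_host {s s' : State} (h : Sim R r s s') (i : Expr) :
    i.sim.host.cost s' ≤ 6 + 3 * (Nat.size R + Nat.size r) + i.sim.cost s' + 2 * Nat.size (i.eval s) := by
  have h1 := size_mul_le (i.eval s) R
  have h2 := size_add_le (i.eval s * R) r
  simp only [Expr.host, Expr.cost, Expr.eval, h.eval, h.R_reg, h.r_reg]
  omega

/-- The summand `2 * Nat.size (e.eval s)` is a reserve that strengthens the induction: when `e` is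
an index, it pays for computing `e * R + r`. -/
theorem Sim.cost_le {s s' : State} (h : Sim R r s s') (e : Expr) :
    e.sim.cost s' + 2 * Nat.size (e.eval s) ≤ simFactor R r * e.cost s := by
  have key : ∀ {v c c' : ℕ}, c' + 2 * v ≤ 3 + 3 * (Nat.size R + Nat.size r) + 3 * v + simFactor R r * c →
      c' + 2 * v ≤ simFactor R r * (1 + v + c) := by
    intro v c c' hc
    rw [Nat.mul_add, Nat.mul_add]
    have h1 : 3 * v ≤ simFactor R r * v := Nat.mul_le_mul_right _ (by unfold simFactor; omega)
    have h2 : simFactor R r = 8 + 3 * (Nat.size R + Nat.size r) := rfl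
    omega
  induction e with
  | const c =>
    have := key (v := Nat.size c) (c := 0) (c' := 1 + Nat.size c) (by omega)
    simpa only [Expr.sim, Expr.cost, Expr.eval, Nat.add_zero] using this
  | var x =>
    have := h.vars x
    simp only [Expr.sim, Expr.cost, Expr.eval, h.r_reg, this]
    simpa using key (v := Nat.size (s.vars x)) (c := 0) (c' := 1 + Nat.size (s.vars x) + (1 + Nat.size r))
      (by omega)
  | get a i ih =>
    have h1 := h.cost_host i
    have h2 := h.eval (.get a i)
    simp only [Expr.sim, Expr.eval] at h2
    simp only [Expr.sim, Expr.cost, Expr.eval, h2]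
    have h3 : simFactor R r = 8 + 3 * (Nat.size R + Nat.size r) := rfl
    have h4 : simFactor R r * (1 + Nat.size (s.arr a (i.eval s)) + i.cost s) = simFactor R r +
      simFactor R r * Nat.size (s.arr a (i.eval s)) + simFactor R r * i.cost s := by ring
    have h5 : 3 * Nat.size (s.arr a (i.eval s)) ≤ simFactor R r * Nat.size (s.arr a (i.eval s)) :=
      Nat.mul_le_mul_right _ (by omega)
    omega
  | add e f ihe ihf | sub e f ihe ihf | mul e f ihe ihf | div e f ihe ihf =>
    simp only [Expr.sim, Expr.cost, Expr.eval, h.eval, Nat.add_assoc _ (Expr.cost s e)]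
    refine key ?_
    rw [Nat.mul_add (simFactor R r) (e.cost s)]
    omega

theorem host_index_inj {i i' : ℕ} (hr : r < R) (h : i * R + r = i' * R + r) : i = i' :=
  Nat.eq_of_mul_eq_mul_right (by omega) (Nat.add_right_cancel h)

theorem Sim.assign {s s' : State} (h : Sim R r s s') (x v : ℕ) (e : Expr) (he : e.eval s' = v) :
    Sim R r (s.set x v) (s'.store (2 * x + 16) (.var 14) e) := by
  refine ⟨h.R_reg, h.r_reg, h.coins, fun y => ?_, fun a i => ?_⟩
  · rw [State.store_arr, State.set_vars, he]
    simp only [Expr.eval, h.r_reg, and_true]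
    by_cases hy : y = x
    · simp [hy]
    · rw [if_neg (by omega), if_neg hy, h.vars]
  · rw [State.store_arr, if_neg (by omega), h.arr]; rfl

theorem Untouched.refl (s : State) : Untouched R r s s := ⟨rfl, rfl, fun _ _ _ => rfl⟩

theorem Untouched.trans {s s' s'' : State} (h : Untouched R r s s') (h' : Untouched R r s' s'') :
    Untouched R r s s'' :=
  ⟨h'.vars.trans h.vars, h'.coins.trans h.coins, fun a i hi => (h'.arr a i hi).trans (h.arr a i hi)⟩

theorem Untouched.store {s : State} {a : ℕ} {i e : Expr} (ha : 16 ≤ a) (hi : i.eval s % R = r) :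
    Untouched R r s (s.store a i e) := by
  refine ⟨rfl, rfl, fun b j hj => ?_⟩
  rw [State.store_arr, if_neg]
  rintro ⟨rfl, rfl⟩
  omega

/-- Coin flips are answered by `0`, in accordance with the all-`false` coins of the simulated state.
This is legitimate since a multiplication program must be correct for every sequence of coins. -/
theorem Sim.exec (hr : r < R) {p : Com} {s s₁ : State} {t : ℕ} (hp : Exec p s t s₁) :
    ∀ {s' : State}, Sim R r s s' → ∃ t' ≤ simFactor R r * t, ∃ s₁', Exec p.sim s' t' s₁' ∧
      Sim R r s₁ s₁' ∧ Untouched R r s' s₁' := by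
  have hk : 8 + 3 * (Nat.size R + Nat.size r) = simFactor R r := rfl
  have hmod : r % R = r := Nat.mod_eq_of_lt hr
  induction hp with
  | skip s => exact fun {s'} h => ⟨1, by omega, s', Exec.skip _, h, .refl _⟩
  | assign s x e =>
    intro s' h
    have := h.cost_le e
    refine ⟨_, ?_, _, Exec.store _ _ _ _, h.assign x _ _ (h.eval e), .store (by omega) ?_⟩
    · simp only [Expr.cost, h.r_reg]
      rw [Nat.mul_add]
      omega
    · rw [Expr.eval, h.r_reg, hmod]
  | flip s x =>
    intro s' h
    refine ⟨_, ?_, _, Exec.store _ _ _ _, ?_, .store (by omega) ?_⟩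
    · simp only [Expr.cost, h.r_reg, Nat.size_zero]
      omega
    · have := h.assign x 0 (.const 0) rfl
      refine ⟨this.R_reg, this.r_reg, fun i => h.coins _, fun y => ?_, this.arr⟩
      rw [this.vars y]
      simp [h.coins 0]
    · rw [Expr.eval, h.r_reg, hmod]
  | store s a i e =>
    intro s' h
    have h1 := h.cost_le e
    have h2 := h.cost_le i
    have h3 := h.cost_host i
    have h4 : i.sim.host.eval s' = i.eval s * R + r := by
      simp [Expr.host, Expr.eval, h.eval, h.R_reg, h.r_reg]
    refine ⟨_, ?_, _, Exec.store _ _ _ _, ⟨h.R_reg, h.r_reg, h.coins, fun x => ?_, fun b j => ?_⟩,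
      .store (by omega) ?_⟩
    · rw [Nat.mul_add, Nat.mul_add]
      omega
    · rw [State.store_arr, if_neg (by omega), h.vars]; rfl
    · rw [State.store_arr, State.store_arr, h4, h.eval, h.arr]
      by_cases hc : b = a ∧ j = i.eval s
      · rw [if_pos hc, if_pos ⟨by omega, by rw [hc.2]⟩]
      · rw [if_neg hc, if_neg]
        rintro ⟨h5, h6⟩
        exact hc ⟨by omega, host_index_inj hr h6⟩
    · rw [h4, Nat.mul_comm, Nat.mul_add_mod, hmod]
  | seq _ _ ih ih' =>
    intro s' h
    obtain ⟨t₁, ht₁, s₁, h1, h2, h3⟩ := ih h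
    obtain ⟨t₂, ht₂, s₂, h1', h2', h3'⟩ := ih' h2
    exact ⟨_, by rw [Nat.mul_add]; omega, s₂, h1.seq h1', h2', h3.trans h3'⟩
  | ite_true he _ ih =>
    intro s' h
    obtain ⟨t₁, ht₁, s₁, h1, h2, h3⟩ := ih h
    have hc := h.cost_le (by assumption)
    refine ⟨_, ?_, s₁, Exec.ite_true (by rwa [h.eval]) h1, h2, h3⟩
    rw [Nat.mul_add, Nat.mul_add]; omega
  | ite_false he _ ih =>
    intro s' h
    obtain ⟨t₁, ht₁, s₁, h1, h2, h3⟩ := ih h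
    have hc := h.cost_le (by assumption)
    refine ⟨_, ?_, s₁, Exec.ite_false (by rwa [h.eval]) h1, h2, h3⟩
    rw [Nat.mul_add, Nat.mul_add]; omega
  | loop_stop he =>
    intro s' h
    have hc := h.cost_le (by assumption)
    refine ⟨_, ?_, s', Exec.loop_stop (by rwa [h.eval]), h, .refl _⟩
    rw [Nat.mul_add]; omega
  | @loop_step e p s _ _ _ _ he _ _ ih ih' =>
    intro s' h
    obtain ⟨t₁, ht₁, s₁, h1, h2, h3⟩ := ih h
    obtain ⟨t₂, ht₂, s₂, h1', h2', h3'⟩ := ih' h2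
    have hc := h.cost_le e
    refine ⟨_, ?_, s₂, Exec.loop_step (by rwa [h.eval]) h1 h1', h2', h3.trans h3'⟩
    rw [Nat.mul_add, Nat.mul_add, Nat.mul_add]; omega

/-! #### Deterministic programs -/

/-- Does the program not use coin flips? -/
def Com.flipFree : Com → Bool
  | .flip _ => false
  | .seq p q => p.flipFree && q.flipFree
  | .ite _ p q => p.flipFree && q.flipFree
  | .loop _ p => p.flipFree
  | _ => true

theorem Com.flipFree_sim (p : Com) : p.sim.flipFree = true := by
  induction p <;> simp_all [Com.sim, Com.flipFree]

theorem Expr.cost_withCoins (s : State) (ρ : ℕ → Bool) (e : Expr) :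
    e.cost (s.withCoins ρ) = e.cost s := by
  have h (e : Expr) : e.eval (s.withCoins ρ) = e.eval s :=
    Expr.eval_congr (s := s.withCoins ρ) (s' := s) rfl rfl e
  induction e with
  | const | var => rfl
  | get a i ih => simp only [Expr.cost, h, ih]; rfl
  | add e f ihe ihf | sub e f ihe ihf | mul e f ihe ihf | div e f ihe ihf =>
    simp only [Expr.cost, h, ihe, ihf]

/-- A computation without flips does not look at the coins. Reachability can thus be computed once,
and the result holds for all coin sequences. -/
theorem Exec.withCoins {p : Com} {s s' : State} {t : ℕ} (h : Exec p s t s')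
    (hp : p.flipFree = true) (ρ : ℕ → Bool) : Exec p (s.withCoins ρ) t (s'.withCoins ρ) := by
  have he (s : State) (e : Expr) : e.eval (s.withCoins ρ) = e.eval s :=
    Expr.eval_congr (s := s.withCoins ρ) (s' := s) rfl rfl e
  induction h with
  | skip => exact Exec.skip _
  | assign s x e =>
    rw [← e.cost_withCoins s ρ]
    have := Exec.assign (s.withCoins ρ) x e
    simp only [State.assign, he] at this
    exact this
  | store s a i e =>
    rw [← e.cost_withCoins s ρ, ← i.cost_withCoins s ρ]
    have := Exec.store (s.withCoins ρ) a i e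
    simp only [State.store, he] at this
    exact this
  | flip => simp [Com.flipFree] at hp
  | seq _ _ ih ih' =>
    simp only [Com.flipFree, Bool.and_eq_true] at hp
    exact (ih hp.1).seq (ih' hp.2)
  | ite_true h0 _ ih =>
    simp only [Com.flipFree, Bool.and_eq_true] at hp
    rw [← Expr.cost_withCoins _ ρ]
    exact Exec.ite_true (by rwa [he]) (ih hp.1)
  | ite_false h0 _ ih =>
    simp only [Com.flipFree, Bool.and_eq_true] at hp
    rw [← Expr.cost_withCoins _ ρ]
    exact Exec.ite_false (by rwa [he]) (ih hp.2)
  | loop_stop h0 =>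
    rw [← Expr.cost_withCoins _ ρ]
    exact Exec.loop_stop (by rwa [he])
  | loop_step h0 _ _ ih ih' =>
    rw [← Expr.cost_withCoins _ ρ]
    exact Exec.loop_step (by rwa [he]) (ih hp) (ih' hp)

end Simulation

end Shortcut
namespace Shortcut

/-! ### Running times with a part that is not governed by the syntax. -/

section Takes

/-- Like `Runs`, with an additional running time of at most `X`. -/
def Takes (v a W g : ℕ) (c : Com) (s : State) (T X : ℕ) (s' : State) : Prop :=
  ∀ M Z, Bnd v a M s → M + g * T ≤ Z →
    ∃ t ≤ T * (W * (Nat.size Z + 1)) + X, Exec c s t s' ∧ Bnd v a (M + g * T) s'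

variable {v a W g T T' X X' : ℕ} {c c' : Com} {s s' s'' : State}

theorem Runs.takes (h : Runs v a W g c s T s') : Takes v a W g c s T 0 s' := h

theorem Takes.seq (h : Takes v a W g c s T X s') (h' : Takes v a W g c' s' T' X' s'') :
    Takes v a W g (.seq c c') s (T + T') (X + X') s'' := by
  intro M Z hM hZ
  rw [Nat.mul_add] at hZ
  obtain ⟨t, ht, hex, hb⟩ := h M Z hM (by omega)
  obtain ⟨t', ht', hex', hb'⟩ := h' _ Z hb (by omega)
  exact ⟨t + t', by rw [Nat.add_mul]; omega, hex.seq hex', by rw [Nat.mul_add, ← Nat.add_assoc]; exact hb'⟩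

theorem Takes.mono (h : Takes v a W g c s T X s') (hT : T ≤ T') (hX : X ≤ X') :
    Takes v a W g c s T' X' s' := by
  intro M Z hM hZ
  have := Nat.mul_le_mul_left g hT
  obtain ⟨t, ht, hex, hb⟩ := h M Z hM (by omega)
  exact ⟨t, ht.trans (Nat.add_le_add (Nat.mul_le_mul_right _ hT) hX), hex, hb.mono (by omega)⟩

/-- The simulated body has no result function, so the states between the rounds are known through
the invariant `I` only. -/
theorem Takes.loop {e : Expr} (he : e.safe v a = true) (hW : 1 + e.wt ≤ W) (I : ℕ → State → Prop)
    (m : ℕ) (h : ∀ k < m, ∀ s, I k s → e.eval s ≠ 0 ∧ ∃ s', I (k + 1) s' ∧ Takes v a W g c s T X s')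
    (hm : ∀ s, I m s → e.eval s = 0) (h0 : I 0 s) :
    ∃ s', I m s' ∧ Takes v a W g (.loop e c) s (m * (T + 1) + 1) (m * X) s' := by
  induction m generalizing I s with
  | zero =>
    refine ⟨s, h0, fun M Z hM hZ => ?_⟩
    have := Expr.cost_le (hM.mono (show M ≤ Z by omega)) he
    have := Nat.mul_le_mul_right (Nat.size Z + 1) hW
    rw [Nat.add_mul] at this
    exact ⟨_, by rw [Nat.zero_mul, Nat.zero_mul, Nat.zero_add, Nat.one_mul]; omega,
      Exec.loop_stop (hm s h0), hM.mono (Nat.le_add_right _ _)⟩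
  | succ m ih =>
    obtain ⟨h1, s', h2, h3⟩ := h 0 (by omega) s h0
    obtain ⟨s'', h4, h5⟩ := ih (fun k => I (k + 1)) (fun k hk => h (k + 1) (by omega)) hm h2
    refine ⟨s'', h4, fun M Z hM hZ => ?_⟩
    have e1 : g * ((m + 1) * (T + 1) + 1) = g * T + g + g * (m * (T + 1) + 1) := by ring
    have hc := Expr.cost_le (hM.mono (show M ≤ Z by omega)) he
    have hc' := Nat.mul_le_mul_right (Nat.size Z + 1) hW
    rw [Nat.add_mul] at hc'
    obtain ⟨t, ht, hex, hb⟩ := h3 M Z hM (by omega)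
    obtain ⟨t', ht', hex', hb'⟩ := h5 (M + g * T) Z hb (by omega)
    refine ⟨_, ?_, Exec.loop_step h1 hex hex', hb'.mono (by omega)⟩
    have e2 : ((m + 1) * (T + 1) + 1) * (W * (Nat.size Z + 1)) = T * (W * (Nat.size Z + 1)) +
      W * (Nat.size Z + 1) + (m * (T + 1) + 1) * (W * (Nat.size Z + 1)) := by ring
    have e3 : (m + 1) * X = m * X + X := by ring
    omega

/-- For loops whose body is bounded by means of the contents of the memory rather than by `Prog.ok`.
-/
theorem Prog.rep_runs {x y c : ℕ} {p : Prog} (hx : x < v) (hy : y < v) (hf : p.fresh x y = true)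
    (hW : 12 ≤ W) (hg : 1 ≤ g) {Q : State → Prop} (hQ : ∀ s, Q s → ∀ d, Q ((p.run s).set x d))
    (hp : ∀ s, Q s → s.vars x < s.vars y → Runs v a W g p.compile s c (p.run s))
    (hs : Q (s.set x 0)) :
    Runs v a W g (Prog.rep x y p).compile s (s.vars y * (c + 2) + 2) ((Prog.rep x y p).run s) := by
  intro M Z hM hZ
  have hxy : y ≠ x := by
    simp only [fresh, Bool.and_eq_true, bne_iff_ne] at hf
    exact Ne.symm hf.1.1
  have e1 : g * (s.vars y * (c + 2) + 2) = g * (s.vars y * (c + 2) + 1) + g := by ring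
  obtain ⟨t, ht, hex, hb⟩ := exec_loop (c := c) (Z := Z) hx hy hf hW hg hQ
    (fun s M h1 h2 h3 h4 => hp s h1 h2 M Z h3 h4) (s.vars y) (s.set x 0) (M + g) hs
    (by simp [hxy]) ((hM.mono (Nat.le_add_right _ _)).set x (Nat.zero_le _)) (by omega)
  refine ⟨1 + (Expr.const 0).cost s + t, ?_, Exec.seq (Exec.assign _ _ _) hex, hb.mono (by omega)⟩
  have : 2 ≤ W * (Nat.size Z + 1) :=
    (show 2 ≤ W by omega).trans (Nat.le_mul_of_pos_right _ (by simp))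
  have e2 : (s.vars y * (c + 2) + 2) * (W * (Nat.size Z + 1)) =
    (s.vars y * (c + 2) + 1) * (W * (Nat.size Z + 1)) + W * (Nat.size Z + 1) := by ring
  simp only [Expr.cost, Nat.size_zero]
  omega

end Takes

/-! ### Reachability by repeated squaring: preparation, loading and reading. -/

section Closure

variable {n D R r : ℕ} {G : Digraph (Fin n)}

theorem within_add {j k : ℕ} {a c : Fin n} :
    Within G (j + k) a c ↔ ∃ b, Within G j a b ∧ Within G k b c := by
  refine ⟨fun ⟨l, hl, h⟩ => ?_, fun ⟨b, h, h'⟩ => h.trans h'⟩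
  have e : l = min l j + (l - min l j) := by omega
  rw [e] at h
  obtain ⟨b, h1, h2⟩ := h.split
  exact ⟨b, ⟨_, min_le_right _ _, h1⟩, ⟨_, by omega, h2⟩⟩

/-- A geodesic does not have more edges than there are vertices. -/
theorem reach_iff_within {k : ℕ} (hk : n ≤ k) {a b : Fin n} : Reach G a b ↔ Within G k a b := by
  refine ⟨fun h => ?_, Within.reach⟩
  obtain ⟨l, hl⟩ := exists_geo h
  have := hl.le_card_interval (S := Finset.univ) (fun _ _ => Finset.mem_univ _)
  rw [Finset.card_univ, Fintype.card_fin] at this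
  exact ⟨l, by omega, hl.1⟩

open scoped Classical in
/-- The matrix of the pairs at distance at most `k`. -/
noncomputable def ballMatrix (G : Digraph (Fin n)) (k : ℕ) : Matrix (Fin n) (Fin n) ℕ :=
  fun i j => if Within G k i j then 1 else 0

theorem ballMatrix_le (k : ℕ) (i j : Fin n) : ballMatrix G k i j ≤ 1 := by
  unfold ballMatrix; split_ifs <;> simp

theorem ballMatrix_mul_le (k : ℕ) (i j : Fin n) : (ballMatrix G k * ballMatrix G k) i j ≤ n := by
  rw [Matrix.mul_apply]
  refine (Finset.sum_le_card_nsmul _ _ 1 fun l _ => ?_).trans (by simp)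
  exact Nat.mul_le_mul (ballMatrix_le k i l) (ballMatrix_le k l j)

/-- An entry of the product counts midpoints, and `1 - (1 - x)` is the indicator of `x ≠ 0`. -/
theorem ballMatrix_mul (k : ℕ) (i j : Fin n) :
    1 - (1 - (ballMatrix G k * ballMatrix G k) i j) = ballMatrix G (k + k) i j := by
  have h : (ballMatrix G k * ballMatrix G k) i j ≠ 0 ↔ Within G (k + k) i j := by
    rw [Matrix.mul_apply, Ne, Finset.sum_eq_zero_iff, within_add]
    simp [ballMatrix, and_comm]
  by_cases hw : Within G (k + k) i j
  · have := h.2 hw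
    rw [ballMatrix, if_pos hw]; omega
  · have := not_not.1 (mt h.1 hw)
    rw [ballMatrix, if_neg hw]; omega

/-- Compute the length of `n`, `n * n`, and the matrix of the pairs at distance at most one. -/
def initProg : Prog :=
  .seq (.set 12 (.var 0)) <| .seq (sizeProg 7 12 23 0) <| .seq (.set 16 (.const 0)) <|
  .seq (.rep 23 0 (.rep 26 0 (.set 16 (.add (.var 16) (.const 1))))) <|
    .rep 23 0 (.rep 26 0 (.store 2 (.add (.mul (.var 23) (.var 0)) (.var 26))
      (.sub (.const 1) (.sub (.const 1) (.add (.get 0 (.add (.mul (.var 23) (.var 0)) (.var 26)))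
        (.sub (.const 1) (.add (.sub (.var 23) (.var 26)) (.sub (.var 26) (.var 23)))))))))

/-- Prepare the simulation of a matrix multiplication. -/
def loadProg : Prog :=
  .seq (.store 16 (.var 14) (.var 0)) <|
  .seq (.rep 23 16 (.store 17 (Expr.var 23).host (.get 2 (.var 23))))
    (.rep 23 16 (.store 19 (Expr.var 23).host (.get 2 (.var 23))))

/-- Read the result of a matrix multiplication. -/
def readProg : Prog :=
  .rep 23 16 (.store 2 (.var 23) (.sub (.const 1) (.sub (.const 1) (.get 21 (Expr.var 23).host))))

/-- Repeated squaring of the reachability matrix by means of the program `p`. -/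
def closureCom (p : Com) : Com :=
  .seq initProg.compile (.loop (.sub (.var 7) (.var 14)) (.seq loadProg.compile
    (.seq p.sim (.seq readProg.compile (Prog.set 14 (.add (.var 14) (.const 1))).compile))))

theorem flipFree_closureCom (p : Com) : (closureCom p).flipFree = true := by
  simp only [closureCom, Com.flipFree, Com.flipFree_sim]
  rfl

/-- The state after `r` squarings. -/
structure Squared (G : Digraph (Fin n)) (D r : ℕ) (s : State) : Prop where
  n_eq : s.vars 0 = n
  D_eq : s.vars 1 = D
  size_eq : s.vars 7 = Nat.size n
  r_eq : s.vars 14 = r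
  sq_eq : s.vars 16 = n * n
  mat : ∀ i j : Fin n, s.arr 2 (i * n + j) = ballMatrix G (2 ^ r) i j
  zero : ∀ a ∈ [1, 7, 10], ∀ i, s.arr a i = 0
  blank : ∀ a, 16 ≤ a → ∀ i, r ≤ i % Nat.size n → s.arr a i = 0

theorem matrixCells_index (A : Matrix (Fin n) (Fin n) ℕ) (i j : Fin n) :
    matrixCells A (i * n + j) = A i j := by
  have hn : 0 < n := i.pos
  rw [matrixCells, dif_pos (index_lt i.2 j.2)]
  congr 1 <;> ext
  · simp only
    rw [Nat.mul_comm, Nat.mul_add_div hn, Nat.div_eq_of_lt j.2, Nat.add_zero]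
  · simp only
    rw [Nat.mul_comm, Nat.mul_add_mod, Nat.mod_eq_of_lt j.2]

theorem matrixCells_eq {A : Matrix (Fin n) (Fin n) ℕ} {α : ℕ → ℕ} (h : ∀ i j : Fin n, α (i * n + j) = A i j)
    {e : ℕ} (he : e < n * n) : matrixCells A e = α e := by
  rw [matrixCells, dif_pos he, ← h]
  congr 1
  exact Nat.div_add_mod' e n

theorem initProg_spec (G : Digraph (Fin n)) (D : ℕ) (ρ : ℕ → Bool) :
    Squared G D 0 (initProg.run (shortcutInput G D ρ)) := by
  set s := shortcutInput G D ρ with hs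
  have f : Frame initProg s (initProg.run s) := Prog.frame _ _
  have v0 : s.vars 0 = n := by simp [hs, shortcutInput]
  have v1 : s.vars 1 = D := by simp [hs, shortcutInput]
  have va : ∀ a, a ≠ 0 → ∀ i, s.arr a i = 0 := fun a ha i => by
    simp [hs, shortcutInput, Function.update_of_ne ha]
  set s₁ := (sizeProg 7 12 23 0).run (s.set 12 n) with hs₁
  have e₁ : s₁.vars 7 = Nat.size n := by
    have := sizeProg_spec (z := 7) (t := 12) (x := 23) (y := 0) (s.set 12 n) (by simp) (by simp [v0])
    simpa using this
  have f₁ : Frame (sizeProg 7 12 23 0) (s.set 12 n) s₁ := Prog.frame _ _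
  set s₂ := (Prog.rep 23 0 (.rep 26 0 (.set 16 (.add (.var 16) (.const 1))))).run (s₁.set 16 0) with hs₂
  have v0₁ : s₁.vars 0 = n := by rw [f₁.1 0 rfl]; simpa using v0
  have e₂ : s₂.vars 16 = n * n := by
    have := Prog.rep_adds (x := 23) (y := 0) (z := 16) (c := n)
      (p := .rep 26 0 (.set 16 (.add (.var 16) (.const 1)))) (s := s₁.set 16 0) rfl (by simp)
      (fun s' fr => by
        have h := Prog.rep_adds (x := 26) (y := 0) (z := 16) (c := 1)
          (p := .set 16 (.add (.var 16) (.const 1))) (s := s') rfl (by simp)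
          (fun s'' _ => by simp [Prog.run, Expr.eval])
        rw [h, fr.1 0 rfl]; simp [v0₁])
    rw [hs₂, this]; simp [v0₁]
  have f₂ : Frame (Prog.rep 23 0 (.rep 26 0 (.set 16 (.add (.var 16) (.const 1))))) (s₁.set 16 0) s₂ :=
    Prog.frame _ _
  have v0₂ : s₂.vars 0 = n := by rw [f₂.1 0 rfl]; simpa using v0₁
  have hrun : initProg.run s = (Prog.rep 23 0 (.rep 26 0 (.store 2 (.add (.mul (.var 23) (.var 0)) (.var 26))
      (.sub (.const 1) (.sub (.const 1) (.add (.get 0 (.add (.mul (.var 23) (.var 0)) (.var 26)))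
        (.sub (.const 1) (.add (.sub (.var 23) (.var 26)) (.sub (.var 26) (.var 23)))))))))).run s₂ := by
    rw [hs₂, hs₁]
    simp only [initProg, Prog.run, Expr.eval, v0]
  have ha0 : s₂.arr 0 = s.arr 0 := by
    rw [f₂.2 0 rfl, State.set_arr, f₁.2 0 rfl, State.set_arr]
  refine ⟨(f.1 0 rfl).trans v0, (f.1 1 rfl).trans v1, ?_, ?_, ?_, fun i j => ?_, fun a ha i => ?_,
    fun a ha i _ => ?_⟩
  · rw [hrun, Prog.run_vars _ rfl, f₂.1 7 rfl]; simpa using e₁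
  · rw [f.1 14 rfl]; simp [hs, shortcutInput]
  · rw [hrun, Prog.run_vars _ rfl, e₂]
  · have := Prog.fill_matrix_spec (x := 23) (y := 0) (x' := 26) (y' := 0) (a := 2)
      (i := .add (.mul (.var 23) (.var 0)) (.var 26))
      (e := .sub (.const 1) (.sub (.const 1) (.add (.get 0 (.add (.mul (.var 23) (.var 0)) (.var 26)))
        (.sub (.const 1) (.add (.sub (.var 23) (.var 26)) (.sub (.var 26) (.var 23)))))))
      s₂ (fun k k' => 1 - (1 - (s.arr 0 (k * n + k') + (1 - ((k - k') + (k' - k)))))) (by simp)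
      (fun k _ k' _ s' h1 h2 h3 h4 _ => by
        simp [Expr.eval, h2, h3, h1, h4 0, v0₂, ha0])
      i (by rw [v0₂]; exact i.2) j (by rw [v0₂]; exact j.2)
    rw [v0₂] at this
    rw [hrun, this]
    have h0 : s.arr 0 (i * n + j) = adjMatrix G i j := by
      simp only [hs, shortcutInput, Function.update_self, matrixCells_index]
    have hw : Within G (2 ^ 0) i j ↔ i = j ∨ G.Adj i j := by
      constructor
      · rintro ⟨l, hl, hwk⟩
        rcases Nat.le_one_iff_eq_zero_or_eq_one.1 hl with rfl | rfl
        · exact .inl hwk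
        · obtain ⟨w, h1, rfl⟩ := hwk
          exact .inr h1
      · rintro (rfl | h)
        · exact Within.refl _ _
        · exact (HasWalk.one h).within
    rw [h0, ballMatrix, adjMatrix]
    by_cases hij : i = j
    · rw [if_pos (hw.2 (.inl hij))]
      subst hij; simp
    · have : (i : ℕ) ≠ j := fun h => hij (Fin.ext h)
      by_cases hadj : G.Adj i j
      · rw [if_pos (hw.2 (.inr hadj)), if_pos hadj]; omega
      · rw [if_neg (fun h => (hw.1 h).elim hij hadj), if_neg hadj]; omega
  · rw [f.2 a (by fin_cases ha <;> rfl)]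
    exact va a (by fin_cases ha <;> simp) i
  · rw [f.2 a (by simp [initProg, sizeProg, Prog.stores]; omega)]
    exact va a (by omega) i

/-- The residue classes from `r` on have not been touched, so the multiplication number `r` finds
the zeroed memory that it requires and nothing has to be cleared. Its running time may far exceed
`n²`, but it stays in its class, and the classes above `r` remain blank. -/
theorem loadProg_spec {s : State} (h : Squared G D r s) (hr : r < Nat.size n) :
    Sim (Nat.size n) r (matMulInput (ballMatrix G (2 ^ r)) (ballMatrix G (2 ^ r)) fun _ => false)
      (loadProg.run s) ∧
    (∀ a, 16 ≤ a → ∀ i, r < i % Nat.size n → (loadProg.run s).arr a i = 0) := by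
  have f : Frame loadProg s (loadProg.run s) := Prog.frame _ _
  set R := Nat.size n with hR
  have hmod : r % R = r := Nat.mod_eq_of_lt hr
  have hmod' (k : ℕ) : (k * R + r) % R = r := by rw [Nat.mul_comm, Nat.mul_add_mod, hmod]
  set s₁ := s.store 16 (.var 14) (.var 0) with hs₁
  have fill : ∀ a, 16 ≤ a → ∀ σ : State, σ.vars 7 = R → σ.vars 14 = r → σ.vars 16 = n * n →
      (∀ k < n * n, ((Prog.rep 23 16 (.store a (Expr.var 23).host (.get 2 (.var 23)))).run σ).arr a
        (k * R + r) = σ.arr 2 k) ∧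
      ∀ j, (∀ k < n * n, j ≠ k * R + r) →
        ((Prog.rep 23 16 (.store a (Expr.var 23).host (.get 2 (.var 23)))).run σ).arr a j =
          σ.arr a j := by
    intro a ha σ h7 h14 h16
    have := Prog.fill_spec (x := 23) (y := 16) (a := a) (i := (Expr.var 23).host)
      (e := .get 2 (.var 23)) σ (fun k => k * R + r) (fun k => σ.arr 2 k) (by simp)
      (fun k _ k' _ he => host_index_inj hr he) (fun k _ s' h1 h2 h3 _ => by
        simp [Expr.host, Expr.eval, h2, h1, h3 2 (by omega), h7, h14])
    rwa [h16] at this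
  set s₂ := (Prog.rep 23 16 (.store 17 (Expr.var 23).host (.get 2 (.var 23)))).run s₁ with hs₂
  have f₂ : Frame (Prog.rep 23 16 (.store 17 (Expr.var 23).host (.get 2 (.var 23)))) s₁ s₂ :=
    Prog.frame _ _
  have hrun : loadProg.run s =
    (Prog.rep 23 16 (.store 19 (Expr.var 23).host (.get 2 (.var 23)))).run s₂ := rfl
  have p₁ := fill 17 (by omega) s₁ h.size_eq h.r_eq h.sq_eq
  have p₂ := fill 19 (by omega) s₂ ((f₂.1 7 rfl).trans h.size_eq) ((f₂.1 14 rfl).trans h.r_eq)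
    ((f₂.1 16 rfl).trans h.sq_eq)
  have a2 : s₂.arr 2 = s.arr 2 := (f₂.2 2 rfl).trans (State.store_arr_of_ne _ _ _ _ (by simp))
  have a19 : s₂.arr 19 = s.arr 19 := (f₂.2 19 rfl).trans (State.store_arr_of_ne _ _ _ _ (by simp))
  have a2' : s₁.arr 2 = s.arr 2 := State.store_arr_of_ne _ _ _ _ (by simp)
  have a17' : s₁.arr 17 = s.arr 17 := State.store_arr_of_ne _ _ _ _ (by simp)
  have c17 : (loadProg.run s).arr 17 = s₂.arr 17 := by rw [hrun, Prog.run_arr _ rfl]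
  have c16 : (loadProg.run s).arr 16 = s₁.arr 16 := by
    rw [hrun, Prog.run_arr _ rfl]; exact f₂.2 16 rfl
  have other : ∀ a, a ≠ 16 → a ≠ 17 → a ≠ 19 → (loadProg.run s).arr a = s.arr a := fun a h1 h2 h3 =>
    f.2 a (by simp [loadProg, Prog.stores, Ne.symm h1, Ne.symm h2, Ne.symm h3])
  have cells : ∀ {α β : ℕ → ℕ}, (∀ k < n * n, α (k * R + r) = s.arr 2 k) →
      (∀ j, (∀ k < n * n, j ≠ k * R + r) → α j = β j) → (∀ i, r ≤ i % R → β i = 0) → ∀ i,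
      α (i * R + r) = matrixCells (ballMatrix G (2 ^ r)) i := by
    intro α β h1 h2 h3 i
    by_cases hi : i < n * n
    · rw [h1 i hi, matrixCells_eq h.mat hi]
    · rw [h2 _ fun k hk he => hi (by rw [host_index_inj hr he]; exact hk), h3 _ (hmod' i).ge, matrixCells, dif_neg hi]
  refine ⟨⟨(f.1 7 rfl).trans h.size_eq, (f.1 14 rfl).trans h.r_eq, fun _ => rfl, fun x => ?_,
    fun a i => ?_⟩, fun a ha i hi => ?_⟩
  · by_cases hx : x = 0
    · subst hx
      rw [c16, hs₁]
      simp [Expr.eval, h.r_eq, h.n_eq, matMulInput]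
    · rw [other _ (by omega) (by omega) (by omega), h.blank _ (by omega) _ hmod.ge]
      simp [matMulInput, hx]
  · by_cases h0 : a = 0
    · subst h0
      rw [show 2 * 0 + 17 = 17 from rfl, c17, cells (fun k hk => (p₁.1 k hk).trans (by rw [a2'])) p₁.2 (by
        rw [a17']; exact h.blank 17 (by omega))]
      simp [matMulInput]
    by_cases h1 : a = 1
    · subst h1
      rw [show 2 * 1 + 17 = 19 from rfl, hrun, cells (fun k hk => (p₂.1 k hk).trans (by rw [a2])) p₂.2 (by
        rw [a19]; exact h.blank 19 (by omega))]
      simp [matMulInput]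
    · rw [other _ (by omega) (by omega) (by omega), h.blank _ (by omega) _ (hmod' i).ge]
      simp [matMulInput, h0, h1]
  · have hne : ∀ k < n * n, i ≠ k * R + r := fun k _ he => by rw [he, hmod'] at hi; omega
    by_cases h16 : a = 16
    · subst h16
      rw [c16, hs₁, State.store_arr, if_neg, h.blank 16 (by omega) i hi.le]
      rintro ⟨-, h2⟩
      rw [Expr.eval, h.r_eq] at h2
      rw [h2, hmod] at hi; omega
    by_cases h17 : a = 17
    · subst h17
      rw [c17, p₁.2 i hne, a17', h.blank 17 (by omega) i hi.le]
    by_cases h19 : a = 19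
    · subst h19
      rw [hrun, p₂.2 i hne, a19, h.blank 19 (by omega) i hi.le]
    · rw [other a h16 h17 h19, h.blank a ha i hi.le]

theorem readProg_spec {s : State} (h7 : s.vars 7 = R) (h14 : s.vars 14 = r) (h16 : s.vars 16 = n * n)
    {e : ℕ} (he : e < n * n) :
    (readProg.run s).arr 2 e = 1 - (1 - s.arr 21 (e * R + r)) := by
  have := Prog.fill_spec (x := 23) (y := 16) (a := 2) (i := .var 23)
    (e := .sub (.const 1) (.sub (.const 1) (.get 21 (Expr.var 23).host))) s (fun k => k)
    (fun k => 1 - (1 - s.arr 21 (k * R + r))) (by simp)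
    (fun k _ k' _ he => he) (fun k _ s' h1 h2 h3 _ => by
      simp [Expr.host, Expr.eval, h2, h1, h3 21 (by omega), h7, h14])
  exact this.1 e (by rwa [h16])

/-- Array `21` carries the result array `2` of the simulated program. It lies outside the arrays
controlled by `Bnd`, so its entries are bounded by hand: inner products of `0/1` vectors are at most
`n`, which is the content of register `0`. -/
theorem readProg_runs {W g : ℕ} (hW : 40 ≤ W) (hg : 1 ≤ g) {s : State} (h0 : s.vars 0 = n)
    (h7 : s.vars 7 = R) (h14 : s.vars 14 = r) (h16 : s.vars 16 = n * n)
    (hc : ∀ e < n * n, s.arr 21 (e * R + r) ≤ n) :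
    Runs 64 16 W g readProg.compile s (3 * (n * n) + 2) (readProg.run s) := by
  have h := Prog.rep_runs (v := 64) (a := 16) (W := W) (g := g) (x := 23) (y := 16) (c := 1)
    (p := .store 2 (.var 23) (.sub (.const 1) (.sub (.const 1) (.get 21 (Expr.var 23).host)))) (s := s)
    (Q := fun s' => s'.vars 0 = n ∧ s'.vars 7 = R ∧ s'.vars 14 = r ∧ s'.vars 16 = n * n ∧
      s'.arr 21 = s.arr 21) (by simp) (by simp) rfl (by omega) hg
    (fun s' ⟨q0, q7, q14, q16, q21⟩ d => by simp [Prog.run, q0, q7, q14, q16, ← q21]; funext; simp) ?_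
    (by simp [h0, h7, h14, h16])
  · rw [h16] at h
    exact h.mono (by omega)
  · rintro s' ⟨q0, q7, q14, q16, q21⟩ hlt M Z hM hZ
    rw [q16] at hlt
    have hv := hc _ hlt
    have hn : n ≤ Z := by have := hM.1 0 (by simp); omega
    have hcost := Expr.cost_le (hM.mono (show M ≤ Z by omega)) (e := (Expr.var 23).host) rfl
    have h1 : ((Expr.var 23).host).wt = 16 := rfl
    have h2 : ((Expr.var 23).host).eval s' = s'.vars 23 * R + r := by
      simp [Expr.host, Expr.eval, q7, q14]
    have h3 := Nat.size_le_size (hv.trans hn)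
    have h4 : Nat.size (s'.vars 23) ≤ Nat.size Z := Nat.size_le_size ((hM.1 23 (by simp)).trans (by omega))
    have h5 : ∀ x, Nat.size (1 - x) ≤ 1 := fun x => by
      have := Nat.size_le_size (show 1 - x ≤ 1 by omega)
      simpa using this
    refine ⟨_, ?_, Exec.store _ _ _ _, (hM.mono (Nat.le_add_right _ _)).store _ _ _ ?_⟩
    · have h6 := h5 (1 - s'.arr 21 (s'.vars 23 * R + r))
      have h7 := h5 (s'.arr 21 (s'.vars 23 * R + r))
      rw [q21] at h6 h7
      have h8 := Nat.mul_le_mul_right (Nat.size Z + 1) hW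
      simp only [Expr.cost, Expr.eval, h2, Nat.size_one, q21] at *
      rw [h1] at hcost
      omega
    · simp only [Expr.eval]; omega

end Closure

end Shortcut
namespace Shortcut

/-! ### Reachability by repeated squaring: one round and the whole loop. -/

section Closure

variable {n D R r : ℕ} {G : Digraph (Fin n)}

theorem Untouched.bnd {s s' : State} (h : Untouched R r s s') {v M : ℕ} (hb : Bnd v 16 M s) :
    Bnd v 16 M s' :=
  ⟨fun x hx => by rw [h.vars]; exact hb.1 x hx, fun a ha i => by rw [h.arr a i (.inl ha)]; exact hb.2 a ha i⟩

theorem Squared.step {p : Com} {B W g : ℕ} (hW : 40 ≤ W) (hg : 1 ≤ g) (hn : 1 ≤ n)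
    (hp : ∀ A B' : Matrix (Fin n) (Fin n) ℕ, (∀ i j, A i j ≤ 1) → (∀ i j, B' i j ≤ 1) →
      ∃ t ≤ B, ∃ s, Exec p (matMulInput A B' fun _ => false) t s ∧
        ∀ i j : Fin n, s.arr 2 (i * n + j) = (A * B') i j)
    {s : State} (h : Squared G D r s) (hr : r < Nat.size n) :
    ∃ s', Squared G D (r + 1) s' ∧ Takes 64 16 W g (.seq loadProg.compile
      (.seq p.sim (.seq readProg.compile (Prog.set 14 (.add (.var 14) (.const 1))).compile))) s
      (20 * n ^ 2) (14 * Nat.size n * B) s' := by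
  obtain ⟨hsim, hblank⟩ := loadProg_spec h hr
  have f₁ : Frame loadProg s (loadProg.run s) := Prog.frame _ _
  have r₁ := Prog.runs (v := 64) (a := 16) (W := W) (g := g) (p := loadProg) (by decide)
    (le_trans (by decide) hW) (le_trans (by decide) hg) rfl s
  have hc₁ : loadProg.cost s.vars = 6 * n ^ 2 + 5 := by
    simp [loadProg, Prog.cost, h.sq_eq]; ring
  rw [hc₁] at r₁
  set s₁ := loadProg.run s
  set A := ballMatrix G (2 ^ r)
  obtain ⟨t, ht, σ, hex, hσ⟩ := hp A A (ballMatrix_le _) (ballMatrix_le _)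
  obtain ⟨t', ht', s₂, hex', hsim', hunt⟩ := Sim.exec hr hex hsim
  have r₂ : Takes 64 16 W g p.sim s₁ 0 (14 * Nat.size n * B) s₂ := by
    intro M Z hM _
    refine ⟨t', ?_, hex', (hunt.bnd hM).mono (Nat.le_add_right _ _)⟩
    rw [Nat.zero_mul, Nat.zero_add]
    -- The factor of the simulation is `8 + 3 (size R + size r)` with `R = Nat.size n` and `r < R`,
    -- hence at most `14 * Nat.size n`.
    refine ht'.trans (Nat.mul_le_mul ?_ ht)
    have h1 := size_le_self (Nat.size n)
    have h2 := (size_le_self r).trans hr.le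
    unfold simFactor
    omega
  have e21 : ∀ i j : Fin n, s₂.arr 21 ((i * n + j) * Nat.size n + r) = (A * A) i j := fun i j => by
    rw [← hσ, ← hsim'.arr 2]
  have e21' : ∀ e < n * n, s₂.arr 21 (e * Nat.size n + r) ≤ n := fun e he => by
    have := e21 ⟨e / n, Nat.div_lt_of_lt_mul he⟩ ⟨e % n, Nat.mod_lt _ hn⟩
    simp only [Nat.div_add_mod'] at this
    rw [this]
    exact ballMatrix_mul_le _ _ _
  have v₂ : ∀ x ≠ 23, s₂.vars x = s.vars x := fun x hx => by
    rw [hunt.vars]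
    exact f₁.1 x (by simp [loadProg, Prog.writes]; omega)
  have f₃ : Frame readProg s₂ (readProg.run s₂) := Prog.frame _ _
  have h0 := (v₂ 0 (by simp)).trans h.n_eq
  have h7 := (v₂ 7 (by simp)).trans h.size_eq
  have h14 := (v₂ 14 (by simp)).trans h.r_eq
  have h16 := (v₂ 16 (by simp)).trans h.sq_eq
  have r₃ := readProg_runs hW hg h0 h7 h14 h16 e21'
  have hread : ∀ i j : Fin n, (readProg.run s₂).arr 2 (i * n + j) = ballMatrix G (2 ^ (r + 1)) i j :=
    fun i j => by
      rw [readProg_spec h7 h14 h16 (index_lt i.2 j.2), e21, ballMatrix_mul, pow_succ, mul_two]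
  set s₃ := readProg.run s₂
  have r₄ := Prog.runs (v := 64) (a := 16) (W := W) (g := g) (p := .set 14 (.add (.var 14) (.const 1)))
    (by decide) (le_trans (by decide) hW) (le_trans (by decide) hg) rfl s₃
  have v₃ : ∀ x ≠ 23, s₃.vars x = s.vars x := fun x hx => by
    rw [← v₂ x hx]
    exact f₃.1 x (by simp [readProg, Prog.writes]; omega)
  have a₃ : ∀ a ≠ 2, s₃.arr a = s₂.arr a := fun a ha =>
    f₃.2 a (by simp [readProg, Prog.stores]; omega)
  refine ⟨_, ?_, (r₁.takes.seq (r₂.seq (r₃.takes.seq r₄.takes))).mono ?_ (by omega)⟩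
  · have e14 : (Expr.add (.var 14) (.const 1)).eval s₃ = r + 1 := by
      simp [Expr.eval, v₃ 14 (by simp), h.r_eq]
    simp only [Prog.run, e14]
    refine ⟨?_, ?_, ?_, ?_, ?_, hread, fun a ha i => ?_, fun a ha i hi => ?_⟩
    · simpa using (v₃ 0 (by simp)).trans h.n_eq
    · simpa using (v₃ 1 (by simp)).trans h.D_eq
    · simpa using (v₃ 7 (by simp)).trans h.size_eq
    · simp
    · simpa using (v₃ 16 (by simp)).trans h.sq_eq
    · rw [State.set_arr, a₃ a (by rintro rfl; simp at ha), hunt.arr a i (.inl (by fin_cases ha <;> simp)),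
        f₁.2 a (by fin_cases ha <;> rfl)]
      exact h.zero a ha i
    · rw [State.set_arr, a₃ a (by omega), hunt.arr a i (.inr (by omega))]
      exact hblank a ha i (by omega)
  · have : (Prog.set 14 (.add (.var 14) (.const 1))).cost s₃.vars = 1 := rfl
    rw [this]
    have : 1 ≤ n ^ 2 := Nat.pow_pos hn
    have : n * n = n ^ 2 := (pow_two n).symm
    omega

/-- After `Nat.size n` squarings the radius is `2 ^ Nat.size n ≥ n`, and `reach_iff_within` applies.
-/
theorem exists_ready {p : Com} {B W g : ℕ} (hW : 2000 ≤ W) (hg : 1 ≤ g) (hn : 1 ≤ n)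
    (hp : ∀ A B' : Matrix (Fin n) (Fin n) ℕ, (∀ i j, A i j ≤ 1) → (∀ i j, B' i j ≤ 1) →
      ∃ t ≤ B, ∃ s, Exec p (matMulInput A B' fun _ => false) t s ∧
        ∀ i j : Fin n, s.arr 2 (i * n + j) = (A * B') i j) (G : Digraph (Fin n)) (D : ℕ) :
    ∃ s', Ready G D s' ∧ Takes 64 16 W g (closureCom p) (shortcutInput G D fun _ => false)
      (100 * (Nat.size n * n ^ 2)) (14 * Nat.size n ^ 2 * B) s' := by
  have hl : 1 ≤ Nat.size n := Nat.size_pos.2 hn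
  have r₁ := Prog.runs (v := 64) (a := 16) (W := W) (g := g) (p := initProg) (by decide)
    (le_trans (by decide) hW) (le_trans (by decide) hg) rfl (shortcutInput G D fun _ => false)
  have hc₁ : initProg.cost (shortcutInput G D fun _ => false).vars ≤ 40 * n ^ 2 := by
    have h0 : (shortcutInput G D fun _ => false).vars 0 = n := by simp [shortcutInput]
    simp only [initProg, sizeProg, Prog.cost, h0]
    norm_num
    nlinarith
  obtain ⟨s', hs', r₂⟩ := Takes.loop (v := 64) (a := 16) (W := W) (g := g) (T := 20 * n ^ 2)
    (X := 14 * Nat.size n * B) (e := .sub (.var 7) (.var 14)) (c := .seq loadProg.compile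
      (.seq p.sim (.seq readProg.compile (Prog.set 14 (.add (.var 14) (.const 1))).compile)))
    rfl (le_trans (by decide) hW) (Squared G D) (Nat.size n)
    (fun k hk s h => ⟨by simp only [Expr.eval, h.size_eq, h.r_eq]; omega,
      h.step (by omega) hg hn hp hk⟩)
    (fun s h => by simp [Expr.eval, h.size_eq, h.r_eq]) (initProg_spec G D fun _ => false)
  refine ⟨s', ⟨hs'.n_eq, hs'.D_eq, hs'.size_eq, fun i j => ?_, hs'.zero⟩,
    (r₁.takes.seq r₂).mono ?_ (le_of_eq ?_)⟩
  · rw [hs'.mat, ballMatrix]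
    classical exact if_congr (reach_iff_within (Nat.lt_size_self n).le).symm rfl rfl
  · have h1 : n ^ 2 ≤ Nat.size n * n ^ 2 := Nat.le_mul_of_pos_left _ hl
    have h2 : 1 ≤ n ^ 2 := Nat.pow_pos hn
    have h3 : Nat.size n * (20 * n ^ 2 + 1) = 20 * (Nat.size n * n ^ 2) + Nat.size n := by ring
    have h4 : Nat.size n ≤ Nat.size n * n ^ 2 := Nat.le_mul_of_pos_right _ h2
    omega
  · ring

end Closure

end Shortcut
namespace Shortcut

/-! ### Bounds for the exponent of matrix multiplication. -/

section Exponent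

theorem Exec.sparse {a m t : ℕ} {p : Com} {s s' : State} (h : Exec p s t s') (hs : Sparse a m s) :
    Sparse a (m + t) s' := by
  induction h generalizing m with
  | skip => exact hs.mono (by omega)
  | assign => exact hs.mono (by omega)
  | store s b i e => exact (hs.store b i e).mono (by omega)
  | flip => exact hs.mono (by omega)
  | seq _ _ ih ih' => exact (ih' (ih hs)).mono (by omega)
  | ite_true _ _ ih => exact (ih hs).mono (by omega)
  | ite_false _ _ ih => exact (ih hs).mono (by omega)
  | loop_stop => exact hs.mono (by omega)
  | loop_step _ _ _ ih ih' => exact (ih' (ih hs)).mono (by omega)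

/-- Polynomials in the logarithm are dominated by every positive power. -/
theorem exists_log_pow_le (k : ℕ) {ε : ℝ} (hε : 0 < ε) :
    ∃ c : ℝ, 0 < c ∧ ∀ n : ℕ, 1 ≤ n → (1 + Real.log n) ^ k ≤ c * (n : ℝ) ^ ε := by
  set δ := ε / (k + 1) with hδ
  have hδ0 : 0 < δ := by positivity
  refine ⟨(1 + 1 / δ) ^ k, by positivity, fun n hn => ?_⟩
  have hn1 : (1 : ℝ) ≤ n := by exact_mod_cast hn
  have h1 : Real.log n ≤ (n : ℝ) ^ δ / δ := Real.log_le_rpow_div (by linarith) hδ0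
  have h2 : 1 ≤ (n : ℝ) ^ δ := Real.one_le_rpow hn1 hδ0.le
  have h3 : 1 + Real.log n ≤ (1 + 1 / δ) * (n : ℝ) ^ δ := by
    have : (1 + 1 / δ) * (n : ℝ) ^ δ = (n : ℝ) ^ δ + (n : ℝ) ^ δ / δ := by ring
    linarith
  have h0 : 0 ≤ 1 + Real.log n := by have := Real.log_nonneg hn1; linarith
  refine (pow_le_pow_left₀ h0 h3 k).trans ?_
  rw [mul_pow, ← Real.rpow_natCast ((n : ℝ) ^ δ), ← Real.rpow_mul (by linarith)]
  refine mul_le_mul_of_nonneg_left (Real.rpow_le_rpow_of_exponent_le hn1 ?_) (by positivity)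
  rw [hδ, div_mul_eq_mul_div, div_le_iff₀ (by positivity)]
  nlinarith

/-- All `n²` entries of the product are nonzero, while array `2` is initially zero and each store
fills one cell. -/
theorem sq_le_of_mul_ones {n t : ℕ} (hn : 1 ≤ n) {p : Com} {s : State} {ρ : ℕ → Bool}
    {J : Matrix (Fin n) (Fin n) ℕ} (hJ : ∀ i j, J i j = 1) (h : Exec p (matMulInput J J ρ) t s)
    (hs : ∀ i j : Fin n, s.arr 2 (i * n + j) = (J * J) i j) : n * n ≤ t := by
  obtain ⟨T, hT, h0⟩ := h.sparse (a := 2) (m := 0) ⟨∅, by simp, fun i _ => by simp [matMulInput]⟩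
  rw [Nat.zero_add] at hT
  have hsub : Finset.range (n * n) ⊆ T := by
    intro e he
    by_contra hc
    have he' := Finset.mem_range.1 he
    have := hs ⟨e / n, Nat.div_lt_of_lt_mul he'⟩ ⟨e % n, Nat.mod_lt _ hn⟩
    simp only [Nat.div_add_mod', h0 e hc, Matrix.mul_apply, hJ] at this
    simp at this
    omega
  simpa using (Finset.card_le_card hsub).trans hT

/-- This allows the `Õ(n²)` steps outside the multiplications to be charged to `n ^ τ`. -/
theorem MatMulInTime.two_le {τ : ℝ} (h : MatMulInTime τ) : 2 ≤ τ := by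
  obtain ⟨p, C, k, h⟩ := h
  by_contra! hτ
  obtain ⟨c, hc, hlog⟩ := exists_log_pow_le k (ε := (2 - τ) / 2) (by linarith)
  have key : ∀ n : ℕ, 1 ≤ n → (n : ℝ) ^ ((2 - τ) / 2) ≤ |C| * c := by
    intro n hn
    have hn0 : (0 : ℝ) < n := by exact_mod_cast hn
    obtain ⟨t, s, hex, ht, hs⟩ := h n hn (Matrix.of fun _ _ => 1) (Matrix.of fun _ _ => 1) (fun _ _ => le_rfl)
      (fun _ _ => le_rfl) (fun _ => false)
    have h1 : ((n * n : ℕ) : ℝ) ≤ t := by exact_mod_cast sq_le_of_mul_ones hn (fun _ _ => rfl) hex hs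
    have hl : 0 ≤ Real.log n := Real.log_nonneg (by exact_mod_cast hn)
    have h2 : (t : ℝ) ≤ |C| * (n : ℝ) ^ τ * (c * (n : ℝ) ^ ((2 - τ) / 2)) := by
      refine ht.trans ?_
      have : C * (n : ℝ) ^ τ ≤ |C| * (n : ℝ) ^ τ := by
        gcongr
        exact le_abs_self C
      calc C * (n : ℝ) ^ τ * (1 + Real.log n) ^ k ≤ |C| * (n : ℝ) ^ τ * (1 + Real.log n) ^ k := by
            gcongr
        _ ≤ _ := by gcongr; exact hlog n hn
    -- Half of the gap `2 - τ` dominates the logarithms, and the other half tends to infinity.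
    have h3 : ((n * n : ℕ) : ℝ) = (n : ℝ) ^ τ * (n : ℝ) ^ ((2 - τ) / 2) * (n : ℝ) ^ ((2 - τ) / 2) := by
      rw [← Real.rpow_add hn0, ← Real.rpow_add hn0, show τ + (2 - τ) / 2 + (2 - τ) / 2 = 2 by ring]
      push_cast
      rw [Real.rpow_two]; ring
    rw [h3] at h1
    have h4 : 0 < (n : ℝ) ^ τ * (n : ℝ) ^ ((2 - τ) / 2) := by positivity
    refine le_of_mul_le_mul_left (h1.trans (h2.trans (le_of_eq ?_))) h4
    ring
  have ht := (tendsto_rpow_atTop (y := (2 - τ) / 2) (by linarith)).comp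
    (tendsto_natCast_atTop_atTop (R := ℝ))
  obtain ⟨n, hn1, hn2⟩ := ((ht.eventually_gt_atTop (|C| * c)).and
    (Filter.eventually_ge_atTop 1)).exists
  exact absurd (key n hn2) (not_le.2 hn1)

theorem size_mul_pow_le (c n d : ℕ) : Nat.size (c * n ^ d) ≤ Nat.size c + d * Nat.size n := by
  induction d with
  | zero => simp
  | succ d ih =>
    rw [pow_succ, ← mul_assoc, Nat.succ_mul]
    have := size_mul_le (c * n ^ d) n
    omega

/-- Set register `5` to `n * n`. -/
def squareProg : Prog :=
  .seq (.set 5 (.const 0)) (.rep 1 0 (.rep 2 0 (.set 5 (.add (.var 5) (.const 1)))))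

/-- The inner product of a row and a column. -/
def innerProg : Prog :=
  .seq (.set 4 (.const 0)) (.rep 3 0 (.ite
    (.mul (.get 0 (.add (.mul (.div (.var 1) (.var 0)) (.var 0)) (.var 3)))
      (.get 1 (.add (.mul (.var 3) (.var 0)) (.sub (.var 1) (.mul (.var 0) (.div (.var 1) (.var 0)))))))
    (.set 4 (.add (.var 4) (.const 1))) .skip))

/-- Matrix multiplication according to the definition. -/
def mulProg : Prog :=
  .seq squareProg (.rep 1 5 (.seq innerProg (.store 2 (.var 1) (.var 4))))

theorem innerProg_spec {n : ℕ} {A B : Matrix (Fin n) (Fin n) ℕ} (hA : ∀ i j, A i j ≤ 1)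
    (hB : ∀ i j, B i j ≤ 1) {s : State} (h0 : s.vars 0 = n) (hsA : s.arr 0 = matrixCells A)
    (hsB : s.arr 1 = matrixCells B) (i j : Fin n) (h1 : s.vars 1 = i * n + j) :
    (innerProg.run s).vars 4 = (A * B) i j := by
  have hn : 0 < n := i.pos
  have hd : ((i : ℕ) * n + j) / n = i := by
    rw [Nat.mul_comm, Nat.mul_add_div hn, Nat.div_eq_of_lt j.2, Nat.add_zero]
  have := Prog.rep_induct (x := 3) (y := 0) (s := s.set 4 0) (p := .ite
    (.mul (.get 0 (.add (.mul (.div (.var 1) (.var 0)) (.var 0)) (.var 3)))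
      (.get 1 (.add (.mul (.var 3) (.var 0)) (.sub (.var 1) (.mul (.var 0) (.div (.var 1) (.var 0)))))))
    (.set 4 (.add (.var 4) (.const 1))) .skip) rfl
    (fun m s' => s'.vars 4 = ∑ l : Fin n, if (l : ℕ) < m then A i l * B l j else 0) (by simp) ?_
  · rw [Matrix.mul_apply]
    simp only [State.set_vars, h0] at this
    refine this.trans (Finset.sum_congr rfl fun l _ => ?_)
    simp
  · intro k s' hk hx fr hI
    have hk' : k < n := by simpa [h0] using hk
    have v0 : s'.vars 0 = n := (fr.1 0 rfl).trans (by simpa using h0)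
    have v1 : s'.vars 1 = i * n + j := (fr.1 1 rfl).trans (by simpa using h1)
    have a0 : s'.arr 0 = matrixCells A := (fr.2 0 rfl).trans hsA
    have a1 : s'.arr 1 = matrixCells B := (fr.2 1 rfl).trans hsB
    have hsum : (∑ l : Fin n, if (l : ℕ) < k + 1 then A i l * B l j else 0) =
        (∑ l : Fin n, if (l : ℕ) < k then A i l * B l j else 0) + A i ⟨k, hk'⟩ * B ⟨k, hk'⟩ j := by
      have : ∀ l : Fin n, (if (l : ℕ) < k + 1 then A i l * B l j else 0) =
          (if (l : ℕ) < k then A i l * B l j else 0) +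
            if l = ⟨k, hk'⟩ then A i ⟨k, hk'⟩ * B ⟨k, hk'⟩ j else 0 := by
        intro l
        by_cases hl : l = ⟨k, hk'⟩
        · subst hl; simp
        · have : (l : ℕ) ≠ k := fun h => hl (Fin.ext h)
          rw [if_neg hl, Nat.add_zero]
          exact if_congr (by omega) rfl rfl
      rw [Finset.sum_congr rfl fun l _ => this l, Finset.sum_add_distrib]
      simp
    have e : (Expr.mul (.get 0 (.add (.mul (.div (.var 1) (.var 0)) (.var 0)) (.var 3)))
        (.get 1 (.add (.mul (.var 3) (.var 0))
          (.sub (.var 1) (.mul (.var 0) (.div (.var 1) (.var 0))))))).eval s' =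
        A i ⟨k, hk'⟩ * B ⟨k, hk'⟩ j := by
      simp only [Expr.eval, v0, v1, hx, a0, a1, hd]
      rw [show (i : ℕ) * n + j - n * i = j by rw [Nat.mul_comm]; omega, ← matrixCells_index A, ← matrixCells_index B]
    have h01 : A i ⟨k, hk'⟩ * B ⟨k, hk'⟩ j ≤ 1 := Nat.mul_le_mul (hA _ _) (hB _ _)
    rw [hsum, ← hI]
    rw [Prog.run, e]
    by_cases hz : A i ⟨k, hk'⟩ * B ⟨k, hk'⟩ j = 0
    · simp [hz, Prog.run]
    · rw [if_pos hz]
      simp [Prog.run, Expr.eval]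
      omega

theorem mulProg_spec {n : ℕ} {A B : Matrix (Fin n) (Fin n) ℕ} (hA : ∀ i j, A i j ≤ 1)
    (hB : ∀ i j, B i j ≤ 1) (ρ : ℕ → Bool) :
    (squareProg.run (matMulInput A B ρ)).vars 5 = n * n ∧
    ∀ i j : Fin n, (mulProg.run (matMulInput A B ρ)).arr 2 (i * n + j) = (A * B) i j := by
  set s := matMulInput A B ρ with hs
  have v0 : s.vars 0 = n := by simp [hs, matMulInput]
  have a0 : s.arr 0 = matrixCells A := by simp [hs, matMulInput]
  have a1 : s.arr 1 = matrixCells B := by simp [hs, matMulInput]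
  set s₁ := squareProg.run s with hs₁
  have f₁ : Frame squareProg s s₁ := Prog.frame _ _
  have e₁ : s₁.vars 5 = n * n := by
    have := Prog.rep_adds (x := 1) (y := 0) (z := 5) (c := n)
      (p := .rep 2 0 (.set 5 (.add (.var 5) (.const 1)))) (s := s.set 5 0) rfl (by simp)
      (fun s' fr => by
        have h := Prog.rep_adds (x := 2) (y := 0) (z := 5) (c := 1)
          (p := .set 5 (.add (.var 5) (.const 1))) (s := s') rfl (by simp)
          (fun s'' _ => by simp [Prog.run, Expr.eval])
        rw [h, fr.1 0 rfl]; simp [v0])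
    refine this.trans ?_
    simp [v0]
  refine ⟨e₁, fun i j => ?_⟩
  have := Prog.rep_induct (x := 1) (y := 5) (p := .seq innerProg (.store 2 (.var 1) (.var 4))) (s := s₁)
    rfl (fun m s' => ∀ i j : Fin n, (i * n + j : ℕ) < m → s'.arr 2 (i * n + j) = (A * B) i j)
    (by simp) ?_
  · exact this i j (by rw [e₁]; exact index_lt i.2 j.2)
  · intro k s' hk hx fr hI i j hij
    have h0 : s'.vars 0 = n := (fr.1 0 rfl).trans ((f₁.1 0 rfl).trans v0)
    have hin : Frame innerProg s' (innerProg.run s') := Prog.frame _ _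
    simp only [Prog.run, State.set_arr, State.store_arr, Expr.eval, hin.1 1 rfl, hx, true_and]
    by_cases hc : (i * n + j : ℕ) = k
    · rw [if_pos hc]
      exact innerProg_spec hA hB h0 ((fr.2 0 rfl).trans ((f₁.2 0 rfl).trans a0))
        ((fr.2 1 rfl).trans ((f₁.2 1 rfl).trans a1)) i j (hx.trans hc.symm)
    · rw [if_neg hc, hin.2 2 rfl]
      exact hI i j (by omega)

theorem matrixCells_le {n : ℕ} {A : Matrix (Fin n) (Fin n) ℕ} (hA : ∀ i j, A i j ≤ 1) (e : ℕ) :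
    matrixCells A e ≤ 1 := by
  unfold matrixCells
  split_ifs
  exacts [hA _ _, Nat.zero_le _]

/-- The school method. Its purpose is that the set of exponents is nonempty, so that every number
above its infimum exceeds some member. -/
theorem matMulInTime_three : MatMulInTime 3 := by
  refine ⟨mulProg.compile, 100 * (2000 * 2 * 20), 1, fun n hn A B hA hB ρ => ?_⟩
  obtain ⟨h1, h2⟩ := mulProg_spec hA hB ρ
  have r₁ := Prog.runs (v := 64) (a := 16) (W := 2000) (g := 1) (p := squareProg) (by decide)
    (by decide) (by decide) rfl (matMulInput A B ρ)
  have r₂ := Prog.runs (v := 64) (a := 16) (W := 2000) (g := 1)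
    (p := .rep 1 5 (.seq innerProg (.store 2 (.var 1) (.var 4)))) (by decide)
    (by decide) (by decide) rfl (squareProg.run (matMulInput A B ρ))
  have h0 : (matMulInput A B ρ).vars 0 = n := by simp [matMulInput]
  have h0' : (squareProg.run (matMulInput A B ρ)).vars 0 = n := (Prog.run_vars _ rfl _).trans h0
  have hr : Runs 64 16 2000 1 mulProg.compile (matMulInput A B ρ) (100 * n ^ 3)
      (mulProg.run (matMulInput A B ρ)) := by
    refine (Prog.runs_seq r₁ r₂).mono ?_
    simp only [innerProg, Prog.cost, h1, h0']
    simp only [squareProg, Prog.cost, h0]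
    norm_num
    have e1 : n ≤ n ^ 3 := Nat.le_self_pow (by norm_num) n
    have e2 : n * n ≤ n ^ 3 := by
      rw [← pow_two]; exact Nat.pow_le_pow_right hn (by norm_num)
    nlinarith
  obtain ⟨t, ht, hex, -⟩ := hr (n + 1) (102 * n ^ 3) ⟨fun x _ => by
      simp only [matMulInput, Function.update_apply]; split_ifs <;> omega, fun a _ i => by
      simp only [matMulInput, Function.update_apply]
      split_ifs
      · exact (matrixCells_le hB i).trans (by omega)
      · exact (matrixCells_le hA i).trans (by omega)
      · simp⟩ (by
    have e1 : n ≤ n ^ 3 := Nat.le_self_pow (by norm_num) n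
    have e2 : 1 ≤ n ^ 3 := Nat.pow_pos hn
    omega)
  refine ⟨t, _, hex, ?_, h2⟩
  have hl : 1 ≤ Nat.size n := Nat.size_pos.2 hn
  have hs := size_mul_pow_le 102 n 3
  have hs' : Nat.size (102 * n ^ 3) + 1 ≤ 20 * Nat.size n := by
    have : Nat.size 102 = 7 := by decide
    omega
  have ht' : t ≤ 100 * n ^ 3 * (2000 * (20 * Nat.size n)) :=
    ht.trans (Nat.mul_le_mul_left _ (Nat.mul_le_mul_left _ hs'))
  have hlog := size_le_log hn
  calc (t : ℝ) ≤ 100 * (n : ℝ) ^ 3 * (2000 * (20 * Nat.size n)) := by exact_mod_cast ht'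
    _ ≤ 100 * (n : ℝ) ^ 3 * (2000 * (20 * (2 * (1 + Real.log n)))) := by gcongr
    _ = 100 * (2000 * 2 * 20) * (n : ℝ) ^ (3 : ℝ) * (1 + Real.log n) ^ 1 := by
      rw [show (n : ℝ) ^ (3 : ℝ) = (n : ℝ) ^ (3 : ℕ) by exact_mod_cast Real.rpow_natCast (n : ℝ) 3]
      ring

theorem exists_matMulInTime_le {τ : ℝ} (h : MatMulInTime τ ∨ matMulExponent < τ) :
    ∃ τ' ≤ τ, MatMulInTime τ' := by
  rcases h with h | h
  · exact ⟨τ, le_rfl, h⟩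
  · obtain ⟨τ', h1, h2⟩ := exists_lt_of_csInf_lt ⟨3, matMulInTime_three⟩ h
    exact ⟨τ', h2.le, h1⟩

end Exponent

end Shortcut
namespace Shortcut

/-! ### Assembly of the algorithm, existence, and the two special cases. -/

section Main

variable {n D : ℕ} {G : Digraph (Fin n)}

theorem Runs.weaken {v a W W' g g' T : ℕ} {c : Com} {s s' : State} (h : Runs v a W g c s T s')
    (hW : W ≤ W') (hg : g ≤ g') : Runs v a W' g' c s T s' := by
  intro M Z hM hZ
  have := Nat.mul_le_mul_right T hg
  obtain ⟨t, ht, hex, hb⟩ := h M Z hM (by omega)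
  exact ⟨t, ht.trans (Nat.mul_le_mul_left _ (Nat.mul_le_mul_right _ hW)), hex, hb.mono (by omega)⟩

theorem bnd_shortcutInput (hDn : D ≤ n) (ρ : ℕ → Bool) :
    Bnd 64 16 (n + 1) (shortcutInput G D ρ) := by
  refine ⟨fun x _ => ?_, fun a _ i => ?_⟩
  · simp only [shortcutInput, Function.update_apply]
    split_ifs <;> omega
  · simp only [shortcutInput, Function.update_apply]
    split_ifs
    · refine (matrixCells_le (fun i j => ?_) i).trans (by omega)
      unfold adjMatrix; split_ifs <;> simp
    · simp

/-- The whole algorithm: the reachability matrix is computed with the matrix multiplication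
program `p`. -/
def shortcutCom (p : Com) (A : ℕ) : Com := .seq (closureCom p) (postProg A).compile

/-- The constant depends on `A` only, and the time of the multiplication program enters through `B`.
The state `s₁` after the computation of reachability is the same for all coin sequences, up to the
coins themselves, as that part does not flip any. -/
theorem exists_exec_shortcutCom {A : ℕ} (hA : 1 ≤ A) : ∃ c : ℕ, ∀ {p : Com} {n D B : ℕ}, 1 ≤ D → D ≤ n →
    (∀ A B' : Matrix (Fin n) (Fin n) ℕ, (∀ i j, A i j ≤ 1) → (∀ i j, B' i j ≤ 1) →
      ∃ t ≤ B, ∃ s, Exec p (matMulInput A B' fun _ => false) t s ∧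
        ∀ i j : Fin n, s.arr 2 (i * n + j) = (A * B') i j) → ∀ G : Digraph (Fin n),
    ∃ s₁, Ready G D s₁ ∧ ∀ ρ, ∃ t ≤ c * Nat.size n ^ 6 * n ^ 2 + 14 * Nat.size n ^ 2 * B,
      Exec (shortcutCom p A) (shortcutInput G D ρ) t ((postProg A).run (s₁.withCoins ρ)) := by
  set W := max 2000 (postProg A).wt with hW
  set g := max 1 (postProg A).gr with hg
  set a := 100 + 20000 * A ^ 5 with ha
  refine ⟨a * (W * (Nat.size (2 + g * a) + 8)), ?_⟩
  intro p n D B hD1 hDn hp G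
  have hn : 1 ≤ n := hD1.trans hDn
  have hl : 1 ≤ Nat.size n := Nat.size_pos.2 hn
  obtain ⟨s₁, hs₁, r₁⟩ := exists_ready (W := W) (g := g) (le_max_left _ _) (le_max_left _ _) hn hp G D
  refine ⟨s₁, hs₁, fun ρ => ?_⟩
  have r₂ := (postProg_runs (hs₁.withCoins ρ) hA hD1 hDn).weaken (le_max_right 2000 _)
    (le_max_right 1 _)
  rw [← hW, ← hg] at r₂
  have r₁' : Takes 64 16 W g (closureCom p) (shortcutInput G D ρ) (100 * (Nat.size n * n ^ 2))
      (14 * Nat.size n ^ 2 * B) (s₁.withCoins ρ) := by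
    intro M Z hM hZ
    obtain ⟨t, ht, hex, hb⟩ := r₁ M Z hM hZ
    exact ⟨t, ht, hex.withCoins (flipFree_closureCom p) ρ, hb⟩
  have r : Takes 64 16 W g (shortcutCom p A) (shortcutInput G D ρ) (a * (Nat.size n ^ 5 * n ^ 2))
      (14 * Nat.size n ^ 2 * B) ((postProg A).run (s₁.withCoins ρ)) := by
    refine (r₁'.seq r₂.takes).mono ?_ le_rfl
    have h1 : Nat.size n * n ^ 2 ≤ Nat.size n ^ 5 * n ^ 2 :=
      Nat.mul_le_mul_right _ (Nat.le_self_pow (by norm_num) _)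
    have h2 : 20000 * ((A * Nat.size n) ^ 5 * n ^ 2) = 20000 * A ^ 5 * (Nat.size n ^ 5 * n ^ 2) := by
      rw [Nat.mul_pow]; ring
    rw [h2, ha, Nat.add_mul]
    omega
  have h5 : Nat.size n ^ 5 * n ^ 2 ≤ n ^ 7 := by
    calc Nat.size n ^ 5 * n ^ 2 ≤ n ^ 5 * n ^ 2 :=
          Nat.mul_le_mul_right _ (Nat.pow_le_pow_left (size_le_self n) 5)
      _ = n ^ 7 := by ring
  -- All numbers under control stay below `(2 + g * a) * n ^ 7`, so their lengths are logarithmic in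
  -- `n`.
  obtain ⟨t, ht, hex, -⟩ := r (n + 1) ((2 + g * a) * n ^ 7) (bnd_shortcutInput hDn ρ) (by
    have h6 : n ≤ n ^ 7 := Nat.le_self_pow (by norm_num) n
    have h7 : 1 ≤ n ^ 7 := Nat.pow_pos hn
    have h8 : g * (a * (Nat.size n ^ 5 * n ^ 2)) ≤ g * a * n ^ 7 := by
      rw [← mul_assoc]; exact Nat.mul_le_mul_left _ h5
    rw [Nat.add_mul 2 (g * a)]
    omega)
  refine ⟨t, ht.trans (Nat.add_le_add_right ?_ _), hex⟩
  have hs := size_mul_pow_le (2 + g * a) n 7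
  have hs' : Nat.size ((2 + g * a) * n ^ 7) + 1 ≤ (Nat.size (2 + g * a) + 8) * Nat.size n := by
    rw [Nat.add_mul (Nat.size (2 + g * a)) 8]
    have := Nat.le_mul_of_pos_right (Nat.size (2 + g * a)) hl
    omega
  calc a * (Nat.size n ^ 5 * n ^ 2) * (W * (Nat.size ((2 + g * a) * n ^ 7) + 1))
      ≤ a * (Nat.size n ^ 5 * n ^ 2) * (W * ((Nat.size (2 + g * a) + 8) * Nat.size n)) :=
        Nat.mul_le_mul_left _ (Nat.mul_le_mul_left _ hs')
    _ = _ := by ring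

/-- An exponent `τ' ≤ τ` with a program is fixed first; `2 ≤ τ'` absorbs the quadratic part, and
logarithmic factors are collected in the power `6 + k₀`. -/
theorem fast_shortcuts (c : ℕ) : ∃ (C : ℝ) (k : ℕ), ∀ τ : ℝ,
      (MatMulInTime τ ∨ matMulExponent < τ) →
      ∃ (p : Com) (C' : ℝ) (k' : ℕ),
        ∀ n D : ℕ, 1 ≤ D → D ≤ n → ∀ G : Digraph (Fin n),
        ∃ H : (ℕ → Bool) → Finset (Fin n × Fin n),
          (∀ ρ : ℕ → Bool,
            (∃ (t : ℕ) (s : State),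
              Exec p (shortcutInput G D ρ) t s ∧
              outputEdges n s = H ρ ∧
              (t : ℝ) ≤ C' * (n : ℝ) ^ τ * (1 + Real.log n) ^ k') ∧
            ofEdges (H ρ) ≤ transClosure G ∧
            ((H ρ).card : ℝ) ≤ C * sizeBound n D * (1 + Real.log n) ^ k) ∧
          fairCoins
              {ρ | ¬ diam (G ⊔ ofEdges (H ρ)) ≤ (D : ℕ∞)} ≤
            ENNReal.ofReal (1 / (n : ℝ) ^ c) := by
  have hA : 1 ≤ 4 * c + 24 := by omega
  obtain ⟨C, -, hC⟩ := exists_card_le hA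
  refine ⟨C, 5, fun τ hτ => ?_⟩
  obtain ⟨τ', hτ', hm⟩ := exists_matMulInTime_le hτ
  have h2 := hm.two_le
  obtain ⟨p, C₀, k₀, hp⟩ := hm
  obtain ⟨c₁, hc₁⟩ := exists_exec_shortcutCom hA
  refine ⟨shortcutCom p (4 * c + 24), c₁ * 64 + 56 * |C₀|, 6 + k₀, fun n D hD1 hDn G => ?_⟩
  have hn : 1 ≤ n := hD1.trans hDn
  have hn1 : (1 : ℝ) ≤ n := by exact_mod_cast hn
  have hL : 1 ≤ 1 + Real.log n := by have := Real.log_nonneg hn1; linarith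
  set B := ⌊|C₀| * (n : ℝ) ^ τ' * (1 + Real.log n) ^ k₀⌋₊ with hB
  have hB0 : 0 ≤ |C₀| * (n : ℝ) ^ τ' * (1 + Real.log n) ^ k₀ := by positivity
  obtain ⟨s₁, hs₁, hex⟩ := hc₁ (p := p) (B := B) hD1 hDn (fun M M' hM hM' => by
    obtain ⟨t, s, h1, h3, h4⟩ := hp n hn M M' hM hM' fun _ => false
    refine ⟨t, Nat.le_floor (h3.trans ?_), s, h1, h4⟩
    gcongr
    exact le_abs_self C₀) G
  refine ⟨fun ρ => outputEdges n ((postProg (4 * c + 24)).run (s₁.withCoins ρ)), fun ρ => ⟨?_,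
    outputEdges_le_transClosure (hs₁.withCoins ρ), hC (hs₁.withCoins ρ) hD1 hDn⟩,
    prob_diam_gt hs₁ hD1 hDn⟩
  obtain ⟨t, ht, he⟩ := hex ρ
  refine ⟨t, _, he, rfl, ?_⟩
  have hlog := size_le_log hn
  set L := 1 + Real.log n with hLd
  have hBr : (B : ℝ) ≤ |C₀| * (n : ℝ) ^ τ * L ^ k₀ := by
    refine (Nat.floor_le hB0).trans ?_
    gcongr
  have hn2 : (n : ℝ) ^ 2 ≤ (n : ℝ) ^ τ := by
    rw [← Real.rpow_two]
    exact Real.rpow_le_rpow_of_exponent_le hn1 (h2.trans hτ')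
  have e1 : L ^ 6 ≤ L ^ (6 + k₀) := pow_le_pow_right₀ hL (by omega)
  have e2 : L ^ 2 * L ^ k₀ ≤ L ^ (6 + k₀) := by
    rw [← pow_add]; exact pow_le_pow_right₀ hL (by omega)
  calc (t : ℝ) ≤ c₁ * (Nat.size n : ℝ) ^ 6 * (n : ℝ) ^ 2 + 14 * (Nat.size n : ℝ) ^ 2 * B := by
        exact_mod_cast ht
    _ ≤ c₁ * (2 * L) ^ 6 * (n : ℝ) ^ τ + 14 * (2 * L) ^ 2 * (|C₀| * (n : ℝ) ^ τ * L ^ k₀) := by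
        gcongr
    _ = c₁ * 64 * (n : ℝ) ^ τ * L ^ 6 + 56 * |C₀| * (n : ℝ) ^ τ * (L ^ 2 * L ^ k₀) := by ring
    _ ≤ c₁ * 64 * (n : ℝ) ^ τ * L ^ (6 + k₀) + 56 * |C₀| * (n : ℝ) ^ τ * L ^ (6 + k₀) := by gcongr
    _ = _ := by ring

/-- Existence needs no multiplication program: a state that already holds the reachability matrix
can be written down. -/
theorem exists_ready_state (G : Digraph (Fin n)) (D : ℕ) : ∃ s, Ready G D s := by
  classical
  refine ⟨⟨fun x => if x = 0 then n else if x = 1 then D else if x = 7 then Nat.size n else 0,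
    fun a => if a = 2 then matrixCells (Matrix.of fun u v => if Reach G u v then 1 else 0) else 0,
    fun _ => false⟩, by simp, by simp, by simp, fun i j => ?_, fun a ha i => ?_⟩
  · simp only [if_true]
    rw [matrixCells_index, Matrix.of_apply]
  · fin_cases ha <;> simp

/-- For `n ≥ 2` and `c = 1` the failure probability is at most `1 / n < 1`, so some coin sequence
succeeds. For `n = 1` there is only one vertex. -/
theorem exists_shortcuts : ∃ (C : ℝ) (k : ℕ), 0 ≤ C ∧ ∀ n D : ℕ, 1 ≤ D → D ≤ n → ∀ G : Digraph (Fin n),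
      ∃ H : Finset (Fin n × Fin n), ofEdges H ≤ transClosure G ∧ diam (G ⊔ ofEdges H) ≤ (D : ℕ∞) ∧
        (H.card : ℝ) ≤ C * sizeBound n D * (1 + Real.log n) ^ k := by
  obtain ⟨C, hC0, hC⟩ := exists_card_le (A := 4 * 1 + 24) (by norm_num)
  refine ⟨C, 5, hC0, fun n D hD1 hDn G => ?_⟩
  obtain ⟨s, hs⟩ := exists_ready_state G D
  set H : (ℕ → Bool) → Finset (Fin n × Fin n) :=
    fun ρ => outputEdges n ((postProg (4 * 1 + 24)).run (s.withCoins ρ)) with hH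
  suffices h : ∃ ρ, diam (G ⊔ ofEdges (H ρ)) ≤ (D : ℕ∞) by
    obtain ⟨ρ, hρ⟩ := h
    exact ⟨H ρ, outputEdges_le_transClosure (hs.withCoins ρ), hρ, hC (hs.withCoins ρ) hD1 hDn⟩
  rcases Nat.lt_or_ge 1 n with hn | hn
  · by_contra! hbad
    have h := prob_diam_gt (c := 1) hs hD1 hDn
    have huniv : {ρ | ¬ diam (G ⊔ ofEdges (H ρ)) ≤ (D : ℕ∞)} = Set.univ :=
      Set.eq_univ_of_forall fun ρ => not_le.2 (hbad ρ)
    have : MeasureTheory.IsProbabilityMeasure fairCoins := by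
      unfold fairCoins; infer_instance
    rw [huniv, MeasureTheory.measure_univ, ENNReal.one_le_ofReal, pow_one] at h
    have h2 : (2 : ℝ) ≤ n := by exact_mod_cast hn
    rw [le_div_iff₀ (by linarith)] at h
    linarith
  · refine ⟨fun _ => false, diam_le_of_within fun u v _ => ?_⟩
    have : u = v := Fin.ext (by omega)
    rw [this]
    exact Within.refl _ _

/-- Rounding down a number that is at least `1` loses at most a factor `2`, and `D` enters the size
bound with exponent `3`. -/
theorem sizeBound_cbrt_le (hn : 1 ≤ n) : 1 ≤ ⌊(n : ℝ) ^ (1 / 3 : ℝ)⌋₊ ∧ ⌊(n : ℝ) ^ (1 / 3 : ℝ)⌋₊ ≤ n ∧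
    sizeBound n ⌊(n : ℝ) ^ (1 / 3 : ℝ)⌋₊ ≤ 8 * n := by
  have hn1 : (1 : ℝ) ≤ n := by exact_mod_cast hn
  set x := (n : ℝ) ^ (1 / 3 : ℝ) with hx
  have hx1 : 1 ≤ x := Real.one_le_rpow hn1 (by norm_num)
  have hx3 : x ^ 3 = n := by
    rw [hx, ← Real.rpow_natCast, ← Real.rpow_mul (by linarith)]; norm_num
  have hD1 : 1 ≤ ⌊x⌋₊ := Nat.le_floor (by simpa using hx1)
  have hle : (⌊x⌋₊ : ℝ) ≤ x := Nat.floor_le (by linarith)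
  have hlt := Nat.lt_floor_add_one x
  have hD1' : (1 : ℝ) ≤ ⌊x⌋₊ := by exact_mod_cast hD1
  refine ⟨hD1, ?_, ?_⟩
  · have : x ≤ n := by rw [← hx3]; exact le_self_pow₀ hx1 (by norm_num)
    exact_mod_cast hle.trans this
  · rw [sizeBound, if_pos hle, div_le_iff₀ (by positivity)]
    have : x ^ 3 ≤ (2 * (⌊x⌋₊ : ℝ)) ^ 3 := pow_le_pow_left₀ (by linarith) (by linarith) 3
    rw [hx3] at this
    nlinarith

/-- For small `n`, rounding can bring `⌊√n⌋` below `n^{1/3}`, so both cases of the size bound have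
to be estimated. -/
theorem sizeBound_sqrt_le (hn : 1 ≤ n) : 1 ≤ ⌊Real.sqrt n⌋₊ ∧ ⌊Real.sqrt n⌋₊ ≤ n ∧
    sizeBound n ⌊Real.sqrt n⌋₊ ≤ 8 * (n : ℝ) ^ (3 / 4 : ℝ) := by
  have hn1 : (1 : ℝ) ≤ n := by exact_mod_cast hn
  set y := (n : ℝ) ^ (1 / 4 : ℝ) with hy
  have hy1 : 1 ≤ y := Real.one_le_rpow hn1 (by norm_num)
  have hy4 : y ^ 4 = n := by
    rw [hy, ← Real.rpow_natCast, ← Real.rpow_mul (by linarith)]; norm_num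
  have hy3 : (n : ℝ) ^ (3 / 4 : ℝ) = y ^ 3 := by
    rw [hy, ← Real.rpow_natCast, ← Real.rpow_mul (by linarith)]; norm_num
  have hyx : Real.sqrt n = y ^ 2 := by
    rw [← hy4, show y ^ 4 = (y ^ 2) ^ 2 by ring, Real.sqrt_sq (by positivity)]
  have hs1 : 1 ≤ y ^ 2 := one_le_pow₀ hy1
  rw [hyx, hy3]
  have hD1 : 1 ≤ ⌊y ^ 2⌋₊ := Nat.le_floor (by simpa using hs1)
  have hle : (⌊y ^ 2⌋₊ : ℝ) ≤ y ^ 2 := Nat.floor_le (by linarith)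
  have hlt := Nat.lt_floor_add_one (y ^ 2)
  have hD1' : (1 : ℝ) ≤ ⌊y ^ 2⌋₊ := by exact_mod_cast hD1
  have h2 : y ^ 2 ≤ 2 * (⌊y ^ 2⌋₊ : ℝ) := by linarith
  refine ⟨hD1, ?_, ?_⟩
  · have : y ^ 2 ≤ n := by rw [← hy4]; exact pow_le_pow_right₀ hy1 (by norm_num)
    exact_mod_cast hle.trans this
  · set d := (⌊y ^ 2⌋₊ : ℝ)
    have hd0 : 0 < d := by linarith
    rw [sizeBound]
    split_ifs
    · rw [div_le_iff₀ (by positivity)]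
      have h3 : (y ^ 2) ^ 3 ≤ (2 * d) ^ 3 := pow_le_pow_left₀ (by positivity) h2 3
      calc (n : ℝ) ^ 2 = y ^ 2 * (y ^ 2) ^ 3 := by rw [← hy4]; ring
        _ ≤ y ^ 2 * (2 * d) ^ 3 := by gcongr
        _ = 8 * y ^ 2 * d ^ 3 := by ring
        _ ≤ 8 * y ^ 3 * d ^ 3 := by gcongr 8 * ?_ * _; exact pow_le_pow_right₀ hy1 (by norm_num)
    · have h3 : (n : ℝ) / d ≤ (2 * y) ^ 2 := by
        rw [div_le_iff₀ hd0, ← hy4]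
        nlinarith [sq_nonneg y]
      calc ((n : ℝ) / d) ^ (3 / 2 : ℝ) ≤ ((2 * y) ^ 2) ^ (3 / 2 : ℝ) :=
            Real.rpow_le_rpow (by positivity) h3 (by norm_num)
        _ = (2 * y) ^ 3 := by
            rw [← Real.rpow_natCast (2 * y) 2, ← Real.rpow_mul (by positivity), ← Real.rpow_natCast]
            norm_num
        _ = 8 * y ^ 3 := by ring

end Main

end Shortcut
theorem theorem1p1 :
    -- existence of small shortcut sets
    (∃ (C : ℝ) (k : ℕ), ∀ n D : ℕ, 1 ≤ D → D ≤ n → ∀ G : Digraph (Fin n),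
      ∃ H : Finset (Fin n × Fin n),
        Shortcut.ofEdges H ≤ Shortcut.transClosure G ∧
        Shortcut.diam (G ⊔ Shortcut.ofEdges H) ≤ (D : ℕ∞) ∧
        (H.card : ℝ) ≤ C * Shortcut.sizeBound n D * (1 + Real.log n) ^ k) ∧
    -- their computation by a randomized algorithm
    (∀ c : ℕ, ∃ (C : ℝ) (k : ℕ), ∀ τ : ℝ,
      (Shortcut.MatMulInTime τ ∨ Shortcut.matMulExponent < τ) →
      ∃ (p : Shortcut.Com) (C' : ℝ) (k' : ℕ),
        ∀ n D : ℕ, 1 ≤ D → D ≤ n → ∀ G : Digraph (Fin n),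
        ∃ H : (ℕ → Bool) → Finset (Fin n × Fin n),
          (∀ ρ : ℕ → Bool,
            (∃ (t : ℕ) (s : Shortcut.State),
              Shortcut.Exec p (Shortcut.shortcutInput G D ρ) t s ∧
              Shortcut.outputEdges n s = H ρ ∧
              (t : ℝ) ≤ C' * (n : ℝ) ^ τ * (1 + Real.log n) ^ k') ∧
            Shortcut.ofEdges (H ρ) ≤ Shortcut.transClosure G ∧
            ((H ρ).card : ℝ) ≤ C * Shortcut.sizeBound n D * (1 + Real.log n) ^ k) ∧
          Shortcut.fairCoins
              {ρ | ¬ Shortcut.diam (G ⊔ Shortcut.ofEdges (H ρ)) ≤ (D : ℕ∞)} ≤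
            ENNReal.ofReal (1 / (n : ℝ) ^ c)) ∧
    -- diameter `n^{1/3}` with `Õ(n)` edges
    (∃ (C : ℝ) (k : ℕ), ∀ n : ℕ, 1 ≤ n → ∀ G : Digraph (Fin n),
      ∃ H : Finset (Fin n × Fin n),
        Shortcut.ofEdges H ≤ Shortcut.transClosure G ∧
        Shortcut.diam (G ⊔ Shortcut.ofEdges H) ≤ ((⌊(n : ℝ) ^ (1 / 3 : ℝ)⌋₊ : ℕ) : ℕ∞) ∧
        (H.card : ℝ) ≤ C * (n : ℝ) * (1 + Real.log n) ^ k) ∧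
    -- diameter `√n` with `Õ(n^{3/4})` edges
    (∃ (C : ℝ) (k : ℕ), ∀ n : ℕ, 1 ≤ n → ∀ G : Digraph (Fin n),
      ∃ H : Finset (Fin n × Fin n),
        Shortcut.ofEdges H ≤ Shortcut.transClosure G ∧
        Shortcut.diam (G ⊔ Shortcut.ofEdges H) ≤ ((⌊Real.sqrt n⌋₊ : ℕ) : ℕ∞) ∧
        (H.card : ℝ) ≤ C * (n : ℝ) ^ (3 / 4 : ℝ) * (1 + Real.log n) ^ k) := by
  obtain ⟨C, k, hC, h⟩ := Shortcut.exists_shortcuts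
  refine ⟨⟨C, k, h⟩, Shortcut.fast_shortcuts, ⟨C * 8, k, fun n hn G => ?_⟩, ⟨C * 8, k, fun n hn G => ?_⟩⟩
  all_goals
    have hL : 0 ≤ 1 + Real.log n := by
      have := Real.log_nonneg (show (1 : ℝ) ≤ n by exact_mod_cast hn)
      linarith
  · obtain ⟨h1, h2, h3⟩ := Shortcut.sizeBound_cbrt_le hn
    obtain ⟨H, hH, hd, hc⟩ := h n _ h1 h2 G
    refine ⟨H, hH, hd, hc.trans ?_⟩
    rw [mul_assoc C 8]
    gcongr
  · obtain ⟨h1, h2, h3⟩ := Shortcut.sizeBound_sqrt_le hn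
    obtain ⟨H, hH, hd, hc⟩ := h n _ h1 h2 G
    refine ⟨H, hH, hd, hc.trans ?_⟩
    rw [mul_assoc C 8]
    gcongr
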